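/- Let $k$ be a field of characteristic $0$, and let $X$ be a smooth $k$-scheme or a complex manifold (with $k=\mathbb C$). Let $S$ be a locally split first-order thickening of $X$ by a locally free sheaf $\mathcal I$ of finite rank: $\mathcal O_S$ is a sheaf of commutative $k$-algebras on $X$ with a $k$-algebra morphism $\mathcal O_S\to\mathcal O_X$ and an exact sequence $0\to\mathcal I\to\mathcal O_S\to\mathcal O_X\to0$ with $\mathcal I^2=0$, $\mathcal I$ locally free of finite rank over $\mathcal O_X$, and $\mathcal O_S\to\mathcal O_X$ has sections that are morphisms of sheaves of $k$-algebras locally on $X$. Let $j:X\to S$ be the corresponding morphism, $\overline{\mathcal K}=j^*\mathcal K$ and $\mathcal E=j^*\Omega^1_S$ (holomorphic differentials in the analytic case). For an $\mathcal O_S$-module $\mathcal F$, the $\mathcal O_X$-module $\mathrm{Tor}^1_S(\mathcal F,\mathcal O_X)$ is the kernel of the multiplication $\mathcal I\otimes\overline{\mathcal F}\to\mathcal F$, and $\mathrm P^1_S(\mathcal F)$ is $(\Omega^1_S\otimes\mathcal F)\oplus\mathcal F$ with $r(\omega\otimes m,m')=(r\omega\otimes m+dr\otimes m',rm')$. These are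 applied degreewise to complexes. A complex $\mathcal L$ of $\mathcal O_S$-modules is admissible if the complex $\mathrm{Tor}^1_S(\mathcal L,\mathcal O_X)$ is exact. $\mathrm D^{\mathrm{adm}}(S)$ is the localization of the category $\mathrm C^-(S)$ of bounded above complexes of $\mathcal O_S$-modules at the morphisms $\varphi$ for which $j^*\varphi$ and $\mathrm{Tor}^1_S(\varphi,\mathcal O_X)$ are quasi-isomorphisms. Then the left derived functor $\mathbb Lj^*:\mathrm D^-(S)\to\mathrm D^-(X)$ exists, the functor $\mathrm{Tor}^1_S(-,\mathcal O_X)$ is isomorphic to the first left derived functor of $j^*$, and for every bounded complex $\mathcal K$ of $\mathcal O_S$-modules the sequence $$0\to\mathrm{Tor}^1_S(\mathcal K,\mathcal O_X)\to\mathcal E\otimes\overline{\mathcal K}\to j^*\mathrm P^1_S(\mathcal K)\to\overline{\mathcal K}\to0$$ is exact, where the first map is induced by $\mathcal I\to\mathcal E$, $i\mapsto di$. Let $\Theta_{\mathcal K}:\overline{\mathcal K}\to\mathrm{Tor}^1_S(\mathcal K,\mathcal O_X)[2]$ be its Yoneda class in the derived category (the geometric HKR class). The following are equivalent: (i) $\Theta_{\mathcal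 K}=0$. (ii) The natural morphism $\mathbb Lj^*\mathcal K\to j^*\mathcal K$ has a right inverse in $\mathrm D^-(X)$. (iii) There are a bounded admissible complex $\mathcal L$ and a morphism $\mathcal L\to\mathcal K$ in $\mathrm D^{\mathrm b}(S)$ such that the composition $\mathbb Lj^*\mathcal L\to\mathbb Lj^*\mathcal K\to j^*\mathcal K$ is an isomorphism in $\mathrm D^-(X)$. (iv) There are a bounded admissible complex $\mathcal L$ and a morphism $\mathcal L\to\mathcal K$ in $\mathrm D^{\mathrm{adm}}(S)$ such that the induced morphism $\overline{\mathcal L}\to\overline{\mathcal K}$ is an isomorphism in $\mathrm D^{\mathrm b}(X)$. (v) There are a bounded admissible complex $\mathcal L$ and a subcomplex $\mathcal T$ of $\mathcal I\otimes\overline{\mathcal L}$ such that $\mathcal K$ is isomorphic in $\mathrm D^{\mathrm{adm}}(S)$ to the quotient $\mathcal L/\mathcal T$ of $\mathcal L$ by the image of $\mathcal T$ under $\mathcal I\otimes\overline{\mathcal L}\to\mathcal L$. If any of these properties holds, there is an isomorphism in $\mathrm D^-(X)$ $$\mathbb Lj^*\mathcal K\simeq j^*\mathcal K\oplus\mathbb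 Lj^*\,\mathrm{Tor}^1_S(\mathcal K,\mathcal O_X)[1],$$ where $\mathrm{Tor}^1_S(\mathcal K,\mathcal O_X)$ is regarded as a complex of $\mathcal O_S$-modules. -/

import Mathlib

open CategoryTheory Limits Opposite MonoidalCategory TopologicalSpace

universe u v

noncomputable section
namespace SqZeroThickening

section Complexes
variable (C : Type v) [Category.{u} C] [Abelian C]

/-- The cochain complexes that vanish in all large degrees. -/
def minusProp : ObjectProperty (CochainComplex C ℤ) := fun K ↦ ∃ n : ℤ, K.IsStrictlyLE n

/-- The category `C⁻` of bounded above cochain complexes in an abelian category. -/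
abbrev CMinus := (minusProp C).FullSubcategory

/-- The inclusion of bounded above complexes into all complexes. -/
abbrev CMinus.ι : CMinus C ⥤ CochainComplex C ℤ := (minusProp C).ι

variable {C} in
/-- A bounded above complex is bounded when it also vanishes in all small degrees. -/
def CMinus.IsBounded (K : CMinus C) : Prop := ∃ n : ℤ, K.obj.IsStrictlyGE n

attribute [local instance] HasDerivedCategory.standard

/-- The derived category `D⁻` of an abelian category. -/
abbrev DMinus := DerivedCategory.Minus C

/-- The localization functor `C⁻ ⥤ D⁻`. -/
def CMinus.Q : CMinus C ⥤ DMinus C :=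
  (DerivedCategory.TStructure.t (C := C)).minus.lift (CMinus.ι C ⋙ DerivedCategory.Q) (by
    rintro ⟨K, n, hK⟩
    exact ⟨n, inferInstanceAs ((DerivedCategory.Q.obj K).IsLE n)⟩)

variable {C} {D : Type v} [Category.{u} D] [Abelian D]

variable (C) in
/-- An object seen as a complex concentrated in degree `0`. -/
def CMinus.single : C ⥤ CMinus C :=
  (minusProp C).lift (CochainComplex.singleFunctor C 0) (fun _ ↦ ⟨0, inferInstance⟩)

lemma CMinus.isIso_Q_map {K L : CMinus C} (f : K ⟶ L) (hf : QuasiIso f.hom) :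
    IsIso ((CMinus.Q C).map f) := by
  have : IsIso (DerivedCategory.Minus.ι.map ((CMinus.Q C).map f)) :=
    inferInstanceAs (IsIso (DerivedCategory.Q.map f.hom))
  exact isIso_of_fully_faithful DerivedCategory.Minus.ι _

lemma minusProp_of_epi {K L : CochainComplex C ℤ} (f : K ⟶ L) [Epi f] (hK : minusProp C K) :
    minusProp C L := by
  obtain ⟨n, hn⟩ := hK
  refine ⟨n, (CochainComplex.isStrictlyLE_iff L n).2 fun i hi ↦ ?_⟩
  exact IsZero.of_epi (f.f i) ((CochainComplex.isStrictlyLE_iff K n).1 hn i hi)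

lemma minusProp_map (F : C ⥤ D) [F.PreservesZeroMorphisms] (K : CochainComplex C ℤ)
    (hK : minusProp C K) : minusProp D ((F.mapHomologicalComplex _).obj K) := by
  obtain ⟨n, hn⟩ := hK
  exact ⟨n, inferInstance⟩

/-- A functor that preserves zero morphisms, applied degreewise. -/
def CMinus.map (F : C ⥤ D) [F.PreservesZeroMorphisms] : CMinus C ⥤ CMinus D :=
  (minusProp D).lift (CMinus.ι C ⋙ F.mapHomologicalComplex _) (fun K ↦ minusProp_map F K.obj K.property)

/-- Exactness of a sequence `0 ⟶ K₁ ⟶ K₂ ⟶ K₃ ⟶ K₄ ⟶ 0` of complexes. -/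
structure IsExactFour {K₁ K₂ K₃ K₄ : CochainComplex C ℤ} (f : K₁ ⟶ K₂) (g : K₂ ⟶ K₃)
    (h : K₃ ⟶ K₄) : Prop where
  zero₁ : f ≫ g = 0
  zero₂ : g ≫ h = 0
  mono : Mono f
  exact₁ : (ShortComplex.mk f g zero₁).Exact
  exact₂ : (ShortComplex.mk g h zero₂).Exact
  epi : Epi h

namespace IsExactFour
variable {K₁ K₂ K₃ K₄ : CochainComplex C ℤ} {f : K₁ ⟶ K₂} {g : K₂ ⟶ K₃} {h : K₃ ⟶ K₄}

lemma shortExact₁ (e : IsExactFour f g h) : (ShortComplex.mk f (kernel.lift h g e.zero₂)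
    (by rw [← cancel_mono (kernel.ι h)]; simp [e.zero₁])).ShortExact where
  exact := by
    let φ : ShortComplex.mk f (kernel.lift h g e.zero₂)
        (by rw [← cancel_mono (kernel.ι h)]; simp [e.zero₁]) ⟶ ShortComplex.mk f g e.zero₁ :=
      { τ₁ := 𝟙 _, τ₂ := 𝟙 _, τ₃ := kernel.ι h }
    have h₁ : Epi φ.τ₁ := inferInstanceAs (Epi (𝟙 _))
    have h₂ : IsIso φ.τ₂ := inferInstanceAs (IsIso (𝟙 _))
    have h₃ : Mono φ.τ₃ := inferInstanceAs (Mono (kernel.ι h))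
    exact (ShortComplex.exact_iff_of_epi_of_isIso_of_mono φ).2 e.exact₁
  mono_f := e.mono
  epi_g := e.exact₂.epi_kernelLift

lemma shortExact₂ (e : IsExactFour f g h) : (ShortComplex.mk (kernel.ι h) h (kernel.condition h)).ShortExact where
  exact := ShortComplex.exact_kernel h
  mono_f := inferInstance
  epi_g := e.epi

/-- The Yoneda class `K₄ ⟶ K₁[2]` of an exact sequence `0 ⟶ K₁ ⟶ K₂ ⟶ K₃ ⟶ K₄ ⟶ 0`: the
composition of the connecting morphisms of `0 ⟶ Z ⟶ K₃ ⟶ K₄ ⟶ 0` and `0 ⟶ K₁ ⟶ K₂ ⟶ Z ⟶ 0`,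
where `Z` is the kernel of `K₃ ⟶ K₄`. -/
def yonedaClass (e : IsExactFour f g h) :
    DerivedCategory.Q.obj K₄ ⟶ (DerivedCategory.Q.obj K₁)⟦(2 : ℤ)⟧ :=
  DerivedCategory.triangleOfSESδ e.shortExact₂ ≫
    (DerivedCategory.triangleOfSESδ e.shortExact₁)⟦(1 : ℤ)⟧' ≫
      (shiftFunctorAdd' (DerivedCategory C) (1 : ℤ) 1 2 (by norm_num)).inv.app _

end IsExactFour
end Complexes

section PrincipalParts
open scoped TensorProduct
variable {C : Type u} [Category.{v} C] {k R : Cᵒᵖ ⥤ CommRingCat.{u}} {ρ : k ⟶ R}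
  {Ω : PresheafOfModules.{u} (R ⋙ forget₂ CommRingCat RingCat)} (δ : Ω.Derivation' ρ)

/-- Sections over `U` of the presheaf of first principal parts `P¹(F) = (Ω ⊗ F) ⊕ F` attached to a
derivation `δ : R ⟶ Ω`; its module structure is `r (t, m) = (r t + δ r ⊗ m, r m)`. -/
def PPart (_ : Ω.Derivation' ρ) (F : PresheafOfModules.{u} (R ⋙ forget₂ CommRingCat RingCat)) (U : Cᵒᵖ) : Type u :=
  ((Ω.obj U : Type u) ⊗[R.obj U] (F.obj U : Type u)) × (F.obj U : Type u)

namespace PPart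
variable (F : PresheafOfModules.{u} (R ⋙ forget₂ CommRingCat RingCat)) (U : Cᵒᵖ)

instance : AddCommGroup (PPart δ F U) :=
  inferInstanceAs (AddCommGroup (((Ω.obj U : Type u) ⊗[R.obj U] (F.obj U : Type u)) × (F.obj U : Type u)))

variable {F U} in
lemma ext' {x y : PPart δ F U} (h₁ : x.1 = y.1) (h₂ : x.2 = y.2) : x = y := Prod.ext h₁ h₂

instance : Module (R.obj U) (PPart δ F U) where
  smul r x := (r • x.1 + (δ.d r : Ω.obj U) ⊗ₜ[R.obj U] x.2, r • x.2)
  one_smul x := by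
    refine PPart.ext' δ ?_ ?_
    · change (1 : R.obj U) • x.1 + (δ.d (1 : R.obj U) : Ω.obj U) ⊗ₜ[R.obj U] x.2 = x.1
      rw [PresheafOfModules.Derivation.d_one, TensorProduct.zero_tmul, one_smul, add_zero]
    · exact one_smul _ _
  mul_smul r s x := by
    refine PPart.ext' δ ?_ ?_
    · change (r * s) • x.1 + (δ.d (r * s) : Ω.obj U) ⊗ₜ[R.obj U] x.2 =
        r • (s • x.1 + (δ.d s : Ω.obj U) ⊗ₜ[R.obj U] x.2) + (δ.d r : Ω.obj U) ⊗ₜ[R.obj U] (s • x.2)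
      rw [PresheafOfModules.Derivation.d_mul, TensorProduct.add_tmul, smul_add, mul_smul,
        TensorProduct.tmul_smul]
      rw [add_assoc]
      rfl
    · exact mul_smul _ _ _
  smul_zero r := by
    refine PPart.ext' δ ?_ ?_
    · change r • (0 : (Ω.obj U : Type u) ⊗[R.obj U] (F.obj U : Type u)) + (δ.d r : Ω.obj U) ⊗ₜ[R.obj U] (0 : F.obj U) = 0
      rw [smul_zero, TensorProduct.tmul_zero, add_zero]
    · exact smul_zero _
  smul_add r x y := by
    refine PPart.ext' δ ?_ ?_
    · change r • (x.1 + y.1) + (δ.d r : Ω.obj U) ⊗ₜ[R.obj U] (x.2 + y.2) =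
        (r • x.1 + (δ.d r : Ω.obj U) ⊗ₜ[R.obj U] x.2) + (r • y.1 + (δ.d r : Ω.obj U) ⊗ₜ[R.obj U] y.2)
      rw [smul_add, TensorProduct.tmul_add]; abel
    · exact smul_add _ _ _
  add_smul r s x := by
    refine PPart.ext' δ ?_ ?_
    · change (r + s) • x.1 + (δ.d (r + s) : Ω.obj U) ⊗ₜ[R.obj U] x.2 =
        (r • x.1 + (δ.d r : Ω.obj U) ⊗ₜ[R.obj U] x.2) + (s • x.1 + (δ.d s : Ω.obj U) ⊗ₜ[R.obj U] x.2)
      rw [add_smul, map_add, TensorProduct.add_tmul]; abel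
    · exact add_smul _ _ _
  zero_smul x := by
    refine PPart.ext' δ ?_ ?_
    · change (0 : R.obj U) • x.1 + (δ.d (0 : R.obj U) : Ω.obj U) ⊗ₜ[R.obj U] x.2 = 0
      rw [map_zero, TensorProduct.zero_tmul, zero_smul, add_zero]
    · exact zero_smul _ _

/-- The restriction maps of the presheaf `Ω ⊗ F`. -/
def tensorRes {U V : Cᵒᵖ} (f : U ⟶ V) :
    (Ω.obj U : Type u) ⊗[R.obj U] (F.obj U : Type u) →+
      (Ω.obj V : Type u) ⊗[R.obj V] (F.obj V : Type u) :=
  ((Ω ⊗ F).presheaf.map f).hom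

lemma tensorRes_smul {U V : Cᵒᵖ} (f : U ⟶ V) (r : R.obj U)
    (x : (Ω.obj U : Type u) ⊗[R.obj U] (F.obj U : Type u)) :
    tensorRes (Ω := Ω) F f (r • x) = (R.map f r) • tensorRes (Ω := Ω) F f x :=
  (Ω ⊗ F).map_smul f r x

lemma tensorRes_tmul {U V : Cᵒᵖ} (f : U ⟶ V) (x : Ω.obj U) (y : F.obj U) :
    tensorRes (Ω := Ω) F f (x ⊗ₜ[R.obj U] y) =
      (show Ω.obj V from Ω.map f x) ⊗ₜ[R.obj V] (show F.obj V from F.map f y) := rfl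

/-- The restriction maps of the principal parts. -/
def res {U V : Cᵒᵖ} (f : U ⟶ V) : PPart δ F U →+ PPart δ F V :=
  AddMonoidHom.prodMap (tensorRes (Ω := Ω) F f) ((F.presheaf.map f).hom)

lemma res_smul {U V : Cᵒᵖ} (f : U ⟶ V) (r : R.obj U) (x : PPart δ F U) :
    res δ F f (r • x) = (R.map f r) • res δ F f x := by
  refine PPart.ext' δ ?_ ?_
  · change tensorRes (Ω := Ω) F f (r • x.1 + (δ.d r : Ω.obj U) ⊗ₜ[R.obj U] x.2) =
      (R.map f r) • tensorRes (Ω := Ω) F f x.1 +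
        (δ.d (R.map f r) : Ω.obj V) ⊗ₜ[R.obj V] (show F.obj V from F.map f x.2)
    rw [map_add, tensorRes_smul, tensorRes_tmul, PresheafOfModules.Derivation.d_map]
  · exact F.map_smul f r x.2

/-- The presheaf of abelian groups of principal parts. -/
def presheaf : Cᵒᵖ ⥤ AddCommGrpCat.{u} where
  obj U := AddCommGrpCat.of (PPart δ F U)
  map f := AddCommGrpCat.ofHom (res δ F f)
  map_id U := by
    ext x
    refine PPart.ext' δ ?_ ?_
    · exact ConcreteCategory.congr_hom ((Ω ⊗ F).presheaf.map_id U) x.1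
    · exact ConcreteCategory.congr_hom (F.presheaf.map_id U) x.2
  map_comp f g := by
    ext x
    refine PPart.ext' δ ?_ ?_
    · exact ConcreteCategory.congr_hom ((Ω ⊗ F).presheaf.map_comp f g) x.1
    · exact ConcreteCategory.congr_hom (F.presheaf.map_comp f g) x.2

instance (U : Cᵒᵖ) : Module ((R ⋙ forget₂ CommRingCat RingCat).obj U) ((presheaf δ F).obj U) :=
  inferInstanceAs (Module (R.obj U) (PPart δ F U))

end PPart

/-- The presheaf of modules `P¹(F)`. -/
def ppObj (F : PresheafOfModules.{u} (R ⋙ forget₂ CommRingCat RingCat)) :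
    PresheafOfModules.{u} (R ⋙ forget₂ CommRingCat RingCat) :=
  PresheafOfModules.ofPresheaf (PPart.presheaf δ F) (fun _ _ f r x ↦ PPart.res_smul δ F f r x)

/-- The map `Ω(U) ⊗ F(U) ⟶ Ω(U) ⊗ G(U)` induced by `f`. -/
def tensorMapApp {F G : PresheafOfModules.{u} (R ⋙ forget₂ CommRingCat RingCat)} (f : F ⟶ G)
    (U : Cᵒᵖ) : (Ω.obj U : Type u) ⊗[R.obj U] (F.obj U : Type u) →ₗ[R.obj U]
      (Ω.obj U : Type u) ⊗[R.obj U] (G.obj U : Type u) :=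
  ((Ω ◁ f).app U).hom

/-- The morphism `P¹(F) ⟶ P¹(G)` induced by `f`. -/
def ppMap {F G : PresheafOfModules.{u} (R ⋙ forget₂ CommRingCat RingCat)} (f : F ⟶ G) :
    ppObj δ F ⟶ ppObj δ G :=
  PresheafOfModules.homMk
    { app U := AddCommGrpCat.ofHom (AddMonoidHom.prodMap
        ((((PresheafOfModules.toPresheaf _).map (Ω ◁ f)).app U).hom)
        ((((PresheafOfModules.toPresheaf _).map f).app U).hom) : PPart δ F U →+ PPart δ G U)
      naturality U V g := by
        ext x
        refine PPart.ext' δ ?_ ?_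
        · exact ConcreteCategory.congr_hom (((PresheafOfModules.toPresheaf _).map (Ω ◁ f)).naturality g) x.1
        · exact ConcreteCategory.congr_hom (((PresheafOfModules.toPresheaf _).map f).naturality g) x.2 }
    (by
      intro U r x
      refine PPart.ext' δ ?_ ?_
      · exact (map_add (tensorMapApp (Ω := Ω) f U) _ _).trans
          (congrArg (· + _) ((tensorMapApp (Ω := Ω) f U).map_smul (r : R.obj U) x.1))
      · exact (f.app U).hom.map_smul r x.2)

/-- First principal parts as a functor `P¹`. -/
def ppFunctor : PresheafOfModules.{u} (R ⋙ forget₂ CommRingCat RingCat) ⥤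
    PresheafOfModules.{u} (R ⋙ forget₂ CommRingCat RingCat) where
  obj := ppObj δ
  map := ppMap δ
  map_id F := by
    ext U (x : PPart δ F U)
    refine PPart.ext' δ ?_ ?_
    · have h : (Ω ◁ 𝟙 F).app U = 𝟙 ((Ω ⊗ F).obj U) := by
        rw [MonoidalCategory.whiskerLeft_id]; rfl
      exact LinearMap.congr_fun (congrArg ModuleCat.Hom.hom h) x.1
    · rfl
  map_comp {F G H} f g := by
    ext U (x : PPart δ F U)
    refine PPart.ext' δ ?_ ?_
    · have h : (Ω ◁ (f ≫ g)).app U = (Ω ◁ f).app U ≫ (Ω ◁ g).app U := by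
        rw [MonoidalCategory.whiskerLeft_comp]; rfl
      exact LinearMap.congr_fun (congrArg ModuleCat.Hom.hom h) x.1
    · rfl

/-- The inclusion `Ω ⊗ F ⟶ P¹(F)`, `t ↦ (t, 0)`. -/
def ppInl : tensorLeft Ω ⟶ ppFunctor δ where
  app F := PresheafOfModules.homMk
    { app U := AddCommGrpCat.ofHom (AddMonoidHom.inl _ _ : _ →+ PPart δ F U)
      naturality U V g := by
        ext x
        refine PPart.ext' δ rfl ?_
        exact (map_zero (F.presheaf.map g).hom).symm }
    (by
      intro U r x
      refine PPart.ext' δ ?_ ?_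
      · exact ((congrArg (_ + ·) (TensorProduct.tmul_zero _ _)).trans (add_zero _)).symm
      · exact (smul_zero (A := F.obj U) (r : R.obj U)).symm)
  naturality F G f := by
    ext U x
    refine PPart.ext' δ rfl ?_
    exact (map_zero (f.app U).hom).symm

/-- The projection `P¹(F) ⟶ F`, `(t, m) ↦ m`. -/
def ppSnd : ppFunctor δ ⟶ 𝟭 _ where
  app F := PresheafOfModules.homMk
    { app U := AddCommGrpCat.ofHom (AddMonoidHom.snd _ _ : PPart δ F U →+ _)
      naturality _ _ _ := rfl }
    (fun _ _ _ ↦ rfl)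
  naturality _ _ _ := rfl

end PrincipalParts

section Sheaves

attribute [local instance] HasDerivedCategory.standard

/-- A sheaf of commutative `k`-algebras on the topological space `X`. -/
structure AlgSheaf (k : Type u) [CommRing k] (X : TopCat.{u}) where
  sheaf : Sheaf (Opens.grothendieckTopology X) CommRingCat.{u}
  str : (Functor.const (Opens X)ᵒᵖ).obj (CommRingCat.of k) ⟶ sheaf.obj

variable {k : Type u} [CommRing k] {X : TopCat.{u}}

namespace AlgSheaf

variable (A : AlgSheaf k X)

/-- Restriction of sections. -/
def res {U V : Opens X} (h : V ≤ U) : A.sheaf.obj.obj (op U) →+* A.sheaf.obj.obj (op V) :=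
  (A.sheaf.obj.map (homOfLE h).op).hom

/-- Presheaves of modules over `A`. -/
abbrev PMod := PresheafOfModules.{u} (A.sheaf.obj ⋙ forget₂ CommRingCat RingCat)

/-- The underlying sheaf of rings. -/
abbrev ringSheaf : Sheaf (Opens.grothendieckTopology X) RingCat.{u} :=
  (sheafCompose (Opens.grothendieckTopology X) (forget₂ CommRingCat RingCat)).obj A.sheaf

/-- The abelian category of sheaves of modules over `A`. -/
abbrev Mod := SheafOfModules.{u} A.ringSheaf

/-- The underlying presheaf of modules. -/
def forget : A.Mod ⥤ A.PMod := SheafOfModules.forget A.ringSheaf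

/-- The sheaf associated with a presheaf of modules. -/
def sheafify : A.PMod ⥤ A.Mod :=
  (PresheafOfModules.sheafification (𝟙 A.ringSheaf.obj) :
    PresheafOfModules.{u} A.ringSheaf.obj ⥤ SheafOfModules.{u} A.ringSheaf)

/-- Sheafification is left adjoint to the forgetful functor. -/
def sheafifyAdj : A.sheafify ⊣ A.forget :=
  (PresheafOfModules.sheafificationAdjunction (𝟙 A.ringSheaf.obj) :)

/-- `A` as a module over itself. -/
abbrev unit : A.Mod := SheafOfModules.unit A.ringSheaf

/-- The underlying presheaf of rings. -/
abbrev presheaf : X.Presheaf CommRingCat.{u} := A.sheaf.obj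

/-- The stalk at a point. -/
abbrev stalk (x : X) : CommRingCat.{u} := TopCat.Presheaf.stalk A.presheaf x

/-- The germ of a section at a point. -/
def germ {V : Opens X} {x : X} (hx : x ∈ V) : A.sheaf.obj.obj (op V) →+* A.stalk x :=
  (TopCat.Presheaf.germ A.presheaf V x hx).hom

lemma germ_res {U V : Opens X} (h : V ≤ U) {x : X} (hx : x ∈ V) (s : A.sheaf.obj.obj (op U)) :
    A.germ hx (A.res h s) = A.germ (h hx) s :=
  ConcreteCategory.congr_hom (TopCat.Presheaf.germ_res A.presheaf (homOfLE h) x hx) s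

/-- The sections over `V` whose germ at `x` lies in the Jacobson radical of the stalk, that is, in the
maximal ideal when the stalk is local. -/
def vanishingIdeal (V : Opens X) (x : X) (hx : x ∈ V) : Ideal (A.sheaf.obj.obj (op V)) :=
  (Ideal.jacobson (⊥ : Ideal (A.stalk x))).comap (A.germ hx)

lemma vanishingIdeal_map_le {U V : Opens X} (h : V ≤ U) (x : X) (hx : x ∈ V) :
    (A.vanishingIdeal U x (h hx)).map (A.res h) ≤ A.vanishingIdeal V x hx := by
  rw [Ideal.map_le_iff_le_comap]
  intro s hs
  change A.germ hx (A.res h s) ∈ Ideal.jacobson (⊥ : Ideal (A.stalk x))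
  rw [germ_res]
  exact hs

/-- The presheaf of Kähler differentials `U ↦ Ω(A(U)/k)`. -/
abbrev kaehler : A.PMod := PresheafOfModules.DifferentialsConstruction.relativeDifferentials' A.str

/-- Restriction of Kähler differentials. -/
def kRes {U V : Opens X} (h : V ≤ U) : A.kaehler.obj (op U) →+ A.kaehler.obj (op V) :=
  (A.kaehler.presheaf.map (homOfLE h).op).hom

lemma kRes_smul {U V : Opens X} (h : V ≤ U) (r : A.sheaf.obj.obj (op U)) (ω : A.kaehler.obj (op U)) :
    A.kRes h (r • ω) = A.res h r • A.kRes h ω :=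
  A.kaehler.map_smul (homOfLE h).op r ω

lemma kRes_kRes {U V W : Opens X} (h : V ≤ U) (h' : W ≤ V) (ω : A.kaehler.obj (op U)) :
    A.kRes h' (A.kRes h ω) = A.kRes (h'.trans h) ω :=
  (ConcreteCategory.congr_hom (A.kaehler.presheaf.map_comp (homOfLE h).op (homOfLE h').op) ω).symm

/-- The Kähler differentials over `V` that lie in `𝔪ⁿ Ω`, with `𝔪` the ideal of the point `x`. -/
def powDiff (n : ℕ) (V : Opens X) (x : X) (hx : x ∈ V) :
    Submodule (A.sheaf.obj.obj (op V)) (A.kaehler.obj (op V)) :=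
  A.vanishingIdeal V x hx ^ n • ⊤

lemma kRes_mem_powDiff {n : ℕ} {U V : Opens X} (h : V ≤ U) {x : X} (hx : x ∈ V)
    {ω : A.kaehler.obj (op U)} (hω : ω ∈ A.powDiff n U x (h hx)) :
    A.kRes h ω ∈ A.powDiff n V x hx := by
  refine Submodule.smul_induction_on hω (fun r hr η _ ↦ ?_) (fun a b ha hb ↦ ?_)
  · rw [kRes_smul]
    refine Submodule.smul_mem_smul ?_ trivial
    have h₁ := Ideal.mem_map_of_mem (A.res h) hr
    rw [Ideal.map_pow] at h₁
    exact Ideal.pow_right_mono (A.vanishingIdeal_map_le h x hx) n h₁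
  · rw [map_add]
    exact add_mem ha hb

/-- The Kähler differentials over `U` whose germ at every point `x` lies in `𝔪ₓⁿ Ωₓ` for all `n`. -/
def flatDiff (U : Opens X) : Submodule (A.sheaf.obj.obj (op U)) (A.kaehler.obj (op U)) where
  carrier := { ω | ∀ x ∈ U, ∀ n : ℕ, ∃ (V : Opens X) (hx : x ∈ V) (h : V ≤ U),
    A.kRes h ω ∈ A.powDiff n V x hx }
  zero_mem' x hx n := ⟨U, hx, le_rfl, by rw [map_zero]; exact zero_mem _⟩
  add_mem' {a b} ha hb x hx n := by
    obtain ⟨V, hV, h, h₁⟩ := ha x hx n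
    obtain ⟨W, hW, h', h₂⟩ := hb x hx n
    refine ⟨V ⊓ W, ⟨hV, hW⟩, inf_le_left.trans h, ?_⟩
    rw [map_add]
    refine add_mem ?_ ?_
    · rw [← A.kRes_kRes h inf_le_left]
      exact A.kRes_mem_powDiff _ _ h₁
    · rw [← A.kRes_kRes h' inf_le_right]
      exact A.kRes_mem_powDiff _ _ h₂
  smul_mem' r a ha x hx n := by
    obtain ⟨V, hV, h, h₁⟩ := ha x hx n
    refine ⟨V, hV, h, ?_⟩
    rw [kRes_smul]
    exact Submodule.smul_mem _ _ h₁

lemma kRes_mem_flatDiff {U V : Opens X} (h : V ≤ U) {ω : A.kaehler.obj (op U)}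
    (hω : ω ∈ A.flatDiff U) : A.kRes h ω ∈ A.flatDiff V := by
  intro x hx n
  obtain ⟨W, hW, h', h₁⟩ := hω x (h hx) n
  refine ⟨V ⊓ W, ⟨hx, hW⟩, inf_le_left, ?_⟩
  rw [kRes_kRes, ← A.kRes_kRes h' inf_le_right]
  exact A.kRes_mem_powDiff _ _ h₁

/-- The previous submodules, as a subpresheaf of the Kähler differentials. -/
def flatSub : A.kaehler.Submodule where
  obj U := A.flatDiff U.unop
  map {_ _} f _ hω := A.kRes_mem_flatDiff (leOfHom f.unop) hω

/-- The (presheaf of) differentials `Ω¹`: Kähler differentials modulo those that are infinitely flat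
at every point. For a scheme locally of finite type over `k` nothing is divided out, as the
stalks `Ωₓ` are finite modules over noetherian local rings, so these are the Kähler differentials.
For a complex analytic space over `ℂ` the stalks are the universal finite differential modules of
the local analytic algebras, so these are the usual holomorphic differentials (where for instance
`d (exp z) = exp z • dz`, which fails for abstract Kähler differentials). -/
def Ω : A.PMod := cokernel A.flatSub.ι

/-- The universal derivation `d : A ⟶ Ω¹`. -/
def δ : A.Ω.Derivation' A.str :=
  PresheafOfModules.Derivation.postcomp
    (PresheafOfModules.DifferentialsConstruction.derivation' A.str) (cokernel.π A.flatSub.ι)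

/-- The sheaf of principal parts `P¹(F)`, as a functor on sheaves of modules. -/
def pp : A.Mod ⥤ A.Mod := A.forget ⋙ ppFunctor A.δ ⋙ A.sheafify

/-- The functor `F ↦ Ω¹ ⊗ F` on sheaves of modules. -/
def omegaT : A.Mod ⥤ A.Mod := A.forget ⋙ tensorLeft A.Ω ⋙ A.sheafify

/-- The inclusion `Ω¹ ⊗ F ⟶ P¹(F)`. -/
def omegaTToPP : A.omegaT ⟶ A.pp :=
  Functor.whiskerLeft A.forget (Functor.whiskerRight (ppInl A.δ) A.sheafify)

/-- The projection `P¹(F) ⟶ F`. -/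
def ppTo : A.pp ⟶ 𝟭 A.Mod :=
  Functor.whiskerLeft A.forget (Functor.whiskerRight (ppSnd A.δ) A.sheafify) ≫ A.sheafifyAdj.counit

end AlgSheaf

/-- Locally free of finite rank: near every point there is a finite basis of sections. -/
def IsLocallyFreeOfFiniteRank {A : AlgSheaf k X} (M : A.Mod) : Prop :=
  ∀ x : X, ∃ (U : Opens X), x ∈ U ∧ ∃ (n : ℕ) (e : Fin n → (A.forget.obj M).obj (op U)),
    ∀ (V : Opens X) (h : V ≤ U), Function.Bijective
      (fun a : Fin n → A.sheaf.obj.obj (op V) ↦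
        ∑ i, a i • (show (A.forget.obj M).obj (op V) from (A.forget.obj M).map (homOfLE h).op (e i)))

/-- Morphisms of sheaves of `k`-algebras on `X`. -/
structure AlgSheaf.Hom (A B : AlgSheaf k X) where
  hom : A.sheaf ⟶ B.sheaf
  comm : A.str ≫ hom.hom = B.str

namespace AlgSheaf.Hom

variable {A B : AlgSheaf k X} (π : A.Hom B)

/-- The ring homomorphism on sections. -/
def app (U : Opens X) : A.sheaf.obj.obj (op U) →+* B.sheaf.obj.obj (op U) :=
  (π.hom.hom.app (op U)).hom

/-- The underlying morphism of sheaves of rings. -/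
def toRing : A.ringSheaf ⟶ ((𝟭 (Opens X)).sheafPushforwardContinuous RingCat.{u}
    (Opens.grothendieckTopology X) (Opens.grothendieckTopology X)).obj B.ringSheaf :=
  ⟨Functor.whiskerRight π.hom.hom (forget₂ CommRingCat RingCat)⟩

/-- Restriction of scalars. For a closed immersion `j` that is the identity on spaces, this is `j_*`. -/
def push : B.Mod ⥤ A.Mod := SheafOfModules.pushforward π.toRing

lemma isRightAdjoint_pushforward_aux {C : Type u} [SmallCategory C] {R S : Cᵒᵖ ⥤ RingCat.{u}} (φ : S ⟶ (𝟭 C).op ⋙ R) :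
    (PresheafOfModules.pushforward.{u} φ).IsRightAdjoint := inferInstance

instance : (PresheafOfModules.pushforward.{u} π.toRing.hom).IsRightAdjoint := isRightAdjoint_pushforward_aux _

instance : (SheafOfModules.pushforward.{u} π.toRing).IsRightAdjoint :=
  (SheafOfModules.PullbackConstruction.adjunction.{u} π.toRing).isRightAdjoint

/-- Extension of scalars `F ↦ B ⊗_A F`, the left adjoint of restriction of scalars; this is `j^*`. -/
def pull : A.Mod ⥤ B.Mod := SheafOfModules.pullback π.toRing

/-- The adjunction between `j^*` and `j_*`. -/
def adj : π.pull ⊣ π.push := SheafOfModules.pullbackPushforwardAdjunction π.toRing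

end AlgSheaf.Hom

namespace AlgSheaf
variable (A : AlgSheaf k X)

instance : A.forget.PreservesZeroMorphisms :=
  inferInstanceAs (SheafOfModules.forget A.ringSheaf).PreservesZeroMorphisms

instance : A.sheafify.PreservesZeroMorphisms :=
  have := A.sheafifyAdj.isLeftAdjoint
  Functor.preservesZeroMorphisms_of_isLeftAdjoint _

variable {A} in
lemma whiskerLeft_zero (P F G : A.PMod) : P ◁ (0 : F ⟶ G) = 0 := by
  ext1 U
  exact ModuleCat.MonoidalCategory.tensor_ext (fun p _ ↦ TensorProduct.tmul_zero _ p)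

instance (P : A.PMod) : (tensorLeft P).PreservesZeroMorphisms where
  map_zero F G := whiskerLeft_zero P F G

instance : (ppFunctor A.δ).PreservesZeroMorphisms where
  map_zero F G := by
    ext U (x : PPart A.δ F U)
    refine PPart.ext' A.δ ?_ rfl
    have h : (A.Ω ◁ (0 : F ⟶ G)).app U = 0 := by
      rw [whiskerLeft_zero]; rfl
    exact LinearMap.congr_fun (congrArg ModuleCat.Hom.hom h) x.1

instance : A.omegaT.PreservesZeroMorphisms := by
  unfold omegaT; infer_instance

instance : A.pp.PreservesZeroMorphisms := by
  unfold pp; infer_instance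

variable {A} {B : AlgSheaf k X} (π : A.Hom B)

instance : π.pull.PreservesZeroMorphisms :=
  have := π.adj.isLeftAdjoint
  Functor.preservesZeroMorphisms_of_isLeftAdjoint _

instance : π.push.PreservesZeroMorphisms :=
  have := π.adj.isRightAdjoint
  Functor.preservesZeroMorphisms_of_isRightAdjoint _

end AlgSheaf

/-- A locally split first order thickening `S` of the `k`-ringed space `(X, A)` by a locally free
`A`-module of finite rank: an exact sequence `0 ⟶ I ⟶ O_S ⟶ A ⟶ 0` where `O_S ⟶ A` is a morphism of
sheaves of `k`-algebras and `I` is an ideal on which `O_S` acts through `A` (that is, `I² = 0`),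
such that `O_S ⟶ A` has sections that are morphisms of sheaves of `k`-algebras locally on `X`
(in particular it is surjective). -/
structure Thickening (A : AlgSheaf k X) where
  /-- the structure sheaf `O_S` -/
  total : AlgSheaf k X
  /-- the projection `O_S ⟶ A` -/
  proj : total.Hom A
  /-- the `A`-module `I` -/
  ideal : A.Mod
  locallyFree : IsLocallyFreeOfFiniteRank ideal
  /-- the inclusion `I ⟶ O_S`, which is `O_S`-linear -/
  incl : proj.push.obj ideal ⟶ total.unit
  incl_injective : ∀ U : (Opens X)ᵒᵖ, Function.Injective ((total.forget.map incl).app U)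
  exact : ∀ (U : Opens X) (s : total.sheaf.obj.obj (op U)), proj.app U s = 0 ↔
    ∃ i, (total.forget.map incl).app (op U) i = s
  locallySplit : ∀ x : X, ∃ U : Opens X, x ∈ U ∧
    ∃ σ : ∀ V : Opens X, V ≤ U → (A.sheaf.obj.obj (op V) →+* total.sheaf.obj.obj (op V)),
      (∀ V (hV : V ≤ U) (s : A.sheaf.obj.obj (op V)), proj.app V (σ V hV s) = s) ∧
      (∀ V (hV : V ≤ U) (c : k), σ V hV ((A.str.app (op V)).hom c) = (total.str.app (op V)).hom c) ∧
      (∀ V W (hV : V ≤ U) (h : W ≤ V) (s : A.sheaf.obj.obj (op V)),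
        σ W (h.trans hV) (A.res h s) = total.res h (σ V hV s))

namespace Thickening

variable {A : AlgSheaf k X} (S : Thickening A)

/-- The ideal as a presheaf of `O_S`-modules. -/
abbrev idealO : S.total.PMod := S.total.forget.obj (S.proj.push.obj S.ideal)

/-- The inclusion of the ideal into `O_S`, on presheaves. -/
abbrev inclO : S.idealO ⟶ 𝟙_ S.total.PMod := S.total.forget.map S.incl

/-- The functor `F ↦ I ⊗ F` on `O_S`-modules; as `I² = 0`, this is `I ⊗_A j^*F`. -/
def idealT : S.total.Mod ⥤ S.total.Mod := S.total.forget ⋙ tensorLeft S.idealO ⋙ S.total.sheafify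

/-- The multiplication `i ⊗ m ↦ i m`, on presheaves. -/
def preMul : tensorLeft S.idealO ⟶ 𝟭 S.total.PMod where
  app F := S.inclO ▷ F ≫ (λ_ F).hom
  naturality F G f := by
    change S.idealO ◁ f ≫ S.inclO ▷ G ≫ (λ_ G).hom = (S.inclO ▷ F ≫ (λ_ F).hom) ≫ f
    rw [Category.assoc, ← leftUnitor_naturality, whisker_exchange_assoc]

/-- The multiplication `I ⊗ F ⟶ F`, `i ⊗ m ↦ i m`. -/
def mul : S.idealT ⟶ 𝟭 S.total.Mod :=
  Functor.whiskerLeft S.total.forget (Functor.whiskerRight S.preMul S.total.sheafify) ≫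
    S.total.sheafifyAdj.counit

/-- The kernel of the multiplication `I ⊗ F ⟶ F`. -/
def torKer : S.total.Mod ⥤ S.total.Mod where
  obj F := kernel (S.mul.app F)
  map f := kernel.map _ _ (S.idealT.map f) f (S.mul.naturality f).symm
  map_id F := by rw [← cancel_mono (kernel.ι _)]; simp [kernel.map]
  map_comp f g := by rw [← cancel_mono (kernel.ι _)]; simp [kernel.map]

/-- The inclusion of this kernel into `I ⊗ F`. -/
def torKerι : S.torKer ⟶ S.idealT where
  app F := kernel.ι (S.mul.app F)
  naturality _ _ _ := kernel.lift_ι _ _ _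

/-- The functor `j^*` from `O_S`-modules to `A`-modules, `F ↦ A ⊗ F = F / I F`. -/
abbrev pull : S.total.Mod ⥤ A.Mod := S.proj.pull

/-- The functor `j_*` from `A`-modules to `O_S`-modules. -/
abbrev push : A.Mod ⥤ S.total.Mod := S.proj.push

/-- The functor `Tor¹(-, A)` on `O_S`-modules: the kernel of `I ⊗ F ⟶ F`, which is annihilated by `I`
and therefore seen as an `A`-module by means of `j^*`. -/
def tor1 : S.total.Mod ⥤ A.Mod := S.torKer ⋙ S.pull

section
open scoped TensorProduct

variable {F : S.total.PMod} {G : A.Mod} (η : S.total.Ω ⊗ F ⟶ S.total.forget.obj (S.push.obj G))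

lemma incl_smul (U : (Opens X)ᵒᵖ) (i : S.idealO.obj U)
    (m : (S.total.forget.obj (S.push.obj G)).obj U) :
    (show S.total.sheaf.obj.obj U from S.inclO.app U i) • m = 0 := by
  have h : S.proj.app U.unop (S.inclO.app U i) = 0 := (S.exact U.unop _).2 ⟨i, rfl⟩
  change (show A.sheaf.obj.obj U from S.proj.app U.unop (S.inclO.app U i)) • (show (A.forget.obj G).obj U from m) = 0
  rw [h]
  exact zero_smul _ _

/-- The map `(i, m) ↦ η (d i ⊗ m)`. -/
def conormalFun (U : (Opens X)ᵒᵖ) (i : S.idealO.obj U) (m : F.obj U) :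
    (S.total.forget.obj (S.push.obj G)).obj U :=
  η.app U ((S.total.δ.d (X := U) (S.inclO.app U i) : S.total.Ω.obj U) ⊗ₜ[S.total.sheaf.obj.obj U] m)

variable {U V : (Opens X)ᵒᵖ} (i i' : S.idealO.obj U) (m m' : F.obj U) (r : S.total.sheaf.obj.obj U)

lemma conormalFun_add_left :
    S.conormalFun η U (i + i') m = S.conormalFun η U i m + S.conormalFun η U i' m := by
  have h : S.inclO.app U (i + i') = S.inclO.app U i + S.inclO.app U i' := map_add _ _ _
  unfold conormalFun
  rw [h]
  refine (congrArg (η.app U) ?_).trans (map_add (η.app U).hom _ _)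
  refine (congrArg (· ⊗ₜ[S.total.sheaf.obj.obj U] m) (map_add S.total.δ.d _ _)).trans ?_
  exact TensorProduct.add_tmul _ _ _

lemma conormalFun_add_right :
    S.conormalFun η U i (m + m') = S.conormalFun η U i m + S.conormalFun η U i m' := by
  unfold conormalFun
  refine (congrArg (η.app U) ?_).trans (map_add (η.app U).hom _ _)
  exact TensorProduct.tmul_add _ _ _

lemma conormalFun_smul_right :
    S.conormalFun η U i (r • m) = r • S.conormalFun η U i m := by
  unfold conormalFun
  refine (congrArg (η.app U) ?_).trans ((η.app U).hom.map_smul r _)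
  exact TensorProduct.tmul_smul _ _ _

lemma conormalFun_smul_left :
    S.conormalFun η U (r • i) m = r • S.conormalFun η U i m := by
  have h : S.inclO.app U (r • i) = r * (show S.total.sheaf.obj.obj U from S.inclO.app U i) :=
    (S.inclO.app U).hom.map_smul r i
  unfold conormalFun
  rw [h]
  have h₁ := S.total.δ.d_mul (X := U) r (S.inclO.app U i)
  refine (congrArg (fun t ↦ η.app U (t ⊗ₜ[S.total.sheaf.obj.obj U] m)) h₁).trans ?_
  refine (congrArg (η.app U) (TensorProduct.add_tmul _ _ _)).trans ?_
  refine (map_add (η.app U).hom _ _).trans ?_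
  have h₂ : ∀ a b c : (S.total.forget.obj (S.push.obj G)).obj U, a = c → b = 0 → a + b = c := by
    rintro a b c rfl rfl
    exact add_zero _
  refine h₂ _ _ _ ((η.app U).hom.map_smul r
    ((S.total.δ.d (X := U) (S.inclO.app U i) : S.total.Ω.obj U) ⊗ₜ[S.total.sheaf.obj.obj U] m)) ?_
  exact ((η.app U).hom.map_smul (S.inclO.app U i) ((S.total.δ.d (X := U) r : S.total.Ω.obj U) ⊗ₜ[S.total.sheaf.obj.obj U] m)).trans (S.incl_smul U i _)

lemma conormalFun_map (f : U ⟶ V) :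
    S.conormalFun η V (S.idealO.map f i) (F.map f m) =
      (S.total.forget.obj (S.push.obj G)).map f (S.conormalFun η U i m) := by
  unfold conormalFun
  refine Eq.trans ?_ (PresheafOfModules.naturality_apply η f _)
  refine congrArg (η.app V) ?_
  have h : S.inclO.app V (S.idealO.map f i) = S.total.sheaf.obj.map f (S.inclO.app U i) :=
    PresheafOfModules.naturality_apply S.inclO f i
  rw [h]
  exact congrArg (· ⊗ₜ[S.total.sheaf.obj.obj V] _) (S.total.δ.d_map f _)

/-- The linear map `i ⊗ m ↦ η (d i ⊗ m)`, for `η : Ω¹ ⊗ F ⟶ j_*G`. -/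
def conormal : S.idealO ⊗ F ⟶ S.total.forget.obj (S.push.obj G) where
  app U := ModuleCat.MonoidalCategory.tensorLift (S.conormalFun η U)
    (S.conormalFun_add_left η) (fun r i m ↦ S.conormalFun_smul_left η i m r)
    (S.conormalFun_add_right η) (fun r i m ↦ S.conormalFun_smul_right η i m r)
  naturality f := ModuleCat.MonoidalCategory.tensor_ext
    (fun i m ↦ S.conormalFun_map η i m f)

lemma whiskerLeft_conormal {F' : S.total.PMod} (f : F' ⟶ F) :
    S.idealO ◁ f ≫ S.conormal η = S.conormal (S.total.Ω ◁ f ≫ η) := by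
  ext1 U
  exact ModuleCat.MonoidalCategory.tensor_ext (fun i m ↦ rfl)

lemma conormal_comp {G' : A.Mod} (g : G ⟶ G') :
    S.conormal η ≫ S.total.forget.map (S.push.map g) =
      S.conormal (η ≫ S.total.forget.map (S.push.map g)) := by
  ext1 U
  exact ModuleCat.MonoidalCategory.tensor_ext (fun i m ↦ rfl)

end

/-- The canonical map `Ω¹ ⊗ F ⟶ j_*j^*(Ω¹ ⊗ F)`. -/
def omegaUnit (F : S.total.Mod) :
    S.total.Ω ⊗ S.total.forget.obj F ⟶ S.total.forget.obj (S.push.obj (S.pull.obj (S.total.omegaT.obj F))) :=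
  S.total.sheafifyAdj.homEquiv _ _ (S.proj.adj.unit.app (S.total.omegaT.obj F))

lemma omegaUnit_naturality {F G : S.total.Mod} (f : F ⟶ G) :
    S.total.Ω ◁ S.total.forget.map f ≫ S.omegaUnit G =
      S.omegaUnit F ≫ S.total.forget.map (S.push.map (S.pull.map (S.total.omegaT.map f))) :=
  (S.total.sheafifyAdj.homEquiv_naturality_left (S.total.Ω ◁ S.total.forget.map f)
    (S.proj.adj.unit.app (S.total.omegaT.obj G))).symm.trans
      ((congrArg (S.total.sheafifyAdj.homEquiv _ _)
        (S.proj.adj.unit.naturality (S.total.omegaT.map f))).trans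
          (S.total.sheafifyAdj.homEquiv_naturality_right _ _))

/-- The conormal morphism `I ⊗ F ⟶ j_*j^*(Ω¹ ⊗ F)`, `i ⊗ m ↦ d i ⊗ m`. Note that `j^*(Ω¹ ⊗ F)` is
`E ⊗ j^*F` with `E = j^*Ω¹`. -/
def idealToOmega : S.idealT ⟶ S.total.omegaT ⋙ S.pull ⋙ S.push where
  app F := (S.total.sheafifyAdj.homEquiv _ _).symm (S.conormal (S.omegaUnit F))
  naturality F G f := by
    refine (S.total.sheafifyAdj.homEquiv_naturality_left_symm (S.idealO ◁ S.total.forget.map f)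
      (S.conormal (S.omegaUnit G))).symm.trans (Eq.trans ?_
        (S.total.sheafifyAdj.homEquiv_naturality_right_symm (S.conormal (S.omegaUnit F))
          (S.push.map (S.pull.map (S.total.omegaT.map f)))))
    refine congrArg (S.total.sheafifyAdj.homEquiv _ _).symm ?_
    rw [whiskerLeft_conormal, omegaUnit_naturality]
    exact (S.conormal_comp _ _).symm

/-- The morphism `Tor¹(F, A) ⟶ I ⊗ j^*F ⟶ E ⊗ j^*F` with `E = j^*Ω¹` of `A`-modules. -/
def torToOmega : S.tor1 ⟶ S.total.omegaT ⋙ S.pull where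
  app F := (S.proj.adj.homEquiv _ _).symm (S.torKerι.app F ≫ S.idealToOmega.app F)
  naturality F G f := by
    refine (S.proj.adj.homEquiv_naturality_left_symm (S.torKer.map f)
      (S.torKerι.app G ≫ S.idealToOmega.app G)).symm.trans (Eq.trans ?_
        (S.proj.adj.homEquiv_naturality_right_symm (S.torKerι.app F ≫ S.idealToOmega.app F)
          (S.pull.map (S.total.omegaT.map f))))
    refine congrArg (S.proj.adj.homEquiv _ _).symm ?_
    rw [← Category.assoc, S.torKerι.naturality, Category.assoc, S.idealToOmega.naturality, Category.assoc]
    rfl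

instance : S.idealT.PreservesZeroMorphisms := by
  unfold idealT; infer_instance

instance : S.torKer.PreservesZeroMorphisms where
  map_zero F G := by
    refine (cancel_mono (kernel.ι (S.mul.app G))).1 ?_
    exact (S.torKerι.naturality 0).trans (by rw [Functor.map_zero, comp_zero]; exact zero_comp.symm)

instance : S.tor1.PreservesZeroMorphisms := by
  unfold tor1; infer_instance

/-- The functor `j^*` applied degreewise to bounded above complexes. -/
def barC : CMinus S.total.Mod ⥤ CMinus A.Mod := CMinus.map S.pull

/-- The functor `Tor¹(-, A)` applied degreewise to bounded above complexes. -/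
def torC : CMinus S.total.Mod ⥤ CMinus A.Mod := CMinus.map S.tor1

/-- The functor `j_*` applied degreewise to bounded above complexes. -/
def pushC : CMinus A.Mod ⥤ CMinus S.total.Mod := CMinus.map S.push

/-- A complex `L` is admissible when the complex `Tor¹(L, A)` is exact. -/
def IsAdmissible (L : CMinus S.total.Mod) : Prop := (S.torC.obj L).obj.Acyclic

/-- The morphism of complexes `Tor¹(K, A) ⟶ E ⊗ j^*K`. -/
def torToOmegaC (K : CochainComplex S.total.Mod ℤ) :
    (S.tor1.mapHomologicalComplex _).obj K ⟶ ((S.total.omegaT ⋙ S.pull).mapHomologicalComplex _).obj K :=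
  (NatTrans.mapHomologicalComplex S.torToOmega _).app K

/-- The morphism of complexes `E ⊗ j^*K ⟶ j^*P¹(K)`. -/
def omegaToPPC (K : CochainComplex S.total.Mod ℤ) :
    ((S.total.omegaT ⋙ S.pull).mapHomologicalComplex _).obj K ⟶ ((S.total.pp ⋙ S.pull).mapHomologicalComplex _).obj K :=
  (NatTrans.mapHomologicalComplex (Functor.whiskerRight S.total.omegaTToPP S.pull) _).app K

/-- The morphism of complexes `j^*P¹(K) ⟶ j^*K`. -/
def ppToBarC (K : CochainComplex S.total.Mod ℤ) :
    ((S.total.pp ⋙ S.pull).mapHomologicalComplex _).obj K ⟶ (S.pull.mapHomologicalComplex _).obj K :=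
  (NatTrans.mapHomologicalComplex (Functor.whiskerRight S.total.ppTo S.pull ≫ S.pull.leftUnitor.hom) _).app K

/-- Exactness of `0 ⟶ Tor¹(K, A) ⟶ E ⊗ j^*K ⟶ j^*P¹(K) ⟶ j^*K ⟶ 0`. -/
def PPExact (K : CochainComplex S.total.Mod ℤ) : Prop :=
  IsExactFour (S.torToOmegaC K) (S.omegaToPPC K) (S.ppToBarC K)

/-- The geometric HKR class `Θ_K : j^*K ⟶ Tor¹(K, A)[2]`, the Yoneda class of the exact sequence
`0 ⟶ Tor¹(K, A) ⟶ E ⊗ j^*K ⟶ j^*P¹(K) ⟶ j^*K ⟶ 0`. -/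
def theta {K : CochainComplex S.total.Mod ℤ} (h : S.PPExact K) :
    DerivedCategory.Q.obj ((S.pull.mapHomologicalComplex _).obj K) ⟶
      (DerivedCategory.Q.obj ((S.tor1.mapHomologicalComplex _).obj K))⟦(2 : ℤ)⟧ :=
  IsExactFour.yonedaClass h

/-- Existence of the left derived functor of `j^*`, that is, of the right Kan extension of
`C⁻(S) ⥤ C⁻(X) ⥤ D⁻(X)` along the localization functor `C⁻(S) ⥤ D⁻(S)`. -/
abbrev HasLeftDerivedPull : Prop := (CMinus.Q S.total.Mod).HasRightKanExtension (S.barC ⋙ CMinus.Q A.Mod)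

section
variable [S.HasLeftDerivedPull]

/-- The left derived functor `Lj^* : D⁻(S) ⥤ D⁻(X)`. -/
def Lpull : DMinus S.total.Mod ⥤ DMinus A.Mod :=
  (CMinus.Q S.total.Mod).rightKanExtension (S.barC ⋙ CMinus.Q A.Mod)

/-- The natural morphism `Lj^*K ⟶ j^*K`. -/
def LpullTo : CMinus.Q S.total.Mod ⋙ S.Lpull ⟶ S.barC ⋙ CMinus.Q A.Mod :=
  (CMinus.Q S.total.Mod).rightKanExtensionCounit (S.barC ⋙ CMinus.Q A.Mod)

/-- The first left derived functor `F ↦ H⁻¹(Lj^*F)` of `j^*`. -/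
def firstDerived : S.total.Mod ⥤ A.Mod :=
  CMinus.single S.total.Mod ⋙ CMinus.Q S.total.Mod ⋙ S.Lpull ⋙ DerivedCategory.Minus.ι ⋙
    DerivedCategory.homologyFunctor A.Mod (-1)

end

/-- The morphisms `f` of bounded above complexes such that `j^*f` and `Tor¹(f, A)` are
quasi-isomorphisms. -/
def admW : MorphismProperty (CMinus S.total.Mod) := fun _ _ f ↦
  QuasiIso (S.barC.map f).hom ∧ QuasiIso (S.torC.map f).hom

/-- The category `D^adm(S)`: the localization of `C⁻(S)` at these morphisms. -/
abbrev DAdm := S.admW.Localization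

/-- The localization functor `C⁻(S) ⥤ D^adm(S)`. -/
abbrev QAdm : CMinus S.total.Mod ⥤ S.DAdm := S.admW.Q

lemma admW_inverted : S.admW.IsInvertedBy (S.barC ⋙ CMinus.Q A.Mod) :=
  fun _ _ f hf ↦ CMinus.isIso_Q_map (S.barC.map f) hf.1

/-- The functor `D^adm(S) ⥤ D⁻(X)` induced by `j^*`. -/
def barAdm : S.DAdm ⥤ DMinus A.Mod :=
  Localization.lift (S.barC ⋙ CMinus.Q A.Mod) S.admW_inverted S.QAdm

/-- The multiplication `I ⊗ L ⟶ L` for a complex `L`. -/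
def mulC (L : CMinus S.total.Mod) : (CMinus.map S.idealT).obj L ⟶ L :=
  (minusProp _).homMk ((NatTrans.mapHomologicalComplex S.mul _).app L.obj ≫
    (Functor.mapHomologicalComplexIdIso _ _).hom.app L.obj)

/-- The quotient `L / T` of `L` by the image of a subcomplex `T` of `I ⊗ L` in `L`. -/
def quotientC (L : CMinus S.total.Mod) {T : CochainComplex S.total.Mod ℤ}
    (t : T ⟶ ((CMinus.map S.idealT).obj L).obj) : CMinus S.total.Mod where
  obj := cokernel (t ≫ (S.mulC L).hom)
  property := minusProp_of_epi (cokernel.π _) L.property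

end Thickening

/-- `(X, A)` is isomorphic, as a space with a sheaf of `k`-algebras, to a smooth `k`-scheme. -/
def IsSmoothScheme (A : AlgSheaf k X) : Prop :=
  ∃ (Y : AlgebraicGeometry.Scheme.{u}) (f : Y ⟶ AlgebraicGeometry.Spec (CommRingCat.of k)),
    AlgebraicGeometry.Smooth f ∧
    ∃ (e : X ≃ₜ Y) (φ : ∀ U : Y.Opens, Y.presheaf.obj (op U) ≃+*
        A.sheaf.obj.obj (op ((Opens.map (TopCat.ofHom e)).obj U))),
      (∀ (U V : Y.Opens) (h : V ≤ U) (s : Y.presheaf.obj (op U)),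
        φ V ((Y.presheaf.map (homOfLE h).op).hom s) = A.res (fun _ hx ↦ h hx) (φ U s)) ∧
      (∀ (U : Y.Opens) (c : k),
        φ U ((Y.presheaf.map (homOfLE le_top).op).hom (f.appTop.hom
          ((AlgebraicGeometry.Scheme.ΓSpecIso (CommRingCat.of k)).inv.hom c))) =
            (A.str.app _).hom c)

/-- `k` is (isomorphic to) `ℂ` and `(X, A)` is isomorphic to a complex manifold with its sheaf of
holomorphic functions: `A` is a sheaf of complex valued functions, and near every point there is a
chart `e` to some `ℂⁿ` such that on its source the sections of `A` are the functions that are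
holomorphic in the coordinates `e`. -/
def IsComplexManifold (A : AlgSheaf k X) : Prop :=
  ∃ (σ : k ≃+* ℂ) (ev : ∀ V : Opens X, A.sheaf.obj.obj (op V) →+* (V → ℂ)),
    (∀ V, Function.Injective (ev V)) ∧
    (∀ (V W : Opens X) (h : W ≤ V) (s : A.sheaf.obj.obj (op V)) (x : W),
      ev W (A.res h s) x = ev V s ⟨x, h x.2⟩) ∧
    (∀ (V : Opens X) (c : k) (x : V), ev V ((A.str.app (op V)).hom c) x = σ c) ∧
    ∀ x : X, ∃ (n : ℕ) (e : OpenPartialHomeomorph X (EuclideanSpace ℂ (Fin n))), x ∈ e.source ∧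
      ∀ V : Opens X, (V : Set X) ⊆ e.source → ∀ g : V → ℂ, g ∈ Set.range (ev V) ↔
        ∃ G : EuclideanSpace ℂ (Fin n) → ℂ, DifferentiableOn ℂ G (e '' V) ∧ ∀ y : V, g y = G (e y)

end Sheaves
end SqZeroThickening
end

open SqZeroThickening

/-! ### Formal setting: j^*, j_* and I ⊗ - as functors between abelian categories. -/

noncomputable section
namespace SqZeroThickening

attribute [local instance] HasDerivedCategory.standard

/-! The formal half works with two abelian categories, a fully faithful exact functor j_* with left
adjoint j^*, and a right exact functor I ⊗ - with a multiplication I ⊗ F → F (`SqZeroPair`). There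
are exact sequences 0 → Tor¹(F) → I ⊗ F → IF → 0 and 0 → IF → F → j_*j^*F → 0, and I ⊗ F depends on
j^*F alone, in an exact way because I is locally free. Long exact sequences then show that an
acyclic bounded above complex with acyclic Tor¹ has acyclic j^* (`acyclic_pull`). Hence admissible
complexes, and not only flat ones, compute Lj^* (`isIso_LpTo`), and the morphisms inverted in D^adm
are quasi-isomorphisms.

Principal parts enter through one computation: i(t, m) = (it + di ⊗ m, im). If a sum of such
products has the form (n, 0), then n is congruent modulo I to the sum of the di ⊗ m; this is the
field `snake` of `PrincipalParts`. Together with the injectivity of i ⊗ m ↦ di ⊗ m it gives the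
exact sequence with four terms, and it identifies Tor¹ with H⁻¹(Lj^*).

The equivalences form the cycle (i) ⇒ (v) ⇒ (iv) ⇒ (iii) ⇒ (ii) ⇒ (i). For (ii) ⇒ (i): Θ is natural
and vanishes on a resolution by modules without Tor¹, and a right inverse factors the identity of
j^*K through j^* of this resolution. The core is (i) ⇒ (v). Let M be the cone of the identity of
j^*(Ω¹ ⊗ K), and let G be the pushout of P¹(K) along Ω¹ ⊗ K → j_*M. Then j^*G is a model of the cone
of E ⊗ j^*K → j^*P¹(K), and the multiplication of G factors through a monomorphism I ⊗ K → G. The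
class Θ is the obstruction to splitting j^*G → j^*K in the derived category. When it vanishes, a
splitting is represented by a map B → j^*G with B quasi-isomorphic to j^*K, and L = G ×_{j_*j^*G}
j_*B satisfies j^*L ≅ B. The multiplication of L still factors as I ⊗ L → I ⊗ K → L with injective
second map, so Tor¹(L) is the kernel of a surjective quasi-isomorphism and L is admissible; up to
isomorphism in D^adm, K is the quotient of L by T = ker(I ⊗ L → K).

The image of T in L is a copy of j_*Tor¹(K), so K is the cone of a map j_*Tor¹(K) → L. This map dies
under j^* because it lands in the image of the multiplication, and the direct sum decomposition
follows.

The geometric half checks the axioms on sections. Most of them come from I² = 0 and local freeness.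
The delicate one is the injectivity of i ⊗ m ↦ di ⊗ m: a local algebra section σ gives a derivation
s ↦ s - σ(s) with values in I, hence a local retraction of d : I → Ω¹. As Ω¹ is the quotient of
Kähler differentials by the infinitely flat ones, the retraction descends because the powers of the
radical of each stalk of O_X intersect in zero: Krull's theorem for schemes, the identity theorem
for manifolds. -/

/-- An abstraction of the pair of functors `j^*`, `j_*` attached to a first order thickening, with
the functor `I ⊗ -` and the multiplication `I ⊗ F ⟶ F`. -/
structure SqZeroPair (𝒮 𝒜 : Type v) [Category.{u} 𝒮] [Category.{u} 𝒜] [Abelian 𝒮] [Abelian 𝒜] where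
  pull : 𝒮 ⥤ 𝒜
  push : 𝒜 ⥤ 𝒮
  adj : pull ⊣ push
  I : 𝒮 ⥤ 𝒮
  mul : I ⟶ 𝟭 𝒮
  additive_I : I.Additive
  rightExact_I : PreservesFiniteColimits I
  full_push : push.Full
  faithful_push : push.Faithful
  epi_push : push.PreservesEpimorphisms
  -- Since I² = 0, tensoring with I does not see the submodule IF.
  isIso_map_unit : ∀ F, IsIso (I.map (adj.unit.app F))
  mono_map_push : ∀ {B B' : 𝒜} (f : B ⟶ B'), Mono f → Mono (I.map (push.map f))
  mul_push : ∀ B, mul.app (push.obj B) = 0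
  mul_I : ∀ F, mul.app (I.obj F) = 0
  mul_unit : ∀ F, mul.app F ≫ adj.unit.app F = 0
  exact_unit : ∀ F, (ShortComplex.mk _ _ (mul_unit F)).Exact
  epi_unit : ∀ F, Epi (adj.unit.app F)
  -- Only injectivity of the multiplication is asked of the covering objects; sheaves associated
  -- with free presheaves will provide them.
  enough : ∀ F, ∃ (E : 𝒮) (p : E ⟶ F), Epi p ∧ Mono (mul.app E)

namespace SqZeroPair
variable {𝒮 𝒜 : Type v} [Category.{u} 𝒮] [Category.{u} 𝒜] [Abelian 𝒮] [Abelian 𝒜]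
  (Z : SqZeroPair 𝒮 𝒜)

instance : Z.I.Additive := Z.additive_I
instance : PreservesFiniteColimits Z.I := Z.rightExact_I
instance : Z.push.Full := Z.full_push
instance : Z.push.Faithful := Z.faithful_push
instance : Z.push.PreservesEpimorphisms := Z.epi_push
instance (F : 𝒮) : Epi (Z.adj.unit.app F) := Z.epi_unit F
instance : Z.pull.IsLeftAdjoint := Z.adj.isLeftAdjoint
instance : Z.push.IsRightAdjoint := Z.adj.isRightAdjoint
instance : PreservesFiniteColimits Z.pull :=
  have := Z.adj.leftAdjoint_preservesColimits; inferInstance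
instance : PreservesFiniteLimits Z.push :=
  have := Z.adj.rightAdjoint_preservesLimits; inferInstance
instance : Z.push.Additive := Functor.additive_of_preserves_binary_products _
instance : Z.pull.Additive := Z.adj.left_adjoint_additive
instance : PreservesFiniteColimits Z.push := by
  rw [Functor.preservesFiniteColimits_iff_forall_exact_map_and_epi]
  intro S hS
  have := hS.epi_g
  refine ⟨?_, inferInstance⟩
  exact ((Functor.preservesFiniteLimits_iff_forall_exact_map_and_mono Z.push).1 inferInstance S hS).1
instance : PreservesFiniteColimits (Z.push ⋙ Z.I) := comp_preservesFiniteColimits _ _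
-- This is the formal trace of the local freeness of I: on modules that come from X the functor I ⊗
-- - is exact, although on all of 𝒮 it is only right exact.
instance : PreservesFiniteLimits (Z.push ⋙ Z.I) := by
  rw [Functor.preservesFiniteLimits_iff_forall_exact_map_and_mono]
  intro S hS
  exact ⟨((Functor.preservesFiniteColimits_iff_forall_exact_map_and_epi (Z.push ⋙ Z.I)).1
    inferInstance S hS).1, Z.mono_map_push _ hS.mono_f⟩
instance : Z.push.ReflectsIsomorphisms := inferInstance
instance (B : 𝒜) : IsIso (Z.adj.counit.app B) := inferInstance

/-- The kernel of the multiplication. -/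
def torKer : 𝒮 ⥤ 𝒮 where
  obj F := kernel (Z.mul.app F)
  map f := kernel.map _ _ (Z.I.map f) f (Z.mul.naturality f).symm
  map_id F := by rw [← cancel_mono (kernel.ι _)]; simp [kernel.map]
  map_comp f g := by rw [← cancel_mono (kernel.ι _)]; simp [kernel.map]

/-- The inclusion of the kernel of the multiplication. -/
def torKerι : Z.torKer ⟶ Z.I where
  app F := kernel.ι (Z.mul.app F)
  naturality _ _ _ := kernel.lift_ι _ _ _

instance (F : 𝒮) : Mono (Z.torKerι.app F) := inferInstanceAs (Mono (kernel.ι _))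

/-- The functor `Tor¹`. -/
def tor1 : 𝒮 ⥤ 𝒜 := Z.torKer ⋙ Z.pull

instance : Z.torKer.Additive where
  map_add {F G f g} := by
    rw [← cancel_mono (Z.torKerι.app G), Preadditive.add_comp, Z.torKerι.naturality,
      Z.torKerι.naturality, Z.torKerι.naturality, Functor.map_add, Preadditive.comp_add]

instance : Z.tor1.Additive := by unfold tor1; infer_instance

/-- The submodule `I F` of `F`. -/
def ideal : 𝒮 ⥤ 𝒮 where
  obj F := kernel (Z.adj.unit.app F)
  map f := kernel.map _ _ f (Z.push.map (Z.pull.map f)) (Z.adj.unit.naturality f).symm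
  map_id F := by rw [← cancel_mono (kernel.ι _)]; simp [kernel.map]
  map_comp f g := by rw [← cancel_mono (kernel.ι _)]; simp [kernel.map]

/-- The inclusion of `I F` in `F`. -/
def idealι : Z.ideal ⟶ 𝟭 𝒮 where
  app F := kernel.ι (Z.adj.unit.app F)
  naturality _ _ _ := kernel.lift_ι _ _ _

instance (F : 𝒮) : Mono (Z.idealι.app F) := inferInstanceAs (Mono (kernel.ι _))

instance : Z.ideal.Additive where
  map_add {F G f g} := by
    rw [← cancel_mono (Z.idealι.app G), Preadditive.add_comp, Z.idealι.naturality,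
      Z.idealι.naturality, Z.idealι.naturality, Functor.map_add, Preadditive.comp_add]

@[simp]
lemma idealι_unit (F : 𝒮) : Z.idealι.app F ≫ Z.adj.unit.app F = 0 := kernel.condition _

@[simp]
lemma torKerι_mul (F : 𝒮) : Z.torKerι.app F ≫ Z.mul.app F = 0 := kernel.condition _

/-- The multiplication `I ⊗ F ⟶ I F`. -/
def mulIdealApp (F : 𝒮) : Z.I.obj F ⟶ Z.ideal.obj F := kernel.lift _ (Z.mul.app F) (Z.mul_unit F)

lemma mulIdealApp_idealι (F : 𝒮) : Z.mulIdealApp F ≫ Z.idealι.app F = Z.mul.app F :=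
  kernel.lift_ι _ _ _

/-- The multiplication seen as a natural transformation to `F ↦ I F`. -/
def mulIdeal : Z.I ⟶ Z.ideal where
  app F := Z.mulIdealApp F
  naturality F G f := by
    rw [← cancel_mono (Z.idealι.app G), Category.assoc, Category.assoc, Z.idealι.naturality,
      mulIdealApp_idealι]
    exact (Z.mul.naturality f).trans
      (by rw [← mulIdealApp_idealι]; exact Category.assoc _ _ _)

@[simp]
lemma mulIdeal_idealι (F : 𝒮) : Z.mulIdeal.app F ≫ Z.idealι.app F = Z.mul.app F :=
  kernel.lift_ι _ _ _

instance (F : 𝒮) : Epi (Z.mulIdeal.app F) := (Z.exact_unit F).epi_kernelLift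

@[simp]
lemma torKerι_mulIdeal (F : 𝒮) : Z.torKerι.app F ≫ Z.mulIdeal.app F = 0 := by
  rw [← cancel_mono (Z.idealι.app F), Category.assoc, mulIdeal_idealι, torKerι_mul, zero_comp]

lemma shortExact_ideal (F : 𝒮) : (ShortComplex.mk _ _ (Z.idealι_unit F)).ShortExact where
  exact := ShortComplex.exact_kernel _

lemma shortExact_tor (F : 𝒮) : (ShortComplex.mk _ _ (Z.torKerι_mulIdeal F)).ShortExact where
  exact := by
    let φ : ShortComplex.mk _ _ (Z.torKerι_mulIdeal F) ⟶ ShortComplex.mk _ _ (Z.torKerι_mul F) :=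
      { τ₁ := 𝟙 _, τ₂ := 𝟙 _, τ₃ := Z.idealι.app F }
    have h₁ : Epi φ.τ₁ := inferInstanceAs (Epi (𝟙 _))
    have h₂ : IsIso φ.τ₂ := inferInstanceAs (IsIso (𝟙 _))
    have h₃ : Mono φ.τ₃ := inferInstanceAs (Mono (Z.idealι.app F))
    exact (ShortComplex.exact_iff_of_epi_of_isIso_of_mono φ).2 (ShortComplex.exact_kernel _)

/-- The image of the multiplication is the kernel of the unit, so an object comes from X exactly
when the ideal acts by zero. This lets ker(I ⊗ F → F) and I ⊗ F be treated as objects of 𝒜. -/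
lemma isIso_unit_iff (F : 𝒮) : IsIso (Z.adj.unit.app F) ↔ Z.mul.app F = 0 := by
  constructor
  · intro h
    rw [← cancel_mono (Z.adj.unit.app F), zero_comp, Z.mul_unit]
  · intro h
    have : Mono (Z.adj.unit.app F) := (Z.exact_unit F).mono_g h
    exact isIso_of_mono_of_epi _

lemma mul_eq_zero_of_mono {F G : 𝒮} (f : F ⟶ G) [Mono f] (h : Z.mul.app G = 0) :
    Z.mul.app F = 0 := by
  have := Z.mul.naturality f
  rw [h, comp_zero] at this
  rw [← cancel_mono f, zero_comp]
  exact this.symm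

lemma isIso_unit_torKer (F : 𝒮) : IsIso (Z.adj.unit.app (Z.torKer.obj F)) :=
  (Z.isIso_unit_iff _).2 (Z.mul_eq_zero_of_mono (Z.torKerι.app F) (Z.mul_I F))

instance (F : 𝒮) : IsIso (Z.adj.unit.app (Z.I.obj F)) :=
  (Z.isIso_unit_iff _).2 (Z.mul_I F)

/-- `Tor¹(F)`, seen as an object of `𝒮`, is the kernel of the multiplication. -/
def torKerIso : Z.torKer ≅ Z.tor1 ⋙ Z.push :=
  NatIso.ofComponents (fun F ↦ @asIso _ _ _ _ _ (Z.isIso_unit_torKer F))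
    (fun f ↦ Z.adj.unit.naturality (Z.torKer.map f))

/-- `I ⊗ F` depends only on `j^* F`. -/
def idealTensorIso : Z.I ≅ Z.pull ⋙ Z.push ⋙ Z.I :=
  NatIso.ofComponents (fun F ↦ @asIso _ _ _ _ _ (Z.isIso_map_unit F))
    (fun f ↦ by
      dsimp
      rw [← Functor.map_comp, ← Functor.map_comp]
      exact congrArg _ (Z.adj.unit.naturality f))

end SqZeroPair

section General
variable {C D : Type v} [Category.{u} C] [Category.{u} D] [Abelian C] [Abelian D]

lemma exactAt_map (F : C ⥤ D) [F.Additive] [PreservesFiniteLimits F] [PreservesFiniteColimits F]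
    {K : CochainComplex C ℤ} {i : ℤ} (h : K.ExactAt i) :
    ((F.mapHomologicalComplex _).obj K).ExactAt i := by
  rw [HomologicalComplex.exactAt_iff] at h ⊢
  exact h.map F

lemma exactAt_of_map (F : C ⥤ D) [F.Additive] [PreservesFiniteLimits F] [PreservesFiniteColimits F]
    [F.Faithful] {K : CochainComplex C ℤ} {i : ℤ}
    (h : ((F.mapHomologicalComplex _).obj K).ExactAt i) : K.ExactAt i := by
  rw [HomologicalComplex.exactAt_iff] at h ⊢
  exact (ShortComplex.exact_map_iff_of_faithful _ F).1 h

lemma exactAt_of_natIso {F G : C ⥤ D} [F.PreservesZeroMorphisms] [G.PreservesZeroMorphisms]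
    (e : F ≅ G) {K : CochainComplex C ℤ} {i : ℤ}
    (h : ((F.mapHomologicalComplex _).obj K).ExactAt i) :
    ((G.mapHomologicalComplex _).obj K).ExactAt i :=
  h.of_iso ((NatIso.mapHomologicalComplex e _).app K)

/-- The short exact sequence of complexes attached to a degreewise short exact sequence of functors. -/
lemma shortExact_map {F G H : C ⥤ D} [F.PreservesZeroMorphisms] [G.PreservesZeroMorphisms]
    [H.PreservesZeroMorphisms] (a : F ⟶ G) (b : G ⟶ H) (w : ∀ X, a.app X ≫ b.app X = 0)
    (h : ∀ X, (ShortComplex.mk _ _ (w X)).ShortExact) (K : CochainComplex C ℤ) :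
    (ShortComplex.mk ((NatTrans.mapHomologicalComplex a (ComplexShape.up ℤ)).app K)
      ((NatTrans.mapHomologicalComplex b _).app K) (by ext i; exact w _)).ShortExact :=
  HomologicalComplex.shortExact_of_degreewise_shortExact _ (fun i ↦ h (K.X i))

end General

end SqZeroThickening
end

/-! ### Exactness of K, j^*K and Tor¹(K) compared degree by degree. -/

noncomputable section
namespace SqZeroThickening

attribute [local instance] HasDerivedCategory.standard

section General
variable {C D : Type v} [Category.{u} C] [Category.{u} D] [Abelian C] [Abelian D]

lemma exactAt_X₁_of_shortExact {S : ShortComplex (CochainComplex C ℤ)} (hS : S.ShortExact) (i j : ℤ)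
    (hij : i + 1 = j) (h₂ : S.X₂.ExactAt j) (h₃ : S.X₃.ExactAt i) : S.X₁.ExactAt j := by
  rw [HomologicalComplex.exactAt_iff_isZero_homology] at h₂ h₃ ⊢
  exact (hS.homology_exact₁ i j hij).isZero_X₂ (h₃.eq_of_src _ _) (h₂.eq_of_tgt _ _)

lemma exactAt_X₃_of_shortExact {S : ShortComplex (CochainComplex C ℤ)} (hS : S.ShortExact) (i j : ℤ)
    (hij : i + 1 = j) (h₁ : S.X₁.ExactAt j) (h₂ : S.X₂.ExactAt i) : S.X₃.ExactAt i := by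
  rw [HomologicalComplex.exactAt_iff_isZero_homology] at h₁ h₂ ⊢
  exact (hS.homology_exact₃ i j hij).isZero_X₂ (h₂.eq_of_src _ _) (h₁.eq_of_tgt _ _)

lemma exactAt_of_isZero {K : CochainComplex C ℤ} {i : ℤ} (h : IsZero (K.X i)) : K.ExactAt i := by
  rw [HomologicalComplex.exactAt_iff]
  exact ShortComplex.exact_of_isZero_X₂ _ h

lemma quasiIso_iff_acyclic_mappingCone {K L : CochainComplex C ℤ} (f : K ⟶ L) :
    QuasiIso f ↔ (CochainComplex.mappingCone f).Acyclic := by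
  have h := (HomotopyCategory.subcategoryAcyclic C).trW_iff_of_distinguished _
    (HomotopyCategory.mappingCone_triangleh_distinguished f)
  rw [← HomotopyCategory.quasiIso_eq_trW_subcategoryAcyclic] at h
  rw [← HomotopyCategory.quotient_obj_mem_subcategoryAcyclic_iff_acyclic]
  rw [← HomologicalComplex.mem_quasiIso_iff, ← HomotopyCategory.quotient_map_mem_quasiIso_iff]
  exact h

lemma quasiIso_map_iff_acyclic (F : C ⥤ D) [F.Additive] {K L : CochainComplex C ℤ} (f : K ⟶ L) :
    QuasiIso ((F.mapHomologicalComplex _).map f) ↔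
      ((F.mapHomologicalComplex (ComplexShape.up ℤ)).obj (CochainComplex.mappingCone f)).Acyclic := by
  rw [quasiIso_iff_acyclic_mappingCone]
  exact ⟨fun h i ↦ (h i).of_iso (CochainComplex.mappingCone.mapHomologicalComplexIso f F).symm,
    fun h i ↦ (h i).of_iso (CochainComplex.mappingCone.mapHomologicalComplexIso f F)⟩

lemma minusProp_mappingCone {K L : CochainComplex C ℤ} (f : K ⟶ L) (hK : minusProp C K)
    (hL : minusProp C L) : minusProp C (CochainComplex.mappingCone f) := by
  obtain ⟨a, ha⟩ := hK
  obtain ⟨b, hb⟩ := hL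
  refine ⟨max a b, (CochainComplex.isStrictlyLE_iff _ _).2 fun i hi ↦ ?_⟩
  rw [CochainComplex.mappingCone.isZero_X_iff]
  exact ⟨K.isZero_of_isStrictlyLE a _ (by omega), L.isZero_of_isStrictlyLE b _ (by omega)⟩

end General

namespace SqZeroPair
variable {𝒮 𝒜 : Type v} [Category.{u} 𝒮] [Category.{u} 𝒜] [Abelian 𝒮] [Abelian 𝒜]
  (Z : SqZeroPair 𝒮 𝒜)

/-- `j^*` on complexes. -/
abbrev pullK : CochainComplex 𝒮 ℤ ⥤ CochainComplex 𝒜 ℤ := Z.pull.mapHomologicalComplex _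
/-- `j_*` on complexes. -/
abbrev pushK : CochainComplex 𝒜 ℤ ⥤ CochainComplex 𝒮 ℤ := Z.push.mapHomologicalComplex _
/-- `I ⊗ -` on complexes. -/
abbrev IK : CochainComplex 𝒮 ℤ ⥤ CochainComplex 𝒮 ℤ := Z.I.mapHomologicalComplex _
/-- `Tor¹` on complexes. -/
abbrev torK : CochainComplex 𝒮 ℤ ⥤ CochainComplex 𝒜 ℤ := Z.tor1.mapHomologicalComplex _
/-- The kernel of the multiplication on complexes. -/
abbrev torKerK : CochainComplex 𝒮 ℤ ⥤ CochainComplex 𝒮 ℤ := Z.torKer.mapHomologicalComplex _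
/-- `K ↦ I K` on complexes. -/
abbrev idealK : CochainComplex 𝒮 ℤ ⥤ CochainComplex 𝒮 ℤ := Z.ideal.mapHomologicalComplex _

variable (K : CochainComplex 𝒮 ℤ)

lemma shortExact_torK : (ShortComplex.mk ((NatTrans.mapHomologicalComplex Z.torKerι _).app K)
    ((NatTrans.mapHomologicalComplex Z.mulIdeal (ComplexShape.up ℤ)).app K)
    (by ext i; exact Z.torKerι_mulIdeal _)).ShortExact :=
  shortExact_map Z.torKerι Z.mulIdeal Z.torKerι_mulIdeal Z.shortExact_tor K

/-- The unit `K ⟶ j_*j^*K` on complexes. -/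
def unitK : 𝟭 (CochainComplex 𝒮 ℤ) ⟶ Z.pullK ⋙ Z.pushK where
  app K := { f := fun i ↦ Z.adj.unit.app (K.X i)
             comm' := fun _ _ _ ↦ (Z.adj.unit.naturality _).symm }
  naturality K L f := by
    ext i
    exact Z.adj.unit.naturality _

/-- The inclusion `I K ⟶ K` on complexes. -/
def idealιK : Z.idealK ⟶ 𝟭 (CochainComplex 𝒮 ℤ) where
  app K := { f := fun i ↦ Z.idealι.app (K.X i)
             comm' := fun _ _ _ ↦ (Z.idealι.naturality _).symm }
  naturality K L f := by
    ext i
    exact Z.idealι.naturality _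

lemma shortExact_idealK : (ShortComplex.mk (Z.idealιK.app K) (Z.unitK.app K)
    (by ext i; exact Z.idealι_unit _)).ShortExact :=
  HomologicalComplex.shortExact_of_degreewise_shortExact _ (fun i ↦ Z.shortExact_ideal (K.X i))

variable {K}

lemma exactAt_push_iff {K : CochainComplex 𝒜 ℤ} {i : ℤ} :
    (Z.pushK.obj K).ExactAt i ↔ K.ExactAt i :=
  ⟨fun h ↦ exactAt_of_map Z.push h, fun h ↦ exactAt_map Z.push h⟩

lemma exactAt_tor_iff {i : ℤ} : (Z.torKerK.obj K).ExactAt i ↔ (Z.torK.obj K).ExactAt i := by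
  rw [← Z.exactAt_push_iff]
  exact ⟨fun h ↦ exactAt_of_natIso Z.torKerIso h,
    fun h ↦ exactAt_of_natIso (F := Z.tor1 ⋙ Z.push) Z.torKerIso.symm h⟩

/-- I ⊗ K is isomorphic to I ⊗ j_*j^*K, and I ⊗ j_*(-) is exact. -/
lemma exactAt_I {i : ℤ} (h : (Z.pullK.obj K).ExactAt i) : (Z.IK.obj K).ExactAt i :=
  exactAt_of_natIso (F := Z.pull ⋙ Z.push ⋙ Z.I) Z.idealTensorIso.symm
    (exactAt_map (Z.push ⋙ Z.I) h)

/-- Exactness of `j^*M` propagates downwards when `M` is exact. -/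
lemma exactAt_pull_pred (i j : ℤ) (hij : i + 1 = j) (hM : K.ExactAt i)
    (hj : (Z.pullK.obj K).ExactAt j) (ht : (Z.torK.obj K).ExactAt (j + 1)) :
    (Z.pullK.obj K).ExactAt i := by
  rw [← Z.exactAt_push_iff]
  -- j_*j^*K is K/IK, so the missing input is exactness of IK one degree higher. In turn IK is the
  -- quotient of I ⊗ K by Tor¹, which accounts for the hypothesis on Tor¹ two degrees above i.
  refine exactAt_X₃_of_shortExact (Z.shortExact_idealK K) i j hij ?_ hM
  exact exactAt_X₃_of_shortExact (Z.shortExact_torK K) j (j + 1) rfl (Z.exactAt_tor_iff.2 ht)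
    (Z.exactAt_I hj)

/-- Descending induction, starting above the upper bound of K, where everything vanishes. The
truncated form, with Tor¹ controlled only from n + 2 on, serves the two term complex Ω¹ ⊗ F → P¹(F),
whose Tor¹ need not be exact in degree -1. -/
lemma exactAt_pull_of_ge (n : ℤ) (hK : minusProp 𝒮 K) (hM : K.Acyclic)
    (ht : ∀ i, n + 2 ≤ i → (Z.torK.obj K).ExactAt i) (i : ℤ) (hi : n ≤ i) :
    (Z.pullK.obj K).ExactAt i := by
  obtain ⟨b, hb⟩ := hK
  have key : ∀ (k : ℕ) (i : ℤ), n ≤ i → b - k < i → (Z.pullK.obj K).ExactAt i := by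
    intro k
    induction k with
    | zero =>
      intro i _ hi
      exact exactAt_of_isZero (Z.pull.map_isZero (K.isZero_of_isStrictlyLE b i (by omega)))
    | succ k ih =>
      intro i h₁ h₂
      exact Z.exactAt_pull_pred i (i + 1) rfl (hM i) (ih _ (by omega) (by push_cast at h₂; omega))
        (ht _ (by omega))
  exact key (b - i + 1).toNat i hi (by omega)

lemma acyclic_pull (hK : minusProp 𝒮 K) (hM : K.Acyclic) (ht : (Z.torK.obj K).Acyclic) :
    (Z.pullK.obj K).Acyclic :=
  fun i ↦ Z.exactAt_pull_of_ge i hK hM (fun j _ ↦ ht j) i le_rfl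

/-- When j^*K is acyclic so is I ⊗ K, and the two short exact sequences carry exactness between
Tor¹(K), IK and K. No boundedness is needed. -/
lemma acyclic_iff_acyclic_tor (h : (Z.pullK.obj K).Acyclic) :
    K.Acyclic ↔ (Z.torK.obj K).Acyclic := by
  constructor
  · intro hK i
    rw [← Z.exactAt_tor_iff]
    refine exactAt_X₁_of_shortExact (Z.shortExact_torK K) (i - 1) i (by omega) (Z.exactAt_I (h i)) ?_
    exact exactAt_X₁_of_shortExact (Z.shortExact_idealK K) (i - 1 - 1) (i - 1) (by omega) (hK _)
      (Z.exactAt_push_iff.2 (h _))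
  · intro hT i
    refine (Z.shortExact_idealK K).exactAt_X₂ i ?_ (Z.exactAt_push_iff.2 (h i))
    exact exactAt_X₃_of_shortExact (Z.shortExact_torK K) i (i + 1) rfl
      (Z.exactAt_tor_iff.2 (hT _)) (Z.exactAt_I (h i))

/-- The previous equivalence for the mapping cone. It makes the morphisms inverted in D^adm
quasi-isomorphisms, so that D^adm maps to D⁻(S). -/
lemma quasiIso_iff_quasiIso_tor {K L : CochainComplex 𝒮 ℤ} (f : K ⟶ L)
    (hf : QuasiIso (Z.pullK.map f)) : QuasiIso f ↔ QuasiIso (Z.torK.map f) := by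
  rw [quasiIso_map_iff_acyclic, quasiIso_iff_acyclic_mappingCone]
  rw [quasiIso_map_iff_acyclic] at hf
  exact Z.acyclic_iff_acyclic_tor hf

lemma acyclic_tor_mappingCone {K L : CochainComplex 𝒮 ℤ} (f : K ⟶ L)
    (hK : (Z.torK.obj K).Acyclic) (hL : (Z.torK.obj L).Acyclic) :
    (Z.torK.obj (CochainComplex.mappingCone f)).Acyclic := by
  rw [← quasiIso_map_iff_acyclic]
  refine ⟨fun i ↦ ?_⟩
  rw [quasiIsoAt_iff_isIso_homologyMap]
  exact isIso_of_source_target_iso_zero _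
    ((HomologicalComplex.exactAt_iff_isZero_homology _ _).1 (hK i)).isoZero
    ((HomologicalComplex.exactAt_iff_isZero_homology _ _).1 (hL i)).isoZero

/-- This is what lets j^* descend to the derived category once restricted to complexes with acyclic
Tor¹. -/
lemma quasiIso_pull {K L : CochainComplex 𝒮 ℤ} (f : K ⟶ L) (hf : QuasiIso f)
    (hK : minusProp 𝒮 K) (hL : minusProp 𝒮 L)
    (hK' : (Z.torK.obj K).Acyclic) (hL' : (Z.torK.obj L).Acyclic) :
    QuasiIso (Z.pullK.map f) := by
  rw [quasiIso_map_iff_acyclic]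
  exact Z.acyclic_pull (minusProp_mappingCone f hK hL) ((quasiIso_iff_acyclic_mappingCone f).1 hf)
    (Z.acyclic_tor_mappingCone f hK' hL')

end SqZeroPair
end SqZeroThickening
end

/-! ### Resolutions of bounded above complexes by successive covers. -/

noncomputable section
namespace SqZeroThickening

attribute [local instance] HasDerivedCategory.standard

section Resolution
variable {C : Type v} [Category.{u} C] [Abelian C]

/-- A stage of the construction of a resolution of a chain complex. -/
structure ResolutionStage (Q : ObjectProperty C) (L : ChainComplex C ℕ) (n : ℕ) where
  obj : C
  prop : Q obj
  cyc : C
  ι : cyc ⟶ obj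
  f : obj ⟶ L.X n
  mono : Mono ι

namespace ResolutionStage
variable {Q : ObjectProperty C} {L : ChainComplex C ℕ}
  (hQ : ∀ F, ∃ (E : C) (p : E ⟶ F), Epi p ∧ Q E) {n : ℕ} (s : ResolutionStage Q L n)

/-- The object covered at the next stage. -/
abbrev next : C := pullback (s.ι ≫ s.f) (L.d (n + 1) n)

omit [Abelian C] in
include hQ in
lemma exists_cover (F : C) : ∃ (Y : Σ E : C, E ⟶ F), Epi Y.2 ∧ Q Y.1 := by
  obtain ⟨E, p, h⟩ := hQ F
  exact ⟨⟨E, p⟩, h⟩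

/-- A chosen cover by an object that satisfies the given property. -/
def cover (F : C) : C := (exists_cover hQ F).choose.1
/-- The projection of the chosen cover. -/
def coverπ (F : C) : cover hQ F ⟶ F := (exists_cover hQ F).choose.2
instance instEpiCoverπ (F : C) : Epi (coverπ hQ F) := (exists_cover hQ F).choose_spec.1
omit [Abelian C] in
lemma prop_cover (F : C) : Q (cover hQ F) := (exists_cover hQ F).choose_spec.2

/-- The next stage. -/
abbrev succ : ResolutionStage Q L (n + 1) where
  obj := cover hQ s.next
  prop := prop_cover hQ _
  -- The differential is this composite followed by the monomorphism `s.ι`, so its kernel is the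
  -- object of cycles.
  cyc := kernel (coverπ hQ s.next ≫ pullback.fst _ _)
  ι := kernel.ι _
  f := coverπ hQ s.next ≫ pullback.snd _ _
  mono := inferInstance

variable (L) in
/-- The initial stage. -/
def zero : ResolutionStage Q L 0 where
  obj := cover hQ (L.X 0)
  prop := prop_cover hQ _
  -- No differential leaves degree 0, so every element there is a cycle.
  cyc := cover hQ (L.X 0)
  ι := 𝟙 _
  f := coverπ hQ _
  mono := inferInstance

variable (L) in
/-- All the stages. -/
def stage : ∀ n : ℕ, ResolutionStage Q L n
  | 0 => zero L hQ
  | n + 1 => (stage n).succ hQ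

end ResolutionStage

/-- A criterion for a morphism of chain complexes constructed by successive covers to be a
quasi-isomorphism. -/
lemma quasiIso_of_successive_covers {P L : ChainComplex C ℕ} (f : P ⟶ L) (cyc : ℕ → C)
    (ι : ∀ n, cyc n ⟶ P.X n) (π : ∀ n, P.X (n + 1) ⟶ pullback (ι n ≫ f.f n) (L.d (n + 1) n))
    (hπ : ∀ n, Epi (π n)) (hd : ∀ n, P.d (n + 1) n = π n ≫ pullback.fst _ _ ≫ ι n)
    (hf : ∀ n, f.f (n + 1) = π n ≫ pullback.snd _ _) (hι : ∀ n, Mono (ι n)) (h₀ : IsIso (ι 0))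
    (hcyc : ∀ (n : ℕ) (A : C) (x : A ⟶ P.X (n + 1)), x ≫ π n ≫ pullback.fst _ _ = 0 →
      ∃ z, z ≫ ι (n + 1) = x) (hf₀ : Epi (f.f 0)) : QuasiIso f := by
  have lift {A : C} (n : ℕ) (x : A ⟶ P.X n) (hx : x ≫ P.d n ((ComplexShape.down ℕ).next n) = 0) :
      ∃ z, z ≫ ι n = x := by
    obtain _ | n := n
    · exact ⟨x ≫ inv (ι 0), by simp⟩
    · refine hcyc n A x ?_
      have hn : (ComplexShape.down ℕ).next (n + 1) = n := by simp
      rw [hn, hd] at hx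
      rw [← cancel_mono (ι n), zero_comp]
      simpa using hx
  refine ⟨fun n ↦ ?_⟩
  rw [quasiIsoAt_iff_isIso_homologyMap]
  have h₁ : Mono (HomologicalComplex.homologyMap f n) := by
    rw [HomologicalComplex.mono_homologyMap_iff_up_to_refinements _ (n + 1) n _ (by simp) rfl]
    intro A x hx y hy
    obtain ⟨z, rfl⟩ := lift n x hx
    rw [Category.assoc] at hy
    -- A cycle z of P and an element y bounding its image form a point of the pullback; lifting the
    -- point through the cover exhibits z as a boundary.
    obtain ⟨A', p, hp, e, he⟩ := surjective_up_to_refinements_of_epi (π n) (pullback.lift _ _ hy)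
    refine ⟨A', p, hp, e, ?_⟩
    rw [hd, ← reassoc_of% he, pullback.lift_fst_assoc]
  have h₂ : Epi (HomologicalComplex.homologyMap f n) := by
    rw [HomologicalComplex.epi_homologyMap_iff_up_to_refinements _ (n + 1) n _ (by simp) rfl]
    intro A y hy
    obtain _ | n := n
    · obtain ⟨A', p, hp, e, he⟩ := surjective_up_to_refinements_of_epi (f.f 0) y
      exact ⟨A', p, hp, e, by rw [P.shape _ _ (by simp), comp_zero], 0, by rw [zero_comp, add_zero, he]⟩
    · have hn : (ComplexShape.down ℕ).next (n + 1) = n := by simp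
      rw [hn] at hy ⊢
      -- For a cycle y of L the pair (0, y) is a point of the pullback, and its lift is a cycle of P
      -- that maps to y.
      obtain ⟨A', p, hp, e, he⟩ := surjective_up_to_refinements_of_epi (π n)
        (pullback.lift 0 y (by rw [hy, zero_comp]))
      refine ⟨A', p, hp, e, ?_, 0, ?_⟩
      · rw [hd, ← reassoc_of% he, pullback.lift_fst_assoc, zero_comp, comp_zero]
      · rw [zero_comp, add_zero, hf, ← reassoc_of% he, pullback.lift_snd]
  exact isIso_of_mono_of_epi _

lemma exists_chain_resolution {Q : ObjectProperty C}
    (hQ : ∀ F, ∃ (E : C) (p : E ⟶ F), Epi p ∧ Q E) (L : ChainComplex C ℕ) :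
    ∃ (P : ChainComplex C ℕ) (f : P ⟶ L), (∀ n, Q (P.X n)) ∧ QuasiIso f := by
  let st := ResolutionStage.stage L hQ
  let d (n : ℕ) : (st (n + 1)).obj ⟶ (st n).obj :=
    ResolutionStage.coverπ hQ (st n).next ≫ pullback.fst _ _ ≫ (st n).ι
  have hιd (n : ℕ) : (st (n + 1)).ι ≫ d n = 0 :=
    (by
    intro X Y Z W f g h
    rw [← Category.assoc f, ← Category.assoc, kernel.condition, zero_comp] : ∀ {X Y Z W : C} (f : X ⟶ Y) (g : Y ⟶ Z) (h : Z ⟶ W),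
      kernel.ι (f ≫ g) ≫ f ≫ g ≫ h = 0) _ _ _
  have hdd (n : ℕ) : d (n + 1) ≫ d n = 0 :=
    (by rintro X Y Z W V f g h k w; simp [w] : ∀ {X Y Z W V : C} (f : X ⟶ Y) (g : Y ⟶ Z) (h : Z ⟶ W) (k : W ⟶ V),
      h ≫ k = 0 → (f ≫ g ≫ h) ≫ k = 0) _ _ _ _ (hιd n)
  have hP (n : ℕ) : (ChainComplex.of (fun n ↦ (st n).obj) d hdd).d (n + 1) n = d n :=
    ChainComplex.of_d (fun n ↦ (st n).obj) d n
  refine ⟨ChainComplex.of (fun n ↦ (st n).obj) d hdd, { f := fun n ↦ (st n).f, comm' := ?_ }, fun n ↦ (st n).prop,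
    quasiIso_of_successive_covers _ (fun n ↦ (st n).cyc) (fun n ↦ (st n).ι)
      (fun n ↦ ResolutionStage.coverπ hQ (st n).next)
      (fun n ↦ ResolutionStage.instEpiCoverπ hQ (st n).next) hP (fun n ↦ rfl)
      (fun n ↦ (st n).mono) (inferInstanceAs (IsIso (𝟙 _))) ?_
      ?_⟩
  · rintro i j (rfl : j + 1 = i)
    rw [hP]
    exact ((Category.assoc _ _ _).trans (congrArg (ResolutionStage.coverπ hQ (st j).next ≫ ·)
      pullback.condition.symm)).trans ((by simp : ∀ {X Y Z W V : C} (f : X ⟶ Y) (g : Y ⟶ Z) (h : Z ⟶ W) (k : W ⟶ V),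
      f ≫ g ≫ h ≫ k = (f ≫ g ≫ h) ≫ k) _ _ _ _)
  · intro n A x hx
    exact ⟨kernel.lift _ x hx, kernel.lift_ι _ _ _⟩
  · exact ResolutionStage.instEpiCoverπ hQ _

/-- A complex that is strictly supported in the image of an embedding is extended from its
restriction. -/
lemma exists_iso_extend {ι ι' : Type*} {c : ComplexShape ι} {c' : ComplexShape ι'} (e : c.Embedding c')
    [e.IsRelIff] (K : HomologicalComplex C c') [K.IsStrictlySupported e] :
    Nonempty ((K.restriction e).extend e ≅ K) := by
  have h : e.HasLift (𝟙 (K.restriction e)) := fun j hj i hij ↦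
    (K.isZero_X_of_isStrictlySupported e i (fun k ↦ hj.notMem hij k)).eq_of_src _ _
  have : ∀ i, IsIso ((e.liftExtend (𝟙 _) h).f i) := fun i ↦ by
    by_cases hi : ∃ j, e.f j = i
    · obtain ⟨j, rfl⟩ := hi
      rw [e.liftExtend_f _ _ rfl]
      infer_instance
    · refine isIso_of_source_target_iso_zero _
        (K.isZero_X_of_isStrictlySupported e i (by simpa using hi)).isoZero
        ((K.restriction e).isZero_extend_X e i (by simpa using hi)).isoZero
  have := HomologicalComplex.Hom.isIso_of_components (e.liftExtend (𝟙 _) h)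
  exact ⟨(asIso (e.liftExtend (𝟙 _) h)).symm⟩

/-- Every bounded above complex has a resolution by a bounded above complex of objects from a
class that contains the zero objects and covers every object. -/
lemma exists_resolution (Q : ObjectProperty C) (h₀ : ∀ X, IsZero X → Q X)
    [Q.IsClosedUnderIsomorphisms]
    (hQ : ∀ F, ∃ (E : C) (p : E ⟶ F), Epi p ∧ Q E) (K : CochainComplex C ℤ) (hK : minusProp C K) :
    ∃ (P : CochainComplex C ℤ) (f : P ⟶ K), minusProp C P ∧ (∀ i, Q (P.X i)) ∧ QuasiIso f := by
  obtain ⟨b, hb⟩ := hK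
  -- The embedding n ↦ b - n turns cochain complexes supported in degrees ≤ b into chain complexes.
  -- Outside its image the resolution is zero, hence the hypothesis on zero objects.
  let e := ComplexShape.embeddingUpIntLE b
  let L := K.restriction e
  obtain ⟨P, f, hP, hf⟩ := exists_chain_resolution hQ L
  have : K.IsStrictlySupported e := hb
  obtain ⟨φ⟩ := exists_iso_extend e K
  refine ⟨P.extend e, HomologicalComplex.extendMap f e ≫ φ.hom,
    ⟨b, inferInstanceAs ((P.extend e).IsStrictlySupported e)⟩, fun i ↦ ?_, inferInstance⟩
  by_cases hi : ∃ j, e.f j = i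
  · obtain ⟨j, hj⟩ := hi
    exact Q.prop_of_iso (P.extendXIso e hj).symm (hP j)
  · exact h₀ _ (P.isZero_extend_X e i (by simpa using hi))

end Resolution
end SqZeroThickening
end

/-! ### Contractible complexes and surjective resolutions. -/

noncomputable section
namespace SqZeroThickening

attribute [local instance] HasDerivedCategory.standard

section General
variable {C D : Type v} [Category.{u} C] [Category.{u} D] [Abelian C] [Abelian D]

lemma quasiIso_g_of_acyclic {S : ShortComplex (CochainComplex C ℤ)} (hS : S.ShortExact)
    (h : S.X₁.Acyclic) : QuasiIso S.g := by
  refine ⟨fun i ↦ ?_⟩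
  rw [quasiIsoAt_iff_isIso_homologyMap]
  have h₁ : Mono (HomologicalComplex.homologyMap S.g i) := by
    refine (hS.homology_exact₂ i).mono_g (IsZero.eq_of_src ?_ _ _)
    exact (HomologicalComplex.exactAt_iff_isZero_homology _ _).1 (h i)
  have h₂ : Epi (HomologicalComplex.homologyMap S.g i) := by
    refine (hS.homology_exact₃ i (i + 1) rfl).epi_f (IsZero.eq_of_tgt ?_ _ _)
    exact (HomologicalComplex.exactAt_iff_isZero_homology _ _).1 (h _)
  exact isIso_of_mono_of_epi _

lemma quasiIso_f_of_acyclic {S : ShortComplex (CochainComplex C ℤ)} (hS : S.ShortExact)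
    (h : S.X₃.Acyclic) : QuasiIso S.f := by
  refine ⟨fun i ↦ ?_⟩
  rw [quasiIsoAt_iff_isIso_homologyMap]
  have h₁ : Mono (HomologicalComplex.homologyMap S.f i) := by
    refine (hS.homology_exact₁ (i - 1) i (by simp)).mono_g (IsZero.eq_of_src ?_ _ _)
    exact (HomologicalComplex.exactAt_iff_isZero_homology _ _).1 (h _)
  have h₂ : Epi (HomologicalComplex.homologyMap S.f i) := by
    refine (hS.homology_exact₂ i).epi_f (IsZero.eq_of_tgt ?_ _ _)
    exact (HomologicalComplex.exactAt_iff_isZero_homology _ _).1 (h _)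
  exact isIso_of_mono_of_epi _

lemma shortExact_kernel {K L : CochainComplex C ℤ} (f : K ⟶ L) [Epi f] :
    (ShortComplex.mk (kernel.ι f) f (kernel.condition f)).ShortExact where
  exact := ShortComplex.exact_kernel f

/-- Opposite sides of a cartesian square have the same kernel, and the kernel of a surjective
quasi-isomorphism is acyclic. This is why resolutions are wanted to be epimorphisms. -/
lemma quasiIso_pullback_fst {K L M : CochainComplex C ℤ} (f : K ⟶ M) (g : L ⟶ M) [Epi g]
    (hg : QuasiIso g) : QuasiIso (pullback.fst f g) := by
  refine quasiIso_g_of_acyclic (shortExact_kernel (pullback.fst f g)) fun i ↦ ?_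
  have := (shortExact_kernel g).acyclic_X₁ hg i
  have h := Limits.isIso_kernel_map_of_isPullback (IsPullback.of_hasPullback f g)
  exact this.of_iso (asIso (kernel.map _ _ _ _ (IsPullback.of_hasPullback f g).w)).symm

/-- An additive functor preserves a contracting homotopy, whereas it need not preserve acyclicity.
-/
lemma acyclic_map_of_isZero_quotient (F : C ⥤ D) [F.Additive] {M : CochainComplex C ℤ}
    (h : IsZero ((HomotopyCategory.quotient C (ComplexShape.up ℤ)).obj M)) :
    ((F.mapHomologicalComplex _).obj M).Acyclic := by
  have h' := HomotopyCategory.homotopyOfEq (𝟙 M) 0 (h.eq_of_src _ _)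
  have h'' := F.mapHomotopy h'
  intro i
  rw [HomologicalComplex.exactAt_iff_isZero_homology, IsZero.iff_id_eq_zero,
    ← HomologicalComplex.homologyMap_id]
  have := h''.homologyMap_eq i
  simpa using this

/-- The cone of the identity of `K[-1]`, which is contractible. -/
def contractibleCover (K : CochainComplex C ℤ) : CochainComplex C ℤ :=
  CochainComplex.mappingCocone (𝟙 K)

/-- The projection from the contractible cover. -/
def contractibleCoverπ (K : CochainComplex C ℤ) : contractibleCover K ⟶ K :=
  CochainComplex.mappingCocone.fst (𝟙 K)

instance (K : CochainComplex C ℤ) (i : ℤ) : Epi ((contractibleCoverπ K).f i) := by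
  have := CochainComplex.mappingCocone.inl_v_fst_f (𝟙 K) i
  exact @SplitEpi.epi _ _ _ _ _ ⟨_, this⟩

instance (K : CochainComplex C ℤ) : Epi (contractibleCoverπ K) :=
  HomologicalComplex.epi_of_epi_f _ inferInstance

lemma isZero_contractibleCover_X (K : CochainComplex C ℤ) (i : ℤ) (h : IsZero (K.X i))
    (h' : IsZero (K.X (i - 1))) : IsZero ((contractibleCover K).X i) := by
  change IsZero ((CochainComplex.mappingCone (𝟙 K)).X (i + -1))
  rw [CochainComplex.mappingCone.isZero_X_iff]
  exact ⟨by simpa using h, by rwa [← sub_eq_add_neg]⟩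

lemma isZero_quotient_contractibleCover (K : CochainComplex C ℤ) :
    IsZero ((HomotopyCategory.quotient C (ComplexShape.up ℤ)).obj (contractibleCover K)) := by
  have h : IsZero ((HomotopyCategory.quotient C (ComplexShape.up ℤ)).obj (CochainComplex.mappingCone (𝟙 K))) :=
    Pretriangulated.Triangle.isZero₃_of_isIso₁ _
      (HomotopyCategory.mappingCone_triangleh_distinguished (𝟙 K))
      (inferInstanceAs (IsIso ((HomotopyCategory.quotient C (ComplexShape.up ℤ)).map (𝟙 K))))
  exact ((shiftFunctor (HomotopyCategory C (ComplexShape.up ℤ)) (-1 : ℤ)).map_isZero h).of_iso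
    (((HomotopyCategory.quotient C (ComplexShape.up ℤ)).commShiftIso (-1 : ℤ)).app _)

lemma acyclic_map_contractibleCover (F : C ⥤ D) [F.Additive] (K : CochainComplex C ℤ) :
    ((F.mapHomologicalComplex _).obj (contractibleCover K)).Acyclic :=
  acyclic_map_of_isZero_quotient F (isZero_quotient_contractibleCover K)

lemma acyclic_contractibleCover (K : CochainComplex C ℤ) : (contractibleCover K).Acyclic :=
  acyclic_map_contractibleCover (𝟭 C) K

lemma minusProp_contractibleCover {K : CochainComplex C ℤ} (h : minusProp C K) :
    minusProp C (contractibleCover K) := by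
  obtain ⟨n, hn⟩ := h
  refine ⟨n + 1, (CochainComplex.isStrictlyLE_iff _ _).2 fun i hi ↦ ?_⟩
  exact isZero_contractibleCover_X K i (K.isZero_of_isStrictlyLE n _ (by omega))
    (K.isZero_of_isStrictlyLE n _ (by omega))

lemma shortExact_biprod (K L : CochainComplex C ℤ) :
    (ShortComplex.mk (biprod.inl : K ⟶ K ⊞ L) biprod.snd (by simp)).ShortExact :=
  (ShortComplex.Splitting.ofHasBinaryBiproduct K L).shortExact

lemma acyclic_map_biprod (F : C ⥤ D) [F.Additive] {K L : CochainComplex C ℤ}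
    (hK : ((F.mapHomologicalComplex _).obj K).Acyclic) (hL : ((F.mapHomologicalComplex _).obj L).Acyclic) :
    ((F.mapHomologicalComplex (ComplexShape.up ℤ)).obj (K ⊞ L)).Acyclic := by
  have := ((ShortComplex.Splitting.ofHasBinaryBiproduct K L).map
    (F.mapHomologicalComplex (ComplexShape.up ℤ))).shortExact
  exact this.acyclic_X₂ hK hL

lemma minusProp_biprod {K L : CochainComplex C ℤ} (hK : minusProp C K) (hL : minusProp C L) :
    minusProp C (K ⊞ L) := by
  obtain ⟨a, ha⟩ := hK
  obtain ⟨b, hb⟩ := hL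
  refine ⟨max a b, (CochainComplex.isStrictlyLE_iff _ _).2 fun i hi ↦ ?_⟩
  refine IsZero.of_iso ?_ ((HomologicalComplex.eval C (ComplexShape.up ℤ) i).mapBiprod K L)
  simp only [biprod_isZero_iff]
  exact ⟨K.isZero_of_isStrictlyLE a _ (by omega), L.isZero_of_isStrictlyLE b _ (by omega)⟩

end General

namespace SqZeroPair
variable {𝒮 𝒜 : Type v} [Category.{u} 𝒮] [Category.{u} 𝒜] [Abelian 𝒮] [Abelian 𝒜]
  (Z : SqZeroPair 𝒮 𝒜)

lemma isZero_tor1_of_mono {F : 𝒮} (h : Mono (Z.mul.app F)) : IsZero (Z.tor1.obj F) :=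
  Z.pull.map_isZero (isZero_kernel_of_mono (Z.mul.app F))

lemma exists_resolution_tor (K : CochainComplex 𝒮 ℤ) (hK : minusProp 𝒮 K) :
    ∃ (P : CochainComplex 𝒮 ℤ) (f : P ⟶ K), minusProp 𝒮 P ∧ (∀ i, IsZero (Z.tor1.obj (P.X i))) ∧
      QuasiIso f := by
  let Q : ObjectProperty 𝒮 := fun F ↦ IsZero (Z.tor1.obj F)
  have : Q.IsClosedUnderIsomorphisms := ⟨fun e h ↦ h.of_iso (Z.tor1.mapIso e.symm)⟩
  refine exists_resolution Q (fun X h ↦ Z.tor1.map_isZero h) (fun F ↦ ?_) K hK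
  obtain ⟨E, p, hp, hE⟩ := Z.enough F
  exact ⟨E, p, hp, Z.isZero_tor1_of_mono hE⟩

/-- Adding a contractible complex that surjects onto K makes the resolution an epimorphism and
changes neither the homology nor, up to quasi-isomorphism, the value of any additive functor. -/
lemma exists_epi_resolution (K : CochainComplex 𝒮 ℤ) (hK : minusProp 𝒮 K) :
    ∃ (P : CochainComplex 𝒮 ℤ) (f : P ⟶ K), minusProp 𝒮 P ∧ (Z.torK.obj P).Acyclic ∧
      QuasiIso f ∧ Epi f := by
  obtain ⟨P, f, hP, hT, hf⟩ := Z.exists_resolution_tor K hK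
  refine ⟨P ⊞ contractibleCover K, biprod.desc f (contractibleCoverπ K),
    minusProp_biprod hP (minusProp_contractibleCover hK),
    acyclic_map_biprod Z.tor1 (fun i ↦ exactAt_of_isZero (hT i)) (acyclic_map_contractibleCover _ K), ?_, ?_⟩
  · have h := quasiIso_f_of_acyclic (shortExact_biprod P (contractibleCover K))
      (acyclic_contractibleCover K)
    have h' : QuasiIso ((biprod.inl : P ⟶ _) ≫ biprod.desc f (contractibleCoverπ K)) := by
      simpa using hf
    exact quasiIso_of_comp_left (biprod.inl : P ⟶ _) _
  · have : Epi ((biprod.inr : contractibleCover K ⟶ _) ≫ biprod.desc f (contractibleCoverπ K)) := by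
      simp only [biprod.inr_desc]; infer_instance
    exact epi_of_epi biprod.inr _

end SqZeroPair
end SqZeroThickening
end

/-! ### D⁻(S) as a localization of complexes with acyclic Tor¹; the derived functor. -/

noncomputable section
namespace SqZeroThickening

attribute [local instance] HasDerivedCategory.standard

lemma acyclic_shift {C : Type v} [Category.{u} C] [Abelian C] {K : CochainComplex C ℤ} (h : K.Acyclic)
    (n : ℤ) : (K⟦n⟧).Acyclic := by
  rw [← HomotopyCategory.quotient_obj_mem_subcategoryAcyclic_iff_acyclic] at h ⊢
  rw [← HomotopyCategory.shift_quotient_obj]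
  exact ObjectProperty.le_shift _ n _ h

namespace SqZeroPair
variable {𝒮 𝒜 : Type v} [Category.{u} 𝒮] [Category.{u} 𝒜] [Abelian 𝒮] [Abelian 𝒜]
  (Z : SqZeroPair 𝒮 𝒜)

/-- The bounded above complexes `P` with `Tor¹(P)` acyclic. -/
def resK : ObjectProperty (CochainComplex 𝒮 ℤ) := fun P ↦ minusProp 𝒮 P ∧ (Z.torK.obj P).Acyclic

/-- The bounded above complexes `P` with `Tor¹(P)` acyclic, as a property of objects of the homotopy
category. -/
def res : ObjectProperty (HomotopyCategory 𝒮 (ComplexShape.up ℤ)) :=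
  Z.resK.strictMap (HomotopyCategory.quotient _ _)

variable {Z} in
lemma res_quotient_obj_iff (K : CochainComplex 𝒮 ℤ) :
    Z.res ((HomotopyCategory.quotient _ _).obj K) ↔ Z.resK K := by
  refine ⟨?_, fun h ↦ ⟨_, h⟩⟩
  simp only [res, ObjectProperty.strictMap_iff]
  rintro ⟨L, h, hL⟩
  obtain rfl : L = K := congr_arg Quotient.as hL
  exact h

lemma resK_shift {K : CochainComplex 𝒮 ℤ} (h : Z.resK K) (n : ℤ) : Z.resK (K⟦n⟧) := by
  obtain ⟨⟨q, _⟩, hT⟩ := h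
  refine ⟨⟨q - n, K.isStrictlyLE_shift q n (q - n) (by omega)⟩, ?_⟩
  have e : Z.torK.obj (K⟦n⟧) ≅ (Z.torK.obj K)⟦n⟧ := (Functor.commShiftIso Z.torK n).app K
  exact fun i ↦ (acyclic_shift hT n i).of_iso e.symm

instance : Z.res.ContainsZero where
  exists_zero :=
    ⟨(HomotopyCategory.quotient _ _).obj (HomologicalComplex.zero), Functor.map_isZero _ HomologicalComplex.isZero_zero, by
      rw [res_quotient_obj_iff]
      exact ⟨⟨0, (CochainComplex.isStrictlyLE_iff _ _).2 fun i _ ↦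
        (HomologicalComplex.eval 𝒮 (ComplexShape.up ℤ) i).map_isZero HomologicalComplex.isZero_zero⟩, fun i ↦ exactAt_of_isZero (Z.tor1.map_isZero
        ((HomologicalComplex.eval 𝒮 (ComplexShape.up ℤ) i).map_isZero HomologicalComplex.isZero_zero))⟩⟩

instance : Z.res.IsStableUnderShift ℤ where
  isStableUnderShiftBy n :=
    { le_shift K hK := by
        obtain ⟨K : CochainComplex _ _, rfl⟩ := K.quotient_obj_surjective
        rw [res_quotient_obj_iff] at hK
        rw [ObjectProperty.prop_shift_iff, HomotopyCategory.shift_quotient_obj, res_quotient_obj_iff]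
        exact Z.resK_shift hK n }

instance : Z.res.IsTriangulatedClosed₃ where
  ext₃' T hT h₁ h₂ := by
    have h₁' : Z.resK T.obj₁.as := by rwa [← res_quotient_obj_iff]
    have h₂' : Z.resK T.obj₂.as := by rwa [← res_quotient_obj_iff]
    obtain ⟨f : T.obj₁.as ⟶ T.obj₂.as, hf⟩ := (HomotopyCategory.quotient _ _).map_surjective T.mor₁
    refine ⟨_, ?_,
      ⟨Pretriangulated.Triangle.π₃.mapIso (Pretriangulated.isoTriangleOfIso₁₂ T _ hT
        (HomotopyCategory.mappingCone_triangleh_distinguished f) (Iso.refl _) (Iso.refl _) ?_)⟩⟩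
    · refine (res_quotient_obj_iff _).2 ⟨minusProp_mappingCone f h₁'.1 h₂'.1,
        Z.acyclic_tor_mappingCone f h₁'.2 h₂'.2⟩
    · exact (Category.comp_id _).trans (hf.symm.trans (Category.id_comp _).symm)

instance : Z.res.IsTriangulated where
  toIsTriangulatedClosed₂ := .of_isTriangulatedClosed₃

instance : Z.res.IsVerdierLeftLocalizing (HomotopyCategory.subcategoryAcyclic 𝒮) := by
  rw [ObjectProperty.isVerdierLeftLocalizing_iff]
  intro X Y s hY hs
  obtain ⟨X : CochainComplex _ _, rfl⟩ := HomotopyCategory.quotient_obj_surjective X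
  obtain ⟨Y : CochainComplex _ _, rfl⟩ := HomotopyCategory.quotient_obj_surjective Y
  obtain ⟨s, rfl⟩ := (HomotopyCategory.quotient _ _).map_surjective s
  rw [res_quotient_obj_iff] at hY
  rw [← HomotopyCategory.quasiIso_eq_trW_subcategoryAcyclic,
    HomotopyCategory.quotient_map_mem_quasiIso_iff, HomologicalComplex.mem_quasiIso_iff] at hs
  obtain ⟨n, hn⟩ := hY.1
  -- X itself may be unbounded above. Being quasi-isomorphic to Y, it can be replaced by a
  -- truncation, and resolutions exist for the truncation.
  have h₁ : QuasiIso (X.ιTruncLE n) := by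
    rw [CochainComplex.quasiIso_ιTruncLE_iff, CochainComplex.isLE_iff]
    exact fun i hi ↦ (exactAt_iff_of_quasiIsoAt s i).2 (Y.exactAt_of_isLE n i hi)
  obtain ⟨P, f, hP, hT, hf⟩ := Z.exists_resolution_tor (X.truncLE n) ⟨n, inferInstance⟩
  have hP' : Z.resK P := ⟨hP, fun i ↦ exactAt_of_isZero (hT i)⟩
  refine ⟨(HomotopyCategory.quotient _ _).obj P, (HomotopyCategory.quotient _ _).map (f ≫ X.ιTruncLE n ≫ s),
    (HomotopyCategory.quotient _ _).map (f ≫ X.ιTruncLE n), (res_quotient_obj_iff _).2 hP', ?_, by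
      simp⟩
  rw [ObjectProperty.trW_iff]
  refine ⟨_, _, _, HomotopyCategory.mappingCone_triangleh_distinguished _, ?_, ?_⟩
  · exact (res_quotient_obj_iff _).2 ⟨minusProp_mappingCone _ hP hY.1,
        Z.acyclic_tor_mappingCone _ hP'.2 hY.2⟩
  · exact (HomotopyCategory.quotient_obj_mem_subcategoryAcyclic_iff_acyclic _).2
      ((quasiIso_iff_acyclic_mappingCone _).1 inferInstance)

/-- The localization functor from the homotopy category of complexes `P` with `Tor¹(P)` acyclic to
the derived category. -/
def resQ : Z.res.FullSubcategory ⥤ DMinus 𝒮 :=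
  (DerivedCategory.TStructure.t (C := 𝒮)).minus.lift (Z.res.ι ⋙ DerivedCategory.Qh) (by
    rintro ⟨K, hK⟩
    obtain ⟨K, rfl⟩ := HomotopyCategory.quotient_obj_surjective K
    obtain ⟨⟨n, _⟩, _⟩ := (res_quotient_obj_iff _).1 hK
    exact ⟨n, inferInstanceAs ((DerivedCategory.Q.obj K).IsLE n)⟩)

instance : Z.resQ.EssSurj where
  mem_essImage := by
    intro ⟨X, n, K, e, h⟩
    obtain ⟨P, f, hP, hT, hf⟩ := Z.exists_resolution_tor K ⟨n, h⟩
    refine ⟨⟨(HomotopyCategory.quotient _ _).obj P, (res_quotient_obj_iff _).2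
      ⟨hP, fun i ↦ exactAt_of_isZero (hT i)⟩⟩, ⟨DerivedCategory.Minus.ι.preimageIso ?_⟩⟩
    have : IsIso (DerivedCategory.Q.map f) := (DerivedCategory.isIso_Q_map_iff_quasiIso 𝒮 f).2 hf
    exact @asIso _ _ _ _ (DerivedCategory.Q.map f) this ≪≫ e.symm

/-- The morphisms of complexes inverted by `resQ`. -/
abbrev resW : MorphismProperty Z.res.FullSubcategory :=
  ((HomotopyCategory.subcategoryAcyclic 𝒮).inverseImage Z.res.ι).trW

/-- The Verdier condition makes the localization of these complexes embed fully faithfully in the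
derived category, and resolutions show that every object of D⁻ is reached. Functors out of D⁻ can
thus be defined on complexes with acyclic Tor¹. -/
instance : Z.resQ.IsLocalization Z.resW :=
  (Z.res.triangulatedLocalizerMorphism
    (HomotopyCategory.subcategoryAcyclic 𝒮)).isLocalization_of_isLocalizedFullyFaithful
      (F := DerivedCategory.Minus.ι) (L₂ := DerivedCategory.Qh) (Iso.refl _)

/-- `j^*` on complexes `P` with `Tor¹(P)` acyclic. -/
def resPull : Z.res.FullSubcategory ⥤ DMinus 𝒜 :=
  (DerivedCategory.TStructure.t (C := 𝒜)).minus.lift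
    (Z.res.ι ⋙ Z.pull.mapHomotopyCategory (ComplexShape.up ℤ) ⋙ DerivedCategory.Qh) (by
    rintro ⟨K, hK⟩
    obtain ⟨K, rfl⟩ := HomotopyCategory.quotient_obj_surjective K
    obtain ⟨n, _⟩ := minusProp_map Z.pull K ((res_quotient_obj_iff _).1 hK).1
    exact ⟨n, inferInstanceAs ((DerivedCategory.Q.obj (Z.pullK.obj K)).IsLE n)⟩)

/-- The object of the homotopy category attached to a complex. -/
def resObj (P : CMinus 𝒮) (hP : (Z.torK.obj P.obj).Acyclic) : Z.res.FullSubcategory :=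
  ⟨(HomotopyCategory.quotient _ _).obj P.obj, (res_quotient_obj_iff _).2 ⟨P.property, hP⟩⟩

/-- The morphism of the homotopy category attached to a morphism of complexes. -/
def resMap {P P' : CMinus 𝒮} (hP : (Z.torK.obj P.obj).Acyclic) (hP' : (Z.torK.obj P'.obj).Acyclic)
    (f : P ⟶ P') : Z.resObj P hP ⟶ Z.resObj P' hP' :=
  Z.res.homMk ((HomotopyCategory.quotient _ _).map f.hom)

variable {Z} in
-- Reduces statements on the homotopy category to actual morphisms of complexes, where naturality
-- can be used.
lemma exists_resMap {X Y : Z.res.FullSubcategory} (f : X ⟶ Y) :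
    ∃ (P P' : CMinus 𝒮) (hP : (Z.torK.obj P.obj).Acyclic) (hP' : (Z.torK.obj P'.obj).Acyclic)
      (g : P ⟶ P') (hX : X = Z.resObj P hP) (hY : Y = Z.resObj P' hP'),
      f = eqToHom hX ≫ Z.resMap hP hP' g ≫ eqToHom hY.symm := by
  obtain ⟨X, hX⟩ := X
  obtain ⟨Y, hY⟩ := Y
  obtain ⟨X, rfl⟩ := HomotopyCategory.quotient_obj_surjective X
  obtain ⟨Y, rfl⟩ := HomotopyCategory.quotient_obj_surjective Y
  have hX' := (res_quotient_obj_iff _).1 hX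
  have hY' := (res_quotient_obj_iff _).1 hY
  obtain ⟨g, hg⟩ := (HomotopyCategory.quotient _ _).map_surjective f.hom
  refine ⟨⟨X, hX'.1⟩, ⟨Y, hY'.1⟩, hX'.2, hY'.2, ObjectProperty.homMk g, rfl, rfl, ?_⟩
  refine Eq.trans ?_ ((Category.id_comp _).trans (Category.comp_id _)).symm
  ext
  exact hg.symm

lemma isInvertedBy_resPull : Z.resW.IsInvertedBy Z.resPull := by
  intro X Y f hf
  have hf' : (HomotopyCategory.subcategoryAcyclic 𝒮).trW f.hom :=
    ObjectProperty.trW_monotone (by simp) _ ((ObjectProperty.trW_inverseImage_ι_iff _ _ _).1 hf)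
  obtain ⟨P, P', hP, hP', g, rfl, rfl, rfl⟩ := exists_resMap f
  simp only [eqToHom_refl, Category.id_comp, Category.comp_id] at hf' ⊢
  rw [← HomotopyCategory.quasiIso_eq_trW_subcategoryAcyclic] at hf'
  have hg : QuasiIso g.hom := by
    rw [← HomologicalComplex.mem_quasiIso_iff, ← HomotopyCategory.quotient_map_mem_quasiIso_iff]
    exact hf'
  have := Z.quasiIso_pull g.hom hg P.property P'.property hP hP'
  have : IsIso (DerivedCategory.Minus.ι.map (Z.resPull.map (Z.resMap hP hP' g))) :=
    inferInstanceAs (IsIso (DerivedCategory.Q.map (Z.pullK.map g.hom)))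
  exact isIso_of_fully_faithful DerivedCategory.Minus.ι _

/-- The left derived functor of `j^*`. -/
def derivedPull : DMinus 𝒮 ⥤ DMinus 𝒜 := Localization.lift Z.resPull Z.isInvertedBy_resPull Z.resQ

/-- The left derived functor of `j^*` is `j^*` on complexes `P` with `Tor¹(P)` acyclic. -/
def resIso : Z.resQ ⋙ Z.derivedPull ≅ Z.resPull := Localization.fac _ _ _

end SqZeroPair
end SqZeroThickening
end

/-! ### Universal property of the derived functor as a right Kan extension. -/

noncomputable section
namespace SqZeroThickening

attribute [local instance] HasDerivedCategory.standard

namespace SqZeroPair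
variable {𝒮 𝒜 : Type v} [Category.{u} 𝒮] [Category.{u} 𝒜] [Abelian 𝒮] [Abelian 𝒜]
  (Z : SqZeroPair 𝒮 𝒜)

/-- `j^*` on bounded above complexes. -/
abbrev bar : CMinus 𝒮 ⥤ CMinus 𝒜 := CMinus.map Z.pull

/-- The derived functor is `j^*` on complexes with acyclic `Tor¹`. -/
def derivedIso (P : CMinus 𝒮) (hP : (Z.torK.obj P.obj).Acyclic) :
    Z.derivedPull.obj ((CMinus.Q 𝒮).obj P) ≅ (CMinus.Q 𝒜).obj (Z.bar.obj P) :=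
  Z.resIso.app (Z.resObj P hP)

lemma derivedIso_naturality {P P' : CMinus 𝒮} (hP : (Z.torK.obj P.obj).Acyclic)
    (hP' : (Z.torK.obj P'.obj).Acyclic) (f : P ⟶ P') :
    Z.derivedPull.map ((CMinus.Q 𝒮).map f) ≫ (Z.derivedIso P' hP').hom =
      (Z.derivedIso P hP).hom ≫ (CMinus.Q 𝒜).map (Z.bar.map f) :=
  Z.resIso.hom.naturality (Z.resMap hP hP' f)

lemma exists_res (K : CMinus 𝒮) : ∃ (P : Σ P : CMinus 𝒮, P ⟶ K), (Z.torK.obj P.1.obj).Acyclic ∧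
    QuasiIso P.2.hom ∧ Epi P.2.hom := by
  obtain ⟨P, f, hP, hT, hf, hf'⟩ := Z.exists_epi_resolution K.obj K.property
  exact ⟨⟨⟨P, hP⟩, ObjectProperty.homMk f⟩, hT, hf, hf'⟩

/-- A chosen resolution. -/
def resolution (K : CMinus 𝒮) : CMinus 𝒮 := (Z.exists_res K).choose.1
/-- The map from the chosen resolution. -/
def resolutionπ (K : CMinus 𝒮) : Z.resolution K ⟶ K := (Z.exists_res K).choose.2
lemma acyclic_resolution (K : CMinus 𝒮) : (Z.torK.obj (Z.resolution K).obj).Acyclic :=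
  (Z.exists_res K).choose_spec.1
lemma quasiIso_resolutionπ (K : CMinus 𝒮) : QuasiIso (Z.resolutionπ K).hom :=
  (Z.exists_res K).choose_spec.2.1
instance (K : CMinus 𝒮) : Epi (Z.resolutionπ K).hom :=
  (Z.exists_res K).choose_spec.2.2
instance (K : CMinus 𝒮) : IsIso ((CMinus.Q 𝒮).map (Z.resolutionπ K)) :=
  CMinus.isIso_Q_map _ (Z.quasiIso_resolutionπ K)

/-- The components of the morphism from the derived functor to `j^*`. -/
def derivedToApp (K : CMinus 𝒮) :
    Z.derivedPull.obj ((CMinus.Q 𝒮).obj K) ⟶ (CMinus.Q 𝒜).obj (Z.bar.obj K) :=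
  inv (Z.derivedPull.map ((CMinus.Q 𝒮).map (Z.resolutionπ K))) ≫
    (Z.derivedIso _ (Z.acyclic_resolution K)).hom ≫ (CMinus.Q 𝒜).map (Z.bar.map (Z.resolutionπ K))

/-- Independence of the chosen resolution. P and the resolution of K are both dominated by a
resolution R of their fibre product over K; since the resolution of K is a surjective
quasi-isomorphism, R → P is a quasi-isomorphism, and the two composites agree after precomposition
with the isomorphism induced by R → P. -/
lemma map_derivedToApp {P K : CMinus 𝒮} (hP : (Z.torK.obj P.obj).Acyclic) (g : P ⟶ K) :
    Z.derivedPull.map ((CMinus.Q 𝒮).map g) ≫ Z.derivedToApp K =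
      (Z.derivedIso P hP).hom ≫ (CMinus.Q 𝒜).map (Z.bar.map g) := by
  obtain ⟨R, f, hR, hT, hf, -⟩ := Z.exists_epi_resolution
    (pullback g.hom (Z.resolutionπ K).hom) (by
      obtain ⟨a, ha⟩ := P.property
      obtain ⟨b, hb⟩ := (Z.resolution K).property
      refine ⟨max a b, (CochainComplex.isStrictlyLE_iff _ _).2 fun i hi ↦ ?_⟩
      have h₁ := P.obj.isZero_of_isStrictlyLE a i (by omega)
      have h₂ := (Z.resolution K).obj.isZero_of_isStrictlyLE b i (by omega)
      refine IsZero.of_iso ?_ (PreservesPullback.iso (HomologicalComplex.eval 𝒮 (ComplexShape.up ℤ) i) _ _)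
      rw [IsZero.iff_id_eq_zero]
      exact pullback.hom_ext (h₁.eq_of_tgt _ _) (h₂.eq_of_tgt _ _))
  let R' : CMinus 𝒮 := ⟨R, hR⟩
  let a : R' ⟶ P := ObjectProperty.homMk (f ≫ pullback.fst _ _)
  let b : R' ⟶ Z.resolution K := ObjectProperty.homMk (f ≫ pullback.snd _ _)
  have hab : a ≫ g = b ≫ Z.resolutionπ K := by
    ext1
    exact (Category.assoc _ _ _).trans ((congrArg (f ≫ ·) pullback.condition).trans
      (Category.assoc _ _ _).symm)
  have ha : QuasiIso a.hom := by
    have := quasiIso_pullback_fst g.hom (Z.resolutionπ K).hom (Z.quasiIso_resolutionπ K)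
    exact quasiIso_comp f (pullback.fst g.hom (Z.resolutionπ K).hom)
  have : IsIso ((CMinus.Q 𝒮).map a) := CMinus.isIso_Q_map _ ha
  have h₁ := Z.derivedIso_naturality (P := R') hT hP a
  have h₂ := Z.derivedIso_naturality (P := R') hT (Z.acyclic_resolution K) b
  rw [← cancel_epi (Z.derivedPull.map ((CMinus.Q 𝒮).map a)), reassoc_of% h₁, ← Functor.map_comp_assoc,
    ← Functor.map_comp, ← Functor.map_comp, ← Functor.map_comp, hab, Functor.map_comp,
    Functor.map_comp, Category.assoc, derivedToApp, IsIso.hom_inv_id_assoc, reassoc_of% h₂,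
    ← Functor.map_comp, ← Functor.map_comp]

/-- The morphism from the derived functor to `j^*`. -/
def derivedTo : CMinus.Q 𝒮 ⋙ Z.derivedPull ⟶ Z.bar ⋙ CMinus.Q 𝒜 where
  app K := Z.derivedToApp K
  naturality K L f := by
    dsimp
    rw [← cancel_epi (Z.derivedPull.map ((CMinus.Q 𝒮).map (Z.resolutionπ K))), ← Functor.map_comp_assoc,
      ← Functor.map_comp, Z.map_derivedToApp (Z.acyclic_resolution K) (Z.resolutionπ K ≫ f),
      reassoc_of% Z.map_derivedToApp (Z.acyclic_resolution K) (Z.resolutionπ K), ← Functor.map_comp,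
      ← Functor.map_comp]

lemma derivedToApp_eq (P : CMinus 𝒮) (hP : (Z.torK.obj P.obj).Acyclic) :
    Z.derivedToApp P = (Z.derivedIso P hP).hom := by
  simpa using Z.map_derivedToApp hP (𝟙 P)

lemma isIso_derivedTo (P : CMinus 𝒮) (hP : (Z.torK.obj P.obj).Acyclic) :
    IsIso (Z.derivedTo.app P) := by
  change IsIso (Z.derivedToApp P)
  rw [Z.derivedToApp_eq P hP]
  infer_instance

section
variable {G : DMinus 𝒮 ⥤ DMinus 𝒜} (β : CMinus.Q 𝒮 ⋙ G ⟶ Z.bar ⋙ CMinus.Q 𝒜)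

lemma exists_resObj (X : Z.res.FullSubcategory) :
    ∃ (P : CMinus 𝒮) (hP : (Z.torK.obj P.obj).Acyclic), X = Z.resObj P hP := by
  obtain ⟨P, _, hP, _, _, h, _⟩ := exists_resMap (𝟙 X)
  exact ⟨P, hP, h⟩

/-- The complex underlying an object of the homotopy category. -/
def resCMinus (X : Z.res.FullSubcategory) : CMinus 𝒮 :=
  ⟨X.obj.as, ((res_quotient_obj_iff X.obj.as).1 X.property).1⟩

/-- The restriction of a natural transformation to complexes with acyclic `Tor¹`. -/
def resNatTrans : Z.resQ ⋙ G ⟶ Z.resQ ⋙ Z.derivedPull where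
  app X := β.app (Z.resCMinus X) ≫ Z.resIso.inv.app X
  naturality X Y f := by
    obtain ⟨P, P', hP, hP', g, rfl, rfl, rfl⟩ := exists_resMap f
    simp only [eqToHom_refl, Category.id_comp, Category.comp_id]
    exact (Category.assoc _ _ _).symm.trans ((congrArg (· ≫ Z.resIso.inv.app (Z.resObj P' hP'))
      (β.naturality g)).trans ((Category.assoc _ _ _).trans ((congrArg (β.app P ≫ ·)
        (Z.resIso.inv.naturality (Z.resMap hP hP' g))).trans (Category.assoc _ _ _).symm)))

/-- The universal property of the derived functor. -/
def derivedLift : G ⟶ Z.derivedPull :=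
  have := Localization.full_whiskeringLeft Z.resQ Z.resW (DMinus 𝒜)
  ((Functor.whiskeringLeft _ _ (DMinus 𝒜)).obj Z.resQ).preimage (Z.resNatTrans β)

lemma derivedLift_app (P : CMinus 𝒮) (hP : (Z.torK.obj P.obj).Acyclic) :
    (Z.derivedLift β).app ((CMinus.Q 𝒮).obj P) ≫ Z.derivedTo.app P = β.app P := by
  have := Localization.full_whiskeringLeft Z.resQ Z.resW (DMinus 𝒜)
  have h : (Z.derivedLift β).app (Z.resQ.obj (Z.resObj P hP)) = β.app P ≫ (Z.derivedIso P hP).inv :=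
    NatTrans.congr_app (((Functor.whiskeringLeft _ _ (DMinus 𝒜)).obj Z.resQ).map_preimage
      (Z.resNatTrans β)) (Z.resObj P hP)
  change (Z.derivedLift β).app (Z.resQ.obj (Z.resObj P hP)) ≫ Z.derivedToApp P = _
  rw [h, Z.derivedToApp_eq P hP]
  exact (Category.assoc _ _ _).trans ((congrArg (β.app P ≫ ·) (Z.derivedIso P hP).inv_hom_id).trans
    (Category.comp_id _))

/-- The identity holds on complexes with acyclic Tor¹ by construction; it extends to every K along
the resolution of K, which becomes invertible in D⁻(S). -/
lemma derivedLift_fac : Functor.whiskerLeft (CMinus.Q 𝒮) (Z.derivedLift β) ≫ Z.derivedTo = β := by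
  ext1
  ext1 K
  have h₁ := Z.derivedLift_app β _ (Z.acyclic_resolution K)
  have h₂ := β.naturality (Z.resolutionπ K)
  have h₃ := Z.derivedTo.naturality (Z.resolutionπ K)
  have h₄ := (Z.derivedLift β).naturality ((CMinus.Q 𝒮).map (Z.resolutionπ K))
  dsimp at h₁ h₂ h₃ h₄ ⊢
  rw [← cancel_epi (G.map ((CMinus.Q 𝒮).map (Z.resolutionπ K))), reassoc_of% h₄, h₃, reassoc_of% h₁, h₂]

end

/-- Natural transformations out of a localization are determined on objects `Z.resQ.obj X`, and
there the comparison morphism `Z.derivedTo` is invertible. -/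
lemma derived_hom_ext {G : DMinus 𝒮 ⥤ DMinus 𝒜} (γ γ' : G ⟶ Z.derivedPull)
    (h : ∀ K, γ.app ((CMinus.Q 𝒮).obj K) ≫ Z.derivedTo.app K =
      γ'.app ((CMinus.Q 𝒮).obj K) ≫ Z.derivedTo.app K) : γ = γ' := by
  refine Localization.natTrans_ext Z.resQ Z.resW fun X ↦ ?_
  obtain ⟨P, hP, rfl⟩ := Z.exists_resObj X
  have := Z.isIso_derivedTo P hP
  exact (cancel_mono (Z.derivedTo.app P)).1 (h P)

instance isRightKanExtension_derivedPull : Z.derivedPull.IsRightKanExtension Z.derivedTo where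
  nonempty_isUniversal := ⟨Limits.IsTerminal.ofUniqueHom
    (fun Y ↦ CostructuredArrow.homMk (Z.derivedLift Y.hom) (Z.derivedLift_fac Y.hom))
    (fun Y m ↦ by
      ext1
      refine Z.derived_hom_ext _ _ fun K ↦ ?_
      have h := NatTrans.congr_app (CostructuredArrow.w m) K
      have h' := NatTrans.congr_app (Z.derivedLift_fac Y.hom) K
      exact h.trans h'.symm)⟩

instance hasRightKanExtension : (CMinus.Q 𝒮).HasRightKanExtension (Z.bar ⋙ CMinus.Q 𝒜) :=
  Functor.HasRightKanExtension.mk Z.derivedPull Z.derivedTo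

/-- The left derived functor of `j^*`. -/
abbrev Lp : DMinus 𝒮 ⥤ DMinus 𝒜 := (CMinus.Q 𝒮).rightKanExtension (Z.bar ⋙ CMinus.Q 𝒜)

/-- The morphism from the left derived functor. -/
abbrev LpTo : CMinus.Q 𝒮 ⋙ Z.Lp ⟶ Z.bar ⋙ CMinus.Q 𝒜 :=
  (CMinus.Q 𝒮).rightKanExtensionCounit (Z.bar ⋙ CMinus.Q 𝒜)

/-- A complex with acyclic `Tor¹` computes the left derived functor of `j^*`. -/
lemma isIso_LpTo (P : CMinus 𝒮) (hP : (Z.torK.obj P.obj).Acyclic) : IsIso (Z.LpTo.app P) := by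
  have h := Functor.liftOfIsRightKanExtension_fac_app Z.Lp Z.LpTo Z.derivedPull Z.derivedTo P
  have h₁ : IsIso (Z.Lp.liftOfIsRightKanExtension Z.LpTo Z.derivedPull Z.derivedTo) :=
    (Functor.isRightKanExtension_iff_isIso _ Z.LpTo Z.derivedTo
      (Functor.liftOfIsRightKanExtension_fac _ _ _ _)).1 inferInstance
  have := Z.isIso_derivedTo P hP
  rw [← h] at this
  exact IsIso.of_isIso_comp_left ((Z.Lp.liftOfIsRightKanExtension Z.LpTo Z.derivedPull Z.derivedTo).app
    ((CMinus.Q 𝒮).obj P)) _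

end SqZeroPair
end SqZeroThickening
end

/-! ### Principal parts, the sequence with four terms and naturality of Yoneda classes. -/

noncomputable section
namespace SqZeroThickening

attribute [local instance] HasDerivedCategory.standard

namespace SqZeroPair
variable {𝒮 𝒜 : Type v} [Category.{u} 𝒮] [Category.{u} 𝒜] [Abelian 𝒮] [Abelian 𝒜]
  (Z : SqZeroPair 𝒮 𝒜)

section
variable {F G A : 𝒮}

/-- The components of the unit `F ⟶ j_*j^*F`. -/
def η (F : 𝒮) : F ⟶ Z.push.obj (Z.pull.obj F) := Z.adj.unit.app F
/-- The components of the multiplication `I ⊗ F ⟶ F`. -/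
def m (F : 𝒮) : Z.I.obj F ⟶ F := Z.mul.app F
/-- The inclusion of the kernel of the multiplication. -/
def κ (F : 𝒮) : Z.torKer.obj F ⟶ Z.I.obj F := Z.torKerι.app F
/-- The isomorphism of the kernel of the multiplication with `j_*Tor¹(F)`. -/
def ηTor (F : 𝒮) : Z.torKer.obj F ⟶ Z.push.obj (Z.tor1.obj F) := Z.adj.unit.app (Z.torKer.obj F)

instance (F : 𝒮) : Epi (Z.η F) := Z.epi_unit F
instance (F : 𝒮) : Mono (Z.κ F) := inferInstanceAs (Mono (Z.torKerι.app F))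
instance (F : 𝒮) : IsIso (Z.ηTor F) := Z.isIso_unit_torKer F
instance {F G : 𝒮} (f : F ⟶ G) [Epi f] : Epi (Z.pull.map f) := inferInstance
instance {F G : 𝒮} (f : F ⟶ G) [Epi f] : Epi (Z.I.map f) := inferInstance

lemma η_naturality (f : F ⟶ G) : f ≫ Z.η G = Z.η F ≫ Z.push.map (Z.pull.map f) :=
  Z.adj.unit.naturality f
lemma m_naturality (f : F ⟶ G) : Z.I.map f ≫ Z.m G = Z.m F ≫ f := Z.mul.naturality f
lemma m_η (F : 𝒮) : Z.m F ≫ Z.η F = 0 := Z.mul_unit F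
lemma κ_m (F : 𝒮) : Z.κ F ≫ Z.m F = 0 := Z.torKerι_mul F
lemma κ_naturality (f : F ⟶ G) : Z.torKer.map f ≫ Z.κ G = Z.κ F ≫ Z.I.map f := Z.torKerι.naturality f
lemma m_push (B : 𝒜) : Z.m (Z.push.obj B) = 0 := Z.mul_push B
lemma ηTor_naturality (f : F ⟶ G) :
    Z.torKer.map f ≫ Z.ηTor G = Z.ηTor F ≫ Z.push.map (Z.tor1.map f) :=
  Z.adj.unit.naturality (Z.torKer.map f)

lemma exact_m_η (F : 𝒮) : (ShortComplex.mk (Z.m F) (Z.η F) (Z.m_η F)).Exact := Z.exact_unit F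
lemma exact_κ_m (F : 𝒮) : (ShortComplex.mk (Z.κ F) (Z.m F) (Z.κ_m F)).Exact :=
  ShortComplex.exact_kernel (Z.mul.app F)

lemma exists_of_comp_η (x : A ⟶ F) (h : x ≫ Z.η F = 0) :
    ∃ (A' : 𝒮) (π : A' ⟶ A) (_ : Epi π) (y : A' ⟶ Z.I.obj F), π ≫ x = y ≫ Z.m F :=
  (Z.exact_m_η F).exact_up_to_refinements x h

/-- Morphisms killed by the multiplication factor through its kernel. -/
def liftκ (x : A ⟶ Z.I.obj F) (h : x ≫ Z.m F = 0) : A ⟶ Z.torKer.obj F := kernel.lift _ x h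
lemma liftκ_κ (x : A ⟶ Z.I.obj F) (h : x ≫ Z.m F = 0) : Z.liftκ x h ≫ Z.κ F = x :=
  kernel.lift_ι _ _ _

/-- The ideal acts by zero on j^*F. Consequently anything that factors through a multiplication dies
under j^*, a fact used for the quotient L/T and for the final splitting. -/
lemma pull_map_m (F : 𝒮) : Z.pull.map (Z.m F) = 0 := by
  apply Z.push.map_injective
  rw [← cancel_epi (Z.η _), ← η_naturality, m_η, Functor.map_zero, comp_zero]

lemma exact_of_exact_push {S : ShortComplex 𝒜} (h : (S.map Z.push).Exact) : S.Exact :=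
  (ShortComplex.exact_map_iff_of_faithful _ Z.push).1 h

end

/-- An abstraction of the functors `Ω¹ ⊗ -` and `P¹` with the conormal morphism. -/
structure PrincipalParts where
  N : 𝒮 ⥤ 𝒮
  P : 𝒮 ⥤ 𝒮
  zero_N : N.PreservesZeroMorphisms
  zero_P : P.PreservesZeroMorphisms
  inl : N ⟶ P
  snd : P ⟶ 𝟭 𝒮
  inl_snd : ∀ F, inl.app F ≫ snd.app F = 0
  shortExact : ∀ F, (ShortComplex.mk _ _ (inl_snd F)).ShortExact
  conormal : Z.I ⟶ N ⋙ Z.pull ⋙ Z.push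
  mono_conormal : ∀ F, Mono (conormal.app F)
  -- From i(t, m) = (it + di ⊗ m, im): if a sum of such products equals (n, 0), then n is the sum of
  -- the di ⊗ m modulo I.
  snake : ∀ {F A : 𝒮} (y : A ⟶ Z.I.obj (P.obj F)) (n : A ⟶ N.obj F),
    n ≫ inl.app F = y ≫ Z.m (P.obj F) →
      n ≫ Z.η (N.obj F) = y ≫ Z.I.map (snd.app F) ≫ conormal.app F

namespace PrincipalParts
variable {Z} (Y : Z.PrincipalParts)

instance : Y.N.PreservesZeroMorphisms := Y.zero_N
instance : Y.P.PreservesZeroMorphisms := Y.zero_P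

/-- The components of the conormal morphism. -/
def c (F : 𝒮) : Z.I.obj F ⟶ Z.push.obj (Z.pull.obj (Y.N.obj F)) := Y.conormal.app F
/-- The components of the inclusion. -/
def i (F : 𝒮) : Y.N.obj F ⟶ Y.P.obj F := Y.inl.app F
/-- The components of the projection. -/
def p (F : 𝒮) : Y.P.obj F ⟶ F := Y.snd.app F

instance (F : 𝒮) : Mono (Y.c F) := Y.mono_conormal F
instance (F : 𝒮) : Mono (Y.i F) := (Y.shortExact F).mono_f
instance (F : 𝒮) : Epi (Y.p F) := (Y.shortExact F).epi_g

lemma i_p (F : 𝒮) : Y.i F ≫ Y.p F = 0 := Y.inl_snd F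
lemma shortExact_ip (F : 𝒮) : (ShortComplex.mk (Y.i F) (Y.p F) (Y.i_p F)).ShortExact := Y.shortExact F
lemma snake' {F A : 𝒮} (y : A ⟶ Z.I.obj (Y.P.obj F)) (n : A ⟶ Y.N.obj F)
    (h : n ≫ Y.i F = y ≫ Z.m (Y.P.obj F)) :
    n ≫ Z.η (Y.N.obj F) = y ≫ Z.I.map (Y.p F) ≫ Y.c F := Y.snake y n h

lemma exists_i {F A : 𝒮} (x : A ⟶ Y.P.obj F) (h : x ≫ Y.p F = 0) : ∃ n, n ≫ Y.i F = x :=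
  ⟨(Y.shortExact_ip F).exact.lift x h, (Y.shortExact_ip F).exact.lift_f x h⟩

/-- The morphism `Tor¹(F) ⟶ j^*(Ω¹ ⊗ F)`. -/
def torToN : Z.tor1 ⟶ Y.N ⋙ Z.pull where
  app F := (Z.adj.homEquiv _ _).symm (Z.torKerι.app F ≫ Y.conormal.app F)
  naturality F G f := by
    refine (Z.adj.homEquiv_naturality_left_symm (Z.torKer.map f)
      (Z.torKerι.app G ≫ Y.conormal.app G)).symm.trans (Eq.trans ?_
        (Z.adj.homEquiv_naturality_right_symm (Z.torKerι.app F ≫ Y.conormal.app F)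
          (Z.pull.map (Y.N.map f))))
    refine congrArg (Z.adj.homEquiv _ _).symm ?_
    rw [← Category.assoc, Z.torKerι.naturality, Category.assoc, Y.conormal.naturality, Category.assoc]
    rfl

/-- The components of the morphism `Tor¹(F) ⟶ j^*(Ω¹ ⊗ F)`. -/
def t (F : 𝒮) : Z.tor1.obj F ⟶ Z.pull.obj (Y.N.obj F) := Y.torToN.app F

lemma ηTor_t (F : 𝒮) : Z.ηTor F ≫ Z.push.map (Y.t F) = Z.κ F ≫ Y.c F := by
  have := (Z.adj.homEquiv_unit (f := Y.torToN.app F)).symm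
  exact this.trans ((Z.adj.homEquiv _ _).apply_symm_apply _)

instance (F : 𝒮) : Mono (Y.t F) := by
  refine Z.push.mono_of_mono_map ?_
  have h' : Mono (Z.ηTor F ≫ Z.push.map (Y.t F)) := by
    rw [ηTor_t]; infer_instance
  exact (mono_comp_iff_of_isIso _ _).1 h'

/-- Lift an element of ker(I ⊗ F → F) to y in I ⊗ P¹(F). Its product in P¹(F) projects to zero in F,
hence is some n in Ω¹ ⊗ F, and `snake` identifies the conormal image with the class of n. In
j^*P¹(F) this class is that of a product with the ideal, which is zero. -/
lemma conormal_i_eq_zero (F : 𝒮) :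
    Z.κ F ≫ Y.c F ≫ Z.push.map (Z.pull.map (Y.i F)) = 0 := by
  obtain ⟨A, π, hπ, y, hy⟩ := surjective_up_to_refinements_of_epi (Z.I.map (Y.p F)) (Z.κ F)
  have w : (y ≫ Z.m _) ≫ Y.p F = 0 := by
    rw [Category.assoc, ← m_naturality, ← reassoc_of% hy, κ_m, comp_zero]
  obtain ⟨n, hn⟩ := Y.exists_i _ w
  rw [← cancel_epi π, comp_zero, reassoc_of% hy, ← Category.assoc (Z.I.map _),
    ← Category.assoc y, ← Y.snake' y n hn, Category.assoc, ← Z.η_naturality, reassoc_of% hn, Z.m_η, comp_zero]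

lemma t_i (F : 𝒮) : Y.t F ≫ Z.pull.map (Y.i F) = 0 := by
  apply Z.push.map_injective
  rw [← cancel_epi (Z.ηTor F), Functor.map_comp, reassoc_of% Y.ηTor_t F,
    conormal_i_eq_zero, Functor.map_zero, comp_zero]

/-- The same chase backwards: a class killed in j^*P¹(F) lifts to n in Ω¹ ⊗ F that equals a product
y in P¹(F); the image of y in I ⊗ F has zero product in F, so it lies in Tor¹, and `snake` says that
it maps to the class of n. -/
lemma exact_t_i (F : 𝒮) : (ShortComplex.mk _ _ (Y.t_i F)).Exact := by
  refine Z.exact_of_exact_push ?_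
  rw [ShortComplex.exact_iff_exact_up_to_refinements]
  intro A (x : A ⟶ Z.push.obj (Z.pull.obj (Y.N.obj F)))
    (hx : x ≫ Z.push.map (Z.pull.map (Y.i F)) = 0)
  suffices ∃ (A' : 𝒮) (π : A' ⟶ A) (_ : Epi π) (z : A' ⟶ Z.push.obj (Z.tor1.obj F)),
    π ≫ x = z ≫ Z.push.map (Y.t F) from this
  obtain ⟨A₁, π₁, hπ₁, n, hn⟩ := surjective_up_to_refinements_of_epi (Z.η (Y.N.obj F)) x
  have h₁ : (n ≫ Y.i F) ≫ Z.η _ = 0 := by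
    rw [Category.assoc, η_naturality, ← reassoc_of% hn, hx, comp_zero]
  obtain ⟨A₂, π₂, hπ₂, y, hy⟩ := Z.exists_of_comp_η _ h₁
  have h₂ := Y.snake' y (π₂ ≫ n) (by rw [Category.assoc, hy])
  have h₃ : (y ≫ Z.I.map (Y.p F)) ≫ Z.m F = 0 := by
    rw [Category.assoc, m_naturality, ← reassoc_of% hy, Y.i_p, comp_zero, comp_zero]
  refine ⟨A₂, π₂ ≫ π₁, epi_comp _ _, Z.liftκ _ h₃ ≫ Z.ηTor F, ?_⟩
  rw [Category.assoc, Category.assoc, ηTor_t, hn, ← Category.assoc π₂, h₂, ← Category.assoc (Z.liftκ _ _),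
    Z.liftκ_κ, Category.assoc]

lemma exact_pull (F : 𝒮) : (ShortComplex.mk (Z.pull.map (Y.i F)) (Z.pull.map (Y.p F))
    (by rw [← Functor.map_comp, Y.i_p, Functor.map_zero])).Exact :=
  (((Functor.preservesFiniteColimits_iff_forall_exact_map_and_epi Z.pull).1 inferInstance _
    (Y.shortExact_ip F)).1)

variable (K : CochainComplex 𝒮 ℤ)

/-- The morphism of complexes `Tor¹(K) ⟶ j^*(Ω¹ ⊗ K)`. -/
abbrev torToNK : Z.torK.obj K ⟶ ((Y.N ⋙ Z.pull).mapHomologicalComplex _).obj K :=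
  (NatTrans.mapHomologicalComplex Y.torToN _).app K

/-- The morphism of complexes `j^*(Ω¹ ⊗ K) ⟶ j^*P¹(K)`. -/
abbrev inlK : ((Y.N ⋙ Z.pull).mapHomologicalComplex (ComplexShape.up ℤ)).obj K ⟶
    ((Y.P ⋙ Z.pull).mapHomologicalComplex _).obj K :=
  (NatTrans.mapHomologicalComplex (Functor.whiskerRight Y.inl Z.pull) _).app K

/-- The morphism of complexes `j^*P¹(K) ⟶ j^*K`. -/
abbrev sndK : ((Y.P ⋙ Z.pull).mapHomologicalComplex (ComplexShape.up ℤ)).obj K ⟶ Z.pullK.obj K :=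
  (NatTrans.mapHomologicalComplex (Functor.whiskerRight Y.snd Z.pull ≫ Z.pull.leftUnitor.hom) _).app K

lemma sndK_f (i : ℤ) : (Y.sndK K).f i = Z.pull.map (Y.p (K.X i)) := Category.comp_id _

lemma isExactFour : IsExactFour (Y.torToNK K) (Y.inlK K) (Y.sndK K) where
  zero₁ := by ext i; exact Y.t_i (K.X i)
  zero₂ := by
    ext i
    rw [HomologicalComplex.comp_f, sndK_f]
    exact (Z.pull.map_comp _ _).symm.trans ((congrArg _ (Y.inl_snd (K.X i))).trans (Z.pull.map_zero _ _))
  mono := HomologicalComplex.mono_of_mono_f _ (fun i ↦ inferInstanceAs (Mono (Y.t (K.X i))))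
  exact₁ := HomologicalComplex.exact_of_degreewise_exact _ (fun i ↦ Y.exact_t_i (K.X i))
  exact₂ := HomologicalComplex.exact_of_degreewise_exact _ (fun i ↦ by
    refine ShortComplex.exact_of_iso ?_ (Y.exact_pull (K.X i))
    exact ShortComplex.isoMk (Iso.refl _) (Iso.refl _) (Iso.refl _)
      ((Category.id_comp _).trans (Category.comp_id _).symm)
      ((Category.id_comp _).trans ((Y.sndK_f K i).trans (Category.comp_id _).symm)))
  epi := HomologicalComplex.epi_of_epi_f _ (fun i ↦ by
    have : Epi (Y.p (K.X i)) := (Y.shortExact_ip (K.X i)).epi_g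
    have := Y.sndK_f K i
    exact this ▸ (inferInstance : Epi (Z.pull.map (Y.p (K.X i)))))

/-- The class of the exact sequence of principal parts. -/
abbrev theta : DerivedCategory.Q.obj (Z.pullK.obj K) ⟶ (DerivedCategory.Q.obj (Z.torK.obj K))⟦(2 : ℤ)⟧ :=
  (Y.isExactFour K).yonedaClass

end PrincipalParts
end SqZeroPair

section
variable {C : Type v} [Category.{u} C] [Abelian C]

lemma IsExactFour.yonedaClass_naturality {K₁ K₂ K₃ K₄ L₁ L₂ L₃ L₄ : CochainComplex C ℤ}
    {f : K₁ ⟶ K₂} {g : K₂ ⟶ K₃} {h : K₃ ⟶ K₄} (e : IsExactFour f g h)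
    {f' : L₁ ⟶ L₂} {g' : L₂ ⟶ L₃} {h' : L₃ ⟶ L₄} (e' : IsExactFour f' g' h')
    (a₁ : K₁ ⟶ L₁) (a₂ : K₂ ⟶ L₂) (a₃ : K₃ ⟶ L₃) (a₄ : K₄ ⟶ L₄)
    (h₁ : a₁ ≫ f' = f ≫ a₂) (h₂ : a₂ ≫ g' = g ≫ a₃) (h₃ : a₃ ≫ h' = h ≫ a₄) :
    DerivedCategory.Q.map a₄ ≫ e'.yonedaClass =
      e.yonedaClass ≫ (DerivedCategory.Q.map a₁)⟦(2 : ℤ)⟧' := by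
  let b : kernel h ⟶ kernel h' := kernel.map _ _ a₃ a₄ h₃.symm
  have hb : b ≫ kernel.ι h' = kernel.ι h ≫ a₃ := kernel.lift_ι _ _ _
  have n₂ : DerivedCategory.triangleOfSESδ e.shortExact₂ ≫ (DerivedCategory.Q.map b)⟦(1 : ℤ)⟧' =
      DerivedCategory.Q.map a₄ ≫ DerivedCategory.triangleOfSESδ e'.shortExact₂ :=
    DerivedCategory.triangleOfSESδ_naturality e.shortExact₂ e'.shortExact₂
      { τ₁ := b, τ₂ := a₃, τ₃ := a₄, comm₁₂ := hb, comm₂₃ := h₃ }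
  have n₁ : DerivedCategory.triangleOfSESδ e.shortExact₁ ≫ (DerivedCategory.Q.map a₁)⟦(1 : ℤ)⟧' =
      DerivedCategory.Q.map b ≫ DerivedCategory.triangleOfSESδ e'.shortExact₁ :=
    DerivedCategory.triangleOfSESδ_naturality e.shortExact₁ e'.shortExact₁
      { τ₁ := a₁, τ₂ := a₂, τ₃ := b, comm₁₂ := h₁, comm₂₃ := by
          have : a₂ ≫ kernel.lift h' g' e'.zero₂ = kernel.lift h g e.zero₂ ≫ b := by
            rw [← cancel_mono (kernel.ι h'), Category.assoc, Category.assoc, hb, kernel.lift_ι,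
              kernel.lift_ι_assoc, h₂]
          exact this }
  have n₃ := (shiftFunctorAdd' (DerivedCategory C) (1 : ℤ) 1 2 (by norm_num)).inv.naturality
    (DerivedCategory.Q.map a₁)
  dsimp at n₃
  unfold yonedaClass
  rw [← reassoc_of% n₂, ← Functor.map_comp_assoc, ← n₁, Functor.map_comp_assoc]
  refine Eq.trans ?_ (Category.assoc _ _ _).symm
  refine congrArg (DerivedCategory.triangleOfSESδ e.shortExact₂ ≫ ·) (Eq.trans ?_ (Category.assoc _ _ _).symm)
  exact congrArg (_ ≫ ·) n₃
end
end SqZeroThickening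
end

/-! ### A right inverse kills Θ; comparison of D^adm with D⁻. -/

noncomputable section
namespace SqZeroThickening

attribute [local instance] HasDerivedCategory.standard

namespace SqZeroPair
variable {𝒮 𝒜 : Type v} [Category.{u} 𝒮] [Category.{u} 𝒜] [Abelian 𝒮] [Abelian 𝒜]
  (Z : SqZeroPair 𝒮 𝒜)

/-- `Tor¹` on bounded above complexes. -/
abbrev torM : CMinus 𝒮 ⥤ CMinus 𝒜 := CMinus.map Z.tor1

/-- The morphisms inverted in `D^adm`. -/
def admW : MorphismProperty (CMinus 𝒮) := fun _ _ f ↦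
  QuasiIso (Z.bar.map f).hom ∧ QuasiIso (Z.torM.map f).hom

lemma quasiIso_of_admW {K L : CMinus 𝒮} (f : K ⟶ L) (hf : Z.admW f) : QuasiIso f.hom :=
  (Z.quasiIso_iff_quasiIso_tor f.hom hf.1).2 hf.2

lemma admW_of_quasiIso {K L : CMinus 𝒮} (f : K ⟶ L) (hf : QuasiIso f.hom)
    (hf' : QuasiIso (Z.pullK.map f.hom)) : Z.admW f :=
  ⟨hf', (Z.quasiIso_iff_quasiIso_tor f.hom hf').1 hf⟩

lemma LpTo_naturality {K L : CMinus 𝒮} (f : K ⟶ L) :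
    Z.Lp.map ((CMinus.Q 𝒮).map f) ≫ Z.LpTo.app L = Z.LpTo.app K ≫ (CMinus.Q 𝒜).map (Z.bar.map f) :=
  Z.LpTo.naturality f

/-- The section condition: `Lj^*K ⟶ j^*K` has a right inverse. -/
def HasSection (K : CMinus 𝒮) : Prop :=
  ∃ s : (CMinus.Q 𝒜).obj (Z.bar.obj K) ⟶ Z.Lp.obj ((CMinus.Q 𝒮).obj K), s ≫ Z.LpTo.app K = 𝟙 _

lemma HasSection.exists_lift {K : CMinus 𝒮} (h : Z.HasSection K) (P : CMinus 𝒮)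
    (π : P ⟶ K) (hπ : QuasiIso π.hom) :
    ∃ s : (CMinus.Q 𝒜).obj (Z.bar.obj K) ⟶ (CMinus.Q 𝒜).obj (Z.bar.obj P),
      s ≫ (CMinus.Q 𝒜).map (Z.bar.map π) = 𝟙 _ := by
  obtain ⟨s, hs⟩ := h
  have := CMinus.isIso_Q_map π hπ
  refine ⟨s ≫ inv (Z.Lp.map ((CMinus.Q 𝒮).map π)) ≫ Z.LpTo.app P, ?_⟩
  have h₁ := Z.LpTo_naturality π
  rw [← IsIso.eq_inv_comp] at h₁
  refine Eq.trans ?_ hs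
  refine (Category.assoc _ _ _).trans ((congrArg (s ≫ ·) ?_))
  exact (Category.assoc _ _ _).trans h₁.symm

lemma PrincipalParts.theta_naturality {Z : SqZeroPair 𝒮 𝒜} (Y : Z.PrincipalParts)
    {K L : CochainComplex 𝒮 ℤ} (f : K ⟶ L) :
    DerivedCategory.Q.map (Z.pullK.map f) ≫ Y.theta L =
      Y.theta K ≫ (DerivedCategory.Q.map (Z.torK.map f))⟦(2 : ℤ)⟧' :=
  (Y.isExactFour K).yonedaClass_naturality (Y.isExactFour L) (Z.torK.map f)
    (((Y.N ⋙ Z.pull).mapHomologicalComplex _).map f)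
    (((Y.P ⋙ Z.pull).mapHomologicalComplex _).map f) (Z.pullK.map f)
    ((NatTrans.mapHomologicalComplex Y.torToN _).naturality f)
    ((NatTrans.mapHomologicalComplex (Functor.whiskerRight Y.inl Z.pull) _).naturality f)
    ((NatTrans.mapHomologicalComplex
      (Functor.whiskerRight Y.snd Z.pull ≫ Z.pull.leftUnitor.hom) _).naturality f)

/-- For a resolution P → K with Tor¹ zero in every degree the target of Θ_P is zero. A right inverse
factors the identity of j^*K through j^*P → j^*K, and by naturality Θ_K restricted to j^*P factors
through Θ_P. -/
lemma PrincipalParts.theta_eq_zero_of_hasSection {Z : SqZeroPair 𝒮 𝒜} (Y : Z.PrincipalParts)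
    {K : CMinus 𝒮} (h : Z.HasSection K) : Y.theta K.obj = 0 := by
  obtain ⟨P, f, hP, hT, hf⟩ := Z.exists_resolution_tor K.obj K.property
  have hT' : IsZero (Z.torK.obj P) := by
    rw [IsZero.iff_id_eq_zero]
    ext i
    exact (hT i).eq_of_src _ _
  obtain ⟨s, hs⟩ := h.exists_lift Z ⟨P, hP⟩ ⟨f⟩ hf
  have hs' : DerivedCategory.Minus.ι.map s ≫ DerivedCategory.Q.map (Z.pullK.map f) = 𝟙 _ :=
    (DerivedCategory.Minus.ι.map_comp _ _).symm.trans
      ((congrArg _ hs).trans (DerivedCategory.Minus.ι.map_id _))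
  have h₀ : IsZero ((DerivedCategory.Q.obj (Z.torK.obj P))⟦(2 : ℤ)⟧) :=
    (shiftFunctor _ (2 : ℤ)).map_isZero (DerivedCategory.Q.map_isZero hT')
  have h₁ : ∀ {X} (s : X ⟶ DerivedCategory.Q.obj (Z.pullK.obj P)),
      s ≫ DerivedCategory.Q.map (Z.pullK.map f) ≫ Y.theta K.obj = 0 := by
    intro X s
    rw [Y.theta_naturality f, h₀.eq_of_tgt (Y.theta P) 0, zero_comp, comp_zero]
  exact (Category.id_comp _).symm.trans ((congrArg (· ≫ Y.theta K.obj) hs'.symm).trans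
    ((Category.assoc _ _ _).trans (h₁ _)))

lemma hasSection_of_isIso {K L : CMinus 𝒮}
    (f : (CMinus.Q 𝒮).obj L ⟶ (CMinus.Q 𝒮).obj K) (_ : IsIso (Z.Lp.map f ≫ Z.LpTo.app K)) :
    Z.HasSection K :=
  ⟨inv (Z.Lp.map f ≫ Z.LpTo.app K) ≫ Z.Lp.map f, (Category.assoc _ _ _).trans (IsIso.inv_hom_id _)⟩

lemma admW_inverted_bar : Z.admW.IsInvertedBy (Z.bar ⋙ CMinus.Q 𝒜) :=
  fun _ _ f hf ↦ CMinus.isIso_Q_map (Z.bar.map f) hf.1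

lemma admW_inverted_Q : Z.admW.IsInvertedBy (CMinus.Q 𝒮) :=
  fun _ _ f hf ↦ CMinus.isIso_Q_map f (Z.quasiIso_of_admW f hf)

/-- The functor `D^adm ⥤ D⁻` induced by `j^*`. -/
abbrev barAdm : Z.admW.Localization ⥤ DMinus 𝒜 :=
  Localization.lift (Z.bar ⋙ CMinus.Q 𝒜) Z.admW_inverted_bar Z.admW.Q

/-- The natural functor `D^adm ⥤ D⁻`. -/
abbrev admTo : Z.admW.Localization ⥤ DMinus 𝒮 :=
  Localization.lift (CMinus.Q 𝒮) Z.admW_inverted_Q Z.admW.Q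

/-- The natural transformation `Lj^* ⟶ j^*` on `D^adm`. -/
def admNat : Z.admTo ⋙ Z.Lp ⟶ Z.barAdm :=
  Localization.liftNatTrans Z.admW.Q Z.admW (CMinus.Q 𝒮 ⋙ Z.Lp) (Z.bar ⋙ CMinus.Q 𝒜) _ _ Z.LpTo

/-- The morphism Lj^* → j^* descends to a natural transformation on D^adm. At the admissible L it is
invertible, so naturality along f turns invertibility of j^*(f) into that of Lj^*L → Lj^*K → j^*K.
-/
lemma exists_isIso_of_barAdm {K L : CMinus 𝒮} (hL : (Z.torK.obj L.obj).Acyclic)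
    (f : Z.admW.Q.obj L ⟶ Z.admW.Q.obj K) (hf : IsIso (Z.barAdm.map f)) :
    ∃ g : (CMinus.Q 𝒮).obj L ⟶ (CMinus.Q 𝒮).obj K, IsIso (Z.Lp.map g ≫ Z.LpTo.app K) := by
  let e := Localization.fac (CMinus.Q 𝒮) Z.admW_inverted_Q Z.admW.Q
  let e' := Localization.fac (Z.bar ⋙ CMinus.Q 𝒜) Z.admW_inverted_bar Z.admW.Q
  have h : ∀ K, Z.admNat.app (Z.admW.Q.obj K) = Z.Lp.map (e.hom.app K) ≫ Z.LpTo.app K ≫ e'.inv.app K :=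
    fun K ↦ Localization.liftNatTrans_app ..
  have := Z.isIso_LpTo L hL
  refine ⟨e.inv.app L ≫ Z.admTo.map f ≫ e.hom.app K, ?_⟩
  have h₁ : Z.Lp.map (Z.admTo.map f) ≫ Z.admNat.app (Z.admW.Q.obj K) =
      Z.admNat.app (Z.admW.Q.obj L) ≫ Z.barAdm.map f := Z.admNat.naturality f
  have i₁ : IsIso (Z.Lp.map (Z.admTo.map f) ≫ Z.admNat.app (Z.admW.Q.obj K)) := by
    rw [h₁, h]
    exact IsIso.comp_isIso' (IsIso.comp_isIso' inferInstance (IsIso.comp_isIso' this inferInstance)) hf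
  rw [h] at i₁
  have i₂ : IsIso (Z.Lp.map (e.inv.app L) ≫ (Z.Lp.map (Z.admTo.map f) ≫
      Z.Lp.map (e.hom.app K) ≫ Z.LpTo.app K ≫ e'.inv.app K) ≫ e'.hom.app K) := inferInstance
  have h₂ : Z.Lp.map (e.inv.app L ≫ Z.admTo.map f ≫ e.hom.app K) ≫ Z.LpTo.app K =
      Z.Lp.map (e.inv.app L) ≫ (Z.Lp.map (Z.admTo.map f) ≫
      Z.Lp.map (e.hom.app K) ≫ Z.LpTo.app K ≫ e'.inv.app K) ≫ e'.hom.app K := by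
    rw [Functor.map_comp, Functor.map_comp]
    simp only [Category.assoc, Iso.inv_hom_id_app]
    exact congrArg (_ ≫ _ ≫ _ ≫ ·) (Category.comp_id _).symm
  exact h₂ ▸ i₂

/-- The multiplication on complexes. -/
def mK (K : CochainComplex 𝒮 ℤ) : Z.IK.obj K ⟶ K :=
  (NatTrans.mapHomologicalComplex Z.mul _).app K ≫ (Functor.mapHomologicalComplexIdIso _ _).hom.app K

lemma mK_f (K : CochainComplex 𝒮 ℤ) (i : ℤ) : (Z.mK K).f i = Z.m (K.X i) := Category.comp_id _

lemma mK_naturality {K L : CochainComplex 𝒮 ℤ} (f : K ⟶ L) : Z.IK.map f ≫ Z.mK L = Z.mK K ≫ f := by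
  ext i
  rw [HomologicalComplex.comp_f, HomologicalComplex.comp_f, mK_f, mK_f]
  exact Z.m_naturality (f.f i)

lemma pullK_map_mK (K : CochainComplex 𝒮 ℤ) : Z.pullK.map (Z.mK K) = 0 := by
  ext i
  exact (congrArg Z.pull.map (Z.mK_f K i)).trans (Z.pull_map_m (K.X i))

instance : PreservesFiniteColimits Z.pullK := by
  rw [Functor.preservesFiniteColimits_iff_forall_exact_map_and_epi]
  intro S hS
  have h (i : ℤ) := (Functor.preservesFiniteColimits_iff_forall_exact_map_and_epi Z.pull).1
    inferInstance _ (hS.map_of_exact (HomologicalComplex.eval 𝒮 (ComplexShape.up ℤ) i))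
  exact ⟨HomologicalComplex.exact_of_degreewise_exact _ (fun i ↦ (h i).1),
    HomologicalComplex.epi_of_epi_f _ (fun i ↦ (h i).2)⟩

/-- j^* is right exact, so dividing out the image of a map that j^* kills does not change j^*. It is
applied to subcomplexes of the image of the multiplication. -/
lemma isIso_pullK_map_cokernelπ {K L : CochainComplex 𝒮 ℤ} (g : K ⟶ L) (h : Z.pullK.map g = 0) :
    IsIso (Z.pullK.map (cokernel.π g)) := by
  have H : ∀ S : ShortComplex (CochainComplex 𝒮 ℤ), S.Exact ∧ Epi S.g →
      (S.map Z.pullK).Exact ∧ Epi (Z.pullK.map S.g) :=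
    ((Functor.preservesFiniteColimits_tfae Z.pullK).out 3 1).1
      (inferInstance : PreservesFiniteColimits Z.pullK)
  have := H (ShortComplex.mk g (cokernel.π g) (cokernel.condition g))
    ⟨ShortComplex.exact_cokernel g, inferInstanceAs (Epi (cokernel.π g))⟩
  have hm : Mono (Z.pullK.map (cokernel.π g)) := this.1.mono_g h
  have : Epi (Z.pullK.map (cokernel.π g)) := this.2
  exact isIso_of_mono_of_epi _

lemma exists_barAdm_of_quotient {K L : CMinus 𝒮} (L' : CMinus 𝒮)
    (q : L ⟶ L') (hq : IsIso (Z.pullK.map q.hom))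
    (e : Z.admW.Q.obj K ≅ Z.admW.Q.obj L') :
    ∃ f : Z.admW.Q.obj L ⟶ Z.admW.Q.obj K, IsIso (Z.barAdm.map f) := by
  refine ⟨Z.admW.Q.map q ≫ e.inv, ?_⟩
  have : IsIso (Z.barAdm.map (Z.admW.Q.map q)) := by
    have h := (Localization.fac (Z.bar ⋙ CMinus.Q 𝒜) Z.admW_inverted_bar Z.admW.Q)
    have : IsIso ((Z.bar ⋙ CMinus.Q 𝒜).map q) := CMinus.isIso_Q_map (Z.bar.map q) (by
      have : IsIso (Z.bar.map q).hom := hq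
      infer_instance)
    exact (NatIso.isIso_map_iff h q).2 this
  rw [Functor.map_comp]
  infer_instance

end SqZeroPair
end SqZeroThickening
end

/-! ### Vanishing of a Yoneda class as a splitting criterion. -/

noncomputable section
namespace SqZeroThickening

attribute [local instance] HasDerivedCategory.standard

section
open Pretriangulated
variable {T : Type*} [Category* T] [Preadditive T] [HasZeroObject T] [HasShift T ℤ]
  [∀ n : ℤ, (shiftFunctor T n).Additive] [Pretriangulated T]

/-- G plays the role of the cone of K₂ → K₃. By the octahedral axiom the morphism c : G → K₄ has
fibre K₁[1], and the obstruction to a section is the composite of the two connecting morphisms. The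
argument replaces the octahedron by successive factorizations of δ₂. -/
lemma exists_section_of_triangles {K₁ K₂ K₃ K₄ Z W G : T} {f : K₁ ⟶ K₂} {g : K₂ ⟶ Z} {δ₁ : Z ⟶ K₁⟦(1 : ℤ)⟧}
    (h₁ : Triangle.mk f g δ₁ ∈ distTriang T) {ι : Z ⟶ K₃} {h : K₃ ⟶ K₄} {δ₂ : K₄ ⟶ Z⟦(1 : ℤ)⟧}
    (h₂ : Triangle.mk ι h δ₂ ∈ distTriang T) {i : K₂ ⟶ W} {q : W ⟶ G} {δ₃ : G ⟶ K₂⟦(1 : ℤ)⟧}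
    (h₃ : Triangle.mk i q δ₃ ∈ distTriang T) (r : W ⟶ K₃) [IsIso r] (c : G ⟶ K₄)
    (w₁ : i ≫ r = g ≫ ι) (w₂ : r ≫ h = q ≫ c) (w₃ : c ≫ δ₂ = δ₃ ≫ g⟦(1 : ℤ)⟧')
    (h₀ : δ₂ ≫ δ₁⟦(1 : ℤ)⟧' = 0) : ∃ s : K₄ ⟶ G, s ≫ c = 𝟙 _ := by
  obtain ⟨ψ, hψ⟩ : ∃ ψ : K₄ ⟶ K₂⟦(1 : ℤ)⟧, δ₂ = ψ ≫ g⟦(1 : ℤ)⟧' := by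
    obtain ⟨ψ, hψ⟩ := Triangle.coyoneda_exact₁ _
      (rot_of_distTriang _ (rot_of_distTriang _ h₁)) δ₂ h₀
    -- Rotating the triangle twice changes the sign of g[1].
    exact ⟨-ψ, hψ.trans ((Preadditive.comp_neg _ _).trans (Preadditive.neg_comp _ _).symm)⟩
  obtain ⟨s₀, hs₀⟩ : ∃ s₀ : K₄ ⟶ G, ψ = s₀ ≫ δ₃ := by
    refine Triangle.coyoneda_exact₁ _ h₃ ψ ?_
    change ψ ≫ i⟦(1 : ℤ)⟧' = 0
    have h₄ : δ₂ ≫ ι⟦(1 : ℤ)⟧' = 0 := comp_distTriang_mor_zero₃₁ _ h₂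
    rw [← cancel_mono (r⟦(1 : ℤ)⟧'), zero_comp, Category.assoc, ← Functor.map_comp, w₁,
      Functor.map_comp, ← reassoc_of% hψ, h₄]
  -- The composite of s₀ with c differs from the identity by a morphism that δ₂ kills, hence by one
  -- that comes from K₃. As W is isomorphic to K₃, the error can be subtracted inside G.
  obtain ⟨a, ha⟩ : ∃ a : K₄ ⟶ K₃, s₀ ≫ c - 𝟙 _ = a ≫ h := by
    refine Triangle.coyoneda_exact₃ _ h₂ _ ?_
    change (s₀ ≫ c - 𝟙 _) ≫ δ₂ = 0
    rw [Preadditive.sub_comp, Category.assoc, w₃, ← reassoc_of% hs₀, ← hψ, Category.id_comp, sub_self]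
  refine ⟨s₀ - a ≫ inv r ≫ q, ?_⟩
  rw [Preadditive.sub_comp, Category.assoc, Category.assoc, ← w₂, IsIso.inv_hom_id_assoc, ← ha]
  abel

end

section
variable {C : Type v} [Category.{u} C] [Abelian C]

lemma IsExactFour.exists_section {K₁ K₂ K₃ K₄ W G : CochainComplex C ℤ}
    {f : K₁ ⟶ K₂} {g : K₂ ⟶ K₃} {h : K₃ ⟶ K₄} (e : IsExactFour f g h) (he : e.yonedaClass = 0)
    {i : K₂ ⟶ W} {q : W ⟶ G} (w : i ≫ q = 0) (hS : (ShortComplex.mk i q w).ShortExact)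
    (r : W ⟶ K₃) (hr : QuasiIso r) (c : G ⟶ K₄) (w₁ : i ≫ r = g) (w₂ : r ≫ h = q ≫ c) :
    ∃ s : DerivedCategory.Q.obj K₄ ⟶ DerivedCategory.Q.obj G, s ≫ DerivedCategory.Q.map c = 𝟙 _ := by
  have hgι : kernel.lift h g e.zero₂ ≫ kernel.ι h = g := kernel.lift_ι _ _ _
  have w₃ : DerivedCategory.triangleOfSESδ hS ≫ (DerivedCategory.Q.map (kernel.lift h g e.zero₂))⟦(1 : ℤ)⟧' =
      DerivedCategory.Q.map c ≫ DerivedCategory.triangleOfSESδ e.shortExact₂ :=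
    DerivedCategory.triangleOfSESδ_naturality hS e.shortExact₂
      { τ₁ := kernel.lift h g e.zero₂, τ₂ := r, τ₃ := c, comm₁₂ := hgι.trans w₁.symm, comm₂₃ := w₂ }
  have he' : DerivedCategory.triangleOfSESδ e.shortExact₂ ≫
      (DerivedCategory.triangleOfSESδ e.shortExact₁)⟦(1 : ℤ)⟧' = 0 := by
    have h' := he
    unfold yonedaClass at h'
    exact (cancel_mono ((shiftFunctorAdd' (DerivedCategory C) (1 : ℤ) 1 2 (by norm_num)).inv.app _)).1
      ((Category.assoc _ _ _).trans (h'.trans zero_comp.symm))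
  have : IsIso (DerivedCategory.Q.map r) := inferInstance
  refine exists_section_of_triangles (DerivedCategory.triangleOfSES_distinguished e.shortExact₁)
    (DerivedCategory.triangleOfSES_distinguished e.shortExact₂)
    (DerivedCategory.triangleOfSES_distinguished hS) (DerivedCategory.Q.map r) (DerivedCategory.Q.map c)
    ?_ ?_ w₃.symm he'
  · exact (DerivedCategory.Q.map_comp _ _).symm.trans ((congrArg _ (w₁.trans hgι.symm)).trans
      (DerivedCategory.Q.map_comp _ _))
  · exact (DerivedCategory.Q.map_comp _ _).symm.trans ((congrArg _ w₂).trans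
      (DerivedCategory.Q.map_comp _ _))

end

namespace SqZeroPair
variable {𝒮 𝒜 : Type v} [Category.{u} 𝒮] [Category.{u} 𝒜] [Abelian 𝒮] [Abelian 𝒜]
  {Z : SqZeroPair 𝒮 𝒜}

lemma exists_of_isPushout {C : Type*} [Category* C] [Abelian C] {X₁ X₂ X₃ X₄ : C}
    {t : X₁ ⟶ X₂} {l : X₁ ⟶ X₃} {r : X₂ ⟶ X₄} {b : X₃ ⟶ X₄} (h : IsPushout t l r b) {A : C}
    (x : A ⟶ X₂) (hx : x ≫ r = 0) :
    ∃ (A' : C) (π : A' ⟶ A) (_ : Epi π) (y : A' ⟶ X₁), y ≫ t = π ≫ x ∧ y ≫ l = 0 := by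
  have h₁ : (x ≫ biprod.inl) ≫ h.shortComplex.g = 0 :=
    (Category.assoc _ _ _).trans ((congrArg (x ≫ ·) (biprod.inl_desc r b)).trans hx)
  obtain ⟨A', π, hπ, y, hy⟩ := h.exact_shortComplex.exact_up_to_refinements _ h₁
  have hy' : π ≫ x ≫ biprod.inl = y ≫ biprod.lift t (-l) := hy
  refine ⟨A', π, hπ, y, ?_, ?_⟩
  · have h₂ : y ≫ biprod.lift t (-l) ≫ biprod.fst = y ≫ t := congrArg (y ≫ ·) (biprod.lift_fst t (-l))
    have h₃ := hy' =≫ biprod.fst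
    simp only [Category.assoc, biprod.inl_fst, Category.comp_id] at h₃
    exact (h₃.trans h₂).symm
  · have h₂ : y ≫ biprod.lift t (-l) ≫ biprod.snd = y ≫ (-l) := congrArg (y ≫ ·) (biprod.lift_snd t (-l))
    have h₃ := hy' =≫ biprod.snd
    simp only [Category.assoc, biprod.inl_snd, comp_zero] at h₃
    exact neg_eq_zero.1 ((Preadditive.comp_neg _ _).symm.trans (h₃.trans h₂).symm)

lemma exact_of_isPushout {C : Type*} [Category* C] [Abelian C] {X₁ X₂ X₃ X₄ X₅ : C}
    {t : X₁ ⟶ X₂} {l : X₁ ⟶ X₃} {r : X₂ ⟶ X₄} {b : X₃ ⟶ X₄} (h : IsPushout t l r b)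
    {p : X₂ ⟶ X₅} (w : t ≫ p = 0) (hp : (ShortComplex.mk t p w).Exact) (hp' : Epi p) {φ : X₄ ⟶ X₅} (h₁ : r ≫ φ = p)
    (h₂ : b ≫ φ = 0) : (ShortComplex.mk b φ h₂).Exact ∧ Epi φ := by
  have hφ : Epi φ := epi_of_epi_fac h₁
  refine ⟨?_, hφ⟩
  rw [ShortComplex.exact_iff_exact_up_to_refinements]
  intro A (x : A ⟶ X₄) (hx : x ≫ φ = 0)
  obtain ⟨A₁, π₁, hπ₁, y, z, e⟩ := h.hom_eq_add_up_to_refinements x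
  have h₃ : y ≫ p = 0 := by
    have := e =≫ φ
    simpa [hx, h₁, h₂] using this.symm
  obtain ⟨A₂, π₂, hπ₂, n, hn⟩ := hp.exact_up_to_refinements y h₃
  refine ⟨A₂, π₂ ≫ π₁, epi_comp _ _, n ≫ l + π₂ ≫ z, ?_⟩
  have hn' : π₂ ≫ y = n ≫ t := hn
  change (π₂ ≫ π₁) ≫ x = (n ≫ l + π₂ ≫ z) ≫ b
  rw [Category.assoc, e, Preadditive.comp_add, reassoc_of% hn', h.w, Preadditive.add_comp,
    Category.assoc, Category.assoc]

namespace PrincipalParts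
variable (Y : Z.PrincipalParts)

/-- Suppose that x in I ⊗ F dies in G, and lift it to y in I ⊗ P¹(F). The product of y in P¹(F) dies
in the pushout, so it is some n in Ω¹ ⊗ F with zero image in j_*M. As μ is injective, n is zero in
j_*j^*(Ω¹ ⊗ F); by `snake` this is the conormal image of x, so x = 0. -/
lemma mono_of_isPushout {F : 𝒮} {M : 𝒜} (μ : Z.pull.obj (Y.N.obj F) ⟶ M) (_ : Mono μ) {G : 𝒮}
    {r : Y.P.obj F ⟶ G} {b : Z.push.obj M ⟶ G}
    (h : IsPushout (Y.i F) (Z.η (Y.N.obj F) ≫ Z.push.map μ) r b) {φ : G ⟶ F} (h₁ : r ≫ φ = Y.p F)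
    {ρ : Z.I.obj F ⟶ G} (hρ : Z.I.map φ ≫ ρ = Z.m G) : Mono ρ := by
  refine Preadditive.mono_of_cancel_zero _ (fun {A} x hx ↦ ?_)
  obtain ⟨A₁, π₁, hπ₁, y, hy⟩ := surjective_up_to_refinements_of_epi (Z.I.map (Y.p F)) x
  have h₂ : (y ≫ Z.m _) ≫ r = 0 := by
    rw [Category.assoc, ← Z.m_naturality, ← hρ, ← Functor.map_comp_assoc, h₁, ← reassoc_of% hy, hx, comp_zero]
  obtain ⟨A₂, π₂, hπ₂, n, hn, hn'⟩ := exists_of_isPushout h _ h₂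
  have h₃ := Y.snake' (π₂ ≫ y) n (by rw [hn, Category.assoc])
  have h₄ : n ≫ Z.η (Y.N.obj F) = 0 := by
    rw [← cancel_mono (Z.push.map μ), Category.assoc, hn', zero_comp]
  rw [← cancel_epi π₁, ← cancel_epi π₂, ← cancel_mono (Y.c F), hy, comp_zero, comp_zero, zero_comp,
    ← h₄, h₃]
  simp only [Category.assoc]

end PrincipalParts
end SqZeroPair
end SqZeroThickening
end

/-! ### Changing j^*G by fibre product; a criterion for admissibility. -/

noncomputable section
namespace SqZeroThickening

attribute [local instance] HasDerivedCategory.standard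

section
variable {C D : Type v} [Category.{u} C] [Category.{u} D] [Abelian C] [Abelian D]

lemma shortExact_of_isPushout {X₁ X₂ X₃ X₄ : C} {t : X₁ ⟶ X₂} {l : X₁ ⟶ X₃} {r : X₂ ⟶ X₄} {b : X₃ ⟶ X₄}
    (h : IsPushout t l r b) [Mono l] (w : biprod.lift t (-l) ≫ biprod.desc r b = 0) :
    (ShortComplex.mk (biprod.lift t (-l)) (biprod.desc r b) w).ShortExact where
  exact := h.exact_shortComplex
  mono_f := by
    have : Mono (biprod.lift t (-l) ≫ biprod.snd) := by rw [biprod.lift_snd]; infer_instance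
    exact mono_of_mono (biprod.lift t (-l)) biprod.snd
  epi_g := h.epi_shortComplex_g

lemma quasiIso_biprod_fst (K L : CochainComplex C ℤ) (hL : L.Acyclic) :
    QuasiIso (biprod.fst : K ⊞ L ⟶ K) := by
  have : (ShortComplex.mk (biprod.inr : L ⟶ K ⊞ L) biprod.fst biprod.inr_fst).ShortExact :=
    { exact := ShortComplex.exact_of_f_is_kernel _ (biprod.isKernelFstKernelFork K L)
      mono_f := inferInstanceAs (Mono biprod.inr)
      epi_g := inferInstanceAs (Epi biprod.fst) }
  exact quasiIso_g_of_acyclic this hL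

lemma quasiIso_biprod_inl (K L : CochainComplex C ℤ) (hL : L.Acyclic) :
    QuasiIso (biprod.inl : K ⟶ K ⊞ L) :=
  quasiIso_f_of_acyclic (shortExact_biprod K L) hL

lemma isZero_of_isPushout {X₁ X₂ X₃ X₄ : C} {t : X₁ ⟶ X₂} {l : X₁ ⟶ X₃} {r : X₂ ⟶ X₄} {b : X₃ ⟶ X₄}
    (h : IsPushout t l r b) (h₂ : IsZero X₂) (h₃ : IsZero X₃) : IsZero X₄ := by
  rw [IsZero.iff_id_eq_zero]
  exact h.hom_ext (h₂.eq_of_src _ _) (h₃.eq_of_src _ _)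

lemma isZero_of_isPullback {X₁ X₂ X₃ X₄ : C} {t : X₁ ⟶ X₂} {l : X₁ ⟶ X₃} {r : X₂ ⟶ X₄} {b : X₃ ⟶ X₄}
    (h : IsPullback t l r b) (h₂ : IsZero X₂) (h₃ : IsZero X₃) : IsZero X₁ := by
  rw [IsZero.iff_id_eq_zero]
  exact h.hom_ext (h₂.eq_of_tgt _ _) (h₃.eq_of_tgt _ _)

lemma isZero_biprod_X (K L : CochainComplex C ℤ) (i : ℤ) (hK : IsZero (K.X i)) (hL : IsZero (L.X i)) :
    IsZero ((K ⊞ L).X i) := by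
  rw [IsZero.iff_id_eq_zero]
  have h : biprod.fst ≫ biprod.inl + biprod.snd ≫ biprod.inr = 𝟙 (K ⊞ L) := biprod.total
  have h' := congrArg (fun φ ↦ HomologicalComplex.Hom.f φ i) h
  refine h'.symm.trans ?_
  change (biprod.fst : K ⊞ L ⟶ K).f i ≫ (biprod.inl : K ⟶ K ⊞ L).f i +
    (biprod.snd : K ⊞ L ⟶ L).f i ≫ (biprod.inr : L ⟶ K ⊞ L).f i = 0
  rw [hK.eq_of_tgt (HomologicalComplex.Hom.f _ i) 0, hL.eq_of_tgt (HomologicalComplex.Hom.f _ i) 0,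
    zero_comp, zero_comp, add_zero]

lemma preservesFiniteColimits_mapHomologicalComplex (F : C ⥤ D) [F.Additive] [PreservesFiniteColimits F] :
    PreservesFiniteColimits (F.mapHomologicalComplex (ComplexShape.up ℤ)) := by
  rw [Functor.preservesFiniteColimits_iff_forall_exact_map_and_epi]
  intro S hS
  have h (i : ℤ) := (Functor.preservesFiniteColimits_iff_forall_exact_map_and_epi F).1
    inferInstance _ (hS.map_of_exact (HomologicalComplex.eval C (ComplexShape.up ℤ) i))
  exact ⟨HomologicalComplex.exact_of_degreewise_exact _ (fun i ↦ (h i).1),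
    HomologicalComplex.epi_of_epi_f _ (fun i ↦ (h i).2)⟩

lemma exact_and_epi_map (F : C ⥤ D) [F.Additive] [PreservesFiniteColimits F] {X₁ X₂ X₃ : C} {f : X₁ ⟶ X₂} {g : X₂ ⟶ X₃}
    (w : f ≫ g = 0) (h : (ShortComplex.mk f g w).Exact) [Epi g] (w' : F.map f ≫ F.map g = 0) :
    (ShortComplex.mk (F.map f) (F.map g) w').Exact ∧ Epi (F.map g) := by
  have H : ∀ S : ShortComplex C, S.Exact ∧ Epi S.g → (S.map F).Exact ∧ Epi (F.map S.g) :=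
    ((Functor.preservesFiniteColimits_tfae F).out 3 1).1 (inferInstance : PreservesFiniteColimits F)
  exact H (ShortComplex.mk f g w) ⟨h, inferInstanceAs (Epi g)⟩

end

namespace SqZeroPair
variable {𝒮 𝒜 : Type v} [Category.{u} 𝒮] [Category.{u} 𝒜] [Abelian 𝒮] [Abelian 𝒜]
  (Z : SqZeroPair 𝒮 𝒜)

instance : PreservesFiniteColimits Z.IK := preservesFiniteColimits_mapHomologicalComplex Z.I
instance : PreservesFiniteLimits Z.pushK := by
  rw [Functor.preservesFiniteLimits_iff_forall_exact_map_and_mono]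
  intro S hS
  have h (i : ℤ) := (Functor.preservesFiniteLimits_iff_forall_exact_map_and_mono Z.push).1
    inferInstance _ (hS.map_of_exact (HomologicalComplex.eval 𝒜 (ComplexShape.up ℤ) i))
  exact ⟨HomologicalComplex.exact_of_degreewise_exact _ (fun i ↦ (h i).1),
    HomologicalComplex.mono_of_mono_f _ (fun i ↦ (h i).2)⟩
instance : PreservesFiniteColimits Z.pushK := preservesFiniteColimits_mapHomologicalComplex Z.push

/-- The unit `K ⟶ j_*j^*K` on complexes. -/
def ηK (K : CochainComplex 𝒮 ℤ) : K ⟶ Z.pushK.obj (Z.pullK.obj K) := Z.unitK.app K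

/-- The counit `j^*j_*B ⟶ B` on complexes. -/
def εK (B : CochainComplex 𝒜 ℤ) : Z.pullK.obj (Z.pushK.obj B) ⟶ B where
  f i := Z.adj.counit.app (B.X i)
  comm' _ _ _ := (Z.adj.counit.naturality _).symm

instance (B : CochainComplex 𝒜 ℤ) : IsIso (Z.εK B) := by
  have (i : ℤ) : IsIso ((Z.εK B).f i) := inferInstanceAs (IsIso (Z.adj.counit.app (B.X i)))
  exact HomologicalComplex.Hom.isIso_of_components _

instance (K : CochainComplex 𝒮 ℤ) : Epi (Z.ηK K) :=
  HomologicalComplex.epi_of_epi_f _ (fun i ↦ inferInstanceAs (Epi (Z.η (K.X i))))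

lemma ηK_naturality {K L : CochainComplex 𝒮 ℤ} (f : K ⟶ L) :
    f ≫ Z.ηK L = Z.ηK K ≫ Z.pushK.map (Z.pullK.map f) := Z.unitK.naturality f

lemma εK_naturality {K L : CochainComplex 𝒜 ℤ} (f : K ⟶ L) :
    Z.pullK.map (Z.pushK.map f) ≫ Z.εK L = Z.εK K ≫ f := by
  ext i
  exact Z.adj.counit.naturality (f.f i)

lemma pullK_map_ηK_εK (K : CochainComplex 𝒮 ℤ) : Z.pullK.map (Z.ηK K) ≫ Z.εK _ = 𝟙 _ := by
  ext i
  exact Z.adj.left_triangle_components (K.X i)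

lemma mK_pushK (B : CochainComplex 𝒜 ℤ) : Z.mK (Z.pushK.obj B) = 0 := by
  ext i
  exact (Z.mK_f _ i).trans (Z.m_push (B.X i))

lemma mK_ηK (K : CochainComplex 𝒮 ℤ) : Z.mK K ≫ Z.ηK K = 0 := by
  rw [ηK_naturality, pullK_map_mK, Functor.map_zero, comp_zero]

lemma exact_mK_ηK (K : CochainComplex 𝒮 ℤ) : (ShortComplex.mk (Z.mK K) (Z.ηK K) (Z.mK_ηK K)).Exact := by
  have h : ∀ {F : 𝒮} (f : Z.I.obj F ⟶ F) (_ : f = Z.m F) (w : f ≫ Z.η F = 0),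
      (ShortComplex.mk f (Z.η F) w).Exact := by
    rintro F _ rfl _
    exact Z.exact_m_η F
  exact HomologicalComplex.exact_of_degreewise_exact _ (fun i ↦ h _ (Z.mK_f K i) _)

variable {Z}

/-- Pulling back `G ⟶ j_*j^*G` along `j_*B ⟶ j_*j^*G`. -/
lemma exists_pullback {G K : CochainComplex 𝒮 ℤ} (φ : G ⟶ K) [Epi φ] (ρ : Z.IK.obj K ⟶ G) [Mono ρ]
    (hρ : Z.IK.map φ ≫ ρ = Z.mK G) {B : CochainComplex 𝒜 ℤ} (g : B ⟶ Z.pullK.obj G) [Epi g]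
    (hg : QuasiIso (g ≫ Z.pullK.map φ)) :
    ∃ (L : CochainComplex 𝒮 ℤ) (φ' : L ⟶ K) (ρ' : Z.IK.obj K ⟶ L), Epi φ' ∧ Mono ρ' ∧
      Z.IK.map φ' ≫ ρ' = Z.mK L ∧ QuasiIso (Z.pullK.map φ') ∧
      ∀ i, IsZero (G.X i) → IsZero (B.X i) → IsZero (L.X i) := by
  have hρη : ρ ≫ Z.ηK G = 0 := by
    rw [← cancel_epi (Z.IK.map φ), reassoc_of% hρ, mK_ηK, comp_zero]
  let a := pullback.fst (Z.ηK G) (Z.pushK.map g)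
  let b := pullback.snd (Z.ηK G) (Z.pushK.map g)
  have hab : a ≫ Z.ηK G = b ≫ Z.pushK.map g := pullback.condition
  have sq : IsPullback a b (Z.ηK G) (Z.pushK.map g) := IsPullback.of_hasPullback _ _
  have ha : Epi a := Abelian.epi_pullback_of_epi_g _ _
  have hb : Epi b := Abelian.epi_pullback_of_epi_f _ _
  -- The image of ρ lies in IG and hence is zero in j_*j^*G, so ρ lifts with zero component in j_*B.
  let ρ' : Z.IK.obj K ⟶ pullback (Z.ηK G) (Z.pushK.map g) := sq.lift ρ 0 (by rw [hρη, zero_comp])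
  have h₁ : ρ' ≫ a = ρ := sq.lift_fst _ _ _
  have h₂ : ρ' ≫ b = 0 := sq.lift_snd _ _ _
  have h₃ : Z.mK (pullback (Z.ηK G) (Z.pushK.map g)) ≫ b = 0 := by
    rw [← mK_naturality, mK_pushK, comp_zero]
  have h₄ : Z.IK.map (a ≫ φ) ≫ ρ' = Z.mK _ := by
    refine sq.hom_ext ?_ ?_
    · rw [Category.assoc, h₁, Functor.map_comp, Category.assoc, hρ, mK_naturality]
    · rw [Category.assoc, h₂, comp_zero, h₃]
  have hm : Mono ρ' := by
    have : Mono (ρ' ≫ a) := by rw [h₁]; infer_instance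
    exact mono_of_mono ρ' a
  -- The kernels of L → j_*B and of G → j_*j^*G coincide. The latter is IG, the image of ρ, and I ⊗
  -- L → I ⊗ K is onto, so the former is the image of the multiplication of L.
  have hex : (ShortComplex.mk _ _ h₃).Exact := by
    rw [ShortComplex.exact_iff_exact_up_to_refinements]
    intro A (x : A ⟶ pullback (Z.ηK G) (Z.pushK.map g)) (hx : x ≫ b = 0)
    have hx' : (x ≫ a) ≫ Z.ηK G = 0 := by rw [Category.assoc, hab, reassoc_of% hx, zero_comp]
    obtain ⟨A₁, π₁, hπ₁, y, hy⟩ := (Z.exact_mK_ηK G).exact_up_to_refinements _ hx'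
    have hy' : π₁ ≫ x ≫ a = y ≫ Z.mK G := hy
    obtain ⟨A₂, π₂, hπ₂, z, hz⟩ := surjective_up_to_refinements_of_epi (Z.IK.map (a ≫ φ)) (y ≫ Z.IK.map φ)
    refine ⟨A₂, π₂ ≫ π₁, epi_comp _ _, z, ?_⟩
    change (π₂ ≫ π₁) ≫ x = z ≫ Z.mK _
    refine sq.hom_ext ?_ ?_
    · have e : Z.mK (pullback (Z.ηK G) (Z.pushK.map g)) ≫ a = Z.IK.map (a ≫ φ) ≫ ρ := by
        rw [← h₄, Category.assoc, h₁]
      rw [Category.assoc, Category.assoc, Category.assoc, e, ← reassoc_of% hz, hρ, hy']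
    · rw [Category.assoc, Category.assoc, Category.assoc, hx, h₃, comp_zero, comp_zero, comp_zero]
  -- The multiplication of L has cokernel j_*B, which forces j^*L ≅ B.
  have hpb : IsIso (Z.pullK.map b) := by
    have := exact_and_epi_map Z.pullK h₃ hex (by rw [← Functor.map_comp, h₃, Functor.map_zero])
    have hm : Mono (Z.pullK.map b) := this.1.mono_g (Z.pullK_map_mK _)
    have := this.2
    exact isIso_of_mono_of_epi _
  have h₅ : Z.pullK.map (a ≫ φ) = Z.pullK.map b ≫ Z.εK B ≫ g ≫ Z.pullK.map φ := by
    have := Z.pullK.congr_map hab =≫ Z.εK _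
    rw [Functor.map_comp, Functor.map_comp, Category.assoc, pullK_map_ηK_εK, Category.comp_id, Category.assoc,
      εK_naturality] at this
    rw [Functor.map_comp, this]
    simp only [Category.assoc]
  refine ⟨_, a ≫ φ, ρ', epi_comp _ _, hm, h₄, ?_, fun i hG hB ↦ ?_⟩
  · rw [h₅]
    infer_instance
  · exact isZero_of_isPullback (sq.map (HomologicalComplex.eval 𝒮 (ComplexShape.up ℤ) i)) hG
      (Z.push.map_isZero hB)

lemma quasiIso_IK_map {K L : CochainComplex 𝒮 ℤ} (f : K ⟶ L) (hf : QuasiIso (Z.pullK.map f)) :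
    QuasiIso (Z.IK.map f) := by
  rw [quasiIso_map_iff_acyclic] at hf ⊢
  exact fun i ↦ Z.exactAt_I (hf i)

/-- As ρ is injective, the kernel of the multiplication of L is the kernel of I ⊗ L → I ⊗ K. This
map is surjective, and it is a quasi-isomorphism because I ⊗ - only depends, exactly, on j^*. -/
lemma acyclic_torK_of_mono {K L : CochainComplex 𝒮 ℤ} (φ : L ⟶ K) [Epi φ] (ρ : Z.IK.obj K ⟶ L) [Mono ρ]
    (hρ : Z.IK.map φ ≫ ρ = Z.mK L) (hφ : QuasiIso (Z.pullK.map φ)) : (Z.torK.obj L).Acyclic := by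
  have hρ' (i : ℤ) : Z.I.map (φ.f i) ≫ ρ.f i = Z.m (L.X i) :=
    (congrArg (fun ψ ↦ HomologicalComplex.Hom.f ψ i) hρ).trans (Z.mK_f L i)
  have (i : ℤ) : Mono (ρ.f i) := inferInstance
  have (i : ℤ) : Epi (φ.f i) := inferInstance
  have w (i : ℤ) : Z.κ (L.X i) ≫ Z.I.map (φ.f i) = 0 := by
    exact (cancel_mono (ρ.f i)).1 ((Category.assoc _ _ _).trans ((congrArg (Z.κ _ ≫ ·) (hρ' i)).trans
      ((Z.κ_m _).trans zero_comp.symm)))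
  have hex : (ShortComplex.mk ((NatTrans.mapHomologicalComplex Z.torKerι (ComplexShape.up ℤ)).app L) (Z.IK.map φ)
      (by ext i; exact w i)).ShortExact := by
    refine HomologicalComplex.shortExact_of_degreewise_shortExact _ (fun i ↦ ?_)
    have h : (ShortComplex.mk (Z.κ (L.X i)) (Z.I.map (φ.f i)) (w i)).ShortExact :=
      { exact := by
          let τ : ShortComplex.mk (Z.κ (L.X i)) (Z.I.map (φ.f i)) (w i) ⟶
              ShortComplex.mk (Z.κ (L.X i)) (Z.m (L.X i)) (Z.κ_m _) :=
            { τ₁ := 𝟙 _, τ₂ := 𝟙 _, τ₃ := ρ.f i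
              comm₁₂ := (Category.id_comp _).trans (Category.comp_id _).symm
              comm₂₃ := (Category.id_comp _).trans (hρ' i).symm }
          have : Epi τ.τ₁ := inferInstanceAs (Epi (𝟙 _))
          have : IsIso τ.τ₂ := inferInstanceAs (IsIso (𝟙 _))
          have : Mono τ.τ₃ := inferInstanceAs (Mono (ρ.f i))
          exact (ShortComplex.exact_iff_of_epi_of_isIso_of_mono τ).2 (Z.exact_κ_m _)
        mono_f := inferInstanceAs (Mono (Z.κ (L.X i)))
        epi_g := inferInstanceAs (Epi (Z.I.map (φ.f i))) }
    exact h
  intro i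
  exact Z.exactAt_tor_iff.1 (hex.acyclic_X₁ (quasiIso_IK_map φ hφ) i)

end SqZeroPair
end SqZeroThickening
end

/-! ### From Θ = 0 to an admissible complex L and the quotient L/T. -/

noncomputable section
namespace SqZeroThickening

attribute [local instance] HasDerivedCategory.standard

section
variable {C D : Type v} [Category.{u} C] [Category.{u} D] [Abelian C] [Abelian D]

lemma IsExactFour.congr {K₁ K₂ K₃ K₄ : CochainComplex C ℤ} {f : K₁ ⟶ K₂} {g g' : K₂ ⟶ K₃} {h h' : K₃ ⟶ K₄}
    (e : IsExactFour f g h) (he : e.yonedaClass = 0) (hg : g = g') (hh : h = h') :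
    ∃ e' : IsExactFour f g' h', e'.yonedaClass = 0 := by
  subst hg hh
  exact ⟨e, he⟩

/-- The embedding of a complex in the cone of its identity. -/
abbrev contractibleHull (K : CochainComplex C ℤ) : CochainComplex C ℤ := CochainComplex.mappingCone (𝟙 K)

/-- The embedding of a complex in the cone of its identity. -/
abbrev contractibleHullι (K : CochainComplex C ℤ) : K ⟶ contractibleHull K := CochainComplex.mappingCone.inr (𝟙 K)

instance (K : CochainComplex C ℤ) (i : ℤ) : Mono ((contractibleHullι K).f i) :=
  @SplitMono.mono _ _ _ _ _ ⟨_, CochainComplex.mappingCone.inr_f_snd_v (𝟙 K) i⟩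

instance (K : CochainComplex C ℤ) : Mono (contractibleHullι K) :=
  HomologicalComplex.mono_of_mono_f _ inferInstance

lemma acyclic_map_contractibleHull (F : C ⥤ D) [F.Additive] (K : CochainComplex C ℤ) :
    ((F.mapHomologicalComplex _).obj (contractibleHull K)).Acyclic :=
  acyclic_map_of_isZero_quotient F (Pretriangulated.Triangle.isZero₃_of_isIso₁ _
      (HomotopyCategory.mappingCone_triangleh_distinguished (𝟙 K))
      (inferInstanceAs (IsIso ((HomotopyCategory.quotient C (ComplexShape.up ℤ)).map (𝟙 K)))))

lemma isZero_contractibleHull_X (K : CochainComplex C ℤ) (i : ℤ) (h : IsZero (K.X i))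
    (h' : IsZero (K.X (i + 1))) : IsZero ((contractibleHull K).X i) := by
  rw [CochainComplex.mappingCone.isZero_X_iff]
  exact ⟨h', h⟩

end

namespace SqZeroPair
variable {𝒮 𝒜 : Type v} [Category.{u} 𝒮] [Category.{u} 𝒜] [Abelian 𝒮] [Abelian 𝒜]
  {Z : SqZeroPair 𝒮 𝒜}

namespace PrincipalParts
variable (Y : Z.PrincipalParts) (K : CochainComplex 𝒮 ℤ)

/-- The complex `Ω¹ ⊗ K`. -/
abbrev NK : CochainComplex 𝒮 ℤ := (Y.N.mapHomologicalComplex _).obj K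
/-- The complex `P¹(K)`. -/
abbrev PK : CochainComplex 𝒮 ℤ := (Y.P.mapHomologicalComplex _).obj K

/-- The inclusion `Ω¹ ⊗ K ⟶ P¹(K)`. -/
def iK : Y.NK K ⟶ Y.PK K where
  f j := Y.i (K.X j)
  comm' _ _ _ := (Y.inl.naturality _).symm

/-- The projection `P¹(K) ⟶ K`. -/
def pK : Y.PK K ⟶ K where
  f j := Y.p (K.X j)
  comm' _ _ _ := (Y.snd.naturality _).symm

lemma iK_pK : Y.iK K ≫ Y.pK K = 0 := by
  ext j
  exact Y.i_p (K.X j)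

lemma shortExact_iK_pK : (ShortComplex.mk _ _ (Y.iK_pK K)).ShortExact :=
  HomologicalComplex.shortExact_of_degreewise_shortExact _ (fun j ↦ Y.shortExact_ip (K.X j))

instance : Epi (Y.pK K) := (Y.shortExact_iK_pK K).epi_g

lemma sndK_eq : Y.sndK K = Z.pullK.map (Y.pK K) := by
  ext i
  exact Y.sndK_f K i

variable {K}

/-- A morphism `G ⟶ K` through which the multiplication of `G` factors by a monomorphism, and
which has a section after `j^*` in the derived category when the class of `K` vanishes. -/
lemma exists_section_of_theta_eq_zero (h : Y.theta K = 0) :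
    ∃ (G : CochainComplex 𝒮 ℤ) (φ : G ⟶ K) (ρ : Z.IK.obj K ⟶ G), Epi φ ∧ Mono ρ ∧
      Z.IK.map φ ≫ ρ = Z.mK G ∧
      (∃ s, s ≫ DerivedCategory.Q.map (Z.pullK.map φ) = 𝟙 _) ∧
      ∀ i, IsZero (K.X i) → IsZero (K.X (i + 1)) → IsZero (G.X i) := by
  -- The hull receives j^*(Ω¹ ⊗ K) injectively, which keeps the pushout square exact after j^*, and
  -- it is contractible. So j^*G is a cone of j^*(Ω¹ ⊗ K) → j^*P¹(K).
  let M := contractibleHull (Z.pullK.obj (Y.NK K))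
  let μ : Z.pullK.obj (Y.NK K) ⟶ M := contractibleHullι _
  let l : Y.NK K ⟶ Z.pushK.obj M := Z.ηK (Y.NK K) ≫ Z.pushK.map μ
  let G := pushout (Y.iK K) l
  let r : Y.PK K ⟶ G := pushout.inl _ _
  let b : Z.pushK.obj M ⟶ G := pushout.inr _ _
  have sq : IsPushout (Y.iK K) l r b := IsPushout.of_hasPushout _ _
  let φ : G ⟶ K := sq.desc (Y.pK K) 0 (by rw [iK_pK, comp_zero])
  have hr : r ≫ φ = Y.pK K := sq.inl_desc _ _ _
  have hb : b ≫ φ = 0 := sq.inr_desc _ _ _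
  obtain ⟨hex, hφ⟩ := exact_of_isPushout sq (Y.iK_pK K) (Y.shortExact_iK_pK K).exact inferInstance hr hb
  have w : Z.IK.map b ≫ Z.IK.map φ = 0 := by rw [← Functor.map_comp, hb, Functor.map_zero]
  obtain ⟨hexI, hφI⟩ := exact_and_epi_map Z.IK hb hex w
  have hbm : Z.IK.map b ≫ Z.mK G = 0 := by rw [mK_naturality, mK_pushK, zero_comp]
  -- The kernel of G → K is the image of j_*M, on which the ideal acts by zero; by right exactness
  -- of I ⊗ - the multiplication of G descends to I ⊗ K.
  let ρ : Z.IK.obj K ⟶ G := hexI.desc (Z.mK G) hbm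
  have hρ : Z.IK.map φ ≫ ρ = Z.mK G := hexI.g_desc _ _
  refine ⟨G, φ, ρ, hφ, ?_, hρ, ?_, ?_⟩
  · have (i : ℤ) : Mono (ρ.f i) := by
      have : Mono (μ.f i) := inferInstanceAs (Mono ((contractibleHullι _).f i))
      refine Y.mono_of_isPushout (μ.f i) this (sq.map (HomologicalComplex.eval 𝒮 (ComplexShape.up ℤ) i))
        (φ := φ.f i) ?_ ?_
      · exact congrArg (fun ψ ↦ HomologicalComplex.Hom.f ψ i) hr
      · exact (congrArg (fun ψ ↦ HomologicalComplex.Hom.f ψ i) hρ).trans (Z.mK_f G i)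
    exact HomologicalComplex.mono_of_mono_f _ this
  · obtain ⟨e, he⟩ := (Y.isExactFour K).congr h (g' := Z.pullK.map (Y.iK K)) rfl (Y.sndK_eq K)
    -- j^* does not preserve monomorphisms in general, but up to the counit j^*j_*M ≅ M this map is
    -- μ.
    have hl : Mono (Z.pullK.map l) := by
      have : Z.pullK.map l ≫ Z.εK M = μ := by
        rw [Functor.map_comp, Category.assoc, εK_naturality, reassoc_of% (Z.pullK_map_ηK_εK (Y.NK K))]
      have : Mono (Z.pullK.map l ≫ Z.εK M) := by
        rw [this]
        exact inferInstanceAs (Mono (contractibleHullι _))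
      exact mono_of_mono _ (Z.εK M)
    have sq' : IsPushout (Z.pullK.map (Y.iK K)) (Z.pullK.map l) (Z.pullK.map r) (Z.pullK.map b) :=
      sq.map Z.pullK
    have hw : biprod.lift (Z.pullK.map (Y.iK K)) (-Z.pullK.map l) ≫
        biprod.desc (Z.pullK.map r) (Z.pullK.map b) = 0 := by
      rw [biprod.lift_desc, Preadditive.neg_comp, sq'.w, add_neg_cancel]
    refine e.exists_section he hw (shortExact_of_isPushout sq' hw) biprod.fst ?_ (Z.pullK.map φ)
      (biprod.lift_fst _ _) ?_
    · exact quasiIso_biprod_fst _ _ (acyclic_map_contractibleHull (Z.push ⋙ Z.pull) _)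
    · refine biprod.hom_ext' _ _ ?_ ?_
      · rw [biprod.inl_fst_assoc, biprod.inl_desc_assoc, ← Functor.map_comp, hr]
      · rw [biprod.inr_fst_assoc, biprod.inr_desc_assoc, ← Functor.map_comp, hb, zero_comp, Functor.map_zero]
  · intro i h₀ h₁
    exact isZero_of_isPushout (sq.map (HomologicalComplex.eval 𝒮 (ComplexShape.up ℤ) i))
      (Y.P.map_isZero h₀) (Z.push.map_isZero (isZero_contractibleHull_X _ _
        (Z.pull.map_isZero (Y.N.map_isZero h₀)) (Z.pull.map_isZero (Y.N.map_isZero h₁))))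

/-- The bounds widen by one on each side: the hull used to build G involves K in degrees i and i +
1, which costs a - 1, and the contractible cover of j^*G involves degrees i and i - 1, which costs b
+ 1. -/
lemma exists_admissible_of_theta_eq_zero (h : Y.theta K = 0) (a b : ℤ) [K.IsStrictlyGE a]
    [K.IsStrictlyLE b] :
    ∃ (L : CochainComplex 𝒮 ℤ) (φ : L ⟶ K) (ρ : Z.IK.obj K ⟶ L), Epi φ ∧ Mono ρ ∧
      Z.IK.map φ ≫ ρ = Z.mK L ∧ QuasiIso (Z.pullK.map φ) ∧
      L.IsStrictlyGE (a - 1) ∧ L.IsStrictlyLE (b + 1) := by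
  obtain ⟨G, φ, ρ, hφ, hm, hρ, ⟨s, hs⟩, hG⟩ := Y.exists_section_of_theta_eq_zero h
  have hK₁ (i : ℤ) (hi : i < a) : IsZero (K.X i) := K.isZero_of_isStrictlyGE a i hi
  have hK₂ (i : ℤ) (hi : b < i) : IsZero (K.X i) := K.isZero_of_isStrictlyLE b i hi
  have hG₁ (i : ℤ) (hi : i < a - 1) : IsZero (G.X i) := hG i (hK₁ _ (by omega)) (hK₁ _ (by omega))
  have hG₂ (i : ℤ) (hi : b < i) : IsZero (G.X i) := hG i (hK₂ _ (by omega)) (hK₂ _ (by omega))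
  have : (Z.pullK.obj K).IsStrictlyGE (a - 1) :=
    (CochainComplex.isStrictlyGE_iff _ _).2 fun i hi ↦ Z.pull.map_isZero (hK₁ _ (by omega))
  have : (Z.pullK.obj K).IsStrictlyLE b :=
    (CochainComplex.isStrictlyLE_iff _ _).2 fun i hi ↦ Z.pull.map_isZero (hK₂ _ (by omega))
  have : (Z.pullK.obj G).IsStrictlyGE (a - 1) :=
    (CochainComplex.isStrictlyGE_iff _ _).2 fun i hi ↦ Z.pull.map_isZero (hG₁ _ (by omega))
  -- The section in the derived category is a fraction, a quasi-isomorphism t : B → j^*K and a map g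
  -- : B → j^*G, in which B can be chosen bounded. Then g followed by j^*G → j^*K has the same image
  -- as t, so it is a quasi-isomorphism.
  obtain ⟨B, hB₁, hB₂, t, ht, g, hg⟩ :=
    DerivedCategory.right_fac_of_isStrictlyLE_of_isStrictlyGE (a - 1) b s
  -- The fibre product with j_*B needs a surjection onto j^*G; the added summand is contractible.
  let g' : B ⊞ contractibleCover (Z.pullK.obj G) ⟶ Z.pullK.obj G := biprod.desc g (contractibleCoverπ _)
  have hg' : Epi g' := by
    have : Epi (biprod.inr ≫ g') := by
      rw [show biprod.inr ≫ g' = contractibleCoverπ _ from biprod.inr_desc _ _]; infer_instance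
    exact epi_of_epi biprod.inr g'
  have hq : QuasiIso (g ≫ Z.pullK.map φ) := by
    rw [← DerivedCategory.isIso_Q_map_iff_quasiIso, Functor.map_comp]
    have : DerivedCategory.Q.map g ≫ DerivedCategory.Q.map (Z.pullK.map φ) = DerivedCategory.Q.map t := by
      rw [hg, Category.assoc, IsIso.inv_comp_eq, Category.comp_id] at hs
      exact hs
    rw [this]
    exact ht
  have hq' : QuasiIso (g' ≫ Z.pullK.map φ) := by
    have h₁ := quasiIso_biprod_inl B (contractibleCover (Z.pullK.obj G)) (acyclic_contractibleCover _)
    have h₂ : QuasiIso (biprod.inl ≫ g' ≫ Z.pullK.map φ) := by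
      rw [← Category.assoc, show biprod.inl ≫ g' = g from biprod.inl_desc _ _]
      exact hq
    exact quasiIso_of_comp_left biprod.inl _
  obtain ⟨L, φ', ρ', h₁, h₂, h₃, h₄, h₅⟩ := exists_pullback φ ρ hρ g' hq'
  have hL (i : ℤ) (h₀ : IsZero (G.X i)) (h₁ : IsZero (B.X i)) (h₂ : IsZero (G.X (i - 1))) : IsZero (L.X i) :=
    h₅ i h₀ (isZero_biprod_X _ _ _ h₁
      (isZero_contractibleCover_X _ _ (Z.pull.map_isZero h₀) (Z.pull.map_isZero h₂)))
  refine ⟨L, φ', ρ', h₁, h₂, h₃, h₄, ?_, ?_⟩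
  · exact (CochainComplex.isStrictlyGE_iff _ _).2 fun i hi ↦ hL _ (hG₁ _ hi)
      (B.isZero_of_isStrictlyGE (a - 1) _ hi) (hG₁ _ (by omega))
  · exact (CochainComplex.isStrictlyLE_iff _ _).2 fun i hi ↦ hL _ (hG₂ _ (by omega))
      (B.isZero_of_isStrictlyLE b _ (by omega)) (hG₂ _ (by omega))

end PrincipalParts

lemma quasiIso_of_idealK {K L : CochainComplex 𝒮 ℤ} (f : K ⟶ L) (hf : QuasiIso (Z.pullK.map f))
    (hf' : QuasiIso (Z.idealK.map f)) : QuasiIso f := by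
  rw [quasiIso_map_iff_acyclic] at hf hf'
  rw [quasiIso_iff_acyclic_mappingCone]
  exact (Z.shortExact_idealK _).acyclic_X₂ hf' (fun i ↦ Z.exactAt_push_iff.2 (hf i))

/-- Elements of IL' come from I ⊗ L. If such an element z has zero product in F, then exactness puts
z in T, whose products are zero in L'. Surjectivity holds because I ⊗ L' → I ⊗ F is onto. -/
lemma isIso_ideal_map {F L L' T : 𝒮} (φ : L ⟶ F) [Epi φ] (t : T ⟶ Z.I.obj L)
    (w : t ≫ Z.I.map φ ≫ Z.m F = 0) (ht : (ShortComplex.mk t _ w).Exact) (π : L ⟶ L') [Epi π]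
    {ψ : L' ⟶ F} (h : π ≫ ψ = φ) (h₀ : t ≫ Z.m L ≫ π = 0) : IsIso (Z.ideal.map ψ) := by
  have hψ : Epi ψ := epi_of_epi_fac h
  have e₁ (F : 𝒮) : Epi (Z.mulIdealApp F) := inferInstanceAs (Epi (Z.mulIdeal.app F))
  have n : Z.mulIdealApp L' ≫ Z.ideal.map ψ = Z.I.map ψ ≫ Z.mulIdealApp F :=
    (Z.mulIdeal.naturality ψ).symm
  have n' : Z.ideal.map ψ ≫ Z.idealι.app F = Z.idealι.app L' ≫ ψ := Z.idealι.naturality ψ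
  have hι : Z.mulIdealApp L' ≫ Z.idealι.app L' = Z.m L' := Z.mulIdealApp_idealι L'
  have e₂ : Epi (Z.ideal.map ψ) := by
    have : Epi (Z.mulIdealApp L' ≫ Z.ideal.map ψ) := by
      rw [n]
      exact epi_comp _ _
    exact epi_of_epi (Z.mulIdealApp L') _
  have : Mono (Z.ideal.map ψ) := by
    refine Preadditive.mono_of_cancel_zero _ (fun {A} x hx ↦ ?_)
    obtain ⟨A₁, π₁, hπ₁, y, hy⟩ := surjective_up_to_refinements_of_epi (Z.mulIdealApp L') x
    obtain ⟨A₂, π₂, hπ₂, z, hz⟩ := surjective_up_to_refinements_of_epi (Z.I.map π) y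
    have h₁ : (π₂ ≫ π₁) ≫ x ≫ Z.idealι.app L' = z ≫ Z.m L ≫ π :=
      calc _ = (π₂ ≫ π₁ ≫ x) ≫ Z.idealι.app L' := by simp only [Category.assoc]
        _ = (π₂ ≫ y) ≫ Z.mulIdealApp L' ≫ Z.idealι.app L' := by rw [hy]; simp only [Category.assoc]
        _ = z ≫ Z.m L ≫ π := by
          rw [hι, hz, Category.assoc]
          exact congrArg (z ≫ ·) (Z.m_naturality π)
    have h₂ : z ≫ Z.I.map φ ≫ Z.m F = 0 := by
      rw [m_naturality, ← h, ← Category.assoc (Z.m L), ← Category.assoc z, ← h₁]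
      calc _ = (π₂ ≫ π₁) ≫ x ≫ Z.idealι.app L' ≫ ψ := by simp only [Category.assoc]
        _ = 0 := by rw [← n', ← Category.assoc x, hx, zero_comp, comp_zero]
    obtain ⟨A₃, π₃, hπ₃, s, hs⟩ := ht.exact_up_to_refinements z h₂
    have hs' : π₃ ≫ z = s ≫ t := hs
    rw [← cancel_mono (Z.idealι.app L'), ← cancel_epi (π₂ ≫ π₁), ← cancel_epi π₃]
    exact (congrArg (π₃ ≫ ·) h₁).trans (by
      rw [reassoc_of% hs', h₀, comp_zero, zero_comp, comp_zero, comp_zero])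
  exact isIso_of_mono_of_epi _

/-- The quotient of `L` by the image of the kernel of `I ⊗ L ⟶ I ⊗ K ⟶ K` is quasi-isomorphic to `K`. -/
lemma exists_quotient {K L : CochainComplex 𝒮 ℤ} (φ : L ⟶ K) [Epi φ] (hφ : QuasiIso (Z.pullK.map φ)) :
    ∃ ψ : cokernel (kernel.ι (Z.IK.map φ ≫ Z.mK K) ≫ Z.mK L) ⟶ K, cokernel.π _ ≫ ψ = φ ∧
      QuasiIso (Z.pullK.map ψ) ∧ QuasiIso ψ := by
  let t := kernel.ι (Z.IK.map φ ≫ Z.mK K)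
  have ht : t ≫ Z.IK.map φ ≫ Z.mK K = 0 := kernel.condition _
  let π := cokernel.π (t ≫ Z.mK L)
  let ψ : cokernel (t ≫ Z.mK L) ⟶ K := cokernel.desc _ φ (by rw [Category.assoc, ← mK_naturality, ht])
  have hψ : π ≫ ψ = φ := cokernel.π_desc _ _ _
  -- L/T and L have the same j^*. So L/T → K is a quasi-isomorphism after j^*, and it remains to
  -- compare the subcomplexes I(L/T) and IK.
  have i₁ : IsIso (Z.pullK.map π) :=
    Z.isIso_pullK_map_cokernelπ _ (by rw [Functor.map_comp, pullK_map_mK, comp_zero])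
  have h₁ : QuasiIso (Z.pullK.map ψ) := by
    have : QuasiIso (Z.pullK.map π ≫ Z.pullK.map ψ) := by rw [← Functor.map_comp, hψ]; exact hφ
    exact quasiIso_of_comp_left (Z.pullK.map π) _
  have hψ' : Epi ψ := epi_of_epi_fac hψ
  have hπ' : Epi π := inferInstanceAs (Epi (cokernel.π _))
  refine ⟨ψ, hψ, h₁, quasiIso_of_idealK ψ h₁ ?_⟩
  have (i : ℤ) : IsIso (Z.ideal.map (ψ.f i)) := by
    have h₃ : (ShortComplex.mk _ _ ht).Exact := ShortComplex.exact_kernel _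
    have h₄ (F : 𝒮) (f : Z.I.obj F ⟶ F) (hf : f = Z.m F) (g : Z.I.obj (L.X i) ⟶ Z.I.obj F) {T : 𝒮}
        (t : T ⟶ Z.I.obj (L.X i)) (w : t ≫ g ≫ f = 0) (w' : t ≫ g ≫ Z.m F = 0)
        (h : (ShortComplex.mk t (g ≫ f) w).Exact) : (ShortComplex.mk t (g ≫ Z.m F) w').Exact := by
      subst hf
      exact h
    have h₅ := h₃.map_of_mono_of_preservesKernel (HomologicalComplex.eval 𝒮 (ComplexShape.up ℤ) i)
      inferInstance inferInstance
    have w : t.f i ≫ Z.I.map (φ.f i) ≫ Z.m (K.X i) = 0 := by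
      rw [← Z.mK_f]
      exact congrArg (fun ψ ↦ HomologicalComplex.Hom.f ψ i) ht
    refine isIso_ideal_map (φ.f i) (t.f i) w (h₄ _ _ (Z.mK_f K i) _ _ _ w h₅) (π.f i)
      (congrArg (fun ψ ↦ HomologicalComplex.Hom.f ψ i) hψ) ?_
    rw [← Z.mK_f]
    have := congrArg (fun ψ ↦ HomologicalComplex.Hom.f ψ i) (cokernel.condition (t ≫ Z.mK L))
    exact (Category.assoc _ _ _).symm.trans this
  have : IsIso (Z.idealK.map ψ) := by
    have (i : ℤ) : IsIso ((Z.idealK.map ψ).f i) := this i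
    exact HomologicalComplex.Hom.isIso_of_components _
  infer_instance

end SqZeroPair
end SqZeroThickening
end

/-! ### K as the cone of j_*Tor¹(K) → L, and the direct sum decomposition. -/

noncomputable section
namespace SqZeroThickening

attribute [local instance] HasDerivedCategory.standard

section
variable {C : Type v} [Category.{u} C] [Abelian C]

lemma CMinus.nonempty_iso_of_Q {K L : CMinus C}
    (h : Nonempty (DerivedCategory.Q.obj K.obj ≅ DerivedCategory.Q.obj L.obj)) :
    Nonempty ((CMinus.Q C).obj K ≅ (CMinus.Q C).obj L) :=
  h.map fun e ↦ DerivedCategory.Minus.ι.preimageIso (X := (CMinus.Q C).obj K) (Y := (CMinus.Q C).obj L) e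

lemma nonempty_iso_of_mappingCone {A A' L M : CochainComplex C ℤ} {f : A ⟶ L} {g : L ⟶ M} (w : f ≫ g = 0)
    (h : (ShortComplex.mk f g w).ShortExact) (α : A' ⟶ A) (hα : QuasiIso α) :
    Nonempty (DerivedCategory.Q.obj (CochainComplex.mappingCone (α ≫ f)) ≅ DerivedCategory.Q.obj M) := by
  have : IsIso (DerivedCategory.Q.map α) := inferInstance
  exact ⟨Pretriangulated.Triangle.π₃.mapIso (Pretriangulated.isoTriangleOfIso₁₂
    (DerivedCategory.Q.mapTriangle.obj (CochainComplex.mappingCone.triangle (α ≫ f)))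
    (DerivedCategory.triangleOfSES h) (DerivedCategory.mappingCone_triangle_distinguished _)
    (DerivedCategory.triangleOfSES_distinguished h) (@asIso _ _ _ _ (DerivedCategory.Q.map α) this) (Iso.refl _)
    ((Category.comp_id _).trans (DerivedCategory.Q.map_comp α f)))⟩

lemma nonempty_iso_mappingCone_zero {A L : CochainComplex C ℤ} {f : A ⟶ L} (hf : f = 0) :
    Nonempty (DerivedCategory.Q.obj (CochainComplex.mappingCone f) ≅
      DerivedCategory.Q.obj L ⊞ (DerivedCategory.Q.obj A)⟦(1 : ℤ)⟧) := by
  have h := Pretriangulated.rot_of_distTriang _ (DerivedCategory.mappingCone_triangle_distinguished f)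
  obtain ⟨e, -⟩ := Pretriangulated.exists_iso_binaryBiproduct_of_distTriang _ h (by
    have : (DerivedCategory.Q.map f)⟦(1 : ℤ)⟧' = 0 := by
      rw [hf, Functor.map_zero, Functor.map_zero]
    exact (congrArg (- ·) this).trans neg_zero)
  exact ⟨e⟩

lemma DMinus.nonempty_iso_biprod (X Y W : DMinus C)
    (h : Nonempty (DerivedCategory.Minus.ι.obj X ≅ DerivedCategory.Minus.ι.obj Y ⊞
      (DerivedCategory.Minus.ι.obj W)⟦(1 : ℤ)⟧)) : Nonempty (X ≅ Y ⊞ W⟦(1 : ℤ)⟧) := by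
  obtain ⟨e⟩ := h
  have : PreservesBinaryBiproducts (DerivedCategory.Minus.ι (C := C)) :=
    preservesBinaryBiproducts_of_preservesBiproducts _
  exact ⟨DerivedCategory.Minus.ι.preimageIso (e ≪≫
    biprod.mapIso (Iso.refl _) ((DerivedCategory.Minus.ι.commShiftIso (1 : ℤ)).symm.app W) ≪≫
      (DerivedCategory.Minus.ι.mapBiprod _ _).symm)⟩

end

namespace SqZeroPair
variable {𝒮 𝒜 : Type v} [Category.{u} 𝒮] [Category.{u} 𝒜] [Abelian 𝒮] [Abelian 𝒜]
  {Z : SqZeroPair 𝒮 𝒜}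

/-- The inclusion `j_*Tor¹(F) ⟶ I ⊗ F`. -/
def ν (Z : SqZeroPair 𝒮 𝒜) (F : 𝒮) : Z.push.obj (Z.tor1.obj F) ⟶ Z.I.obj F := inv (Z.ηTor F) ≫ Z.κ F

lemma exact_ν_m (F : 𝒮) (w : Z.ν F ≫ Z.m F = 0) : (ShortComplex.mk (Z.ν F) (Z.m F) w).Exact := by
  refine ShortComplex.exact_of_iso ?_ (Z.exact_κ_m F)
  refine ShortComplex.isoMk (asIso (Z.ηTor F)) (Iso.refl _) (Iso.refl _) ?_ ?_
  · exact ((IsIso.hom_inv_id_assoc (Z.ηTor F) (Z.κ F))).trans (Category.comp_id _).symm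
  · exact (Category.id_comp _).trans (Category.comp_id _).symm

lemma ν_m (F : 𝒮) : Z.ν F ≫ Z.m F = 0 := by
  unfold ν
  rw [Category.assoc, κ_m, comp_zero]

instance (F : 𝒮) : Mono (Z.ν F) := by
  unfold ν
  infer_instance

lemma ν_naturality {F G : 𝒮} (f : F ⟶ G) :
    Z.ν F ≫ Z.I.map f = Z.push.map (Z.tor1.map f) ≫ Z.ν G := by
  unfold ν
  rw [Category.assoc, ← κ_naturality, IsIso.inv_comp_eq, ← Category.assoc, ← ηTor_naturality,
    Category.assoc, IsIso.hom_inv_id_assoc]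

/-- The inclusion `j_*Tor¹(K) ⟶ I ⊗ K` of complexes. -/
def νK (Z : SqZeroPair 𝒮 𝒜) (K : CochainComplex 𝒮 ℤ) : Z.pushK.obj (Z.torK.obj K) ⟶ Z.IK.obj K where
  f i := Z.ν (K.X i)
  comm' _ _ _ := Z.ν_naturality _

instance (K : CochainComplex 𝒮 ℤ) : Mono (Z.νK K) :=
  HomologicalComplex.mono_of_mono_f _ (fun i ↦ inferInstanceAs (Mono (Z.ν (K.X i))))

lemma νK_mK (K : CochainComplex 𝒮 ℤ) : Z.νK K ≫ Z.mK K = 0 := by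
  ext i
  rw [HomologicalComplex.comp_f, mK_f]
  exact Z.ν_m (K.X i)

lemma exact_νK_mK (K : CochainComplex 𝒮 ℤ) : (ShortComplex.mk _ _ (Z.νK_mK K)).Exact := by
  have h : ∀ {F : 𝒮} (f : Z.I.obj F ⟶ F) (_ : f = Z.m F) (w : Z.ν F ≫ f = 0),
      (ShortComplex.mk (Z.ν F) f w).Exact := by
    rintro F _ rfl _
    exact Z.exact_ν_m F _
  exact HomologicalComplex.exact_of_degreewise_exact _ (fun i ↦ h _ (Z.mK_f K i) _)

/-- T = ker(I ⊗ L → K) maps onto ker(I ⊗ K → K) = j_*Tor¹(K), and the multiplication of L is I ⊗ L →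
I ⊗ K followed by ρ. So the image of T in L is the embedded copy of j_*Tor¹(K) under ρ. -/
lemma shortExact_quotient {K L : CochainComplex 𝒮 ℤ} (φ : L ⟶ K) [Epi φ] (ρ : Z.IK.obj K ⟶ L) [Mono ρ]
    (hρ : Z.IK.map φ ≫ ρ = Z.mK L) :
    ∃ w : (Z.νK K ≫ ρ) ≫ cokernel.π (kernel.ι (Z.IK.map φ ≫ Z.mK K) ≫ Z.mK L) = 0,
      (ShortComplex.mk _ _ w).ShortExact := by
  let t := kernel.ι (Z.IK.map φ ≫ Z.mK K)
  have ht : t ≫ Z.IK.map φ ≫ Z.mK K = 0 := kernel.condition _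
  have e := Z.exact_νK_mK K
  let s := e.lift (t ≫ Z.IK.map φ) (by rw [Category.assoc]; exact ht)
  have hs : s ≫ Z.νK K = t ≫ Z.IK.map φ := e.lift_f _ _
  have hs' : Epi s := by
    rw [epi_iff_surjective_up_to_refinements]
    intro A (x : A ⟶ Z.pushK.obj (Z.torK.obj K))
    obtain ⟨A₁, π₁, hπ₁, y, hy⟩ := surjective_up_to_refinements_of_epi (Z.IK.map φ) (x ≫ Z.νK K)
    have hy' : y ≫ Z.IK.map φ ≫ Z.mK K = 0 := by
      rw [← reassoc_of% hy, νK_mK, comp_zero, comp_zero]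
    refine ⟨A₁, π₁, hπ₁, kernel.lift _ y hy', ?_⟩
    have h₁ : kernel.lift _ y hy' ≫ t = y := kernel.lift_ι _ _ _
    have h₂ : (kernel.lift _ y hy' ≫ s) ≫ Z.νK K = (π₁ ≫ x) ≫ Z.νK K := by
      rw [Category.assoc, hs, reassoc_of% h₁, Category.assoc, hy]
    exact ((cancel_mono (Z.νK K)).1 h₂).symm
  have hc : (t ≫ Z.mK L) ≫ cokernel.π (t ≫ Z.mK L) = 0 := cokernel.condition _
  have h₁ : s ≫ Z.νK K ≫ ρ = t ≫ Z.mK L := by rw [reassoc_of% hs, hρ]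
  have w : (Z.νK K ≫ ρ) ≫ cokernel.π (t ≫ Z.mK L) = 0 := by
    rw [← cancel_epi s, comp_zero, ← Category.assoc, h₁, hc]
  refine ⟨w, { exact := ?_, mono_f := inferInstanceAs (Mono (Z.νK K ≫ ρ)), epi_g := inferInstanceAs (Epi (cokernel.π _)) }⟩
  rw [ShortComplex.exact_iff_exact_up_to_refinements]
  intro A (x : A ⟶ L) (hx : x ≫ cokernel.π (t ≫ Z.mK L) = 0)
  obtain ⟨A₁, π₁, hπ₁, y, hy⟩ := (ShortComplex.exact_cokernel (t ≫ Z.mK L)).exact_up_to_refinements x hx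
  refine ⟨A₁, π₁, hπ₁, y ≫ s, ?_⟩
  have hy' : π₁ ≫ x = y ≫ t ≫ Z.mK L := hy
  change π₁ ≫ x = (y ≫ s) ≫ Z.νK K ≫ ρ
  rw [hy', Category.assoc, h₁]

/-- I ⊗ L → I ⊗ K stays surjective under j^*, and its composite with ρ is a multiplication, which
j^* kills. -/
lemma pullK_map_eq_zero {K L : CochainComplex 𝒮 ℤ} (φ : L ⟶ K) [Epi φ] (ρ : Z.IK.obj K ⟶ L)
    (hρ : Z.IK.map φ ≫ ρ = Z.mK L) : Z.pullK.map ρ = 0 := by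
  rw [← cancel_epi (Z.pullK.map (Z.IK.map φ)), ← Functor.map_comp, hρ, pullK_map_mK, comp_zero]

namespace PrincipalParts
variable (Y : Z.PrincipalParts) {K : CMinus 𝒮}

/-- `j_*` on bounded above complexes. -/
abbrev _root_.SqZeroThickening.SqZeroPair.pushM (Z : SqZeroPair 𝒮 𝒜) : CMinus 𝒜 ⥤ CMinus 𝒮 := CMinus.map Z.push

lemma exists_of_theta_eq_zero (hK : K.IsBounded) (h : Y.theta K.obj = 0) :
    ∃ (L : CMinus 𝒮) (φ : L.obj ⟶ K.obj) (ρ : Z.IK.obj K.obj ⟶ L.obj), L.IsBounded ∧ Epi φ ∧ Mono ρ ∧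
      Z.IK.map φ ≫ ρ = Z.mK L.obj ∧ QuasiIso (Z.pullK.map φ) ∧ (Z.torK.obj L.obj).Acyclic := by
  obtain ⟨a, ha⟩ := hK
  obtain ⟨b, hb⟩ := K.property
  obtain ⟨L, φ, ρ, h₁, h₂, h₃, h₄, h₅, h₆⟩ := Y.exists_admissible_of_theta_eq_zero h a b
  exact ⟨⟨L, ⟨_, h₆⟩⟩, φ, ρ, ⟨_, h₅⟩, h₁, h₂, h₃, h₄, acyclic_torK_of_mono φ ρ h₃ h₄⟩

lemma exists_quotient_of_theta_eq_zero (hK : K.IsBounded) (h : Y.theta K.obj = 0) :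
    ∃ L : CMinus 𝒮, L.IsBounded ∧ (Z.torK.obj L.obj).Acyclic ∧
      ∃ (T : CochainComplex 𝒮 ℤ) (t : T ⟶ Z.IK.obj L.obj), Mono t ∧
        Nonempty (Z.admW.Q.obj K ≅ Z.admW.Q.obj
          ⟨cokernel (t ≫ Z.mK L.obj), minusProp_of_epi (cokernel.π _) L.property⟩) := by
  obtain ⟨L, φ, ρ, hL, h₁, h₂, h₃, h₄, h₅⟩ := Y.exists_of_theta_eq_zero hK h
  obtain ⟨ψ, -, hψ, hψ'⟩ := exists_quotient φ h₄
  refine ⟨L, hL, h₅, _, kernel.ι (Z.IK.map φ ≫ Z.mK K.obj), inferInstance, ?_⟩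
  let ψ' : (⟨_, minusProp_of_epi (cokernel.π (kernel.ι (Z.IK.map φ ≫ Z.mK K.obj) ≫ Z.mK L.obj))
    L.property⟩ : CMinus 𝒮) ⟶ K := ⟨ψ⟩
  exact ⟨(Localization.isoOfHom Z.admW.Q Z.admW ψ' (Z.admW_of_quasiIso ψ' hψ' hψ)).symm⟩

/-- Replace j_*Tor¹(K) by a resolution P with acyclic Tor¹. The cone of P → L is isomorphic to K in
D⁻(S) and still has acyclic Tor¹, so j^* of it computes Lj^*K. As j^*P → j^*L is zero, this cone
splits as j^*L ⊕ j^*P[1]. -/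
lemma nonempty_iso_of_theta_eq_zero (hK : K.IsBounded) (h : Y.theta K.obj = 0) :
    Nonempty (Z.Lp.obj ((CMinus.Q 𝒮).obj K) ≅ (CMinus.Q 𝒜).obj (Z.bar.obj K) ⊞
      (Z.Lp.obj ((CMinus.Q 𝒮).obj (Z.pushM.obj (Z.torM.obj K))))⟦(1 : ℤ)⟧) := by
  obtain ⟨L, φ, ρ, hL, h₁, h₂, h₃, h₄, h₅⟩ := Y.exists_of_theta_eq_zero hK h
  obtain ⟨ψ, -, -, hψ⟩ := exists_quotient φ h₄
  obtain ⟨w, hw⟩ := shortExact_quotient φ ρ h₃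
  obtain ⟨P, α, hP, hP', hα, -⟩ := Z.exists_epi_resolution (Z.pushK.obj (Z.torK.obj K.obj))
    (Z.pushM.obj (Z.torM.obj K)).property
  let f : P ⟶ L.obj := α ≫ Z.νK K.obj ≫ ρ
  have hf : Z.pullK.map f = 0 := by
    rw [Functor.map_comp, Functor.map_comp, pullK_map_eq_zero φ ρ h₃, comp_zero, comp_zero]
  let M : CMinus 𝒮 := ⟨CochainComplex.mappingCone f, minusProp_mappingCone f hP L.property⟩
  have hM : (Z.torK.obj M.obj).Acyclic := Z.acyclic_tor_mappingCone f hP' h₅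
  let P' : CMinus 𝒮 := ⟨P, hP⟩
  have i₁ := Z.isIso_LpTo M hM
  have i₂ := Z.isIso_LpTo P' hP'
  have i₃ : IsIso ((CMinus.Q 𝒮).map (⟨α⟩ : P' ⟶ Z.pushM.obj (Z.torM.obj K))) := CMinus.isIso_Q_map _ hα
  have i₄ : IsIso ((CMinus.Q 𝒜).map (Z.bar.map (⟨φ⟩ : L ⟶ K))) := CMinus.isIso_Q_map _ h₄
  obtain ⟨e₁⟩ : Nonempty ((CMinus.Q 𝒮).obj M ≅ (CMinus.Q 𝒮).obj K) := by
    refine CMinus.nonempty_iso_of_Q ?_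
    obtain ⟨e⟩ := nonempty_iso_of_mappingCone w hw α hα
    have : IsIso (DerivedCategory.Q.map ψ) := inferInstance
    exact ⟨e ≪≫ asIso (DerivedCategory.Q.map ψ)⟩
  obtain ⟨e₂⟩ : Nonempty ((CMinus.Q 𝒜).obj (Z.bar.obj M) ≅ (CMinus.Q 𝒜).obj (Z.bar.obj L) ⊞
      ((CMinus.Q 𝒜).obj (Z.bar.obj P'))⟦(1 : ℤ)⟧) := by
    refine DMinus.nonempty_iso_biprod _ _ _ ?_
    obtain ⟨e⟩ := nonempty_iso_mappingCone_zero hf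
    exact ⟨DerivedCategory.Q.mapIso (CochainComplex.mappingCone.mapHomologicalComplexIso f Z.pull) ≪≫ e⟩
  exact ⟨Z.Lp.mapIso e₁.symm ≪≫ asIso (Z.LpTo.app M) ≪≫ e₂ ≪≫ biprod.mapIso (asIso ((CMinus.Q 𝒜).map (Z.bar.map (⟨φ⟩ : L ⟶ K))))
    ((shiftFunctor _ (1 : ℤ)).mapIso ((asIso (Z.LpTo.app P')).symm ≪≫ Z.Lp.mapIso (asIso ((CMinus.Q 𝒮).map
      (⟨α⟩ : P' ⟶ Z.pushM.obj (Z.torM.obj K))))))⟩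

end PrincipalParts
end SqZeroPair
end SqZeroThickening
end

/-! ### Tor¹ as the first derived functor; the cycle of implications. -/

noncomputable section
namespace SqZeroThickening

attribute [local instance] HasDerivedCategory.standard

section
variable {C D : Type v} [Category.{u} C] [Category.{u} D] [Abelian C] [Abelian D]
open HomologicalComplex

lemma exactAt_mappingCone {K L : CochainComplex C ℤ} (f : K ⟶ L) (i : ℤ) (hK : K.ExactAt (i + 1))
    (hL : L.ExactAt i) : (CochainComplex.mappingCone f).ExactAt i := by
  rw [exactAt_iff_isZero_homology] at hK hL ⊢
  exact (CochainComplex.homologyMap_exact₃_of_distTriang _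
    (DerivedCategory.mappingCone_triangle_distinguished f) i (i + 1) rfl).isZero_X₂
      (hL.eq_of_src _ _) (hK.eq_of_tgt _ _)

lemma isIso_homologyMap_of_exactAt {K L : CochainComplex C ℤ} (f : K ⟶ L) (i j : ℤ) (hij : i + 1 = j)
    (hi : (CochainComplex.mappingCone f).ExactAt i) (hj : (CochainComplex.mappingCone f).ExactAt j) :
    IsIso (homologyMap f j) := by
  rw [exactAt_iff_isZero_homology] at hi hj
  have h₁ : Mono (homologyMap f j) := (CochainComplex.homologyMap_exact₁_of_distTriang _
    (DerivedCategory.mappingCone_triangle_distinguished f) i j hij).mono_g (hi.eq_of_src _ _)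
  have h₂ : Epi (homologyMap f j) := (CochainComplex.homologyMap_exact₂_of_distTriang _
    (DerivedCategory.mappingCone_triangle_distinguished f) j).epi_f (hj.eq_of_tgt _ _)
  exact isIso_of_mono_of_epi _

lemma exactAt_map_mappingCone (F : C ⥤ D) [F.Additive] {K L : CochainComplex C ℤ} (f : K ⟶ L) (i : ℤ)
    (hK : ((F.mapHomologicalComplex _).obj K).ExactAt (i + 1))
    (hL : ((F.mapHomologicalComplex _).obj L).ExactAt i) :
    ((F.mapHomologicalComplex (ComplexShape.up ℤ)).obj (CochainComplex.mappingCone f)).ExactAt i :=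
  (exactAt_mappingCone _ i hK hL).of_iso (CochainComplex.mappingCone.mapHomologicalComplexIso f F).symm

lemma isIso_homologyMap_map (F : C ⥤ D) [F.Additive] {K L : CochainComplex C ℤ} (f : K ⟶ L) (i j : ℤ)
    (hij : i + 1 = j)
    (hi : ((F.mapHomologicalComplex (ComplexShape.up ℤ)).obj (CochainComplex.mappingCone f)).ExactAt i)
    (hj : ((F.mapHomologicalComplex (ComplexShape.up ℤ)).obj (CochainComplex.mappingCone f)).ExactAt j) :
    IsIso (homologyMap ((F.mapHomologicalComplex (ComplexShape.up ℤ)).map f) j) :=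
  isIso_homologyMap_of_exactAt _ i j hij
    (hi.of_iso (CochainComplex.mappingCone.mapHomologicalComplexIso f F))
    (hj.of_iso (CochainComplex.mappingCone.mapHomologicalComplexIso f F))

/-- The lowest homology of a complex as a subobject. -/
def homologyι₁ (K : CochainComplex C ℤ) (h : IsZero (K.X (-2))) : K.homology (-1) ⟶ K.X (-1) :=
  have := K.isIso_homologyπ (-2) (-1) (by simp) (h.eq_of_src _ _)
  inv (K.homologyπ (-1)) ≫ K.iCycles (-1)

lemma homologyπ_homologyι₁ (K : CochainComplex C ℤ) (h : IsZero (K.X (-2))) :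
    K.homologyπ (-1) ≫ homologyι₁ K h = K.iCycles (-1) := by
  have := K.isIso_homologyπ (-2) (-1) (by simp) (h.eq_of_src _ _)
  exact IsIso.hom_inv_id_assoc _ _

instance (K : CochainComplex C ℤ) (h : IsZero (K.X (-2))) : Mono (homologyι₁ K h) := by
  have := K.isIso_homologyπ (-2) (-1) (by simp) (h.eq_of_src _ _)
  exact mono_comp _ _

lemma homologyι₁_naturality {K L : CochainComplex C ℤ} (f : K ⟶ L) (h : IsZero (K.X (-2)))
    (h' : IsZero (L.X (-2))) : homologyMap f (-1) ≫ homologyι₁ L h' = homologyι₁ K h ≫ f.f (-1) := by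
  rw [← cancel_epi (K.homologyπ (-1)), homologyπ_naturality_assoc, homologyπ_homologyι₁,
    cyclesMap_i, ← Category.assoc, homologyπ_homologyι₁]

lemma homologyι₁_d (K : CochainComplex C ℤ) (h : IsZero (K.X (-2))) : homologyι₁ K h ≫ K.d (-1) 0 = 0 := by
  rw [← cancel_epi (K.homologyπ (-1)), ← Category.assoc, homologyπ_homologyι₁, comp_zero, iCycles_d]

lemma exists_homologyι₁ (K : CochainComplex C ℤ) (h : IsZero (K.X (-2))) {A : C} (x : A ⟶ K.X (-1))
    (hx : x ≫ K.d (-1) 0 = 0) : ∃ y, y ≫ homologyι₁ K h = x :=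
  ⟨K.liftCycles x 0 (by simp) hx ≫ K.homologyπ (-1), by
    rw [Category.assoc, homologyπ_homologyι₁, liftCycles_i]⟩

end

lemma comp_aux {C : Type v} [Category.{u} C] {A B B' M D M' D' E' : C} (a : A ≅ B) (f : B ⟶ B') (b : M ≅ B')
    (p : B' ⟶ D) (c : M' ≅ D) (q : B ⟶ D') (g : D' ⟶ D) (e : E' ≅ D') (h : f ≫ p = q ≫ g) :
    (a.hom ≫ f ≫ b.inv) ≫ (b.hom ≫ p) ≫ c.inv = ((a.hom ≫ q) ≫ e.inv) ≫ e.hom ≫ g ≫ c.inv := by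
  simp only [Category.assoc, Iso.inv_hom_id_assoc]
  rw [reassoc_of% h]

lemma comp_aux_zero {C : Type v} [Category.{u} C] [HasZeroMorphisms C] {A B M B' D M' : C} (a : A ≅ B)
    (i : B ⟶ B') (b : M ≅ B') (p : B' ⟶ D) (c : M' ≅ D) (h : i ≫ p = 0) :
    (a.hom ≫ i ≫ b.inv) ≫ (b.hom ≫ p) ≫ c.inv = 0 := by
  simp only [Category.assoc, Iso.inv_hom_id_assoc]
  rw [reassoc_of% h, zero_comp, comp_zero]

namespace SqZeroPair
variable {𝒮 𝒜 : Type v} [Category.{u} 𝒮] [Category.{u} 𝒜] [Abelian 𝒮] [Abelian 𝒜]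
  {Z : SqZeroPair 𝒮 𝒜}

namespace PrincipalParts
variable (Y : Z.PrincipalParts)

/-- For x in ker(I ⊗ P¹(F) → P¹(F)), `snake` with n = 0 shows that the image of x in I ⊗ F has zero
conormal image, hence is zero. So x comes from some z in I ⊗ (Ω¹ ⊗ F), and the product of z is zero
because Ω¹ ⊗ F → P¹(F) is injective. -/
lemma epi_tor1_map_i (F : 𝒮) : Epi (Z.tor1.map (Y.i F)) := by
  have : Epi (Z.torKer.map (Y.i F)) := by
    rw [epi_iff_surjective_up_to_refinements]
    intro A x
    have h₀ : (x ≫ Z.κ _) ≫ Z.m _ = 0 := by rw [Category.assoc, κ_m, comp_zero]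
    have h₁ := Y.snake' (x ≫ Z.κ _) 0 (by rw [zero_comp, h₀])
    have h₂ : (x ≫ Z.κ _) ≫ Z.I.map (Y.p F) = 0 := by
      rw [← cancel_mono (Y.c F), zero_comp, Category.assoc, ← h₁, zero_comp]
    obtain ⟨hex, -⟩ := exact_and_epi_map Z.I (Y.i_p F) (Y.shortExact_ip F).exact
      (by rw [← Functor.map_comp, Y.i_p, Functor.map_zero])
    obtain ⟨A₁, π₁, hπ₁, z, hz⟩ := hex.exact_up_to_refinements _ h₂
    have hz' : π₁ ≫ x ≫ Z.κ _ = z ≫ Z.I.map (Y.i F) := hz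
    have h₃ : z ≫ Z.m _ = 0 := by
      rw [← cancel_mono (Y.i F), zero_comp, Category.assoc, ← m_naturality, ← reassoc_of% hz', κ_m,
        comp_zero, comp_zero]
    refine ⟨A₁, π₁, hπ₁, Z.liftκ z h₃, ?_⟩
    rw [← cancel_mono (Z.κ _), Category.assoc, Category.assoc, κ_naturality, ← Category.assoc (Z.liftκ z h₃),
      Z.liftκ_κ, hz']
  exact inferInstanceAs (Epi (Z.pull.map (Z.torKer.map (Y.i F))))

lemma rel_neg_one_zero : (ComplexShape.up ℤ).Rel (-1) 0 := by simp

lemma neg_one_ne_zero' : (-1 : ℤ) ≠ 0 := by simp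

/-- The complex `Ω¹ ⊗ F ⟶ P¹(F)` in degrees `-1` and `0`. -/
def twoTerm (F : 𝒮) : CochainComplex 𝒮 ℤ := HomologicalComplex.double (Y.i F) rel_neg_one_zero

/-- The term in degree `-1`. -/
def twoTermIso₀ (F : 𝒮) : (Y.twoTerm F).X (-1) ≅ Y.N.obj F := HomologicalComplex.doubleXIso₀ _ _

/-- The term in degree `0`. -/
def twoTermIso₁ (F : 𝒮) : (Y.twoTerm F).X 0 ≅ Y.P.obj F := HomologicalComplex.doubleXIso₁ _ _ neg_one_ne_zero'

lemma twoTerm_d (F : 𝒮) : (Y.twoTerm F).d (-1) 0 = (Y.twoTermIso₀ F).hom ≫ Y.i F ≫ (Y.twoTermIso₁ F).inv :=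
  HomologicalComplex.double_d _ _ neg_one_ne_zero'

lemma isZero_twoTerm_X (F : 𝒮) (i : ℤ) (h₀ : i ≠ -1) (h₁ : i ≠ 0) : IsZero ((Y.twoTerm F).X i) :=
  HomologicalComplex.isZero_double_X _ rel_neg_one_zero _ h₀ h₁

/-- The functoriality of the two term complex. -/
def twoTermMap {F G : 𝒮} (f : F ⟶ G) : Y.twoTerm F ⟶ Y.twoTerm G :=
  HomologicalComplex.mkHomFromDouble _ neg_one_ne_zero' (Y.N.map f ≫ (Y.twoTermIso₀ G).inv)
    (Y.P.map f ≫ (Y.twoTermIso₁ G).inv) (by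
      have : Y.N.map f ≫ Y.i G = Y.i F ≫ Y.P.map f := Y.inl.naturality f
      rw [twoTerm_d, Category.assoc, Iso.inv_hom_id_assoc, reassoc_of% this])
    (fun k hk ↦ (Y.isZero_twoTerm_X G k (by simp at hk; omega) (by simp at hk; omega)).eq_of_tgt _ _)

lemma twoTermMap_f₀ {F G : 𝒮} (f : F ⟶ G) :
    (Y.twoTermMap f).f (-1) = (Y.twoTermIso₀ F).hom ≫ Y.N.map f ≫ (Y.twoTermIso₀ G).inv :=
  HomologicalComplex.mkHomFromDouble_f₀ _ _ _ _ _ _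

lemma twoTermMap_f₁ {F G : 𝒮} (f : F ⟶ G) :
    (Y.twoTermMap f).f 0 = (Y.twoTermIso₁ F).hom ≫ Y.P.map f ≫ (Y.twoTermIso₁ G).inv :=
  HomologicalComplex.mkHomFromDouble_f₁ _ _ _ _ _ _

lemma twoTerm_hom_ext {F : 𝒮} {K : CochainComplex 𝒮 ℤ} {φ ψ : Y.twoTerm F ⟶ K} (h₀ : φ.f (-1) = ψ.f (-1))
    (h₁ : φ.f 0 = ψ.f 0) : φ = ψ := HomologicalComplex.from_double_hom_ext h₀ h₁

lemma twoTermMap_id (F : 𝒮) : Y.twoTermMap (𝟙 F) = 𝟙 _ := by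
  refine Y.twoTerm_hom_ext ?_ ?_
  · rw [twoTermMap_f₀, CategoryTheory.Functor.map_id, Category.id_comp, Iso.hom_inv_id, HomologicalComplex.id_f]
  · rw [twoTermMap_f₁, CategoryTheory.Functor.map_id, Category.id_comp, Iso.hom_inv_id, HomologicalComplex.id_f]

lemma twoTermMap_comp {F G H : 𝒮} (f : F ⟶ G) (g : G ⟶ H) :
    Y.twoTermMap (f ≫ g) = Y.twoTermMap f ≫ Y.twoTermMap g := by
  refine Y.twoTerm_hom_ext ?_ ?_
  · rw [HomologicalComplex.comp_f, twoTermMap_f₀, twoTermMap_f₀, twoTermMap_f₀]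
    simp
  · rw [HomologicalComplex.comp_f, twoTermMap_f₁, twoTermMap_f₁, twoTermMap_f₁]
    simp

/-- The two term complexes as a functor. -/
def twoTermC : 𝒮 ⥤ CMinus 𝒮 where
  obj F := ⟨Y.twoTerm F, 0, (CochainComplex.isStrictlyLE_iff _ _).2 fun i hi ↦
    Y.isZero_twoTerm_X F i (by omega) (by omega)⟩
  map f := ⟨Y.twoTermMap f⟩
  map_id F := ObjectProperty.hom_ext _ (Y.twoTermMap_id F)
  map_comp f g := ObjectProperty.hom_ext _ (Y.twoTermMap_comp f g)

/-- The augmentation of the two term complex. -/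
def twoTermTo (F : 𝒮) : Y.twoTerm F ⟶ (CochainComplex.singleFunctor 𝒮 0).obj F :=
  HomologicalComplex.mkHomToSingle ((Y.twoTermIso₁ F).hom ≫ Y.p F) (by
    intro i hi
    obtain rfl : i = -1 := by simp at hi; omega
    rw [twoTerm_d]
    simp [Y.i_p])

lemma twoTermTo_f (F : 𝒮) : (Y.twoTermTo F).f 0 =
    ((Y.twoTermIso₁ F).hom ≫ Y.p F) ≫ (HomologicalComplex.singleObjXSelf (ComplexShape.up ℤ) 0 F).inv :=
  HomologicalComplex.mkHomToSingle_f _ _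

lemma twoTermTo_naturality {F G : 𝒮} (f : F ⟶ G) :
    Y.twoTermMap f ≫ Y.twoTermTo G = Y.twoTermTo F ≫ (CochainComplex.singleFunctor 𝒮 0).map f := by
  refine Y.twoTerm_hom_ext ((HomologicalComplex.isZero_single_obj_X _ _ _ _ (by simp)).eq_of_tgt _ _) ?_
  have h₁ : Y.P.map f ≫ Y.p G = Y.p F ≫ f := Y.snd.naturality f
  have h₂ : ((CochainComplex.singleFunctor 𝒮 0).map f).f 0 =
      (HomologicalComplex.singleObjXSelf (ComplexShape.up ℤ) 0 F).hom ≫ f ≫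
        (HomologicalComplex.singleObjXSelf (ComplexShape.up ℤ) 0 G).inv :=
    HomologicalComplex.single_map_f_self (ComplexShape.up ℤ) 0 f
  refine (congrArg₂ (· ≫ ·) (Y.twoTermMap_f₁ f) (Y.twoTermTo_f G)).trans (Eq.trans ?_
    (congrArg₂ (· ≫ ·) (Y.twoTermTo_f F) h₂).symm)
  exact comp_aux _ _ _ _ _ _ _ _ h₁

/-- The augmentation as a natural transformation. -/
def twoTermCTo : Y.twoTermC ⟶ CMinus.single 𝒮 where
  app F := ⟨Y.twoTermTo F⟩
  naturality _ _ f := ObjectProperty.hom_ext _ (Y.twoTermTo_naturality f)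

/-- The contractible complex `Ω¹ ⊗ F ⟶ Ω¹ ⊗ F`. -/
abbrev twoTermN (F : 𝒮) : CochainComplex 𝒮 ℤ := HomologicalComplex.double (𝟙 (Y.N.obj F)) rel_neg_one_zero

/-- The inclusion of the contractible complex. -/
def twoTermι (F : 𝒮) : Y.twoTermN F ⟶ Y.twoTerm F :=
  HomologicalComplex.mkHomFromDouble _ neg_one_ne_zero' (Y.twoTermIso₀ F).inv (Y.i F ≫ (Y.twoTermIso₁ F).inv)
    (by rw [twoTerm_d, Iso.inv_hom_id_assoc, Category.id_comp])
    (fun k hk ↦ (Y.isZero_twoTerm_X F k (by simp at hk; omega) (by simp at hk; omega)).eq_of_tgt _ _)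

lemma acyclic_twoTermN (F : 𝒮) : (Y.twoTermN F).Acyclic := by
  have hd : IsIso ((Y.twoTermN F).d (-1) 0) := by
    rw [HomologicalComplex.double_d _ _ neg_one_ne_zero']
    infer_instance
  intro i
  by_cases h₀ : i = -1
  · subst h₀
    rw [(Y.twoTermN F).exactAt_iff' (-2) (-1) 0 (by simp) (by simp)]
    rw [ShortComplex.exact_iff_mono _
      ((HomologicalComplex.isZero_double_X (𝟙 (Y.N.obj F)) rel_neg_one_zero _ (by simp) (by simp)).eq_of_src _ _)]
    exact inferInstanceAs (Mono ((Y.twoTermN F).d (-1) 0))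
  · by_cases h₁ : i = 0
    · subst h₁
      rw [(Y.twoTermN F).exactAt_iff' (-1) 0 1 (by simp) (by simp)]
      rw [ShortComplex.exact_iff_epi _
        ((HomologicalComplex.isZero_double_X (𝟙 (Y.N.obj F)) rel_neg_one_zero _ (by simp) (by simp)).eq_of_tgt _ _)]
      exact inferInstanceAs (Epi ((Y.twoTermN F).d (-1) 0))
    · exact exactAt_of_isZero (HomologicalComplex.isZero_double_X _ rel_neg_one_zero _ h₀ h₁)

/-- The kernel of the augmentation is the complex given by the identity of Ω¹ ⊗ F, which is acyclic.
-/
lemma quasiIso_twoTermTo (F : 𝒮) : QuasiIso (Y.twoTermTo F) := by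
  have f₀ : (Y.twoTermι F).f (-1) = (HomologicalComplex.doubleXIso₀ _ _).hom ≫ (Y.twoTermIso₀ F).inv :=
    HomologicalComplex.mkHomFromDouble_f₀ _ _ _ _ _ _
  have f₁ : (Y.twoTermι F).f 0 = (HomologicalComplex.doubleXIso₁ _ _ neg_one_ne_zero').hom ≫ Y.i F ≫
      (Y.twoTermIso₁ F).inv :=
    HomologicalComplex.mkHomFromDouble_f₁ _ _ _ _ _ _
  have w : Y.twoTermι F ≫ Y.twoTermTo F = 0 := by
    refine HomologicalComplex.from_double_hom_ext
      ((HomologicalComplex.isZero_single_obj_X _ _ _ _ (by simp)).eq_of_tgt _ _) ?_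
    exact (congrArg₂ (· ≫ ·) f₁ (Y.twoTermTo_f F)).trans (comp_aux_zero _ _ _ _ _ (Y.i_p F))
  have hS : (ShortComplex.mk _ _ w).ShortExact := by
    refine HomologicalComplex.shortExact_of_degreewise_shortExact _ (fun i ↦ ?_)
    by_cases h₁ : i = 0
    · subst h₁
      refine ShortComplex.shortExact_of_iso ?_ (Y.shortExact_ip F)
      refine ShortComplex.isoMk (HomologicalComplex.doubleXIso₁ (𝟙 (Y.N.obj F)) rel_neg_one_zero neg_one_ne_zero').symm (Y.twoTermIso₁ F).symm
        (HomologicalComplex.singleObjXSelf (ComplexShape.up ℤ) 0 F).symm ?_ ?_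
      · refine (congrArg (_ ≫ ·) f₁).trans ?_
        exact Iso.inv_hom_id_assoc _ _
      · refine (congrArg (_ ≫ ·) (Y.twoTermTo_f F)).trans ?_
        exact (congrArg (_ ≫ ·) (Category.assoc _ _ _)).trans (Iso.inv_hom_id_assoc _ _)
    · have z₃ : IsZero (((CochainComplex.singleFunctor 𝒮 0).obj F).X i) :=
        HomologicalComplex.isZero_single_obj_X _ _ _ _ h₁
      have h : ∀ {A B C : 𝒮} (f : A ⟶ B) (g : B ⟶ C) (w : f ≫ g = 0), IsIso f → IsZero C →
          (ShortComplex.mk f g w).ShortExact := by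
        intro A B C f g w hf hC
        have hg : g = 0 := hC.eq_of_tgt _ _
        subst hg
        exact { exact := (ShortComplex.exact_iff_epi _ rfl).2 (inferInstanceAs (Epi f))
                mono_f := inferInstanceAs (Mono f)
                epi_g := ⟨fun _ _ _ ↦ hC.eq_of_src _ _⟩ }
      refine h _ _ _ ?_ z₃
      by_cases h₀ : i = -1
      · subst h₀
        change IsIso ((Y.twoTermι F).f (-1))
        rw [f₀]
        infer_instance
      · exact isIso_of_source_target_iso_zero _
          (HomologicalComplex.isZero_double_X (𝟙 (Y.N.obj F)) rel_neg_one_zero _ h₀ h₁).isoZero (Y.isZero_twoTerm_X F i h₀ h₁).isoZero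
  exact quasiIso_g_of_acyclic hS (Y.acyclic_twoTermN F)

lemma isZero_pull_twoTerm_X (F : 𝒮) : IsZero ((Z.pullK.obj (Y.twoTerm F)).X (-2)) :=
  Z.pull.map_isZero (Y.isZero_twoTerm_X F (-2) (by omega) (by omega))

/-- The lowest homology of `j^*` of the two term complex. -/
def bottom (F : 𝒮) : (Z.pullK.obj (Y.twoTerm F)).homology (-1) ⟶ Z.pull.obj (Y.N.obj F) :=
  homologyι₁ _ (Y.isZero_pull_twoTerm_X F) ≫ Z.pull.map (Y.twoTermIso₀ F).hom

instance (F : 𝒮) : Mono (Y.bottom F) := by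
  have : Mono (Z.pull.map (Y.twoTermIso₀ F).hom) := have := (Z.pull.mapIso (Y.twoTermIso₀ F)).isIso_hom; IsIso.mono_of_iso (Z.pull.mapIso (Y.twoTermIso₀ F)).hom
  exact @mono_comp _ _ _ _ _ (homologyι₁ _ (Y.isZero_pull_twoTerm_X F)) _ (Z.pull.map (Y.twoTermIso₀ F).hom) this

lemma bottom_naturality {F G : 𝒮} (f : F ⟶ G) :
    HomologicalComplex.homologyMap (Z.pullK.map (Y.twoTermMap f)) (-1) ≫ Y.bottom G =
      Y.bottom F ≫ Z.pull.map (Y.N.map f) := by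
  have h₁ := homologyι₁_naturality (Z.pullK.map (Y.twoTermMap f)) (Y.isZero_pull_twoTerm_X F)
    (Y.isZero_pull_twoTerm_X G)
  have h₂ : Z.pull.map ((Y.twoTermMap f).f (-1)) ≫ Z.pull.map (Y.twoTermIso₀ G).hom =
      Z.pull.map (Y.twoTermIso₀ F).hom ≫ Z.pull.map (Y.N.map f) := by
    rw [← Functor.map_comp, ← Functor.map_comp, twoTermMap_f₀]
    simp
  refine (Category.assoc _ _ _).symm.trans ((congrArg (· ≫ _) h₁).trans ?_)
  exact (Category.assoc _ _ _).trans ((congrArg (_ ≫ ·) h₂).trans (Category.assoc _ _ _).symm)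

lemma pull_twoTerm_d (F : 𝒮) : Z.pull.map ((Y.twoTerm F).d (-1) 0) ≫ Z.pull.map (Y.twoTermIso₁ F).hom =
    Z.pull.map (Y.twoTermIso₀ F).hom ≫ Z.pull.map (Y.i F) := by
  rw [← Functor.map_comp, ← Functor.map_comp, twoTerm_d]
  simp

lemma bottom_i (F : 𝒮) : Y.bottom F ≫ Z.pull.map (Y.i F) = 0 := by
  refine (Category.assoc _ _ _).trans ((congrArg (_ ≫ ·) (Y.pull_twoTerm_d F).symm).trans ?_)
  refine (Category.assoc _ _ _).symm.trans ?_
  exact (congrArg (· ≫ _) (homologyι₁_d _ (Y.isZero_pull_twoTerm_X F))).trans zero_comp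

lemma exists_bottom (F : 𝒮) : ∃ y : Z.tor1.obj F ⟶ _, y ≫ Y.bottom F = Y.t F := by
  have h : (Y.t F ≫ Z.pull.map (Y.twoTermIso₀ F).inv) ≫ Z.pull.map ((Y.twoTerm F).d (-1) 0) = 0 := by
    rw [← cancel_mono (Z.pull.map (Y.twoTermIso₁ F).hom), Category.assoc, Category.assoc, pull_twoTerm_d,
      ← Functor.map_comp_assoc, Iso.inv_hom_id, CategoryTheory.Functor.map_id, Category.id_comp, t_i, zero_comp]
  obtain ⟨y, hy⟩ := exists_homologyι₁ _ (Y.isZero_pull_twoTerm_X F) _ h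
  refine ⟨y, (Category.assoc _ _ _).symm.trans ((congrArg (· ≫ _) hy).trans ?_)⟩
  exact ((Category.assoc _ _ _).trans (congrArg (_ ≫ ·) (Z.pull.mapIso (Y.twoTermIso₀ F)).inv_hom_id)).trans
    (Category.comp_id _)

/-- The lowest homology of `j^*` of the two term complex is `Tor¹`. -/
def bottomIso (F : 𝒮) : Z.tor1.obj F ≅ (Z.pullK.obj (Y.twoTerm F)).homology (-1) where
  hom := (Y.exists_bottom F).choose
  inv := (Y.exact_t_i F).lift (Y.bottom F) (Y.bottom_i F)
  hom_inv_id := by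
    rw [← cancel_mono (Y.t F), Category.assoc, Category.id_comp]
    exact (congrArg (_ ≫ ·) ((Y.exact_t_i F).lift_f _ _)).trans (Y.exists_bottom F).choose_spec
  inv_hom_id := by
    rw [← cancel_mono (Y.bottom F), Category.assoc, Category.id_comp, (Y.exists_bottom F).choose_spec]
    exact (Y.exact_t_i F).lift_f _ _

lemma bottomIso_hom_bottom (F : 𝒮) : (Y.bottomIso F).hom ≫ Y.bottom F = Y.t F :=
  (Y.exists_bottom F).choose_spec

lemma t_naturality {F G : 𝒮} (f : F ⟶ G) : Z.tor1.map f ≫ Y.t G = Y.t F ≫ Z.pull.map (Y.N.map f) :=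
  Y.torToN.naturality f

/-- `Tor¹` as a homology object, naturally. -/
def bottomNatIso : Z.tor1 ≅ Y.twoTermC ⋙ Z.bar ⋙ CMinus.ι 𝒜 ⋙ HomologicalComplex.homologyFunctor 𝒜 _ (-1) :=
  NatIso.ofComponents Y.bottomIso (fun {F G} f ↦ by
    have : (Z.tor1.map f ≫ (Y.bottomIso G).hom) ≫ Y.bottom G = ((Y.bottomIso F).hom ≫
        HomologicalComplex.homologyMap (Z.pullK.map (Y.twoTermMap f)) (-1)) ≫ Y.bottom G := by
      rw [Category.assoc, bottomIso_hom_bottom, Category.assoc, bottom_naturality, ← Category.assoc,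
        bottomIso_hom_bottom, t_naturality]
    exact (cancel_mono (Y.bottom G)).1 this)

lemma exactAt_tor_twoTerm (F : 𝒮) (i : ℤ) (hi : 0 ≤ i) : (Z.torK.obj (Y.twoTerm F)).ExactAt i := by
  rcases hi.lt_or_eq with hi | rfl
  · exact exactAt_of_isZero (Z.tor1.map_isZero (Y.isZero_twoTerm_X F i (by omega) (by omega)))
  · rw [(Z.torK.obj (Y.twoTerm F)).exactAt_iff' (-1) 0 1 (by simp) (by simp)]
    rw [ShortComplex.exact_iff_epi _ ((Z.tor1.map_isZero
      (Y.isZero_twoTerm_X F 1 (by omega) (by omega))).eq_of_tgt _ _)]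
    have h : Epi (Z.tor1.map ((Y.twoTerm F).d (-1) 0)) := by
      have := Y.epi_tor1_map_i F
      rw [twoTerm_d, Functor.map_comp, Functor.map_comp]
      infer_instance
    exact h

/-- The homology object of degree `-1`. -/
abbrev _root_.SqZeroThickening.DMinus.H₁ (C : Type v) [Category.{u} C] [Abelian C] : DMinus C ⥤ C :=
  DerivedCategory.Minus.ι ⋙ DerivedCategory.homologyFunctor C (-1)

lemma isIso_H₁_map_Q {K L : CMinus 𝒜} (f : K ⟶ L) (h : IsIso (HomologicalComplex.homologyMap f.hom (-1))) :
    IsIso ((DMinus.H₁ 𝒜).map ((CMinus.Q 𝒜).map f)) :=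
  (NatIso.isIso_map_iff (DerivedCategory.homologyFunctorFactors 𝒜 (-1)) f.hom).2 h

/-- The two term complex need not have acyclic Tor¹, but its Tor¹ is exact in degrees ≥ 0. Compared
with a genuine resolution P, this suffices for j^* of the cone to be exact in degrees -2 and -1, so
H⁻¹ of j^* is already the derived value. -/
lemma isIso_H₁_map_LpTo (F : 𝒮) : IsIso ((DMinus.H₁ 𝒜).map (Z.LpTo.app (Y.twoTermC.obj F))) := by
  obtain ⟨P, π, hP, hP', hπ, -⟩ := Z.exists_epi_resolution (Y.twoTerm F) (Y.twoTermC.obj F).property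
  let P' : CMinus 𝒮 := ⟨P, hP⟩
  let π' : P' ⟶ Y.twoTermC.obj F := ⟨π⟩
  have i₁ := Z.isIso_LpTo P' hP'
  have i₂ := CMinus.isIso_Q_map π' hπ
  have ha : (CochainComplex.mappingCone π).Acyclic := (quasiIso_iff_acyclic_mappingCone π).1 hπ
  have ht (i : ℤ) (hi : -2 + 2 ≤ i) : (Z.torK.obj (CochainComplex.mappingCone π)).ExactAt i :=
    exactAt_map_mappingCone Z.tor1 π i (hP' _) (Y.exactAt_tor_twoTerm F i (by omega))
  have he := Z.exactAt_pull_of_ge (-2) (minusProp_mappingCone π hP (Y.twoTermC.obj F).property) ha ht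
  have i₃ := isIso_H₁_map_Q (Z.bar.map π')
    (isIso_homologyMap_map Z.pull π (-2) (-1) (by simp) (he _ (by omega)) (he _ (by omega)))
  have h := congrArg (DMinus.H₁ 𝒜).map (Z.LpTo_naturality π')
  rw [Functor.map_comp, Functor.map_comp] at h
  have i₄ : IsIso ((DMinus.H₁ 𝒜).map (Z.LpTo.app P') ≫ (DMinus.H₁ 𝒜).map ((CMinus.Q 𝒜).map (Z.bar.map π'))) :=
    IsIso.comp_isIso' inferInstance i₃
  rw [← h] at i₄
  exact IsIso.of_isIso_comp_left ((DMinus.H₁ 𝒜).map (Z.Lp.map ((CMinus.Q 𝒮).map π'))) _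

/-- `Tor¹` is the first left derived functor of `j^*`. -/
def firstDerivedIso : Z.tor1 ≅ CMinus.single 𝒮 ⋙ CMinus.Q 𝒮 ⋙ Z.Lp ⋙ DMinus.H₁ 𝒜 :=
  have (F : 𝒮) : IsIso ((Functor.whiskerRight (Functor.whiskerLeft Y.twoTermC Z.LpTo) (DMinus.H₁ 𝒜)).app F) :=
    Y.isIso_H₁_map_LpTo F
  have := NatIso.isIso_of_isIso_app (Functor.whiskerRight (Functor.whiskerLeft Y.twoTermC Z.LpTo) (DMinus.H₁ 𝒜))
  have (F : 𝒮) : IsIso ((Functor.whiskerRight Y.twoTermCTo (CMinus.Q 𝒮)).app F) :=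
    CMinus.isIso_Q_map _ (Y.quasiIso_twoTermTo F)
  have := NatIso.isIso_of_isIso_app (Functor.whiskerRight Y.twoTermCTo (CMinus.Q 𝒮))
  Y.bottomNatIso ≪≫
    Functor.isoWhiskerLeft (Y.twoTermC ⋙ Z.bar ⋙ CMinus.ι 𝒜) (DerivedCategory.homologyFunctorFactors 𝒜 (-1)).symm ≪≫
    (asIso (Functor.whiskerRight (Functor.whiskerLeft Y.twoTermC Z.LpTo) (DMinus.H₁ 𝒜))).symm ≪≫
    Functor.isoWhiskerRight (asIso (Functor.whiskerRight Y.twoTermCTo (CMinus.Q 𝒮))) (Z.Lp ⋙ DMinus.H₁ 𝒜)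

/-- The substance is in (i) ⇒ (v), where L is built, and in (ii) ⇒ (i), where Θ is killed; the other
steps transport isomorphisms along L → L/T and along Lj^* → j^*. -/
lemma tfae {K : CMinus 𝒮} (hK : K.IsBounded) : List.TFAE [
    Y.theta K.obj = 0,
    ∃ s : (CMinus.Q 𝒜).obj (Z.bar.obj K) ⟶ Z.Lp.obj ((CMinus.Q 𝒮).obj K), s ≫ Z.LpTo.app K = 𝟙 _,
    ∃ L : CMinus 𝒮, L.IsBounded ∧ (Z.torK.obj L.obj).Acyclic ∧
      ∃ f : (CMinus.Q 𝒮).obj L ⟶ (CMinus.Q 𝒮).obj K, IsIso (Z.Lp.map f ≫ Z.LpTo.app K),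
    ∃ L : CMinus 𝒮, L.IsBounded ∧ (Z.torK.obj L.obj).Acyclic ∧
      ∃ f : Z.admW.Q.obj L ⟶ Z.admW.Q.obj K, IsIso (Z.barAdm.map f),
    ∃ L : CMinus 𝒮, L.IsBounded ∧ (Z.torK.obj L.obj).Acyclic ∧
      ∃ (T : CochainComplex 𝒮 ℤ) (t : T ⟶ Z.IK.obj L.obj), Mono t ∧
        Nonempty (Z.admW.Q.obj K ≅ Z.admW.Q.obj
          ⟨cokernel (t ≫ Z.mK L.obj), minusProp_of_epi (cokernel.π _) L.property⟩)] := by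
  tfae_have 1 → 5 := Y.exists_quotient_of_theta_eq_zero hK
  tfae_have 5 → 4 := by
    rintro ⟨L, hL, hL', T, t, -, ⟨e⟩⟩
    exact ⟨L, hL, hL', Z.exists_barAdm_of_quotient _ ⟨cokernel.π (t ≫ Z.mK L.obj)⟩
      (Z.isIso_pullK_map_cokernelπ _ (by rw [Functor.map_comp, pullK_map_mK, comp_zero])) e⟩
  tfae_have 4 → 3 := by
    rintro ⟨L, hL, hL', f, hf⟩
    exact ⟨L, hL, hL', Z.exists_isIso_of_barAdm hL' f hf⟩
  tfae_have 3 → 2 := by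
    rintro ⟨L, hL, hL', f, hf⟩
    exact Z.hasSection_of_isIso f hf
  tfae_have 2 → 1 := fun h ↦ Y.theta_eq_zero_of_hasSection h
  tfae_finish

end PrincipalParts
end SqZeroPair
end SqZeroThickening
end

/-! ### Sheaves of modules handled through sections and local conditions. -/

noncomputable section
namespace SqZeroThickening

namespace AlgSheaf
variable {k : Type u} [CommRing k] {X : TopCat.{u}} {A : AlgSheaf k X}

/-- Sections of a presheaf of modules. -/
abbrev Sec (P : A.PMod) (U : Opens X) : Type u := P.obj (op U)

/-- Restriction of sections of a presheaf of modules. -/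
def rs (P : A.PMod) {U V : Opens X} (h : V ≤ U) : Sec P U →+ Sec P V :=
  (P.presheaf.map (homOfLE h).op).hom

lemma rs_smul (P : A.PMod) {U V : Opens X} (h : V ≤ U) (r : A.sheaf.obj.obj (op U)) (s : Sec P U) :
    rs P h (r • s) = A.res h r • rs P h s :=
  P.map_smul (homOfLE h).op r s

lemma rs_rs (P : A.PMod) {U V W : Opens X} (h : V ≤ U) (h' : W ≤ V) (s : Sec P U) :
    rs P h' (rs P h s) = rs P (h'.trans h) s :=
  (ConcreteCategory.congr_hom (P.presheaf.map_comp (homOfLE h).op (homOfLE h').op) s).symm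

lemma rs_refl (P : A.PMod) {U : Opens X} (s : Sec P U) : rs P le_rfl s = s :=
  ConcreteCategory.congr_hom (P.presheaf.map_id (op U)) s

/-- A morphism of presheaves of modules on sections. -/
def ap {P Q : A.PMod} (f : P ⟶ Q) (U : Opens X) : Sec P U →ₗ[A.sheaf.obj.obj (op U)] Sec Q U :=
  (f.app (op U)).hom

lemma ap_rs {P Q : A.PMod} (f : P ⟶ Q) {U V : Opens X} (h : V ≤ U) (s : Sec P U) :
    ap f V (rs P h s) = rs Q h (ap f U s) :=
  PresheafOfModules.naturality_apply f (homOfLE h).op s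

lemma ap_comp {P Q R : A.PMod} (f : P ⟶ Q) (g : Q ⟶ R) (U : Opens X) (s : Sec P U) :
    ap (f ≫ g) U s = ap g U (ap f U s) := rfl

lemma ap_zero (P Q : A.PMod) (U : Opens X) (s : Sec P U) : ap (0 : P ⟶ Q) U s = 0 := rfl

lemma pmod_hom_ext {P Q : A.PMod} {f g : P ⟶ Q} (h : ∀ U s, ap f U s = ap g U s) : f = g := by
  ext U s
  exact h U.unop s

/-- Surjectivity locally on `X`. -/
def LocSurj {P Q : A.PMod} (f : P ⟶ Q) : Prop :=
  ∀ (U : Opens X) (q : Sec Q U) (x : X), x ∈ U → ∃ (V : Opens X) (h : V ≤ U), x ∈ V ∧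
    ∃ p : Sec P V, ap f V p = rs Q h q

/-- Injectivity locally on `X`. -/
def LocInj {P Q : A.PMod} (f : P ⟶ Q) : Prop :=
  ∀ (U : Opens X) (p : Sec P U), ap f U p = 0 → ∀ x ∈ U, ∃ (V : Opens X) (h : V ≤ U), x ∈ V ∧ rs P h p = 0

lemma LocInj.of_injective {P Q : A.PMod} {f : P ⟶ Q} (h : ∀ U, Function.Injective (ap f U)) : LocInj f :=
  fun U p hp x hx ↦ ⟨U, le_rfl, hx, by rw [(injective_iff_map_eq_zero _).1 (h U) p hp, map_zero]⟩

lemma LocSurj.of_surjective {P Q : A.PMod} {f : P ⟶ Q} (h : ∀ U, Function.Surjective (ap f U)) : LocSurj f :=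
  fun U q x hx ↦ ⟨U, le_rfl, hx, by rw [rs_refl]; exact h U q⟩

lemma sec_ext (F : A.Mod) {U : Opens X} {s t : Sec (A.forget.obj F) U}
    (h : ∀ x ∈ U, ∃ (V : Opens X) (h : V ≤ U), x ∈ V ∧ rs _ h s = rs _ h t) : s = t := by
  let S : Sieve U :=
    { arrows V f := rs (A.forget.obj F) (leOfHom f) s = rs (A.forget.obj F) (leOfHom f) t
      downward_closed {V W f} hf g := by
        rw [← rs_rs _ (leOfHom f) (leOfHom g), ← rs_rs _ (leOfHom f) (leOfHom g), hf] }
  refine F.isSheaf.isSeparated U S (fun x hx ↦ ?_) s t (fun V f hf ↦ hf)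
  obtain ⟨V, h, hV, e⟩ := h x hx
  exact ⟨V, homOfLE h, e, hV⟩

lemma sec_eq_zero (F : A.Mod) {U : Opens X} {s : Sec (A.forget.obj F) U}
    (h : ∀ x ∈ U, ∃ (V : Opens X) (h : V ≤ U), x ∈ V ∧ rs _ h s = 0) : s = 0 :=
  sec_ext F fun x hx ↦ by
    obtain ⟨V, h, hV, e⟩ := h x hx
    exact ⟨V, h, hV, by rw [e, map_zero]⟩

/-- The unit `P ⟶ P^#` of sheafification. -/
def toSh (P : A.PMod) : P ⟶ A.forget.obj (A.sheafify.obj P) := A.sheafifyAdj.unit.app P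

lemma toSh_naturality {P Q : A.PMod} (f : P ⟶ Q) : f ≫ toSh Q = toSh P ≫ A.forget.map (A.sheafify.map f) :=
  A.sheafifyAdj.unit.naturality f

lemma ap_toSh {P Q : A.PMod} (f : P ⟶ Q) (U : Opens X) (s : Sec P U) :
    ap (A.forget.map (A.sheafify.map f)) U (ap (toSh P) U s) = ap (toSh Q) U (ap f U s) := by
  rw [← ap_comp, ← toSh_naturality, ap_comp]

lemma locSurj_toSh (P : A.PMod) : LocSurj (toSh P) := by
  have h : Presheaf.IsLocallySurjective (Opens.grothendieckTopology X)
    (CategoryTheory.toSheafify (Opens.grothendieckTopology X) P.presheaf) := inferInstance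
  intro U q x hx
  obtain ⟨V, i, ⟨p, hp⟩, hV⟩ := h.imageSieve_mem (U := U) q x hx
  exact ⟨V, leOfHom i, hV, p, hp⟩

lemma locInj_toSh (P : A.PMod) : LocInj (toSh P) := by
  have h : Presheaf.IsLocallyInjective (Opens.grothendieckTopology X)
    (CategoryTheory.toSheafify (Opens.grothendieckTopology X) P.presheaf) := inferInstance
  intro U p hp x hx
  obtain ⟨V, i, e, hV⟩ := h.equalizerSieve_mem (X := op U) p 0 (by exact hp.trans (map_zero _).symm) x hx
  exact ⟨V, leOfHom i, hV, Eq.trans e (map_zero _)⟩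

instance : A.forget.Full := inferInstanceAs (SheafOfModules.forget A.ringSheaf).Full
instance : A.forget.Faithful := inferInstanceAs (SheafOfModules.forget A.ringSheaf).Faithful
instance : A.forget.IsRightAdjoint := A.sheafifyAdj.isRightAdjoint
instance : A.sheafify.IsLeftAdjoint := A.sheafifyAdj.isLeftAdjoint
instance : A.forget.Additive := inferInstanceAs (SheafOfModules.forget A.ringSheaf).Additive
instance : A.sheafify.Additive := A.sheafifyAdj.left_adjoint_additive

lemma mod_hom_ext {F G : A.Mod} {f g : F ⟶ G} (h : ∀ U s, ap (A.forget.map f) U s = ap (A.forget.map g) U s) :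
    f = g := A.forget.map_injective (pmod_hom_ext h)

lemma mono_of_injective {F G : A.Mod} (f : F ⟶ G) (h : ∀ U, Function.Injective (ap (A.forget.map f) U)) :
    Mono f :=
  have : Mono (A.forget.map f) := PresheafOfModules.mono_of_injective fun U ↦ h U.unop
  A.forget.mono_of_mono_map this

lemma injective_of_mono {F G : A.Mod} (f : F ⟶ G) [Mono f] (U : Opens X) :
    Function.Injective (ap (A.forget.map f) U) :=
  have : Mono (A.forget.map f) := inferInstance
  PresheafOfModules.injective_of_mono (A.forget.map f) (op U)

lemma mono_of_locInj {F G : A.Mod} (f : F ⟶ G) (h : LocInj (A.forget.map f)) : Mono f :=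
  mono_of_injective f fun U ↦ (injective_iff_map_eq_zero _).2 fun s hs ↦ sec_eq_zero F (h U s hs)

lemma epi_of_locSurj {F G : A.Mod} (f : F ⟶ G) (h : LocSurj (A.forget.map f)) : Epi f where
  left_cancellation {H} a b hab := mod_hom_ext fun U s ↦ sec_ext H fun x hx ↦ by
    obtain ⟨V, hV, hxV, p, hp⟩ := h U s x hx
    refine ⟨V, hV, hxV, ?_⟩
    rw [← ap_rs, ← ap_rs, ← hp, ← ap_comp, ← ap_comp, ← Functor.map_comp, ← Functor.map_comp, hab]

lemma locInj_sheafify {P Q : A.PMod} (f : P ⟶ Q) (h : LocInj f) : LocInj (A.forget.map (A.sheafify.map f)) := by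
  intro U s hs x hx
  obtain ⟨V, hV, hxV, p, hp⟩ := locSurj_toSh P U s x hx
  have h₁ : ap (toSh Q) V (ap f V p) = 0 := by rw [← ap_toSh, hp, ap_rs, hs, map_zero]
  obtain ⟨W, hW, hxW, h₂⟩ := locInj_toSh Q V _ h₁ x hxV
  rw [← ap_rs] at h₂
  obtain ⟨W', hW', hxW', h₃⟩ := h W _ h₂ x hxW
  refine ⟨W', (hW'.trans hW).trans hV, hxW', ?_⟩
  rw [← rs_rs _ hV (hW'.trans hW), ← rs_rs _ hW hW', ← hp, ← ap_rs, ← ap_rs, h₃, map_zero]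

lemma locSurj_sheafify {P Q : A.PMod} (f : P ⟶ Q) (h : LocSurj f) : LocSurj (A.forget.map (A.sheafify.map f)) := by
  intro U s x hx
  obtain ⟨V, hV, hxV, q, hq⟩ := locSurj_toSh Q U s x hx
  obtain ⟨W, hW, hxW, p, hp⟩ := h V q x hxV
  refine ⟨W, hW.trans hV, hxW, ap (toSh P) W p, ?_⟩
  rw [ap_toSh, hp, ap_rs, hq, rs_rs]

lemma mono_sheafify {P Q : A.PMod} (f : P ⟶ Q) (h : LocInj f) : Mono (A.sheafify.map f) :=
  mono_of_locInj _ (locInj_sheafify f h)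

lemma epi_sheafify {P Q : A.PMod} (f : P ⟶ Q) (h : LocSurj f) : Epi (A.sheafify.map f) :=
  epi_of_locSurj _ (locSurj_sheafify f h)

lemma isIso_sheafify {P Q : A.PMod} (f : P ⟶ Q) (h : LocInj f) (h' : LocSurj f) : IsIso (A.sheafify.map f) :=
  have := mono_sheafify f h
  have := epi_sheafify f h'
  isIso_of_mono_of_epi _

lemma exists_of_exact {P Q R : A.PMod} {f : P ⟶ Q} {g : Q ⟶ R} {w : f ≫ g = 0}
    (h : (ShortComplex.mk f g w).Exact) {U : Opens X} {q : Sec Q U} (hq : ap g U q = 0) : ∃ p, ap f U p = q :=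
  (ShortComplex.moduleCat_exact_iff _).1 (h.map (PresheafOfModules.evaluation _ (op U))) q hq

lemma exists_of_cokernel_π_eq_zero {P Q : A.PMod} (f : P ⟶ Q) {U : Opens X} {q : Sec Q U}
    (hq : ap (cokernel.π f) U q = 0) : ∃ p, ap f U p = q :=
  exists_of_exact (ShortComplex.exact_cokernel f) hq

/-- Test the epimorphism f against the sheaf associated with its presheaf cokernel: the map from G
to it composes to zero with f, hence is zero, so every section of G locally dies in the presheaf
cokernel. -/
lemma locSurj_of_epi {F G : A.Mod} (f : F ⟶ G) [Epi f] : LocSurj (A.forget.map f) := by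
  let c := cokernel.π (A.forget.map f)
  obtain ⟨γ, hγ⟩ := A.forget.map_surjective (c ≫ toSh _)
  have h₁ : f ≫ γ = 0 := A.forget.map_injective (by
    rw [Functor.map_comp, hγ, cokernel.condition_assoc, zero_comp, Functor.map_zero])
  have h₂ : γ = 0 := by rw [← cancel_epi f, h₁, comp_zero]
  intro U s x hx
  have h₃ : ap (toSh _) U (ap c U s) = 0 := by
    rw [← ap_comp, ← hγ, h₂, Functor.map_zero, ap_zero]
  obtain ⟨V, hV, hxV, h₄⟩ := locInj_toSh _ U _ h₃ x hx
  rw [← ap_rs] at h₄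
  exact ⟨V, hV, hxV, exists_of_cokernel_π_eq_zero _ h₄⟩

lemma exact_of_locExact {F G H : A.Mod} (f : F ⟶ G) (g : G ⟶ H) (w : f ≫ g = 0)
    (h : ∀ (U : Opens X) (s : Sec (A.forget.obj G) U), ap (A.forget.map g) U s = 0 → ∀ x ∈ U,
      ∃ (V : Opens X) (h : V ≤ U), x ∈ V ∧ ∃ p, ap (A.forget.map f) V p = rs _ h s) :
    (ShortComplex.mk f g w).Exact := by
  rw [ShortComplex.exact_iff_epi_kernel_lift]
  refine epi_of_locSurj _ fun U s x hx ↦ ?_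
  have h₁ : ap (A.forget.map g) U (ap (A.forget.map (kernel.ι g)) U s) = 0 := by
    rw [← ap_comp, ← Functor.map_comp, kernel.condition, Functor.map_zero, ap_zero]
  obtain ⟨V, hV, hxV, p, hp⟩ := h U _ h₁ x hx
  refine ⟨V, hV, hxV, p, injective_of_mono (kernel.ι g) V ?_⟩
  have h₂ : kernel.lift g f w ≫ kernel.ι g = f := kernel.lift_ι _ _ _
  refine (ap_comp _ _ _ _).symm.trans ?_
  rw [ap_rs, ← hp]
  exact (congrArg (fun m ↦ ap m V p) (A.forget.map_comp _ _).symm).trans (congrArg (fun m ↦ ap (A.forget.map m) V p) h₂)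

/-- The counit of sheafification. -/
def ofSh (F : A.Mod) : A.sheafify.obj (A.forget.obj F) ⟶ F := A.sheafifyAdj.counit.app F

instance (F : A.Mod) : IsIso (ofSh F) := inferInstanceAs (IsIso (A.sheafifyAdj.counit.app F))

lemma ap_ofSh (F : A.Mod) (U : Opens X) (s : Sec (A.forget.obj F) U) :
    ap (A.forget.map (ofSh F)) U (ap (toSh (A.forget.obj F)) U s) = s := by
  have := A.sheafifyAdj.right_triangle_components F
  rw [← ap_comp]
  exact (congrArg (fun f ↦ ap f U s) this)

end AlgSheaf
end SqZeroThickening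
end

/-! ### Tensor products of presheaves and sheafification. -/

noncomputable section
namespace SqZeroThickening

namespace AlgSheaf
variable {k : Type u} [CommRing k] {X : TopCat.{u}} {A : AlgSheaf k X}
open scoped TensorProduct

lemma res_res {U V W : Opens X} (h : V ≤ U) (h' : W ≤ V) (s : A.sheaf.obj.obj (op U)) :
    A.res h' (A.res h s) = A.res (h'.trans h) s :=
  (ConcreteCategory.congr_hom (A.sheaf.obj.map_comp (homOfLE h).op (homOfLE h').op) s).symm

/-- A pure tensor of sections. -/
def tm {P Q : A.PMod} {U : Opens X} (p : Sec P U) (q : Sec Q U) : Sec (P ⊗ Q) U :=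
  p ⊗ₜ[A.sheaf.obj.obj (op U)] q

section
variable {P Q R : A.PMod} {U V : Opens X}

lemma tm_add (p : Sec P U) (q q' : Sec Q U) : tm p (q + q') = tm p q + tm p q' := TensorProduct.tmul_add _ _ _
lemma add_tm (p p' : Sec P U) (q : Sec Q U) : tm (p + p') q = tm p q + tm p' q := TensorProduct.add_tmul _ _ _
lemma tm_zero (p : Sec P U) : tm p (0 : Sec Q U) = 0 := TensorProduct.tmul_zero _ _
lemma zero_tm (q : Sec Q U) : tm (0 : Sec P U) q = 0 := TensorProduct.zero_tmul _ _
lemma tm_smul (r : A.sheaf.obj.obj (op U)) (p : Sec P U) (q : Sec Q U) : tm p (r • q) = r • tm p q :=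
  TensorProduct.tmul_smul _ _ _
lemma smul_tm (r : A.sheaf.obj.obj (op U)) (p : Sec P U) (q : Sec Q U) : tm (r • p) q = r • tm p q := rfl
lemma smul_tm' (r : A.sheaf.obj.obj (op U)) (p : Sec P U) (q : Sec Q U) : tm (r • p) q = tm p (r • q) := by
  rw [smul_tm, tm_smul]
lemma sum_tm {ι : Type*} (s : Finset ι) (p : ι → Sec P U) (q : Sec Q U) : tm (∑ i ∈ s, p i) q = ∑ i ∈ s, tm (p i) q :=
  TensorProduct.sum_tmul _ _ _
lemma tm_sum {ι : Type*} (s : Finset ι) (p : Sec P U) (q : ι → Sec Q U) : tm p (∑ i ∈ s, q i) = ∑ i ∈ s, tm p (q i) :=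
  TensorProduct.tmul_sum _ _ _

lemma rs_tm (h : V ≤ U) (p : Sec P U) (q : Sec Q U) : rs (P ⊗ Q) h (tm p q) = tm (rs P h p) (rs Q h q) := rfl

lemma ap_whiskerLeft (f : Q ⟶ R) (p : Sec P U) (q : Sec Q U) : ap (P ◁ f) U (tm p q) = tm p (ap f U q) := rfl

lemma tm_induction {motive : Sec (P ⊗ Q) U → Prop} (zero : motive 0) (tm : ∀ p q, motive (tm p q))
    (add : ∀ s t, motive s → motive t → motive (s + t)) (t : Sec (P ⊗ Q) U) : motive t :=
  TensorProduct.induction_on t zero tm add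

lemma tensor_hom_ext {f g : P ⊗ Q ⟶ R} (h : ∀ U (p : Sec P U) (q : Sec Q U), ap f U (tm p q) = ap g U (tm p q)) :
    f = g :=
  pmod_hom_ext fun U ↦ tm_induction (by rw [map_zero, map_zero]) (h U)
    fun s t hs ht ↦ by rw [map_add, map_add, hs, ht]

end

lemma exists_common {ι : Type*} [Finite ι] {x : X} {U : Opens X} (hx : x ∈ U) (p : ι → Opens X → Prop)
    (mono : ∀ i V W, W ≤ V → p i V → p i W) (h : ∀ i, ∃ V ≤ U, x ∈ V ∧ p i V) :
    ∃ V ≤ U, x ∈ V ∧ ∀ i, p i V := by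
  classical
  cases nonempty_fintype ι
  have : ∀ s : Finset ι, ∃ V ≤ U, x ∈ V ∧ ∀ i ∈ s, p i V := by
    intro s
    induction s using Finset.induction_on with
    | empty => exact ⟨U, le_rfl, hx, by simp⟩
    | insert i s _ ih =>
      obtain ⟨V, hV, hxV, h₁⟩ := ih
      obtain ⟨W, hW, hxW, h₂⟩ := h i
      refine ⟨V ⊓ W, inf_le_left.trans hV, ⟨hxV, hxW⟩, fun j hj ↦ ?_⟩
      rcases Finset.mem_insert.1 hj with rfl | hj
      · exact mono _ _ _ inf_le_right h₂
      · exact mono _ _ _ inf_le_left (h₁ j hj)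
  obtain ⟨V, hV, hxV, h₁⟩ := this Finset.univ
  exact ⟨V, hV, hxV, fun i ↦ h₁ i (Finset.mem_univ i)⟩

lemma LocSurj.exists_lift {P Q : A.PMod} {f : P ⟶ Q} (hf : LocSurj f) {ι : Type*} [Finite ι] {U : Opens X}
    (q : ι → Sec Q U) {x : X} (hx : x ∈ U) :
    ∃ (V : Opens X) (h : V ≤ U), x ∈ V ∧ ∃ p : ι → Sec P V, ∀ i, ap f V (p i) = rs Q h (q i) := by
  obtain ⟨V, h, hxV, H⟩ := exists_common hx (fun i V ↦ ∃ (h : V ≤ U) (p : Sec P V), ap f V p = rs Q h (q i))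
    (fun i V W hW ⟨h, p, hp⟩ ↦ ⟨hW.trans h, rs P hW p, by rw [ap_rs, hp, rs_rs]⟩)
    (fun i ↦ by
      obtain ⟨V, h, hxV, p, hp⟩ := hf U (q i) x hx
      exact ⟨V, h, hxV, h, p, hp⟩)
  choose _ p hp using H
  exact ⟨V, h, hxV, p, hp⟩

lemma LocInj.exists_rs_eq_zero {P Q : A.PMod} {f : P ⟶ Q} (hf : LocInj f) {ι : Type*} [Finite ι] {U : Opens X}
    (p : ι → Sec P U) (hp : ∀ i, ap f U (p i) = 0) {x : X} (hx : x ∈ U) :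
    ∃ (V : Opens X) (h : V ≤ U), x ∈ V ∧ ∀ i, rs P h (p i) = 0 := by
  obtain ⟨V, h, hxV, H⟩ := exists_common hx (fun i V ↦ ∃ (h : V ≤ U), rs P h (p i) = 0)
    (fun i V W hW ⟨h, hp⟩ ↦ ⟨hW.trans h, by rw [← rs_rs _ h hW, hp, map_zero]⟩)
    (fun i ↦ by
      obtain ⟨V, h, hxV, e⟩ := hf U (p i) (hp i) x hx
      exact ⟨V, h, hxV, h, e⟩)
  exact ⟨V, h, hxV, fun i ↦ (H i).2⟩

/-- Presheaves of modules that are finitely generated locally on `X`. -/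
def LocFG (P : A.PMod) : Prop :=
  ∀ (U : Opens X) (x : X), x ∈ U → ∃ (V : Opens X) (_ : V ≤ U), x ∈ V ∧ ∃ (n : ℕ) (e : Fin n → Sec P V),
    ∀ p, ∃ a : Fin n → A.sheaf.obj.obj (op V), p = ∑ i, a i • e i

lemma exists_sum_tm {P Q : A.PMod} {V : Opens X} {n : ℕ} {e : Fin n → Sec P V}
    (he : ∀ p, ∃ a : Fin n → A.sheaf.obj.obj (op V), p = ∑ i, a i • e i) (t : Sec (P ⊗ Q) V) :
    ∃ q : Fin n → Sec Q V, t = ∑ i, tm (e i) (q i) := by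
  induction t using tm_induction with
  | zero => exact ⟨0, by simp [tm_zero]⟩
  | tm p q =>
    obtain ⟨a, rfl⟩ := he p
    exact ⟨fun i ↦ a i • q, by simp [sum_tm, smul_tm']⟩
  | add s t hs ht =>
    obtain ⟨q, rfl⟩ := hs
    obtain ⟨q', rfl⟩ := ht
    exact ⟨q + q', by simp [tm_add, Finset.sum_add_distrib]⟩

lemma LocSurj.whiskerLeft {P Q : A.PMod} {f : P ⟶ Q} (hf : LocSurj f) (M : A.PMod) : LocSurj (M ◁ f) := by
  intro U t x hx
  induction t using tm_induction with
  | zero => exact ⟨U, le_rfl, hx, 0, by rw [map_zero, map_zero]⟩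
  | tm m q =>
    obtain ⟨V, h, hxV, p, hp⟩ := hf U q x hx
    exact ⟨V, h, hxV, tm (rs M h m) p, by rw [ap_whiskerLeft, hp, rs_tm]⟩
  | add s t hs ht =>
    obtain ⟨V, h, hxV, p, hp⟩ := hs
    obtain ⟨W, h', hxW, q, hq⟩ := ht
    refine ⟨V ⊓ W, inf_le_left.trans h, ⟨hxV, hxW⟩, rs _ inf_le_left p + rs _ inf_le_right q, ?_⟩
    rw [map_add, ap_rs, ap_rs, hp, hq, rs_rs, rs_rs, map_add]

/-- The equational criterion for vanishing in a tensor product expresses the vanishing of ∑ eᵢ ⊗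
f(qᵢ) by finitely many relations. These lift along f after shrinking, because f is locally
surjective and locally injective. -/
lemma LocInj.whiskerLeft {P Q : A.PMod} {f : P ⟶ Q} (hf : LocInj f) (hf' : LocSurj f) {M : A.PMod} (hM : LocFG M) :
    LocInj (M ◁ f) := by
  intro U t ht x hx
  obtain ⟨V, hV, hxV, n, e, he⟩ := hM U x hx
  obtain ⟨q, hq⟩ := exists_sum_tm he (rs _ hV t)
  have h₁ : ∑ i, tm (e i) (ap f V (q i)) = 0 := by
    have := ap_rs (M ◁ f) hV t
    rw [ht, map_zero, hq, map_sum] at this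
    exact this
  -- This yields f(qᵢ) = ∑ aᵢⱼ yⱼ with ∑ aᵢⱼ eᵢ = 0 for every j. The criterion asks that the eᵢ
  -- generate, which is where local finite generation is used.
  obtain ⟨m, a, y, h₂, h₃⟩ := TensorProduct.vanishesTrivially_of_sum_tmul_eq_zero (A.sheaf.obj.obj (op V))
    (m := e) (n := fun i ↦ ap f V (q i)) (by
      rw [eq_top_iff]
      rintro p -
      obtain ⟨b, rfl⟩ := he p
      exact Submodule.sum_mem _ fun i _ ↦ Submodule.smul_mem _ _ (Submodule.subset_span ⟨i, rfl⟩)) h₁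
  replace h₂ : ∀ i, ap f V (q i) = ∑ j, a i j • y j := h₂
  obtain ⟨W, hW, hxW, z, hz⟩ := hf'.exists_lift y hxV
  have h₄ : ∀ i, ap f W (rs P hW (q i) - ∑ j, A.res hW (a i j) • z j) = 0 := by
    intro i
    rw [map_sub, ap_rs, h₂, map_sum, map_sum]
    simp [rs_smul, hz]
  obtain ⟨W', hW', hxW', h₅⟩ := hf.exists_rs_eq_zero _ h₄ hxW
  refine ⟨W', (hW'.trans hW).trans hV, hxW', ?_⟩
  have h₆ : ∀ i, rs P (hW'.trans hW) (q i) = ∑ j, A.res (hW'.trans hW) (a i j) • rs P hW' (z j) := by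
    intro i
    have := h₅ i
    rw [map_sub, rs_rs, sub_eq_zero] at this
    rw [this, map_sum]
    refine Finset.sum_congr rfl fun j _ ↦ ?_
    rw [rs_smul, res_res]
  rw [← rs_rs _ hV (hW'.trans hW), hq, map_sum]
  simp only [rs_tm, h₆, tm_sum]
  rw [Finset.sum_comm]
  refine Finset.sum_eq_zero fun j _ ↦ ?_
  simp only [tm_smul, ← smul_tm, ← rs_smul]
  rw [← sum_tm, ← map_sum, h₃, map_zero, zero_tm]

/-- The unit of sheafification induces an isomorphism `(M ⊗ P)^# ≅ (M ⊗ P^#)^#`. -/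
lemma isIso_sheafify_whiskerLeft_toSh {M : A.PMod} (hM : LocFG M) (P : A.PMod) :
    IsIso (A.sheafify.map (M ◁ toSh P)) :=
  isIso_sheafify _ ((locInj_toSh P).whiskerLeft (locSurj_toSh P) hM) ((locSurj_toSh P).whiskerLeft M)

/-- The functor `F ↦ (M ⊗ F)^#` on sheaves of modules. -/
def shTensor (M : A.PMod) : A.Mod ⥤ A.Mod := A.forget ⋙ tensorLeft M ⋙ A.sheafify

/-- Sheafification commutes with `M ⊗ -`. -/
def sheafifyTensorIso {M : A.PMod} (hM : LocFG M) : tensorLeft M ⋙ A.sheafify ≅ A.sheafify ⋙ shTensor M :=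
  NatIso.ofComponents (fun P ↦ @asIso _ _ _ _ (A.sheafify.map (M ◁ toSh P)) (isIso_sheafify_whiskerLeft_toSh hM P))
    (fun {P Q} f ↦ by
      change A.sheafify.map (M ◁ f) ≫ A.sheafify.map (M ◁ toSh Q) = A.sheafify.map (M ◁ toSh P) ≫
        A.sheafify.map (M ◁ A.forget.map (A.sheafify.map f))
      rw [← Functor.map_comp, ← Functor.map_comp, ← whiskerLeft_comp, ← whiskerLeft_comp, toSh_naturality])

instance (M : A.PMod) : (tensorLeft M).Additive where
  map_add {P Q f g} := tensor_hom_ext fun U p q ↦ by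
    change tm p (ap f U q + ap g U q) = tm p (ap f U q) + tm p (ap g U q)
    rw [tm_add]

instance (M : A.PMod) : (shTensor M).Additive := by unfold shTensor; infer_instance

/-- Finite colimits of sheaves are sheafified colimits of presheaves, and on sheafifications the
functor agrees with the presheaf tensor product followed by sheafification, which preserves
colimits. -/
lemma preservesFiniteColimits_shTensor {M : A.PMod} (hM : LocFG M) : PreservesFiniteColimits (shTensor M) where
  preservesFiniteColimits J _ _ := ⟨fun {K} ↦ by
    have h₁ : PreservesColimit (K ⋙ A.forget) (A.sheafify ⋙ shTensor M) :=
      preservesColimit_of_natIso _ (sheafifyTensorIso hM)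
    have h₂ : PreservesColimit (K ⋙ A.forget ⋙ A.sheafify) (shTensor M) :=
      preservesColimit_of_preserves_colimit_cocone
        (isColimitOfPreserves A.sheafify (colimit.isColimit (K ⋙ A.forget)))
        (isColimitOfPreserves (A.sheafify ⋙ shTensor M) (colimit.isColimit (K ⋙ A.forget)))
    exact preservesColimit_of_iso_diagram (K₁ := K ⋙ A.forget ⋙ A.sheafify) _
      (Functor.isoWhiskerLeft K (asIso A.sheafifyAdj.counit))⟩

end AlgSheaf
end SqZeroThickening
end

/-! ### Sections of a thickening: j_*, the ideal and its multiplication. -/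

noncomputable section
namespace SqZeroThickening

namespace AlgSheaf
variable {k : Type u} [CommRing k] {X : TopCat.{u}} {A : AlgSheaf k X}

lemma sheafify_hom_ext {P : A.PMod} {F : A.Mod} {f g : A.sheafify.obj P ⟶ F}
    (h : toSh P ≫ A.forget.map f = toSh P ≫ A.forget.map g) : f = g := by
  apply (A.sheafifyAdj.homEquiv _ _).injective
  rw [Adjunction.homEquiv_unit, Adjunction.homEquiv_unit]
  exact h

lemma toSh_homEquiv_symm {P : A.PMod} {F : A.Mod} (f : P ⟶ A.forget.obj F) :
    toSh P ≫ A.forget.map ((A.sheafifyAdj.homEquiv _ _).symm f) = f := by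
  have := (A.sheafifyAdj.homEquiv _ _).apply_symm_apply f
  rwa [Adjunction.homEquiv_unit] at this

/-- Construction of a morphism of presheaves of modules on sections. -/
def mkHom {P Q : A.PMod} (φ : ∀ U, Sec P U →+ Sec Q U)
    (hr : ∀ {U V : Opens X} (h : V ≤ U) (s : Sec P U), φ V (rs P h s) = rs Q h (φ U s))
    (hs : ∀ (U : Opens X) (r : A.sheaf.obj.obj (op U)) (s : Sec P U), φ U (r • s) = r • φ U s) : P ⟶ Q :=
  PresheafOfModules.homMk
    { app U := AddCommGrpCat.ofHom (φ U.unop)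
      naturality U V f := by
        ext s
        exact hr (leOfHom f.unop) s }
    (fun U r s ↦ hs U.unop r s)

/-- The category of sheaves of modules is the category with the section maps as morphisms. -/
lemma exists_mod_hom {F G : A.Mod} (φ : A.forget.obj F ⟶ A.forget.obj G) : ∃ f : F ⟶ G, A.forget.map f = φ :=
  A.forget.map_surjective φ

end AlgSheaf

open AlgSheaf

namespace Thickening
variable {k : Type u} [CommRing k] {X : TopCat.{u}} {A : AlgSheaf k X} (S : Thickening A)

/-- Sections of `j_*B` are sections of `B`. -/
def psec (B : A.Mod) (U : Opens X) : Sec (A.forget.obj B) U ≃+ Sec (S.total.forget.obj (S.push.obj B)) U :=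
  AddEquiv.refl _

lemma smul_psec (B : A.Mod) (U : Opens X) (r : S.total.sheaf.obj.obj (op U)) (b : Sec (A.forget.obj B) U) :
    r • S.psec B U b = S.psec B U (S.proj.app U r • b) := rfl

lemma rs_psec (B : A.Mod) {U V : Opens X} (h : V ≤ U) (b : Sec (A.forget.obj B) U) :
    rs _ h (S.psec B U b) = S.psec B V (rs _ h b) := rfl

lemma psec_surj (B : A.Mod) (U : Opens X) (t : Sec (S.total.forget.obj (S.push.obj B)) U) : ∃ b, S.psec B U b = t :=
  (S.psec B U).surjective t

/-- The inclusion of the ideal on sections. -/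
def inc (U : Opens X) : Sec S.idealO U →ₗ[S.total.sheaf.obj.obj (op U)] S.total.sheaf.obj.obj (op U) :=
  ap S.inclO U

lemma inc_injective (U : Opens X) : Function.Injective (S.inc U) := S.incl_injective (op U)

lemma proj_inc (U : Opens X) (j : Sec S.idealO U) : S.proj.app U (S.inc U j) = 0 := (S.exact U _).2 ⟨j, rfl⟩

lemma exists_inc {U : Opens X} {s : S.total.sheaf.obj.obj (op U)} (h : S.proj.app U s = 0) : ∃ j, S.inc U j = s :=
  (S.exact U s).1 h

lemma inc_rs {U V : Opens X} (h : V ≤ U) (j : Sec S.idealO U) : S.inc V (rs _ h j) = S.total.res h (S.inc U j) :=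
  ap_rs S.inclO h j

lemma inc_smul_psec (B : A.Mod) (U : Opens X) (j : Sec S.idealO U) (b : Sec (A.forget.obj B) U) :
    S.inc U j • S.psec B U b = 0 := by
  rw [smul_psec, proj_inc, zero_smul, map_zero]

lemma inc_smul (B : A.Mod) (U : Opens X) (j : Sec S.idealO U) (b : Sec (S.total.forget.obj (S.push.obj B)) U) :
    S.inc U j • b = 0 := S.inc_smul_psec B U j b

lemma inc_smul' (U : Opens X) (j j' : Sec S.idealO U) : S.inc U j • j' = 0 := S.inc_smul S.ideal U j j'

lemma proj_res {U V : Opens X} (h : V ≤ U) (s : S.total.sheaf.obj.obj (op U)) :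
    S.proj.app V (S.total.res h s) = A.res h (S.proj.app U s) :=
  ConcreteCategory.congr_hom (S.proj.hom.hom.naturality (homOfLE h).op) s

/-- The opens on which the projection `O_S ⟶ A` is surjective, hereditarily. -/
def SurjOn (U : Opens X) : Prop := ∀ V ≤ U, Function.Surjective (S.proj.app V)

lemma exists_surjOn (U : Opens X) (x : X) (hx : x ∈ U) : ∃ V ≤ U, x ∈ V ∧ S.SurjOn V := by
  obtain ⟨V, hV, σ, hσ, -⟩ := S.locallySplit x
  exact ⟨U ⊓ V, inf_le_left, ⟨hx, hV⟩, fun W hW a ↦ ⟨σ W (hW.trans inf_le_right) a, hσ _ _ _⟩⟩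

lemma exists_proj (U : Opens X) (a : A.sheaf.obj.obj (op U)) (x : X) (hx : x ∈ U) :
    ∃ (V : Opens X) (h : V ≤ U), x ∈ V ∧ ∃ s, S.proj.app V s = A.res h a := by
  obtain ⟨V, hV, hxV, h⟩ := S.exists_surjOn U x hx
  exact ⟨V, hV, hxV, h V le_rfl _⟩

/-- Near every point the ideal has a basis over `A`. -/
lemma exists_basis (U : Opens X) (x : X) (hx : x ∈ U) : ∃ V ≤ U, x ∈ V ∧ S.SurjOn V ∧
    ∃ n : ℕ, Nonempty (Module.Basis (Fin n) (A.sheaf.obj.obj (op V)) (Sec (A.forget.obj S.ideal) V)) := by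
  obtain ⟨V₀, hV₀, hxV₀, h₀⟩ := S.exists_surjOn U x hx
  obtain ⟨V₁, hxV₁, n, e, he⟩ := S.locallyFree x
  refine ⟨V₀ ⊓ V₁, inf_le_left.trans hV₀, ⟨hxV₀, hxV₁⟩, fun W hW ↦ h₀ W (hW.trans inf_le_left), n, ⟨?_⟩⟩
  refine Module.Basis.ofEquivFun (LinearEquiv.ofBijective
    (Fintype.linearCombination (A.sheaf.obj.obj (op (V₀ ⊓ V₁))) (fun i ↦ rs _ inf_le_right (e i))) ?_).symm
  exact he (V₀ ⊓ V₁) inf_le_right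

lemma locFG_idealO : LocFG S.idealO := by
  intro U x hx
  obtain ⟨V, hV, hxV, hs, n, ⟨b⟩⟩ := S.exists_basis U x hx
  refine ⟨V, hV, hxV, n, fun i ↦ S.psec S.ideal V (b i), fun p ↦ ?_⟩
  obtain ⟨p, rfl⟩ := S.psec_surj _ _ p
  choose a ha using fun i ↦ hs V le_rfl (b.repr p i)
  refine ⟨a, ?_⟩
  simp only [smul_psec, ha]
  rw [← map_sum, b.sum_repr]

lemma ap_preMul (P : S.total.PMod) (U : Opens X) (j : Sec S.idealO U) (p : Sec P U) :
    ap (S.preMul.app P) U (tm j p) = S.inc U j • p := rfl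

/-- The map from the presheaf tensor product to `I ⊗ F`. -/
def toI (F : S.total.Mod) : S.idealO ⊗ S.total.forget.obj F ⟶ S.total.forget.obj (S.idealT.obj F) := toSh _

lemma locSurj_toI (F : S.total.Mod) : LocSurj (S.toI F) := locSurj_toSh (S.idealO ⊗ S.total.forget.obj F)

lemma toI_naturality {F G : S.total.Mod} (f : F ⟶ G) :
    S.toI F ≫ S.total.forget.map (S.idealT.map f) = S.idealO ◁ S.total.forget.map f ≫ S.toI G :=
  (toSh_naturality (S.idealO ◁ S.total.forget.map f)).symm

lemma toI_mul (F : S.total.Mod) :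
    S.toI F ≫ S.total.forget.map (S.mul.app F) = S.preMul.app (S.total.forget.obj F) :=
  pmod_hom_ext fun U t ↦ (congrArg (fun m ↦ ap m U (ap (S.toI F) U t)) (S.total.forget.map_comp
    (S.total.sheafify.map (S.preMul.app (S.total.forget.obj F))) (ofSh F))).trans
      ((congrArg (ap (S.total.forget.map (ofSh F)) U) (ap_toSh _ _ _)).trans (ap_ofSh _ _ _))

lemma ap_mul (F : S.total.Mod) (U : Opens X) (j : Sec S.idealO U) (m : Sec (S.total.forget.obj F) U) :
    ap (S.total.forget.map (S.mul.app F)) U (ap (S.toI F) U (tm j m)) = S.inc U j • m :=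
  congrArg (fun f ↦ ap f U (tm j m)) (S.toI_mul F)

lemma ap_idealT_map {F G : S.total.Mod} (f : F ⟶ G) (U : Opens X) (t : Sec (S.idealO ⊗ S.total.forget.obj F) U) :
    ap (S.total.forget.map (S.idealT.map f)) U (ap (S.toI F) U t) =
      ap (S.toI G) U (ap (S.idealO ◁ S.total.forget.map f) U t) :=
  congrArg (fun f ↦ ap f U t) (S.toI_naturality f)

lemma idealT_hom_ext {F G : S.total.Mod} {f g : S.idealT.obj F ⟶ G}
    (h : ∀ U (j : Sec S.idealO U) (m : Sec (S.total.forget.obj F) U),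
      ap (S.total.forget.map f) U (ap (S.toI F) U (tm j m)) = ap (S.total.forget.map g) U (ap (S.toI F) U (tm j m))) :
    f = g :=
  sheafify_hom_ext (tensor_hom_ext h)

lemma mul_app_push (B : A.Mod) : S.mul.app (S.push.obj B) = 0 :=
  S.idealT_hom_ext fun U j m ↦ by
    rw [Functor.map_zero, ap_zero]
    exact (S.ap_mul _ U _ _).trans (S.inc_smul B U j m)

lemma inc_smul_tm (P : S.total.PMod) (U : Opens X) (j : Sec S.idealO U) (t : Sec (S.idealO ⊗ P) U) :
    S.inc U j • t = 0 := by
  induction t using tm_induction with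
  | zero => exact smul_zero _
  | tm p q => rw [← smul_tm, inc_smul', zero_tm]
  | add s t hs ht => rw [smul_add, hs, ht, add_zero]

lemma inc_smul_idealT (F : S.total.Mod) (U : Opens X) (j : Sec S.idealO U)
    (t : Sec (S.total.forget.obj (S.idealT.obj F)) U) : S.inc U j • t = 0 := by
  refine sec_eq_zero _ fun x hx ↦ ?_
  obtain ⟨V, hV, hxV, p, hp⟩ := S.locSurj_toI F U t x hx
  refine ⟨V, hV, hxV, ?_⟩
  rw [rs_smul, ← inc_rs]
  refine (congrArg (S.inc V (rs _ hV j) • ·) hp.symm).trans ?_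
  exact (map_smul (ap (S.toI F) V) _ _).symm.trans ((congrArg (ap (S.toI F) V) (S.inc_smul_tm _ V _ p)).trans (map_zero _))

lemma mul_app_idealT (F : S.total.Mod) : S.mul.app (S.idealT.obj F) = 0 :=
  S.idealT_hom_ext fun U j m ↦ by
    rw [Functor.map_zero, ap_zero]
    exact (S.ap_mul _ U _ _).trans (S.inc_smul_idealT F U j m)

instance : S.push.Faithful where
  map_injective {B _} _ _ h := mod_hom_ext fun U s ↦
    congrArg (fun m ↦ ap (S.total.forget.map m) U (S.psec B U s)) h

/-- O_S → A is locally surjective and linearity can be tested locally, so an O_S-linear map between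
A-modules is A-linear. -/
instance : S.push.Full where
  map_surjective {B B'} f := by
    obtain ⟨g, hg⟩ := exists_mod_hom (F := B) (G := B') (mkHom
      (fun U ↦ ((ap (S.total.forget.map f) U).toAddMonoidHom : Sec (A.forget.obj B) U →+ Sec (A.forget.obj B') U))
      (fun h s ↦ ap_rs (S.total.forget.map f) h s)
      (fun U a s ↦ sec_ext B' fun x hx ↦ by
        obtain ⟨V, hV, hxV, r, hr⟩ := S.exists_proj U a x hx
        refine ⟨V, hV, hxV, ?_⟩
        have h₁ := ap_rs (S.total.forget.map f) hV (S.psec B U (a • s))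
        have h₂ := ap_rs (S.total.forget.map f) hV (S.psec B U s)
        rw [rs_psec, rs_smul, ← hr, ← smul_psec, map_smul, ← rs_psec, h₂] at h₁
        refine Eq.trans h₁.symm ?_
        refine Eq.trans ?_ (rs_smul (A.forget.obj B') hV a _).symm
        rw [← hr]
        rfl))
    exact ⟨g, mod_hom_ext fun U s ↦ congrArg (fun m ↦ S.psec B' U (ap m U ((S.psec B U).symm s))) hg⟩

instance : S.push.PreservesEpimorphisms where
  preserves {B B'} f _ := epi_of_locSurj _ fun U s x hx ↦ by
    obtain ⟨V, hV, hxV, p, hp⟩ := locSurj_of_epi f U s x hx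
    exact ⟨V, hV, hxV, S.psec B V p, congrArg (S.psec B' V) hp⟩

end Thickening
end SqZeroThickening
end

/-! ### Exactness of I ⊗ j_*(-), and an explicit model of j^*F. -/

noncomputable section
namespace SqZeroThickening
open AlgSheaf

lemma exact_of_comp_iso {C : Type v} [Category.{u} C] [Abelian C] {K L M N : C} (f : K ⟶ L) (g : L ⟶ M)
    (w : f ≫ g = 0) (e : M ≅ N) (g' : L ⟶ N) (h : g ≫ e.hom = g') (w' : f ≫ g' = 0)
    (hS : (ShortComplex.mk f g w).Exact) : (ShortComplex.mk f g' w').Exact :=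
  ShortComplex.exact_of_iso (S₁ := ShortComplex.mk f g w)
    (ShortComplex.isoMk (Iso.refl _) (Iso.refl _) e (by simp) (by simp [h])) hS

namespace Thickening
variable {k : Type u} [CommRing k] {X : TopCat.{u}} {A : AlgSheaf k X} (S : Thickening A)
open scoped TensorProduct

/-- The map `i ⊗ b ↦ c(i) b` for a linear form `c` on the ideal. -/
def contract (B : A.Mod) (U : Opens X) (c : Sec (A.forget.obj S.ideal) U →ₗ[A.sheaf.obj.obj (op U)] A.sheaf.obj.obj (op U)) :
    Sec (S.idealO ⊗ S.total.forget.obj (S.push.obj B)) U →ₗ[S.total.sheaf.obj.obj (op U)]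
      Sec (S.total.forget.obj (S.push.obj B)) U :=
  TensorProduct.lift (LinearMap.mk₂ _
    (fun (j : Sec S.idealO U) (b : Sec (S.total.forget.obj (S.push.obj B)) U) ↦
      S.psec B U (c ((S.psec S.ideal U).symm j) • (S.psec B U).symm b))
    (fun j j' b ↦ by rw [map_add, map_add, add_smul, map_add])
    (fun r j b ↦ by
      have : (S.psec S.ideal U).symm (r • j) = S.proj.app U r • (S.psec S.ideal U).symm j := rfl
      rw [this, c.map_smul, smul_psec, smul_eq_mul, mul_smul])
    (fun j b b' ↦ by rw [map_add, smul_add, map_add])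
    (fun r j b ↦ by
      have : (S.psec B U).symm (r • b) = S.proj.app U r • (S.psec B U).symm b := rfl
      rw [this, smul_psec, smul_comm]))

lemma contract_tm (B : A.Mod) (U : Opens X)
    (c : Sec (A.forget.obj S.ideal) U →ₗ[A.sheaf.obj.obj (op U)] A.sheaf.obj.obj (op U))
    (j : Sec (A.forget.obj S.ideal) U) (b : Sec (A.forget.obj B) U) :
    S.contract B U c (tm (S.psec S.ideal U j) (S.psec B U b)) = S.psec B U (c j • b) := rfl

/-- Near a point I has a basis, a tensor is a sum of bᵢ ⊗ qᵢ, and contracting with the coordinate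
forms isolates each f(qᵢ); injectivity of f then gives qᵢ = 0. -/
lemma locInj_whiskerLeft_push {B B' : A.Mod} (f : B ⟶ B') [Mono f] :
    LocInj (S.idealO ◁ S.total.forget.map (S.push.map f)) := by
  intro U t ht x hx
  obtain ⟨V, hV, hxV, hs, n, ⟨b⟩⟩ := S.exists_basis U x hx
  refine ⟨V, hV, hxV, ?_⟩
  have he : ∀ p, ∃ a : Fin n → S.total.sheaf.obj.obj (op V), p = ∑ i, a i • S.psec S.ideal V (b i) := by
    intro p
    obtain ⟨p, rfl⟩ := S.psec_surj _ _ p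
    choose a ha using fun i ↦ hs V le_rfl (b.repr p i)
    refine ⟨a, ?_⟩
    simp only [smul_psec, ha]
    rw [← map_sum, b.sum_repr]
  obtain ⟨q, hq⟩ := exists_sum_tm he (rs _ hV t)
  have h₁ : ∑ i, tm (S.psec S.ideal V (b i)) (S.psec B' V (ap (A.forget.map f) V ((S.psec B V).symm (q i)))) = 0 := by
    have := ap_rs (S.idealO ◁ S.total.forget.map (S.push.map f)) hV t
    rw [ht, map_zero, hq, map_sum] at this
    exact this
  have h₂ : ∀ l, ap (A.forget.map f) V ((S.psec B V).symm (q l)) = 0 := by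
    intro l
    have h₃ := congrArg (S.contract B' V (b.coord l)) h₁
    rw [map_sum, map_zero] at h₃
    simp only [contract_tm] at h₃
    rw [Finset.sum_eq_single l (fun i _ hi ↦ by simp [hi]) (by simp)] at h₃
    simpa using h₃
  rw [hq]
  refine Finset.sum_eq_zero fun i _ ↦ ?_
  have h₃ := (injective_iff_map_eq_zero _).1 (injective_of_mono f V) _ (h₂ i)
  have h₄ : q i = 0 := h₃
  rw [h₄, tm_zero]

/-- The sheaf `A`, as a presheaf of `O_S`-modules. -/
abbrev AO : S.total.PMod := S.total.forget.obj (S.push.obj A.unit)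

/-- A section of `A` seen as a section of the `O_S`-module `A`. -/
def oA (U : Opens X) : A.sheaf.obj.obj (op U) ≃+ Sec S.AO U := AddEquiv.refl _

lemma smul_oA (U : Opens X) (r : S.total.sheaf.obj.obj (op U)) (a : A.sheaf.obj.obj (op U)) :
    r • S.oA U a = S.oA U (S.proj.app U r * a) := rfl

lemma oA_symm_smul (U : Opens X) (r : S.total.sheaf.obj.obj (op U)) (b : Sec S.AO U) :
    (S.oA U).symm (r • b) = S.proj.app U r * (S.oA U).symm b := rfl

lemma rs_oA {U V : Opens X} (h : V ≤ U) (a : A.sheaf.obj.obj (op U)) :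
    rs S.AO h (S.oA U a) = S.oA V (A.res h a) := rfl

lemma tensorAO_induction {P : S.total.PMod} {U : Opens X} {motive : Sec (S.AO ⊗ P) U → Prop} (zero : motive 0)
    (tm : ∀ a p, motive (tm (S.oA U a) p)) (add : ∀ s t, motive s → motive t → motive (s + t))
    (t : Sec (S.AO ⊗ P) U) : motive t :=
  tm_induction zero (fun b p ↦ tm ((S.oA U).symm b) p) add t

/-- Multiplication by a section of `A`. -/
def mulA (U : Opens X) (a : A.sheaf.obj.obj (op U)) : Sec S.AO U →ₗ[S.total.sheaf.obj.obj (op U)] Sec S.AO U where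
  toFun b := S.oA U (a * (S.oA U).symm b)
  map_add' b b' := by rw [map_add, mul_add, map_add]
  map_smul' r b := by rw [oA_symm_smul, mul_left_comm, ← smul_oA]; rfl

/-- The action of a section of `A` on `A ⊗ P`. -/
def act (P : S.total.PMod) (U : Opens X) (a : A.sheaf.obj.obj (op U)) :
    Sec (S.AO ⊗ P) U →ₗ[S.total.sheaf.obj.obj (op U)] Sec (S.AO ⊗ P) U :=
  TensorProduct.map (S.mulA U a) LinearMap.id

lemma act_tm (P : S.total.PMod) (U : Opens X) (a b : A.sheaf.obj.obj (op U)) (p : Sec P U) :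
    S.act P U a (tm (S.oA U b) p) = tm (S.oA U (a * b)) p := rfl

/-- The action of `A` on `A ⊗ P`. -/
def actA (P : S.total.PMod) (U : Opens X) :
    A.sheaf.obj.obj (op U) →+* Module.End (S.total.sheaf.obj.obj (op U)) (Sec (S.AO ⊗ P) U) where
  toFun a := S.act P U a
  map_one' := LinearMap.ext (S.tensorAO_induction (by rw [map_zero, map_zero])
    (fun a p ↦ by rw [act_tm, one_mul]; rfl) (fun s t hs ht ↦ by rw [map_add, map_add, hs, ht]))
  map_mul' a a' := LinearMap.ext (S.tensorAO_induction (by rw [map_zero, map_zero])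
    (fun b p ↦ by rw [act_tm, Module.End.mul_apply, act_tm, act_tm, mul_assoc])
    (fun s t hs ht ↦ by rw [map_add, map_add, hs, ht]))
  map_zero' := LinearMap.ext (S.tensorAO_induction (by rw [map_zero, map_zero])
    (fun b p ↦ by rw [act_tm, zero_mul, map_zero, zero_tm]; rfl)
    (fun s t hs ht ↦ by rw [map_add, map_add, hs, ht]))
  map_add' a a' := LinearMap.ext (S.tensorAO_induction (by rw [map_zero, map_zero])
    (fun b p ↦ by rw [act_tm, LinearMap.add_apply, act_tm, act_tm, add_mul, map_add, add_tm])
    (fun s t hs ht ↦ by rw [map_add, map_add, hs, ht]))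

lemma actA_tm (P : S.total.PMod) (U : Opens X) (a b : A.sheaf.obj.obj (op U)) (p : Sec P U) :
    S.actA P U a (tm (S.oA U b) p) = tm (S.oA U (a * b)) p := rfl

lemma rs_actA (P : S.total.PMod) {U V : Opens X} (h : V ≤ U) (a : A.sheaf.obj.obj (op U)) (t : Sec (S.AO ⊗ P) U) :
    rs _ h (S.actA P U a t) = S.actA P V (A.res h a) (rs _ h t) := by
  induction t using S.tensorAO_induction with
  | zero => rw [map_zero, map_zero, map_zero]
  | tm b p => rw [actA_tm, rs_tm, rs_tm, rs_oA, rs_oA, map_mul, actA_tm]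
  | add s t hs ht => rw [map_add, map_add, hs, ht, map_add, map_add]

/-- The presheaf `U ↦ A(U) ⊗ P(U)` of `A`-modules. -/
def extend (P : S.total.PMod) : A.PMod :=
  letI (U : (Opens X)ᵒᵖ) : Module ((A.sheaf.obj ⋙ forget₂ CommRingCat RingCat).obj U) ((S.AO ⊗ P).presheaf.obj U) :=
    Module.compHom (Sec (S.AO ⊗ P) U.unop) (S.actA P U.unop)
  PresheafOfModules.ofPresheaf (S.AO ⊗ P).presheaf (fun _ _ f r x ↦ S.rs_actA P (leOfHom f.unop) r x)

/-- Sections of `A ⊗ P`. -/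
def esec (P : S.total.PMod) (U : Opens X) : Sec (S.AO ⊗ P) U ≃+ Sec (S.extend P) U := AddEquiv.refl _

lemma smul_esec (P : S.total.PMod) (U : Opens X) (a : A.sheaf.obj.obj (op U)) (t : Sec (S.AO ⊗ P) U) :
    a • S.esec P U t = S.esec P U (S.actA P U a t) := rfl

lemma rs_esec (P : S.total.PMod) {U V : Opens X} (h : V ≤ U) (t : Sec (S.AO ⊗ P) U) :
    rs _ h (S.esec P U t) = S.esec P V (rs _ h t) := rfl

lemma toExtend_smul (F : S.total.Mod) (U : Opens X) (r : S.total.sheaf.obj.obj (op U))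
    (m : Sec (S.total.forget.obj F) U) :
    S.psec _ U (ap (toSh (S.extend (S.total.forget.obj F))) U (S.esec _ U (tm (S.oA U 1) (r • m)))) =
      r • S.psec _ U (ap (toSh (S.extend (S.total.forget.obj F))) U (S.esec _ U (tm (S.oA U 1) m))) := by
  rw [smul_psec, ← map_smul, smul_esec, actA_tm, ← smul_tm', smul_oA]

/-- The canonical map `F ⟶ (A ⊗ F)^#`. -/
def toExtend (F : S.total.Mod) : F ⟶ S.push.obj (A.sheafify.obj (S.extend (S.total.forget.obj F))) :=
  S.total.forget.preimage (mkHom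
    (fun U ↦ ((S.psec _ U).toAddMonoidHom.comp ((ap (toSh (S.extend (S.total.forget.obj F))) U).toAddMonoidHom.comp
      (S.esec (S.total.forget.obj F) U).toAddMonoidHom)).comp (AddMonoidHom.mk' (fun m ↦ tm (S.oA U 1) m) (tm_add _)))
    (fun {_ V} h m ↦ congrArg (S.psec _ V) ((ap_rs (toSh (S.extend (S.total.forget.obj F))) h _).symm.trans
      (congrArg (fun a ↦ ap (toSh (S.extend (S.total.forget.obj F))) V (S.esec (S.total.forget.obj F) V
        (tm (S.oA V a) (rs _ h m)))) (map_one (A.res h)))).symm)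
    (fun U r m ↦ S.toExtend_smul F U r m))

lemma ap_toExtend (F : S.total.Mod) (U : Opens X) (m : Sec (S.total.forget.obj F) U) :
    ap (S.total.forget.map (S.toExtend F)) U m = S.psec _ U (ap (toSh (S.extend (S.total.forget.obj F))) U
      (S.esec _ U (tm (S.oA U 1) m))) := by
  rw [toExtend, Functor.map_preimage]
  rfl

lemma surjOn_exists_tm (P : S.total.PMod) {V : Opens X} (hV : Function.Surjective (S.proj.app V))
    (t : Sec (S.AO ⊗ P) V) : ∃ p, t = tm (S.oA V 1) p := by
  induction t using S.tensorAO_induction with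
  | zero => exact ⟨0, (tm_zero _).symm⟩
  | tm a p =>
    obtain ⟨r, rfl⟩ := hV a
    exact ⟨r • p, by rw [← smul_tm', smul_oA, mul_one]⟩
  | add s t hs ht =>
    obtain ⟨p, rfl⟩ := hs
    obtain ⟨q, rfl⟩ := ht
    exact ⟨p + q, (tm_add _ _ _).symm⟩

/-- The relation is read off from A ⊗ P → P/IP, a ⊗ p ↦ σ(a)p. The lift σ is only a map of sets: its
failure to be additive or linear takes values in the ideal, which acts by zero on P/IP. -/
lemma exists_preMul_of_tm_eq_zero (P : S.total.PMod) {V : Opens X} (hV : Function.Surjective (S.proj.app V))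
    {p : Sec P V} (hp : tm (S.oA V 1) p = 0) : ∃ t, ap (S.preMul.app P) V t = p := by
  let N : Submodule (S.total.sheaf.obj.obj (op V)) (Sec P V) := LinearMap.range (ap (S.preMul.app P) V)
  have hN : ∀ r p, S.proj.app V r = 0 → r • p ∈ N := by
    intro r p hr
    obtain ⟨j, rfl⟩ := S.exists_inc hr
    exact ⟨tm j p, S.ap_preMul P V j p⟩
  obtain ⟨σ, hσ⟩ := hV.hasRightInverse
  let φ : Sec (S.AO ⊗ P) V →ₗ[S.total.sheaf.obj.obj (op V)] (Sec P V ⧸ N) :=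
    TensorProduct.lift (LinearMap.mk₂ _ (fun (a : Sec S.AO V) (p : Sec P V) ↦ N.mkQ (σ ((S.oA V).symm a) • p))
      (fun a a' p ↦ by
        rw [← map_add, ← sub_eq_zero, ← map_sub, ← add_smul, ← sub_smul]
        refine (Submodule.Quotient.mk_eq_zero N).2 (hN _ _ ?_)
        rw [map_sub, map_add, map_add, hσ, hσ, hσ, sub_self])
      (fun r a p ↦ by
        rw [← map_smul, ← sub_eq_zero, ← map_sub, ← mul_smul, ← sub_smul]
        refine (Submodule.Quotient.mk_eq_zero N).2 (hN _ _ ?_)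
        rw [map_sub, map_mul, hσ, hσ, oA_symm_smul, sub_self])
      (fun a p p' ↦ by rw [smul_add, map_add])
      (fun r a p ↦ by rw [smul_comm, map_smul]))
  have h : N.mkQ (σ 1 • p) = 0 := (congrArg φ hp).trans (map_zero φ)
  have h₁ : σ 1 • p ∈ N := (Submodule.Quotient.mk_eq_zero N).1 h
  have h₂ : (σ 1 - 1) • p ∈ N := hN _ _ (by rw [map_sub, map_one, hσ, sub_self])
  have h₃ : p ∈ N := by
    have := N.sub_mem h₁ h₂
    rwa [sub_smul, one_smul, sub_sub_cancel] at this
  exact h₃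

lemma epi_toExtend (F : S.total.Mod) : Epi (S.toExtend F) := by
  refine epi_of_locSurj _ fun U s x hx ↦ ?_
  obtain ⟨s, rfl⟩ := S.psec_surj _ _ s
  obtain ⟨V, hV, hxV, t, ht⟩ := locSurj_toSh (S.extend (S.total.forget.obj F)) U s x hx
  obtain ⟨W, hW, hxW, hs⟩ := S.exists_surjOn V x hxV
  obtain ⟨t, rfl⟩ := (S.esec _ V).surjective t
  obtain ⟨p, hp⟩ := S.surjOn_exists_tm _ (hs W le_rfl) (rs _ hW t)
  refine ⟨W, hW.trans hV, hxW, p, ?_⟩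
  rw [ap_toExtend, ← hp, ← rs_esec, ap_rs, ht, rs_rs, rs_psec]

lemma mul_toExtend (F : S.total.Mod) : S.mul.app F ≫ S.toExtend F = 0 := by
  have h := S.mul.naturality (S.toExtend F)
  rw [mul_app_push, comp_zero] at h
  exact h.symm

lemma exists_preMul_of_toExtend (F : S.total.Mod) (U : Opens X) (m : Sec (S.total.forget.obj F) U)
    (hm : ap (S.total.forget.map (S.toExtend F)) U m = 0) (x : X) (hx : x ∈ U) :
    ∃ (V : Opens X) (h : V ≤ U), x ∈ V ∧ ∃ t, ap (S.preMul.app (S.total.forget.obj F)) V t = rs _ h m := by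
  rw [ap_toExtend] at hm
  obtain ⟨V, hV, hxV, h₁⟩ := locInj_toSh _ U _ ((S.psec _ U).injective (hm.trans (map_zero _).symm)) x hx
  obtain ⟨W, hW, hxW, hs⟩ := S.exists_surjOn V x hxV
  have h₂ : tm (S.oA W 1) (rs _ (hW.trans hV) m) = 0 := by
    have h₃ := congrArg (rs _ hW) h₁
    rw [rs_rs, rs_esec, rs_tm, rs_oA, map_one, map_zero] at h₃
    exact (S.esec _ W).injective (h₃.trans (map_zero _).symm)
  obtain ⟨t, ht⟩ := S.exists_preMul_of_tm_eq_zero _ (hs W le_rfl) h₂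
  exact ⟨W, hW.trans hV, hxW, t, ht⟩

lemma exact_toExtend (F : S.total.Mod) : (ShortComplex.mk _ _ (S.mul_toExtend F)).Exact := by
  refine exact_of_locExact _ _ _ fun U m hm x hx ↦ ?_
  obtain ⟨W, hW, hxW, t, ht⟩ := S.exists_preMul_of_toExtend F U m hm x hx
  exact ⟨W, hW, hxW, ap (S.toI F) W t, (congrArg (fun f ↦ ap f W t) (S.toI_mul F)).trans ht⟩

/-- The unit of the adjunction between `j^*` and `j_*`. -/
def unitP (F : S.total.Mod) : F ⟶ S.push.obj (S.pull.obj F) := S.proj.adj.unit.app F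

lemma mul_unitP (F : S.total.Mod) : S.mul.app F ≫ S.unitP F = 0 := by
  have h := S.mul.naturality (S.unitP F)
  rw [mul_app_push, comp_zero] at h
  exact h.symm

/-- j^* is given as an abstract left adjoint, and this identifies its unit with the explicit map F →
(A ⊗ F)^#. One direction comes from the adjunction; the other exists because the explicit map is a
cokernel of the multiplication, which the unit kills. -/
lemma exists_iso_unitP (F : S.total.Mod) : ∃ e : S.push.obj (A.sheafify.obj (S.extend (S.total.forget.obj F))) ≅
    S.push.obj (S.pull.obj F), S.toExtend F ≫ e.hom = S.unitP F := by
  have := S.epi_toExtend F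
  let E := A.sheafify.obj (S.extend (S.total.forget.obj F))
  obtain ⟨χ, hχ⟩ := S.push.map_surjective ((S.exact_toExtend F).desc (S.unitP F) (S.mul_unitP F))
  have h₁ : S.toExtend F ≫ S.push.map χ = S.unitP F := by rw [hχ]; exact (S.exact_toExtend F).g_desc _ _
  let ψ : S.pull.obj F ⟶ E := (S.proj.adj.homEquiv _ _).symm (S.toExtend F)
  have h₂ : S.unitP F ≫ S.push.map ψ = S.toExtend F := by
    have := (S.proj.adj.homEquiv F E).apply_symm_apply (S.toExtend F)
    rwa [Adjunction.homEquiv_unit] at this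
  have h₃ : ψ ≫ χ = 𝟙 _ := by
    apply (S.proj.adj.homEquiv _ _).injective
    rw [Adjunction.homEquiv_unit, Adjunction.homEquiv_unit]
    change S.unitP F ≫ S.push.map (ψ ≫ χ) = S.unitP F ≫ S.push.map (𝟙 _)
    rw [Functor.map_comp, reassoc_of% h₂, h₁, CategoryTheory.Functor.map_id, Category.comp_id]
  have h₄ : χ ≫ ψ = 𝟙 _ := S.push.map_injective (by
    rw [← cancel_epi (S.toExtend F), Functor.map_comp, reassoc_of% h₁, h₂, CategoryTheory.Functor.map_id,
      Category.comp_id])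
  exact ⟨S.push.mapIso ⟨χ, ψ, h₄, h₃⟩, h₁⟩

lemma epi_unitP (F : S.total.Mod) : Epi (S.unitP F) := by
  obtain ⟨e, he⟩ := S.exists_iso_unitP F
  have := S.epi_toExtend F
  rw [← he]
  infer_instance

lemma exact_unitP (F : S.total.Mod) : (ShortComplex.mk _ _ (S.mul_unitP F)).Exact := by
  obtain ⟨e, he⟩ := S.exists_iso_unitP F
  exact exact_of_comp_iso _ _ (S.mul_toExtend F) e _ he (S.mul_unitP F) (S.exact_toExtend F)

lemma exists_preMul_of_unitP (F : S.total.Mod) (U : Opens X) (m : Sec (S.total.forget.obj F) U)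
    (hm : ap (S.total.forget.map (S.unitP F)) U m = 0) (x : X) (hx : x ∈ U) :
    ∃ (V : Opens X) (h : V ≤ U), x ∈ V ∧ ∃ t, ap (S.preMul.app (S.total.forget.obj F)) V t = rs _ h m := by
  obtain ⟨e, he⟩ := S.exists_iso_unitP F
  refine S.exists_preMul_of_toExtend F U m (injective_of_mono e.hom U ?_) x hx
  rw [map_zero, ← ap_comp, ← Functor.map_comp, he, hm]

end Thickening
end SqZeroThickening
end

/-! ### The axioms of `SqZeroPair` for a thickening. -/

noncomputable section
namespace SqZeroThickening
open AlgSheaf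

lemma mono_of_isIso_comp {C : Type v} [Category.{u} C] {K L M : C} {f : K ⟶ L} {g : L ⟶ M} {h : K ⟶ M}
    (e : f ≫ g = h) (hf : IsIso f) (hh : Mono h) : Mono g := by
  rw [← IsIso.eq_inv_comp] at e
  rw [e]
  exact mono_comp _ _

namespace Thickening
variable {k : Type u} [CommRing k] {X : TopCat.{u}} {A : AlgSheaf k X} (S : Thickening A)
open scoped TensorProduct

instance : S.idealT.Additive := inferInstanceAs (shTensor S.idealO).Additive

instance : PreservesFiniteColimits S.idealT := preservesFiniteColimits_shTensor S.locFG_idealO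

lemma mono_idealT_map_push {B B' : A.Mod} (f : B ⟶ B') (hf : Mono f) : Mono (S.idealT.map (S.push.map f)) :=
  mono_sheafify _ (S.locInj_whiskerLeft_push f)

/-- Move scalars across the tensor sign: j ⊗ im = ij ⊗ m, and ij = 0 since I² = 0. -/
lemma toI_smul_mul (F : S.total.Mod) (U : Opens X) (j : Sec S.idealO U)
    (t : Sec (S.idealO ⊗ S.total.forget.obj F) U) :
    tm j (ap (S.preMul.app (S.total.forget.obj F)) U t) = (0 : Sec (S.idealO ⊗ S.total.forget.obj F) U) := by
  induction t using tm_induction with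
  | zero => rw [map_zero, tm_zero]
  | tm p q =>
    refine (congrArg (tm j) (S.ap_preMul _ U p q)).trans ?_
    rw [← smul_tm', inc_smul', zero_tm]
  | add s t hs ht => rw [map_add, tm_add, hs, ht, add_zero]

lemma idealT_map_mul (F : S.total.Mod) : S.idealT.map (S.mul.app F) = 0 :=
  S.idealT_hom_ext fun U j t ↦ by
    rw [Functor.map_zero, ap_zero]
    refine (S.ap_idealT_map (S.mul.app F) U (tm j t)).trans ?_
    refine sec_eq_zero (S.idealT.obj F) fun x hx ↦ ?_
    obtain ⟨V, hV, hxV, p, hp⟩ := S.locSurj_toI F U t x hx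
    refine ⟨V, hV, hxV, ?_⟩
    have h₁ : ap (S.total.forget.map (S.mul.app F)) V (rs _ hV t) = ap (S.preMul.app (S.total.forget.obj F)) V p := by
      rw [← hp]
      exact congrArg (fun f ↦ ap f V p) (S.toI_mul F)
    have h₂ := ap_rs (S.idealO ◁ S.total.forget.map (S.mul.app F) ≫ S.toI F) hV (tm j t)
    refine h₂.symm.trans ((congrArg (fun m ↦ ap (S.toI F) V (tm (rs _ hV j) m)) h₁).trans ?_)
    exact (congrArg (ap (S.toI F) V) (S.toI_smul_mul F V _ p)).trans (map_zero _)

lemma isIso_idealT_map_unitP (F : S.total.Mod) : IsIso (S.idealT.map (S.unitP F)) := by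
  have := S.epi_unitP F
  have h := (exact_and_epi_map S.idealT _ (S.exact_unitP F)
    (by rw [← Functor.map_comp, mul_unitP, Functor.map_zero])).1
  have h₁ : Mono (S.idealT.map (S.unitP F)) := h.mono_g (S.idealT_map_mul F)
  exact isIso_of_mono_of_epi _

/-- The free presheaf of modules on a presheaf of sets. -/
abbrev freeP (T : (Opens X)ᵒᵖ ⥤ Type u) : S.total.PMod := PresheafOfModules.freeObj T

lemma injective_preMul_freeP (T : (Opens X)ᵒᵖ ⥤ Type u) (U : Opens X) :
    Function.Injective (ap (S.preMul.app (S.freeP T)) U) := by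
  have : Module.Flat (S.total.sheaf.obj.obj (op U)) (Sec (S.freeP T) U) :=
    inferInstanceAs (Module.Flat (S.total.sheaf.obj.obj (op U)) (T.obj (op U) →₀ S.total.sheaf.obj.obj (op U)))
  have h := Module.Flat.rTensor_preserves_injective_linearMap (M := Sec (S.freeP T) U) (S.inc U) (S.inc_injective U)
  exact (TensorProduct.lid (S.total.sheaf.obj.obj (op U)) (Sec (S.freeP T) U)).injective.comp h

lemma sheafify_mul (P : S.total.PMod) :
    S.total.sheafify.map (S.idealO ◁ toSh P) ≫ S.mul.app (S.total.sheafify.obj P) =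
      S.total.sheafify.map (S.preMul.app P) := by
  have h₁ := S.preMul.naturality (toSh P)
  have h₂ : S.total.sheafify.map (toSh P) ≫ ofSh (S.total.sheafify.obj P) = 𝟙 _ :=
    S.total.sheafifyAdj.left_triangle_components P
  have h₃ : S.total.sheafify.map (S.idealO ◁ toSh P) ≫
      S.total.sheafify.map (S.preMul.app (S.total.forget.obj (S.total.sheafify.obj P))) =
      S.total.sheafify.map (S.preMul.app P) ≫ S.total.sheafify.map (toSh P) :=
    (Functor.map_comp _ _ _).symm.trans ((congrArg S.total.sheafify.map h₁).trans (Functor.map_comp _ _ _))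
  exact (Category.assoc _ _ _).symm.trans ((congrArg (· ≫ ofSh _) h₃).trans
    ((Category.assoc _ _ _).trans ((congrArg (_ ≫ ·) h₂).trans (Category.comp_id _))))

/-- Over each open set a free module is flat, so tensoring with it preserves the inclusion of the
ideal; sheafification commutes with I ⊗ - up to isomorphism and preserves injectivity. -/
lemma mono_mul_free (T : (Opens X)ᵒᵖ ⥤ Type u) : Mono (S.mul.app (S.total.sheafify.obj (S.freeP T))) := by
  have h₁ : IsIso (S.total.sheafify.map (S.idealO ◁ toSh (S.freeP T))) :=
    isIso_sheafify_whiskerLeft_toSh S.locFG_idealO _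
  have h₂ : Mono (S.total.sheafify.map (S.preMul.app (S.freeP T))) :=
    mono_sheafify _ (LocInj.of_injective (S.injective_preMul_freeP T))
  exact mono_of_isIso_comp (S.sheafify_mul (S.freeP T)) h₁ h₂

lemma exists_epi_mono_mul (F : S.total.Mod) : ∃ (E : S.total.Mod) (p : E ⟶ F), Epi p ∧ Mono (S.mul.app E) := by
  let T := (S.total.forget.obj F).presheaf ⋙ CategoryTheory.forget _
  let p : S.freeP T ⟶ S.total.forget.obj F := PresheafOfModules.freeObjDesc (𝟙 T)
  refine ⟨S.total.sheafify.obj (S.freeP T), S.total.sheafify.map p ≫ ofSh F, ?_, S.mono_mul_free T⟩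
  have h : Epi (S.total.sheafify.map p) := epi_sheafify p (LocSurj.of_surjective fun U m ↦
    ⟨ModuleCat.freeMk (R := (S.total.sheaf.obj ⋙ forget₂ CommRingCat RingCat).obj (op U)) (X := T.obj (op U)) m,
      ModuleCat.freeDesc_apply _ _⟩)
  exact epi_comp _ _

/-- The pair of functors `j^*`, `j_*` of a thickening. -/
def pair : SqZeroPair S.total.Mod A.Mod where
  pull := S.pull
  push := S.push
  adj := S.proj.adj
  I := S.idealT
  mul := S.mul
  additive_I := inferInstance
  rightExact_I := inferInstance
  full_push := inferInstance
  faithful_push := inferInstance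
  epi_push := inferInstance
  isIso_map_unit := S.isIso_idealT_map_unitP
  mono_map_push f hf := S.mono_idealT_map_push f hf
  mul_push := S.mul_app_push
  mul_I := S.mul_app_idealT
  mul_unit := S.mul_unitP
  exact_unit := S.exact_unitP
  epi_unit := S.epi_unitP
  enough := S.exists_epi_mono_mul

end Thickening
end SqZeroThickening
end

/-! ### Principal parts of sheaves and the `snake` relation on sections. -/

noncomputable section
namespace SqZeroThickening

namespace AlgSheaf
variable {k : Type u} [CommRing k] {X : TopCat.{u}} {A : AlgSheaf k X}

/-- The principal part `(t, m)`. -/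
def pmk (P : A.PMod) (U : Opens X) (t : Sec (A.Ω ⊗ P) U) (m : Sec P U) : Sec (ppObj A.δ P) U :=
  show PPart A.δ P (op U) from (t, m)

/-- The inclusion `Ω ⊗ P ⟶ P¹(P)`. -/
def pInl (P : A.PMod) : A.Ω ⊗ P ⟶ ppObj A.δ P := (ppInl A.δ).app P

/-- The projection `P¹(P) ⟶ P`. -/
def pSnd (P : A.PMod) : ppObj A.δ P ⟶ P := (ppSnd A.δ).app P

/-- The first component of a principal part. -/
def pfst (P : A.PMod) (U : Opens X) : Sec (ppObj A.δ P) U →+ Sec (A.Ω ⊗ P) U :=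
  AddMonoidHom.mk' (fun p ↦ (show PPart A.δ P (op U) from p).1) (fun _ _ ↦ rfl)

/-- The universal derivation on sections. -/
def dA (U : Opens X) : A.sheaf.obj.obj (op U) →+ Sec A.Ω U := A.δ.d (X := op U)

lemma pfst_smul (P : A.PMod) (U : Opens X) (r : A.sheaf.obj.obj (op U)) (p : Sec (ppObj A.δ P) U) :
    pfst P U (r • p) = r • pfst P U p + tm (dA U r) (ap (pSnd P) U p) := rfl

lemma pfst_ppInl (P : A.PMod) (U : Opens X) (t : Sec (A.Ω ⊗ P) U) :
    pfst P U (ap (pInl P) U t) = t := rfl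

lemma ppInl_pfst (P : A.PMod) (U : Opens X) (p : Sec (ppObj A.δ P) U) (hp : ap (pSnd P) U p = 0) :
    ap (pInl P) U (pfst P U p) = p :=
  PPart.ext' A.δ rfl hp.symm

lemma ppInl_ppSnd (P : A.PMod) : pInl P ≫ pSnd P = 0 := rfl

lemma locSurj_ppSnd (P : A.PMod) : LocSurj (pSnd P) :=
  LocSurj.of_surjective fun U m ↦ ⟨pmk P U 0 m, rfl⟩

lemma locInj_ppInl (P : A.PMod) : LocInj (pInl P) :=
  LocInj.of_injective fun U _ _ h ↦ congrArg (pfst P U) h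

/-- The map from the presheaf tensor product to `Ω¹ ⊗ F`. -/
def toN (F : A.Mod) : A.Ω ⊗ A.forget.obj F ⟶ A.forget.obj (A.omegaT.obj F) := toSh _

/-- The map from the presheaf of principal parts to `P¹(F)`. -/
def toP (F : A.Mod) : ppObj A.δ (A.forget.obj F) ⟶ A.forget.obj (A.pp.obj F) := toSh _

lemma locSurj_toN (F : A.Mod) : LocSurj (toN F) := locSurj_toSh (A.Ω ⊗ A.forget.obj F)
lemma locInj_toN (F : A.Mod) : LocInj (toN F) := locInj_toSh (A.Ω ⊗ A.forget.obj F)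
lemma locSurj_toP (F : A.Mod) : LocSurj (toP F) := locSurj_toSh (ppObj A.δ (A.forget.obj F))
lemma locInj_toP (F : A.Mod) : LocInj (toP F) := locInj_toSh (ppObj A.δ (A.forget.obj F))

/-- The inclusion `Ω¹ ⊗ F ⟶ P¹(F)`. -/
def inlP (F : A.Mod) : A.omegaT.obj F ⟶ A.pp.obj F := A.omegaTToPP.app F

/-- The projection `P¹(F) ⟶ F`. -/
def sndP (F : A.Mod) : A.pp.obj F ⟶ F := A.ppTo.app F

lemma ap_inlP (F : A.Mod) (U : Opens X) (t : Sec (A.Ω ⊗ A.forget.obj F) U) :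
    ap (A.forget.map (inlP F)) U (ap (toN F) U t) = ap (toP F) U (ap (pInl (A.forget.obj F)) U t) :=
  ap_toSh (pInl (A.forget.obj F)) U t

lemma toP_sndP (F : A.Mod) : toP F ≫ A.forget.map (sndP F) = pSnd (A.forget.obj F) :=
  pmod_hom_ext fun U t ↦ (congrArg (fun m ↦ ap m U (ap (toP F) U t)) (A.forget.map_comp
    (A.sheafify.map (pSnd (A.forget.obj F))) (ofSh F))).trans
      ((congrArg (ap (A.forget.map (ofSh F)) U) (ap_toSh _ _ _)).trans (ap_ofSh _ _ _))

lemma ap_sndP (F : A.Mod) (U : Opens X) (p : Sec (ppObj A.δ (A.forget.obj F)) U) :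
    ap (A.forget.map (sndP F)) U (ap (toP F) U p) = ap (pSnd (A.forget.obj F)) U p :=
  congrArg (fun f ↦ ap f U p) (toP_sndP F)

lemma inlP_sndP (F : A.Mod) : inlP F ≫ sndP F = 0 := by
  have h : A.sheafify.map (pInl (A.forget.obj F)) ≫ A.sheafify.map (pSnd (A.forget.obj F)) = 0 :=
    (A.sheafify.map_comp _ _).symm.trans ((congrArg A.sheafify.map (ppInl_ppSnd _)).trans (Functor.map_zero _ _ _))
  exact (Category.assoc _ _ _).symm.trans ((congrArg (· ≫ ofSh F) h).trans zero_comp)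

lemma shortExact_inlP_sndP (F : A.Mod) : (ShortComplex.mk _ _ (inlP_sndP F)).ShortExact where
  mono_f := mono_sheafify _ (locInj_ppInl (A.forget.obj F))
  epi_g := by
    have := epi_sheafify _ (locSurj_ppSnd (A.forget.obj F))
    exact epi_comp (A.sheafify.map (pSnd (A.forget.obj F))) (ofSh F)
  exact := exact_of_locExact _ _ _ fun U s hs x hx ↦ by
    obtain ⟨V, hV, hxV, p, hp⟩ := locSurj_toP F U s x hx
    refine ⟨V, hV, hxV, ap (toN F) V (pfst _ V p), ?_⟩
    refine (ap_inlP F V _).trans ?_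
    rw [ppInl_pfst, hp]
    rw [← ap_sndP, hp, ap_rs]
    exact (congrArg (rs _ hV) hs).trans (map_zero _)

end AlgSheaf

namespace Thickening
open AlgSheaf
variable {k : Type u} [CommRing k] {X : TopCat.{u}} {A : AlgSheaf k X} (S : Thickening A)

/-- The unit `Ω¹ ⊗ F ⟶ j_*j^*(Ω¹ ⊗ F)` in terms of presheaves. -/
lemma ap_omegaUnit (F : S.total.Mod) (U : Opens X) (t : Sec (S.total.Ω ⊗ S.total.forget.obj F) U) :
    ap (S.omegaUnit F) U t = ap (S.total.forget.map (S.unitP (S.total.omegaT.obj F))) U (ap (toN F) U t) := rfl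

/-- The components of the conormal morphism. -/
def con (F : S.total.Mod) : S.idealT.obj F ⟶ S.push.obj (S.pull.obj (S.total.omegaT.obj F)) := S.idealToOmega.app F

lemma ap_con (F : S.total.Mod) (U : Opens X) (t : Sec (S.idealO ⊗ S.total.forget.obj F) U) :
    ap (S.total.forget.map (S.con F)) U (ap (S.toI F) U t) = ap (S.conormal (S.omegaUnit F)) U t :=
  congrArg (fun f ↦ ap f U t) (toSh_homEquiv_symm (S.conormal (S.omegaUnit F)))

/-- The multiplication `I ⊗ P ⟶ P` of presheaves. -/
def pMul (P : S.total.PMod) : S.idealO ⊗ P ⟶ P := S.preMul.app P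

lemma ap_pMul (P : S.total.PMod) (U : Opens X) (j : Sec S.idealO U) (p : Sec P U) :
    ap (S.pMul P) U (tm j p) = S.inc U j • p := rfl

/-- In i(t, m) = (it + di ⊗ m, im) the term it becomes zero in j_*j^*(Ω¹ ⊗ F), which leaves di ⊗ m.
-/
lemma omegaUnit_pfst_preMul (F : S.total.Mod) (U : Opens X)
    (T : Sec (S.idealO ⊗ ppObj S.total.δ (S.total.forget.obj F)) U) :
    ap (S.omegaUnit F) U (pfst _ U (ap (S.pMul (ppObj S.total.δ (S.total.forget.obj F))) U T)) =
      ap (S.conormal (S.omegaUnit F)) U (ap (S.idealO ◁ pSnd (S.total.forget.obj F)) U T) := by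
  induction T using tm_induction with
  | zero => rw [map_zero, map_zero, map_zero, map_zero, map_zero]
  | tm j p =>
    rw [ap_pMul, pfst_smul, map_add, map_smul]
    refine (congrArg (· + _) (S.inc_smul _ U j _)).trans ((zero_add _).trans ?_)
    rfl
  | add s t hs ht => rw [map_add, map_add, map_add, hs, ht, map_add, map_add]

lemma ap_preMul_naturality {P Q : S.total.PMod} (f : P ⟶ Q) (U : Opens X) (T : Sec (S.idealO ⊗ P) U) :
    ap (S.pMul Q) U (ap (S.idealO ◁ f) U T) = ap f U (ap (S.pMul P) U T) :=
  congrArg (fun m ↦ ap m U T) (S.preMul.naturality f)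

/-- After shrinking, n lifts to the presheaf Ω¹ ⊗ F and y to I ⊗ P¹(F) formed with presheaves; the
hypothesis holds for the lifts after one more shrinking, and its first component is the previous
computation. -/
lemma snake_aux (F : S.total.Mod) (U : Opens X) (y : Sec (S.total.forget.obj (S.idealT.obj (S.total.pp.obj F))) U)
    (n : Sec (S.total.forget.obj (S.total.omegaT.obj F)) U)
    (h : ap (S.total.forget.map (inlP F)) U n = ap (S.total.forget.map (S.mul.app (S.total.pp.obj F))) U y) :
    ap (S.total.forget.map (S.unitP (S.total.omegaT.obj F))) U n =
      ap (S.total.forget.map (S.con F)) U (ap (S.total.forget.map (S.idealT.map (sndP F))) U y) := by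
  refine sec_ext _ fun x hx ↦ ?_
  obtain ⟨V, hV, hxV, T, hT⟩ := S.locSurj_toI _ U y x hx
  obtain ⟨W, hW, hxW, T', hT'⟩ := (locSurj_toP F).whiskerLeft S.idealO V T x hxV
  obtain ⟨W₁, hW₁, hxW₁, w, hw⟩ := locSurj_toN F W (rs _ (hW.trans hV) n) x hxW
  have h₁ : ap (toP F) W₁ (ap (pInl (S.total.forget.obj F)) W₁ w -
      ap (S.pMul (ppObj S.total.δ (S.total.forget.obj F))) W₁ (rs _ hW₁ T')) = 0 := by
    rw [map_sub, ← ap_inlP, hw, ← ap_preMul_naturality, ap_rs _ hW₁ T', hT', rs_rs, rs_rs, ap_rs, h, sub_eq_zero]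
    rw [← ap_rs, ← rs_rs _ hV, ← hT, ap_rs, ap_rs]
    exact congrArg (rs _ _) (congrArg (fun m ↦ ap m V T) (S.toI_mul _))
  obtain ⟨W₂, hW₂, hxW₂, h₂⟩ := locInj_toP F W₁ _ h₁ x hxW₁
  rw [map_sub, sub_eq_zero, ← ap_rs, ← ap_rs, rs_rs] at h₂
  have h₃ := congrArg (pfst _ W₂) h₂
  rw [pfst_ppInl] at h₃
  have h₄ := congrArg (ap (S.omegaUnit F) W₂) h₃
  rw [omegaUnit_pfst_preMul, ap_omegaUnit, ap_rs, hw, rs_rs, rs_rs] at h₄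
  have h₅ : W₂ ≤ U := ((hW₂.trans hW₁).trans hW).trans hV
  refine ⟨W₂, h₅, hxW₂, ?_⟩
  rw [← ap_rs, h₄, ← ap_rs, ← ap_rs, ← ap_con]
  refine congrArg (ap (S.total.forget.map (S.con F)) W₂) ?_
  rw [← rs_rs _ hV ((hW₂.trans hW₁).trans hW), ← hT, ← ap_rs, ← rs_rs _ hW (hW₂.trans hW₁), ← hT',
    ap_idealT_map, ← ap_rs]
  refine congrArg (ap (S.toI F) W₂) ?_
  have h₆ : S.idealO ◁ toP F ≫ S.idealO ◁ S.total.forget.map (sndP F) =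
      S.idealO ◁ pSnd (S.total.forget.obj F) := by
    rw [← whiskerLeft_comp, toP_sndP]
  exact (congrArg (fun m ↦ ap m W₂ _) h₆).symm

end Thickening
end SqZeroThickening
end

/-! ### Local retractions of d : I → Ω¹ and injectivity of the conormal map. -/

noncomputable section
namespace SqZeroThickening

lemma span_range_kaehler_d {R B : CommRingCat.{u}} (f : R ⟶ B) :
    Submodule.span B (Set.range (fun b : B ↦ (CommRingCat.KaehlerDifferential.d (f := f) b))) = ⊤ :=
  letI := f.hom.toAlgebra
  KaehlerDifferential.span_range_derivation R B

lemma kaehler_d_induction {R B : CommRingCat.{u}} (f : R ⟶ B) {motive : CommRingCat.KaehlerDifferential f → Prop}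
    (zero : motive 0) (smul : ∀ (r s : B), motive (r • CommRingCat.KaehlerDifferential.d (f := f) s))
    (add : ∀ s t, motive s → motive t → motive (s + t)) (ω : CommRingCat.KaehlerDifferential f) : motive ω := by
  have h : ω ∈ Submodule.span B (Set.range (fun b : B ↦ (CommRingCat.KaehlerDifferential.d (f := f) b))) := by
    rw [span_range_kaehler_d]
    trivial
  induction h using Submodule.closure_induction with
  | zero => exact zero
  | add x y _ _ hx hy => exact add x y hx hy
  | smul_mem r x hx =>
    obtain ⟨s, rfl⟩ := hx
    exact smul r s

namespace AlgSheaf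
variable {k : Type u} [CommRing k] {X : TopCat.{u}} {A : AlgSheaf k X}

/-- The universal derivation with values in Kähler differentials. -/
def dK (U : Opens X) (s : A.sheaf.obj.obj (op U)) : Sec A.kaehler U :=
  CommRingCat.KaehlerDifferential.d (f := A.str.app (op U)) s

lemma kRes_dK {U V : Opens X} (h : V ≤ U) (s : A.sheaf.obj.obj (op U)) :
    A.kRes h (dK U s) = dK V (A.res h s) :=
  PresheafOfModules.DifferentialsConstruction.relativeDifferentials'_map_d A.str (homOfLE h).op s

lemma kaehler_induction {U : Opens X} {motive : Sec A.kaehler U → Prop} (zero : motive 0)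
    (smul : ∀ (r s : A.sheaf.obj.obj (op U)), motive (r • dK U s)) (add : ∀ s t, motive s → motive t → motive (s + t)) (ω : Sec A.kaehler U) :
    motive ω :=
  kaehler_d_induction (A.str.app (op U)) (motive := motive) zero smul add ω

/-- The projection from Kähler differentials to `Ω¹`. -/
def πΩ : A.kaehler ⟶ A.Ω := cokernel.π A.flatSub.ι

lemma dA_eq (U : Opens X) (s : A.sheaf.obj.obj (op U)) : dA U s = ap πΩ U (dK U s) := rfl

lemma πΩ_surjective (U : Opens X) : Function.Surjective (ap (πΩ (A := A)) U) := by
  have : Epi (πΩ (A := A)) := inferInstanceAs (Epi (cokernel.π A.flatSub.ι))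
  exact PresheafOfModules.surjective_of_epi πΩ (op U)

lemma mem_flatDiff_of_πΩ {U : Opens X} {ω : Sec A.kaehler U} (h : ap πΩ U ω = 0) : ω ∈ A.flatDiff U := by
  obtain ⟨⟨p, hp⟩, rfl⟩ := exists_of_cokernel_π_eq_zero A.flatSub.ι h
  exact hp

/-- A linear map that kills flat differentials descends to `Ω¹`. -/
lemma exists_desc_Ω {U : Opens X} {M : Type u} [AddCommGroup M] [Module (A.sheaf.obj.obj (op U)) M]
    (l : Sec A.kaehler U →ₗ[A.sheaf.obj.obj (op U)] M) (hl : ∀ ω ∈ A.flatDiff U, l ω = 0) :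
    ∃ l' : Sec A.Ω U →ₗ[A.sheaf.obj.obj (op U)] M, ∀ s, l' (dA U s) = l (dK U s) := by
  have h : LinearMap.ker (ap (πΩ (A := A)) U) ≤ LinearMap.ker l := fun ω hω ↦ hl ω (mem_flatDiff_of_πΩ hω)
  refine ⟨((LinearMap.ker (ap (πΩ (A := A)) U)).liftQ l h).comp
    ((ap (πΩ (A := A)) U).quotKerEquivOfSurjective (πΩ_surjective U)).symm.toLinearMap, fun s ↦ ?_⟩
  rw [dA_eq]
  have : ((ap (πΩ (A := A)) U).quotKerEquivOfSurjective (πΩ_surjective U)).symm (ap πΩ U (dK U s)) =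
      Submodule.Quotient.mk (dK U s) := by
    rw [LinearEquiv.symm_apply_eq]
    rfl
  exact congrArg ((LinearMap.ker (ap (πΩ (A := A)) U)).liftQ l h) this

/-- The linear map on Kähler differentials defined by a derivation. -/
lemma exists_desc_kaehler {U : Opens X} (M : ModuleCat.{u} (A.sheaf.obj.obj (op U)))
    (D : A.sheaf.obj.obj (op U) → M) (hadd : ∀ s t, D (s + t) = D s + D t)
    (hmul : ∀ s t, D (s * t) = s • D t + t • D s) (hstr : ∀ c : k, D ((A.str.app (op U)).hom c) = 0) :
    ∃ l : Sec A.kaehler U →ₗ[A.sheaf.obj.obj (op U)] M, ∀ s, l (dK U s) = D s :=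
  ⟨(ModuleCat.Derivation.mk (f := A.str.app (op U)) D hadd hmul hstr).desc.hom,
    fun s ↦ ModuleCat.Derivation.desc_d (ModuleCat.Derivation.mk (f := A.str.app (op U)) D hadd hmul hstr) s⟩

lemma eq_zero_of_germ {U : Opens X} {a : A.sheaf.obj.obj (op U)} (h : ∀ x (hx : x ∈ U), A.germ hx a = 0) : a = 0 :=
  TopCat.Presheaf.section_ext (A.sheaf : TopCat.Sheaf CommRingCat.{u} X) U a 0
    (fun x hx ↦ (h x hx).trans (map_zero (A.germ hx)).symm)

lemma exists_germ {x : X} (a : A.stalk x) : ∃ (U : Opens X) (hx : x ∈ U) (s : A.sheaf.obj.obj (op U)), A.germ hx s = a :=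
  TopCat.Presheaf.exists_germ_eq A.presheaf a

end AlgSheaf

namespace Thickening
open AlgSheaf
variable {k : Type u} [CommRing k] {X : TopCat.{u}} {A : AlgSheaf k X} (S : Thickening A)

/-- The projection on stalks. -/
def stalkProj (x : X) : S.total.stalk x →+* A.stalk x :=
  ((TopCat.Presheaf.stalkFunctor CommRingCat.{u} x).map S.proj.hom.hom).hom

lemma stalkProj_germ {U : Opens X} {x : X} (hx : x ∈ U) (s : S.total.sheaf.obj.obj (op U)) :
    S.stalkProj x (S.total.germ hx s) = A.germ hx (S.proj.app U s) :=
  TopCat.Presheaf.stalkFunctor_map_germ_apply U x hx S.proj.hom.hom s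

/-- The map of stalks is surjective, and a surjective ring map carries the Jacobson radical into the
Jacobson radical, since 1 + sy remains a unit. -/
lemma proj_mem_vanishingIdeal {U : Opens X} {x : X} (hx : x ∈ U) {s : S.total.sheaf.obj.obj (op U)}
    (hs : s ∈ S.total.vanishingIdeal U x hx) : S.proj.app U s ∈ A.vanishingIdeal U x hx := by
  change A.germ hx (S.proj.app U s) ∈ Ideal.jacobson (⊥ : Ideal (A.stalk x))
  replace hs : S.total.germ hx s ∈ Ideal.jacobson (⊥ : Ideal (S.total.stalk x)) := hs
  rw [Ideal.mem_jacobson_bot] at hs ⊢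
  intro y
  obtain ⟨V, hxV, a, rfl⟩ := exists_germ y
  obtain ⟨W, hW, hxW, t, ht⟩ := S.exists_proj V a x hxV
  have h := (hs (S.total.germ hxW t)).map (S.stalkProj x)
  rwa [map_add, map_mul, map_one, stalkProj_germ, stalkProj_germ, ht, germ_res] at h

/-- A section of `O_S ⟶ A` over `U`. -/
structure LocalSection (U : Opens X) where
  toHom : ∀ V : Opens X, V ≤ U → (A.sheaf.obj.obj (op V) →+* S.total.sheaf.obj.obj (op V))
  proj_toHom : ∀ V (hV : V ≤ U) (s : A.sheaf.obj.obj (op V)), S.proj.app V (toHom V hV s) = s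
  toHom_str : ∀ V (hV : V ≤ U) (c : k), toHom V hV ((A.str.app (op V)).hom c) = (S.total.str.app (op V)).hom c
  toHom_res : ∀ V W (hV : V ≤ U) (h : W ≤ V) (s : A.sheaf.obj.obj (op V)),
    toHom W (h.trans hV) (A.res h s) = S.total.res h (toHom V hV s)

namespace LocalSection
variable {S} {U : Opens X} (σ : S.LocalSection U) {V : Opens X} (hV : V ≤ U)

lemma exists_inc_eq (s : S.total.sheaf.obj.obj (op V)) : ∃ j, S.inc V j = s - σ.toHom V hV (S.proj.app V s) :=
  S.exists_inc (by rw [map_sub, σ.proj_toHom, sub_self])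

/-- The derivation `s ↦ s - σ s` with values in the ideal. -/
def D (s : S.total.sheaf.obj.obj (op V)) : Sec S.idealO V := (σ.exists_inc_eq hV s).choose

lemma inc_D (s : S.total.sheaf.obj.obj (op V)) : S.inc V (σ.D hV s) = s - σ.toHom V hV (S.proj.app V s) :=
  (σ.exists_inc_eq hV s).choose_spec

lemma D_inc (j : Sec S.idealO V) : σ.D hV (S.inc V j) = j :=
  S.inc_injective V (by rw [inc_D, proj_inc, map_zero, sub_zero])

lemma D_add (s t : S.total.sheaf.obj.obj (op V)) : σ.D hV (s + t) = σ.D hV s + σ.D hV t :=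
  S.inc_injective V (by simp only [map_add, inc_D]; ring)

/-- The Leibniz rule amounts to (s - σs)(t - σt) = 0, a product of two elements of the ideal. -/
lemma D_mul (s t : S.total.sheaf.obj.obj (op V)) : σ.D hV (s * t) = s • σ.D hV t + t • σ.D hV s := by
  have h : (S.inc V (σ.D hV s)) • σ.D hV t = 0 := S.inc_smul' V _ _
  have h₁ := congrArg (S.inc V) h
  apply S.inc_injective V
  simp only [map_smul, smul_eq_mul, map_zero, map_add, inc_D, map_mul] at h₁ ⊢
  linear_combination -h₁

lemma D_str (hk : ∀ c : k, S.proj.app V ((S.total.str.app (op V)).hom c) = (A.str.app (op V)).hom c) (c : k) :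
    σ.D hV ((S.total.str.app (op V)).hom c) = 0 :=
  S.inc_injective V (by rw [inc_D, hk, σ.toHom_str, sub_self, map_zero])

lemma rs_D {W : Opens X} (h : W ≤ V) (s : S.total.sheaf.obj.obj (op V)) :
    rs _ h (σ.D hV s) = σ.D (h.trans hV) (S.total.res h s) :=
  S.inc_injective W (by rw [inc_rs, inc_D, inc_D, map_sub, proj_res, σ.toHom_res])

/-- The linear map on Kähler differentials. -/
lemma exists_linearMap : ∃ l : Sec S.total.kaehler V →ₗ[S.total.sheaf.obj.obj (op V)] Sec S.idealO V,
    ∀ s, l (dK V s) = σ.D hV s :=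
  exists_desc_kaehler (S.idealO.obj (op V)) (σ.D hV) (σ.D_add hV) (σ.D_mul hV)
    (σ.D_str hV fun c ↦ congrArg (fun m ↦ (m.app (op V)).hom c) S.proj.comm)

/-- The linear map on Kähler differentials. -/
def lam : Sec S.total.kaehler V →ₗ[S.total.sheaf.obj.obj (op V)] Sec S.idealO V := (σ.exists_linearMap hV).choose

lemma lam_d (s : S.total.sheaf.obj.obj (op V)) : σ.lam hV (dK V s) = σ.D hV s := (σ.exists_linearMap hV).choose_spec s

lemma lam_kRes {W : Opens X} (h : W ≤ V) (ω : Sec S.total.kaehler V) :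
    σ.lam (h.trans hV) (S.total.kRes h ω) = rs _ h (σ.lam hV ω) := by
  induction ω using kaehler_induction with
  | zero => rw [map_zero, map_zero, map_zero, map_zero]
  | smul r s => rw [kRes_smul, map_smul, map_smul, kRes_dK, lam_d, lam_d, rs_smul, rs_D]
  | add s t hs ht => rw [map_add, map_add, hs, ht, map_add, map_add]

end LocalSection

lemma exists_localSection (x : X) : ∃ U, x ∈ U ∧ Nonempty (S.LocalSection U) := by
  obtain ⟨U, hxU, σ, h₁, h₂, h₃⟩ := S.locallySplit x
  exact ⟨U, hxU, ⟨⟨σ, h₁, h₂, h₃⟩⟩⟩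

/-- The sections `∑ cᵢ eᵢ` with all `cᵢ` in an ideal `J`. -/
lemma exists_coeff_of_mem_smul {V : Opens X} (J : Ideal (S.total.sheaf.obj.obj (op V))) (J' : Ideal (A.sheaf.obj.obj (op V)))
    (hJ : ∀ r ∈ J, S.proj.app V r ∈ J') {n : ℕ} (e : Fin n → Sec (A.forget.obj S.ideal) V)
    (he : ∀ i : Sec (A.forget.obj S.ideal) V, ∃ a : Fin n → A.sheaf.obj.obj (op V), ∑ l, a l • e l = i)
    {i : Sec S.idealO V} (hi : i ∈ J • (⊤ : Submodule (S.total.sheaf.obj.obj (op V)) (Sec S.idealO V))) :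
    ∃ a : Fin n → A.sheaf.obj.obj (op V), (∀ l, a l ∈ J') ∧ S.psec S.ideal V (∑ l, a l • e l) = i := by
  refine Submodule.smul_induction_on hi (fun r hr i _ ↦ ?_) (fun i i' hi hi' ↦ ?_)
  · obtain ⟨i, rfl⟩ := S.psec_surj _ _ i
    obtain ⟨a, rfl⟩ := he i
    refine ⟨fun l ↦ S.proj.app V r * a l, fun l ↦ J'.mul_mem_right _ (hJ r hr), ?_⟩
    rw [smul_psec, Finset.smul_sum]
    simp only [mul_smul]
  · obtain ⟨a, ha, rfl⟩ := hi
    obtain ⟨a', ha', rfl⟩ := hi'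
    refine ⟨a + a', fun l ↦ J'.add_mem (ha l) (ha' l), ?_⟩
    rw [← map_add, ← Finset.sum_add_distrib]
    simp only [Pi.add_apply, add_smul]

/-- Near x a flat differential lies in 𝔪ⁿΩ for every n, so its image has coefficients in 𝔪ⁿ with
respect to a basis of I. By uniqueness of coordinates these are restrictions of fixed coefficients
aₗ, whose germs lie in every power of the radical and hence vanish. -/
lemma LocalSection.lam_flatDiff {S : Thickening A}
    (hA : ∀ x : X, ⨅ n : ℕ, (Ideal.jacobson (⊥ : Ideal (A.stalk x))) ^ n = ⊥) {U : Opens X}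
    (σ : S.LocalSection U) {V : Opens X} (hV : V ≤ U) {n : ℕ} (e : Fin n → Sec (A.forget.obj S.ideal) V)
    (he : ∀ (W : Opens X) (h : W ≤ V), Function.Bijective
      (fun a : Fin n → A.sheaf.obj.obj (op W) ↦ ∑ i, a i • rs _ h (e i)))
    (ω : Sec S.total.kaehler V) (hω : ω ∈ S.total.flatDiff V) : σ.lam hV ω = 0 := by
  obtain ⟨a, ha⟩ := (he V le_rfl).2 ((S.psec _ V).symm (σ.lam hV ω))
  have key : ∀ l, a l = 0 := by
    refine fun l ↦ eq_zero_of_germ fun x hx ↦ ?_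
    have h₁ : A.germ hx (a l) ∈ ⨅ n : ℕ, (Ideal.jacobson (⊥ : Ideal (A.stalk x))) ^ n := by
      rw [Ideal.mem_iInf]
      intro m
      obtain ⟨W, hxW, hW, h₂⟩ := hω x hx m
      have h₃ : σ.lam (hW.trans hV) (S.total.kRes hW ω) ∈ S.total.vanishingIdeal W x hxW ^ m •
          (⊤ : Submodule (S.total.sheaf.obj.obj (op W)) (Sec S.idealO W)) := by
        have h := Submodule.mem_map_of_mem (f := σ.lam (hW.trans hV)) h₂
        rw [powDiff, Submodule.map_smul''] at h
        exact Submodule.smul_mono le_rfl le_top h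
      obtain ⟨b, hb, hb'⟩ := S.exists_coeff_of_mem_smul _ (A.vanishingIdeal W x hxW ^ m)
        (fun r hr ↦ by
          have h := Ideal.mem_map_of_mem (S.proj.app W) hr
          rw [Ideal.map_pow] at h
          have h' : (S.total.vanishingIdeal W x hxW).map (S.proj.app W) ≤ A.vanishingIdeal W x hxW :=
            Ideal.map_le_iff_le_comap.2 fun s hs ↦ S.proj_mem_vanishingIdeal hxW hs
          exact Ideal.pow_right_mono h' m h)
        (fun i ↦ rs _ hW (e i)) (he W hW).2 h₃
      have h₄ : (fun i ↦ A.res hW (a i)) = b := by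
        refine (he W hW).1 ((S.psec _ W).injective ?_)
        refine Eq.trans ?_ hb'.symm
        rw [σ.lam_kRes]
        have h₅ := congrArg (fun s ↦ S.psec S.ideal W (rs _ hW s)) ha
        simp only [map_sum, rs_smul, rs_rs] at h₅
        simp only [map_sum]
        exact h₅
      rw [← germ_res A hW hxW, congrFun h₄ l]
      have h₅ := Ideal.mem_map_of_mem (A.germ hxW) (hb l)
      rw [Ideal.map_pow] at h₅
      exact Ideal.pow_right_mono (Ideal.map_le_iff_le_comap.2 fun s hs ↦ hs) m h₅
    rwa [hA x] at h₁
  have h₀ : (S.psec _ V).symm (σ.lam hV ω) = 0 := ha.symm.trans (Finset.sum_eq_zero fun l _ ↦ by rw [key, zero_smul])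
  exact (S.psec _ V).symm.injective (h₀.trans (map_zero _).symm)

/-- Near every point the map `i ↦ d i` from the ideal to `Ω¹` has a retraction. -/
lemma exists_retraction (hA : ∀ x : X, ⨅ n : ℕ, (Ideal.jacobson (⊥ : Ideal (A.stalk x))) ^ n = ⊥) (x : X) :
    ∃ U : Opens X, x ∈ U ∧ ∀ V ≤ U, ∃ l : Sec S.total.Ω V →ₗ[S.total.sheaf.obj.obj (op V)] Sec S.idealO V,
      ∀ j, l (dA V (S.inc V j)) = j := by
  obtain ⟨U, hxU, ⟨σ⟩⟩ := S.exists_localSection x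
  obtain ⟨U', hxU', n, e, he⟩ := S.locallyFree x
  refine ⟨U ⊓ U', ⟨hxU, hxU'⟩, fun V hV ↦ ?_⟩
  obtain ⟨l, hl⟩ := exists_desc_Ω (σ.lam (hV.trans inf_le_left)) (σ.lam_flatDiff hA (hV.trans inf_le_left)
    (fun i ↦ rs _ (hV.trans inf_le_right) (e i)) (fun W hW ↦ by
      simp only [rs_rs]
      exact he W (hW.trans (hV.trans inf_le_right))))
  exact ⟨l, fun j ↦ by rw [hl, σ.lam_d, σ.D_inc]⟩

/-- For t a sum of i ⊗ m take w to be the same sum of di ⊗ m. The choice of w does not involve a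
retraction, yet every local retraction of d recovers t from w. -/
lemma exists_omegaUnit_eq_conormal (F : S.total.Mod) (U : Opens X) (t : Sec (S.idealO ⊗ S.total.forget.obj F) U) :
    ∃ w : Sec (S.total.Ω ⊗ S.total.forget.obj F) U, ap (S.conormal (S.omegaUnit F)) U t = ap (S.omegaUnit F) U w ∧
      ∀ (V : Opens X) (h : V ≤ U) (l : Sec S.total.Ω V →ₗ[S.total.sheaf.obj.obj (op V)] Sec S.idealO V),
        (∀ j, l (dA V (S.inc V j)) = j) →
          l.rTensor (Sec (S.total.forget.obj F) V) (rs (S.total.Ω ⊗ S.total.forget.obj F) h w) =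
            rs (S.idealO ⊗ S.total.forget.obj F) h t := by
  induction t using tm_induction with
  | zero => exact ⟨0, by rw [map_zero, map_zero], fun V h l _ ↦ by rw [map_zero, map_zero]; exact map_zero _⟩
  | tm j m =>
    refine ⟨tm (dA U (S.inc U j)) m, rfl, fun V h l hl ↦ ?_⟩
    have h₁ : rs _ h (dA U (S.inc U j)) = dA V (S.inc V (rs _ h j)) := by
      rw [inc_rs]
      exact (S.total.δ.d_map (homOfLE h).op _).symm
    rw [rs_tm, rs_tm, h₁]
    exact congrArg (fun i ↦ tm (P := S.idealO) (Q := S.total.forget.obj F) i (rs _ h m)) (hl _)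
  | add s t hs ht =>
    obtain ⟨v, hv, hv'⟩ := hs
    obtain ⟨w, hw, hw'⟩ := ht
    refine ⟨v + w, by rw [map_add, map_add, hv, hw], fun V h l hl ↦ ?_⟩
    rw [map_add, map_add, ← hv' V h l hl, ← hw' V h l hl]
    exact map_add _ _ _

lemma rTensor_pMul {P Q : S.total.PMod} {V : Opens X}
    (l : Sec (P ⊗ Q) V →ₗ[S.total.sheaf.obj.obj (op V)] Sec (S.idealO ⊗ Q) V)
    (T : Sec (S.idealO ⊗ (P ⊗ Q)) V) : l (ap (S.pMul (P ⊗ Q)) V T) = 0 := by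
  induction T using tm_induction with
  | zero => rw [map_zero, map_zero]
  | tm j p => rw [ap_pMul, map_smul, inc_smul_tm]
  | add s t hs ht => rw [map_add, map_add, hs, ht, add_zero]

/-- If the conormal image of t is zero, then w locally lies in I(Ω¹ ⊗ F). A retraction l maps w to
t, and l ⊗ 1 kills I(Ω¹ ⊗ F) because I acts by zero on I ⊗ F. So t is locally zero. -/
lemma locInj_conormal (hA : ∀ x : X, ⨅ n : ℕ, (Ideal.jacobson (⊥ : Ideal (A.stalk x))) ^ n = ⊥) (F : S.total.Mod) :
    LocInj (S.conormal (S.omegaUnit F)) := by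
  intro U t ht x hx
  obtain ⟨w, hw, hw'⟩ := S.exists_omegaUnit_eq_conormal F U t
  rw [ht, ap_omegaUnit] at hw
  obtain ⟨V, hV, hxV, T, hT⟩ := S.exists_preMul_of_unitP _ U _ hw.symm x hx
  obtain ⟨W, hW, hxW, T', hT'⟩ := (locSurj_toN F).whiskerLeft S.idealO V T x hxV
  have h₁ : ap (toN F) W (rs _ (hW.trans hV) w - ap (S.pMul (S.total.Ω ⊗ S.total.forget.obj F)) W T') = 0 := by
    rw [map_sub, ap_rs, ← ap_preMul_naturality, hT', ap_rs, ← rs_rs _ hV hW, ← hT, sub_eq_zero]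
    rfl
  obtain ⟨W', hW', hxW', h₂⟩ := locInj_toN F W _ h₁ x hxW
  rw [map_sub, sub_eq_zero, rs_rs, ← ap_rs] at h₂
  obtain ⟨U₀, hxU₀, hU₀⟩ := S.exists_retraction hA x
  obtain ⟨l, hl⟩ := hU₀ (W' ⊓ U₀) inf_le_right
  have h₃ := congrArg (rs _ (inf_le_left : W' ⊓ U₀ ≤ W')) h₂
  rw [rs_rs, ← ap_rs] at h₃
  refine ⟨W' ⊓ U₀, inf_le_left.trans (hW'.trans (hW.trans hV)), ⟨hxW', hxU₀⟩, ?_⟩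
  rw [← hw' _ _ l hl, h₃]
  exact S.rTensor_pMul (l.rTensor (Sec (S.total.forget.obj F) (W' ⊓ U₀))) _

lemma mono_con (hA : ∀ x : X, ⨅ n : ℕ, (Ideal.jacobson (⊥ : Ideal (A.stalk x))) ^ n = ⊥) (F : S.total.Mod) :
    Mono (S.con F) := by
  refine mono_of_locInj _ fun U s hs x hx ↦ ?_
  obtain ⟨V, hV, hxV, t, ht⟩ := S.locSurj_toI F U s x hx
  have h₁ : ap (S.conormal (S.omegaUnit F)) V t = 0 := by
    rw [← ap_con, ht, ap_rs, hs, map_zero]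
  obtain ⟨W, hW, hxW, h₂⟩ := S.locInj_conormal hA F V t h₁ x hxV
  refine ⟨W, hW.trans hV, hxW, ?_⟩
  rw [← rs_rs _ hV hW, ← ht, ← ap_rs, h₂, map_zero]

lemma snake {F M : S.total.Mod} (y : M ⟶ S.idealT.obj (S.total.pp.obj F)) (n : M ⟶ S.total.omegaT.obj F)
    (h : n ≫ inlP F = y ≫ S.mul.app (S.total.pp.obj F)) :
    n ≫ S.unitP (S.total.omegaT.obj F) = y ≫ S.idealT.map (sndP F) ≫ S.con F :=
  mod_hom_ext fun U a ↦ S.snake_aux F U (ap (S.total.forget.map y) U a) (ap (S.total.forget.map n) U a)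
    (congrArg (fun m ↦ ap (S.total.forget.map m) U a) h)

/-- The functors `Ω¹ ⊗ -` and `P¹` of a thickening. -/
def parts (hA : ∀ x : X, ⨅ n : ℕ, (Ideal.jacobson (⊥ : Ideal (A.stalk x))) ^ n = ⊥) : S.pair.PrincipalParts where
  N := S.total.omegaT
  P := S.total.pp
  zero_N := inferInstance
  zero_P := inferInstance
  inl := S.total.omegaTToPP
  snd := S.total.ppTo
  inl_snd F := inlP_sndP F
  shortExact F := shortExact_inlP_sndP F
  conormal := S.idealToOmega
  mono_conormal F := S.mono_con hA F
  snake y n h := S.snake y n h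

end Thickening
end SqZeroThickening
end

/-! ### Powers of the radical of a stalk intersect in zero; the theorem. -/

noncomputable section

namespace SqZeroThickening

section Noetherian

lemma iInf_jacobson_pow_eq_bot {R : Type*} [CommRing R] [IsNoetherianRing R] [IsLocalRing R] :
    ⨅ n : ℕ, (Ideal.jacobson (⊥ : Ideal R)) ^ n = ⊥ := by
  rw [IsLocalRing.jacobson_eq_maximalIdeal _ bot_ne_top]
  exact Ideal.iInf_pow_eq_bot_of_isLocalRing _ (IsLocalRing.maximalIdeal.isMaximal R).ne_top

variable {k : Type u} [Field k] {X : TopCat.{u}} (A : AlgSheaf k X)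

/-- A scheme locally of finite type over a field is locally noetherian. The stalks are transported
through the homeomorphism, and Krull's intersection theorem applies to noetherian local rings. -/
lemma iInf_jacobson_stalk_of_isSmoothScheme (hA : IsSmoothScheme A) (x : X) :
    ⨅ n : ℕ, (Ideal.jacobson (⊥ : Ideal (A.stalk x))) ^ n = ⊥ := by
  obtain ⟨Y, f, hf, e, φ, hφ, -⟩ := hA
  have : AlgebraicGeometry.IsLocallyNoetherian Y := AlgebraicGeometry.LocallyOfFiniteType.isLocallyNoetherian f
  let g : X ⟶ Y.toTopCat := TopCat.ofHom e
  let α : Y.presheaf ≅ (TopCat.Presheaf.pushforward CommRingCat.{u} g).obj A.presheaf :=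
    NatIso.ofComponents (fun U ↦ (φ U.unop).toCommRingCatIso) (fun {U V} i ↦ by
      ext s
      exact hφ U.unop V.unop (leOfHom i.unop) s)
  have := TopCat.Presheaf.stalkPushforward.stalkPushforward_iso_of_isInducing CommRingCat.{u} (f := g) e.isInducing
    A.presheaf x
  let i : Y.presheaf.stalk (g x) ≅ A.stalk x := (TopCat.Presheaf.stalkFunctor CommRingCat.{u} (g x)).mapIso α ≪≫
    @asIso _ _ _ _ (TopCat.Presheaf.stalkPushforward CommRingCat.{u} g A.presheaf x) this
  have h₁ : IsNoetherianRing (A.stalk x) := isNoetherianRing_of_ringEquiv _ i.commRingCatIsoToRingEquiv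
  have h₂ : IsLocalRing (A.stalk x) := i.commRingCatIsoToRingEquiv.isLocalRing
  exact iInf_jacobson_pow_eq_bot

end Noetherian

section Analytic
open Filter Topology Asymptotics

/-- A nonzero analytic germ is tⁿ g with g(0) ≠ 0, and the bound for the exponent n + 1 would force
g(0) = 0. -/
lemma eventually_eq_zero_of_isBigO {f : ℂ → ℂ} (hf : AnalyticAt ℂ f 0)
    (h : ∀ n : ℕ, f =O[𝓝 0] fun t ↦ ‖t‖ ^ n) : ∀ᶠ t in 𝓝 0, f t = 0 := by
  by_contra hc
  obtain ⟨n, g, hg, hg₀, hfg⟩ := hf.exists_eventuallyEq_pow_smul_nonzero_iff.2 hc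
  obtain ⟨c, hc⟩ := (h (n + 1)).bound
  have h₁ : ∀ᶠ t in 𝓝[≠] (0 : ℂ), ‖g t‖ ≤ c * ‖t‖ := by
    filter_upwards [hc.filter_mono nhdsWithin_le_nhds, hfg.filter_mono nhdsWithin_le_nhds, self_mem_nhdsWithin] with t h₁ h₂ h₃
    have h₄ : 0 < ‖t‖ ^ n := pow_pos (norm_pos_iff.2 h₃) n
    rw [h₂, sub_zero, smul_eq_mul, norm_mul, norm_pow, norm_pow, norm_norm, pow_succ] at h₁
    refine le_of_mul_le_mul_left ?_ h₄
    linarith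
  have h₂ : Tendsto (fun t ↦ ‖g t‖) (𝓝[≠] 0) (𝓝 ‖g 0‖) := (hg.continuousAt.norm).tendsto.mono_left nhdsWithin_le_nhds
  have h₃ : Tendsto (fun t : ℂ ↦ c * ‖t‖) (𝓝[≠] 0) (𝓝 (c * ‖(0 : ℂ)‖)) :=
    (Continuous.tendsto (by fun_prop) 0).mono_left nhdsWithin_le_nhds
  have h₄ := le_of_tendsto_of_tendsto h₂ h₃ h₁
  rw [norm_zero, mul_zero] at h₄
  exact hg₀ (norm_le_zero_iff.1 h₄)

/-- A holomorphic function on a ball that is flat at the center vanishes. -/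
lemma eq_zero_of_isBigO {E : Type*} [NormedAddCommGroup E] [NormedSpace ℂ E] {G : E → ℂ} {z₀ : E} {r : ℝ}
    (hG : DifferentiableOn ℂ G (Metric.ball z₀ r)) (h : ∀ n : ℕ, G =O[𝓝 z₀] fun z ↦ ‖z - z₀‖ ^ n)
    {z : E} (hz : z ∈ Metric.ball z₀ r) : G z = 0 := by
  -- Restriction to the complex line through z₀ and z reduces the claim to one variable; the
  -- parameter 1 gives z and lies in the disc of radius r / ‖z - z₀‖ since z is in the ball.
  let ℓ : ℂ → E := fun t ↦ z₀ + t • (z - z₀)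
  have hℓ : Differentiable ℂ ℓ := by fun_prop
  let U : Set ℂ := Metric.ball 0 (r / ‖z - z₀‖)
  have hr : 0 < r := Metric.pos_of_mem_ball hz
  rcases eq_or_ne z z₀ with rfl | hne
  · have h₁ := (h 1).bound
    obtain ⟨c, hc⟩ := h₁
    have := hc.self_of_nhds
    simpa using this
  have hp : 0 < ‖z - z₀‖ := norm_pos_iff.2 (sub_ne_zero.2 hne)
  have hU : ∀ t ∈ U, ℓ t ∈ Metric.ball z₀ r := by
    intro t ht
    have h₁ : ‖t‖ < r / ‖z - z₀‖ := by simpa [U] using ht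
    rw [lt_div_iff₀ hp] at h₁
    simpa [ℓ, dist_eq_norm, norm_smul] using h₁
  have hd : DifferentiableOn ℂ (G ∘ ℓ) U := hG.comp hℓ.differentiableOn hU
  have ha : AnalyticOnNhd ℂ (G ∘ ℓ) U := hd.analyticOnNhd Metric.isOpen_ball
  have h0 : (0 : ℂ) ∈ U := by simpa [U] using div_pos hr hp
  have h1 : (1 : ℂ) ∈ U := by
    have : ‖z - z₀‖ < r := by simpa [dist_eq_norm] using hz
    simpa [U, one_lt_div hp] using this
  have h₂ : ∀ᶠ t in 𝓝 0, (G ∘ ℓ) t = 0 := by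
    refine eventually_eq_zero_of_isBigO (ha 0 h0) fun n ↦ ?_
    have h₃ : Tendsto ℓ (𝓝 0) (𝓝 z₀) := by
      have := hℓ.continuous.tendsto 0
      simpa [ℓ] using this
    refine ((h n).comp_tendsto h₃).trans (IsBigO.of_bound (‖z - z₀‖ ^ n) (Eventually.of_forall fun t ↦ ?_))
    simp [ℓ, norm_smul, mul_pow, mul_comm]
  have h₃ := ha.eqOn_zero_of_preconnected_of_eventuallyEq_zero (convex_ball _ _).isPreconnected h0 h₂ h1
  simpa [ℓ] using h₃

variable {k : Type u} [Field k] {X : TopCat.{u}} {A : AlgSheaf k X}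
open AlgSheaf

/-- The values of a section, extended by zero. -/
def extendedValue (ev : ∀ V : Opens X, A.sheaf.obj.obj (op V) →+* (V → ℂ)) {V : Opens X}
    (s : A.sheaf.obj.obj (op V)) (y : X) : ℂ :=
  open scoped Classical in if h : y ∈ V then ev V s ⟨y, h⟩ else 0


/-- The compatibility of the evaluation of sections with restriction. -/
def EvRes (ev : ∀ V : Opens X, A.sheaf.obj.obj (op V) →+* (V → ℂ)) : Prop :=
  ∀ (V W : Opens X) (h : W ≤ V) (s : A.sheaf.obj.obj (op V)) (x : W), ev W (A.res h s) x = ev V s ⟨x, h x.2⟩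

variable {ev : ∀ V : Opens X, A.sheaf.obj.obj (op V) →+* (V → ℂ)}

lemma extendedValue_of_mem {V : Opens X} (s : A.sheaf.obj.obj (op V)) {y : X} (h : y ∈ V) :
    extendedValue ev s y = ev V s ⟨y, h⟩ := dif_pos h

lemma extendedValue_add {V : Opens X} (s t : A.sheaf.obj.obj (op V)) :
    extendedValue ev (s + t) = extendedValue ev s + extendedValue ev t := by
  ext y
  by_cases h : y ∈ V <;> simp [extendedValue, h]

lemma extendedValue_mul {V : Opens X} (s t : A.sheaf.obj.obj (op V)) :
    extendedValue ev (s * t) = extendedValue ev s * extendedValue ev t := by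
  ext y
  by_cases h : y ∈ V <;> simp [extendedValue, h]

lemma EvRes.extendedValue_res (hres : EvRes ev) {V W : Opens X} (h : W ≤ V) (s : A.sheaf.obj.obj (op V)) {y : X}
    (hy : y ∈ W) : extendedValue ev (A.res h s) y = extendedValue ev s y := by
  rw [extendedValue_of_mem _ hy, extendedValue_of_mem _ (h hy), hres]

lemma EvRes.eventuallyEq (hres : EvRes ev) {V W : Opens X} {x : X} (hV : x ∈ V) (hW : x ∈ W) (s : A.sheaf.obj.obj (op V))
    (t : A.sheaf.obj.obj (op W)) (h : A.germ hV s = A.germ hW t) :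
    extendedValue ev s =ᶠ[𝓝 x] extendedValue ev t := by
  obtain ⟨U, hU, iV, iW, e⟩ := TopCat.Presheaf.germ_eq A.presheaf x hV hW s t h
  replace e : A.res (leOfHom iV) s = A.res (leOfHom iW) t := e
  filter_upwards [U.isOpen.mem_nhds hU] with y hy
  rw [← hres.extendedValue_res (leOfHom iV) s hy, e, hres.extendedValue_res (leOfHom iW) t hy]

/-- The germs of functions that are `O(wⁿ)` at `x`. -/
def HasOrder (ev : ∀ V : Opens X, A.sheaf.obj.obj (op V) →+* (V → ℂ)) (w : X → ℝ) (x : X) (n : ℕ) (a : A.stalk x) : Prop :=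
  ∀ (V : Opens X) (hV : x ∈ V) (s : A.sheaf.obj.obj (op V)), A.germ hV s = a → extendedValue ev s =O[𝓝 x] fun y ↦ w y ^ n

lemma HasOrder.of_germ (hres : EvRes ev) {w : X → ℝ} {x : X} {n : ℕ} {V : Opens X} {hV : x ∈ V}
    {s : A.sheaf.obj.obj (op V)} (h : extendedValue ev s =O[𝓝 x] fun y ↦ w y ^ n) :
    HasOrder ev w x n (A.germ hV s) :=
  fun _ hW t ht ↦ (hres.eventuallyEq hW hV t s ht).trans_isBigO h

lemma exists_germ_pair {x : X} (a b : A.stalk x) : ∃ (V : Opens X) (hV : x ∈ V) (s t : A.sheaf.obj.obj (op V)),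
    A.germ hV s = a ∧ A.germ hV t = b := by
  obtain ⟨V, hV, s, rfl⟩ := exists_germ a
  obtain ⟨W, hW, t, rfl⟩ := exists_germ b
  exact ⟨V ⊓ W, ⟨hV, hW⟩, A.res inf_le_left s, A.res inf_le_right t, germ_res _ _ _ _, germ_res _ _ _ _⟩

lemma hasOrder_of_mem_pow (hres : EvRes ev) {w : X → ℝ} {x : X} {J : Ideal (A.stalk x)}
    (hJ : ∀ a ∈ J, HasOrder ev w x 1 a) (n : ℕ) (a : A.stalk x) (ha : a ∈ J ^ (n + 1)) : HasOrder ev w x (n + 1) a := by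
  induction n generalizing a with
  | zero => exact hJ a (by simpa using ha)
  | succ n ih =>
    rw [pow_succ] at ha
    refine Submodule.mul_induction_on ha (fun a ha b hb ↦ ?_) (fun a b ha hb ↦ ?_)
    · obtain ⟨V, hV, s, t, rfl, rfl⟩ := exists_germ_pair a b
      rw [← map_mul]
      refine .of_germ hres ?_
      rw [extendedValue_mul]
      exact ((ih _ ha V hV s rfl).mul (hJ _ hb V hV t rfl)).congr (fun _ ↦ rfl) (fun y ↦ by rw [pow_one, ← pow_succ])
    · obtain ⟨V, hV, s, t, rfl, rfl⟩ := exists_germ_pair a b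
      rw [← map_add]
      refine .of_germ hres ?_
      rw [extendedValue_add]
      exact (ha V hV s rfl).add (hb V hV t rfl)

/-- Germs in the Jacobson radical vanish at the point. -/
lemma EvRes.eq_zero_of_mem_jacobson (hres : EvRes ev) {σ : k ≃+* ℂ}
    (hσ : ∀ (V : Opens X) (c : k) (x : V), ev V ((A.str.app (op V)).hom c) x = σ c) {x : X} {V : Opens X} (hV : x ∈ V)
    (s : A.sheaf.obj.obj (op V)) (hs : A.germ hV s ∈ Ideal.jacobson (⊥ : Ideal (A.stalk x))) : ev V s ⟨x, hV⟩ = 0 := by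
  by_contra hne
  -- With c the constant -1/s(x), the germ of 1 + sc is a unit, although its value at x is zero.
  let c : A.sheaf.obj.obj (op V) := (A.str.app (op V)).hom (σ.symm (-(ev V s ⟨x, hV⟩)⁻¹))
  have h₁ := Ideal.mem_jacobson_bot.1 hs (A.germ hV c)
  rw [← map_mul, ← map_one (A.germ hV), ← map_add] at h₁
  obtain ⟨b, hb⟩ := h₁.exists_right_inv
  obtain ⟨W, hW, t, rfl⟩ := exists_germ b
  rw [← germ_res A inf_le_left ⟨hV, hW⟩ (s * c + 1), ← germ_res A inf_le_right ⟨hV, hW⟩ t, ← map_mul,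
    ← map_one (A.germ hW)] at hb
  have h₂ := (hres.eventuallyEq _ _ _ _ hb).self_of_nhds
  rw [extendedValue_of_mem _ (show x ∈ V ⊓ W from ⟨hV, hW⟩), extendedValue_of_mem _ hW, map_one, map_mul, Pi.mul_apply,
    hres, map_add, map_mul, Pi.add_apply, Pi.mul_apply, map_one, hσ] at h₂
  simp [hne] at h₂

/-- Germs in the radical vanish at x, so they are O(w) with w the distance to x in a chart, and the
n-th power of the radical consists of germs that are O(wⁿ). A germ in all powers is infinitely flat
at x, hence zero on a coordinate ball. -/
lemma iInf_jacobson_stalk_of_isComplexManifold (hA : IsComplexManifold A) (x : X) :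
    ⨅ n : ℕ, (Ideal.jacobson (⊥ : Ideal (A.stalk x))) ^ n = ⊥ := by
  obtain ⟨σ, ev, hinj, hres, hσ, hchart⟩ := hA
  replace hres : EvRes ev := hres
  obtain ⟨n, e, hx, he⟩ := hchart x
  let w : X → ℝ := fun y ↦ ‖e y - e x‖
  have hopen (V : Opens X) (hV : (V : Set X) ⊆ e.source) : IsOpen (e '' V) := e.isOpen_image_of_subset_source V.isOpen hV
  have hJ : ∀ a ∈ Ideal.jacobson (⊥ : Ideal (A.stalk x)), HasOrder ev w x 1 a := by
    intro a ha
    obtain ⟨V, hV, s, rfl⟩ := exists_germ a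
    let V' : Opens X := V ⊓ ⟨e.source, e.open_source⟩
    have hV' : x ∈ V' := ⟨hV, hx⟩
    have hVe : (V' : Set X) ⊆ e.source := fun y hy ↦ hy.2
    have h : A.germ hV' (A.res inf_le_left s) = A.germ hV s := germ_res _ _ _ _
    rw [← h] at ha ⊢
    refine .of_germ hres ?_
    obtain ⟨G, hG, hs⟩ := (he V' hVe (ev V' (A.res inf_le_left s))).1 ⟨_, rfl⟩
    have h₀ : G (e x) = 0 := (hs ⟨x, hV'⟩).symm.trans (hres.eq_zero_of_mem_jacobson hσ hV' _ ha)
    have h₁ : DifferentiableAt ℂ G (e x) := hG.differentiableAt ((hopen V' hVe).mem_nhds ⟨x, hV', rfl⟩)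
    have h₂ := h₁.isBigO_sub.comp_tendsto (e.continuousAt hx).tendsto
    have h₃ : extendedValue ev (A.res inf_le_left s : A.sheaf.obj.obj (op V')) =ᶠ[𝓝 x] fun y ↦ G (e y) - G (e x) := by
      filter_upwards [V'.isOpen.mem_nhds hV'] with y hy
      rw [extendedValue_of_mem _ hy, hs, h₀, sub_zero]
    refine h₃.trans_isBigO ?_
    simpa [w, Function.comp_def] using h₂.norm_right
  rw [eq_bot_iff]
  intro a ha
  rw [Ideal.mem_iInf] at ha
  obtain ⟨V, hV, s, rfl⟩ := exists_germ a
  have hord : ∀ m : ℕ, extendedValue ev s =O[𝓝 x] fun y ↦ w y ^ (m + 1) := fun m ↦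
    hasOrder_of_mem_pow hres hJ m _ (ha (m + 1)) V hV s rfl
  let V' : Opens X := V ⊓ ⟨e.source, e.open_source⟩
  have hVe : (V' : Set X) ⊆ e.source := fun y hy ↦ hy.2
  obtain ⟨r, hr, hball⟩ := Metric.isOpen_iff.1 (hopen V' hVe) (e x) ⟨x, ⟨hV, hx⟩, rfl⟩
  obtain ⟨G, hG, hs⟩ := (he V' hVe (ev V' (A.res inf_le_left s))).1 ⟨_, rfl⟩
  let W : Opens X := V' ⊓ ⟨e.source ∩ e ⁻¹' Metric.ball (e x) r, e.isOpen_inter_preimage Metric.isOpen_ball⟩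
  have hW : x ∈ W := ⟨⟨hV, hx⟩, hx, Metric.mem_ball_self hr⟩
  have hGs : ∀ y (hy : y ∈ V'), extendedValue ev s y = G (e y) := fun y hy ↦ by
    rw [← hs ⟨y, hy⟩, ← extendedValue_of_mem, hres.extendedValue_res inf_le_left s hy]
  have hflat : ∀ m : ℕ, G =O[𝓝 (e x)] fun z ↦ ‖z - e x‖ ^ (m + 1) := by
    intro m
    have ht : Tendsto e.symm (𝓝 (e x)) (𝓝 x) := by
      have := (e.continuousAt_symm (e.map_source hx)).tendsto
      rwa [e.left_inv hx] at this
    have h₁ := (hord m).comp_tendsto ht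
    have h₂ : ∀ᶠ z in 𝓝 (e x), ∃ y ∈ V', e y = z := (hopen V' hVe).mem_nhds ⟨x, ⟨hV, hx⟩, rfl⟩
    refine (EventuallyEq.trans_isBigO ?_ h₁).trans_eventuallyEq ?_
    · filter_upwards [h₂] with z hz
      obtain ⟨y, hy, rfl⟩ := hz
      rw [Function.comp_apply, e.left_inv (hVe hy), hGs y hy]
    · filter_upwards [h₂] with z hz
      obtain ⟨y, hy, rfl⟩ := hz
      rw [Function.comp_apply, e.left_inv (hVe hy)]
  -- The orders obtained from powers of the radical start at 1; the surplus factor is bounded near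
  -- the centre, which covers exponent 0 as well.
  have hflat' : ∀ m : ℕ, G =O[𝓝 (e x)] fun z ↦ ‖z - e x‖ ^ m := fun m ↦ (hflat m).trans (by
    have h₁ : Tendsto (fun z ↦ ‖z - e x‖) (𝓝 (e x)) (𝓝 0) := by
      have : Continuous (fun z ↦ ‖z - e x‖) := by fun_prop
      simpa using this.tendsto (e x)
    have h₂ : (fun z ↦ ‖z - e x‖) =O[𝓝 (e x)] fun _ ↦ (1 : ℝ) := h₁.isBigO_one ℝ
    simpa [pow_succ] using (isBigO_refl (fun z ↦ ‖z - e x‖ ^ m) (𝓝 (e x))).mul h₂)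
  have h₀ : A.res (inf_le_left.trans inf_le_left : W ≤ V) s = 0 := by
    apply hinj W
    ext y
    rw [map_zero, hres, ← extendedValue_of_mem, hGs y y.2.1]
    exact eq_zero_of_isBigO (hG.mono hball) hflat' y.2.2.2
  rw [Ideal.mem_bot, ← germ_res A (inf_le_left.trans inf_le_left : W ≤ V) hW s, h₀, map_zero]

end Analytic

lemma iInf_jacobson_stalk_eq_bot {k : Type u} [Field k] {X : TopCat.{u}} {A : AlgSheaf k X}
    (hA : IsSmoothScheme A ∨ IsComplexManifold A) (x : X) :
    ⨅ n : ℕ, (Ideal.jacobson (⊥ : Ideal (A.stalk x))) ^ n = ⊥ :=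
  hA.elim (fun h ↦ iInf_jacobson_stalk_of_isSmoothScheme A h x) (fun h ↦ iInf_jacobson_stalk_of_isComplexManifold h x)

end SqZeroThickening
end

open SqZeroThickening

theorem theorem5p5 {k : Type u} [Field k] [CharZero k] {X : TopCat.{u}} (A : AlgSheaf k X)
    (hA : IsSmoothScheme A ∨ IsComplexManifold A) (S : Thickening A) :
    ∃ _ : S.HasLeftDerivedPull, Nonempty (S.tor1 ≅ S.firstDerived) ∧
      ∀ K : CMinus S.total.Mod, K.IsBounded →
        ∃ h : S.PPExact K.obj,
          List.TFAE [
            S.theta h = 0,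
            ∃ s : (CMinus.Q A.Mod).obj (S.barC.obj K) ⟶ S.Lpull.obj ((CMinus.Q S.total.Mod).obj K),
              s ≫ S.LpullTo.app K = 𝟙 _,
            ∃ (L : CMinus S.total.Mod), L.IsBounded ∧ S.IsAdmissible L ∧
              ∃ f : (CMinus.Q S.total.Mod).obj L ⟶ (CMinus.Q S.total.Mod).obj K,
                IsIso (S.Lpull.map f ≫ S.LpullTo.app K),
            ∃ (L : CMinus S.total.Mod), L.IsBounded ∧ S.IsAdmissible L ∧
              ∃ f : S.QAdm.obj L ⟶ S.QAdm.obj K, IsIso (S.barAdm.map f),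
            ∃ (L : CMinus S.total.Mod), L.IsBounded ∧ S.IsAdmissible L ∧
              ∃ (T : CochainComplex S.total.Mod ℤ) (t : T ⟶ ((CMinus.map S.idealT).obj L).obj),
                Mono t ∧ Nonempty (S.QAdm.obj K ≅ S.QAdm.obj (S.quotientC L t))] ∧
          (S.theta h = 0 →
            Nonempty (S.Lpull.obj ((CMinus.Q S.total.Mod).obj K) ≅
              (CMinus.Q A.Mod).obj (S.barC.obj K) ⊞
                (S.Lpull.obj ((CMinus.Q S.total.Mod).obj (S.pushC.obj (S.torC.obj K))))⟦(1 : ℤ)⟧)) := by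
  -- The functors in the statement unfold to those of `S.pair` and `Y`, so the abstract results
  -- apply without transport.
  let Y := S.parts (iInf_jacobson_stalk_eq_bot hA)
  exact ⟨S.pair.hasRightKanExtension, ⟨Y.firstDerivedIso⟩, fun K hK ↦
    ⟨Y.isExactFour K.obj, Y.tfae hK, Y.nonempty_iso_of_theta_eq_zero hK⟩⟩
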